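/- Let $d\in\{2,3\}$, $T>0$, $\mathbb T^d=\mathbb R^d/\mathbb Z^d$, $p\in(d,\infty)$, $\gamma\in(\tfrac dp,1)$, an integer $k\ge 3$, $\sigma\ge 0$ and $A>0$; if $d=3$ assume $\frac\gamma2+\frac32(\frac12-\frac1p)<1$. Write $\|f\|_{\gamma,p}=\|(I-\Delta)^{\gamma/2}f\|_{L^p(\mathbb T^d)}$, where $(I-\Delta)^{\gamma/2}$ is the Fourier multiplier $(1+|k|^2)^{\gamma/2}$, $k\in\mathbb Z^d$, and $\langle v\rangle=(1+|v|^2)^{1/2}$. **Limit system.** Let $u^\circ:\mathbb T^d\to\mathbb R^d$ and $F^\circ:\mathbb T^d\times\mathbb R^d\to\mathbb R$ satisfy $F^\circ\in L^\infty\cap L^1$, $\iint|v|^{p+d(p-1)}|F^\circ|\,dv\,dx<\infty$, $\int\langle v\rangle^{2k}|F^\circ|^2dv\in L^2(\mathbb T^d)$, $\|u^\circ\|_{\gamma,p}<\infty$. Let $(u,F)$ be a weak solution on $[0,T]$ of $$\partial_tu-\Delta u+(u\cdot\nabla)u+\nabla \pi+\int_{\mathbb R^d}(u-v)F\,dv=0,\quad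 \operatorname{div}u=0,\quad u_0=u^\circ,$$ $$\partial_tF+v\cdot\nabla_xF+\operatorname{div}_v((u-v)F)=\tfrac{\sigma^2}2\Delta_vF,\quad F_0=F^\circ,$$ that is: $u\in L^\infty(0,T;L^2)\cap L^2(0,T;H^1)$ is divergence-free, $0\le F\in L^\infty(0,T;L^\infty\cap L^1)$, $|v|^2F\in L^\infty(0,T;L^1)$, and the equations hold, with their initial data, against smooth test functions on $[0,T]\times\mathbb T^d\times\mathbb R^d$ compactly supported in $v$ and vanishing at $t=T$, respectively against smooth divergence-free test fields on $[0,T]\times\mathbb T^d$ vanishing at $t=T$. Assume that $u$ is bounded, with $\|u\|_{L^\infty_{t,x}}\le A$. Then $u$ has a representative that is continuous on $[0,T]\times\mathbb T^d$, again denoted $u$, and for every real $q\ge1$ there is a constant $C>0$, depending only on $d,T,p,\gamma,k,\sigma,A,q$, $(u^\circ,F^\circ)$ and $(u,F)$, such that the following holds. **Particles.** Let $(\Omega,\mathcal F,(\mathcal F_t)_{t\ge0},\mathbb P)$ be a filtered probability space with independent $d$-dimensional $(\mathcal F_t)$-Brownian motions $(B^i)_{i\in\mathbb N}$. Let $\chi_A\in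 C^2(\mathbb R)$ with $\chi_A(r)=r$ on $[-A,A]$, $\chi_A=A$ on $(1+A,\infty)$, $\chi_A=-A$ on $(-\infty,-1-A)$, $|\chi_A'|\le1$, $\chi_A''$ bounded, and let $\boldsymbol\chi$ be $\chi_A$ applied to each coordinate. Let $\alpha,\beta\in(0,1]$ with $\beta<\alpha$ and $d\beta+(d+1)\alpha<\frac12$. Let $\vartheta^1,\vartheta^2$ be smooth probability densities on $\mathbb R^d$, $\vartheta^1$ supported in $(-\frac12,\frac12)^d$, $\vartheta^2$ supported in $B(0,1)$ with $\int v\,\vartheta^2(v)\,dv=0$; let $\vartheta^{1,N}$ be the periodisation of $N^{d\beta}\vartheta^1(N^\beta\cdot)$ restricted to $[-\frac12,\frac12)^d$, $\vartheta^{2,N}=N^{d\alpha}\vartheta^2(N^\alpha\cdot)$ and $\vartheta^N(x,v)=\vartheta^{1,N}(x)\vartheta^{2,N}(v)$. Let $\sigma_N>0$ with $\sigma_N\to\sigma$ and $\sqrt{\log N}\,\sigma_N\to+\infty$. Let $(X^i_0,V^i_0)_{i\in\mathbb N}$ be random variables in $\mathbb T^d\times\mathbb R^d$ and $u^{\circ,N}$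 random fields such that, for all $q'\ge1$, the quantities $\mathbb E\|u^{\circ,N}\|_{L^2}^{q'}$, $\mathbb E\|u^{\circ,N}\|_{\gamma,p}^{q'}$ and $\mathbb E\big\|\langle v\rangle^k\,\frac1N\sum_{i=1}^N\vartheta^N(x-X_0^i,v-V_0^i)\big\|_{L^2_{x,v}}^{q'}$ are bounded uniformly in $N\ge1$. For each $N\ge1$ let $(u^N,(X^{i,N},V^{i,N})_{1\le i\le N})$ be an adapted solution on $[0,T]$ of $$\partial_tu^N-\Delta u^N+(u^N\cdot\nabla)\boldsymbol\chi(u^N)+\nabla \pi^N+\frac1N\sum_{i=1}^N\big(\boldsymbol\chi(u^N_t(X^{i,N}_t))-V^{i,N}_t\big)\vartheta^{1,N}(x-X^{i,N}_t)=0,\quad\operatorname{div}u^N=0,\quad u^N_0=u^{\circ,N},$$ $$dX^{i,N}_t=V^{i,N}_tdt,\qquad dV^{i,N}_t=\big(\boldsymbol\chi(u^N_t(X^{i,N}_t))-V^{i,N}_t\big)dt+\sigma_N\,dB^i_t,\qquad (X^{i,N}_0,V^{i,N}_0)=(X^i_0,V^i_0),$$ where, almost surely, $u^N\in L^\infty([0,T];H^\gamma_p)$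 is continuous on $[0,T]\times\mathbb T^d$ and the fluid equation holds in the mild sense (Leray projection and heat semigroup). For each $i$ let $(\overline X^i,\overline V^i)$ be the adapted solution on $[0,T]$ of $$d\overline X^i_t=\overline V^i_tdt,\qquad d\overline V^i_t=(u_t(\overline X^i_t)-\overline V^i_t)dt+\sigma\,dB^i_t,\qquad(\overline X^i_0,\overline V^i_0)=(X^i_0,V^i_0).$$ Then for every $N\ge1$ $$\max_{1\le i\le N}\mathbb E\sup_{t\in[0,T]}\big|(X^{i,N}_t,V^{i,N}_t)-(\overline X^i_t,\overline V^i_t)\big|^q\le C\Big(|\sigma-\sigma_N|^q+\mathbb E\sup_{t\in[0,T]}\|u^N_t-u_t\|_{\gamma,p}^q\Big),$$ where $|\cdot|$ is the distance of the flat product metric on $\mathbb T^d\times\mathbb R^d$. -/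

import Mathlib

open MeasureTheory ProbabilityTheory Set
open scoped ENNReal NNReal

noncomputable section

namespace FluidParticle

/-! ### The torus `ℝᵈ / ℤᵈ` -/

/-- Euclidean space `ℝᵈ`. -/
abbrev E (d : ℕ) := EuclideanSpace ℝ (Fin d)

/-- The torus `𝕋ᵈ = ℝᵈ / ℤᵈ`. -/
abbrev Torus (d : ℕ) := UnitAddTorus (Fin d)

variable {d : ℕ}

/-- Lebesgue measure on the torus (total mass one). It is, by definition, the measure with respect
to which `UnitAddTorus.mFourierCoeff` is taken. -/
def torusVol (d : ℕ) : Measure (Torus d) := Measure.pi fun _ => AddCircle.haarAddCircle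

/-- The projection `ℝᵈ → 𝕋ᵈ`. -/
def proj (y : E d) : Torus d := fun j => ((y j : ℝ) : UnitAddCircle)

/-- The representative in `[-1/2, 1/2)ᵈ` of a point of the torus. -/
def rep (x : Torus d) : E d :=
  WithLp.toLp 2 fun j => ((AddCircle.equivIco (1 : ℝ) (-1 / 2) (x j) : Ico (-1 / 2 : ℝ) (-1 / 2 + 1)) : ℝ)

/-- Distance on the phase space `𝕋ᵈ × ℝᵈ`: the flat product metric (the norm of `UnitAddCircle` is
the distance to zero modulo one). -/
def phaseDist (x : Torus d) (v : E d) (y : Torus d) (w : E d) : ℝ :=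
  Real.sqrt ((∑ j, ‖x j - y j‖ ^ 2) + ‖v - w‖ ^ 2)

/-! ### Fourier coefficients, Bessel norms, divergence-free fields -/

/-- Fourier coefficients of a real vector field on the torus. -/
def fourierVec (f : Torus d → E d) (k : Fin d → ℤ) : Fin d → ℂ :=
  fun j => UnitAddTorus.mFourierCoeff (fun x => ((f x j : ℝ) : ℂ)) k

/-- `|k|²`. -/
def freqSq (k : Fin d → ℤ) : ℝ := ∑ j, (k j : ℝ) ^ 2

/-- The Bessel norm `‖f‖_{γ,p} = ‖(I - Δ)^{γ/2} f‖_{Lᵖ}` of a vector field, where `(I - Δ)^{γ/2}`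
multiplies the `k`-th Fourier coefficient by `(1 + |k|²)^{γ/2}`; it is `∞` if `(I - Δ)^{γ/2} f` is
not in `Lᵖ`. The field `g = (I - Δ)^{γ/2} f` is unique up to a null set, so the infimum is over at
most one class. (For `γ ≥ 0`, `p ≥ 1` every element of `H^γ_p` is an integrable function.) -/
def besselENorm (γ : ℝ) (p : ℝ≥0∞) (f : Torus d → E d) : ℝ≥0∞ :=
  ⨅ (g : Torus d → E d) (_ : Integrable f (torusVol d) ∧ MemLp g p (torusVol d) ∧
      ∀ k, fourierVec g k = ((1 + freqSq k) ^ (γ / 2) : ℝ) • fourierVec f k),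
    eLpNorm g p (torusVol d)

/-- `div f = 0`, i.e. `⟨k, f̂(k)⟩ = 0` for all `k`. -/
def IsDivFree (f : Torus d → E d) : Prop :=
  ∀ k : Fin d → ℤ, ∑ j, (k j : ℂ) * fourierVec f k j = 0

/-! ### Weak solutions of the Vlasov(-Fokker-Planck)-Navier-Stokes system -/

/-- Test functions in `C^∞([0,T] × 𝕋ᵈ × ℝᵈ)`, compactly supported in `v`, zero at time `T`. -/
structure IsKineticTest (T : ℝ) (φ : ℝ → Torus d → E d → ℝ) : Prop where
  smooth : ContDiff ℝ ((⊤ : ℕ∞) : WithTop ℕ∞) fun z : ℝ × E d × E d => φ z.1 (proj z.2.1) z.2.2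
  compact_v : ∃ R : ℝ, ∀ s x v, R < ‖v‖ → φ s x v = 0
  terminal : ∀ x v, φ T x v = 0

/-- Divergence-free test fields in `C^∞([0,T] × 𝕋ᵈ; ℝᵈ)`, zero at time `T`. -/
structure IsFluidTest (T : ℝ) (ψ : ℝ → Torus d → E d) : Prop where
  smooth : ContDiff ℝ ((⊤ : ℕ∞) : WithTop ℕ∞) fun z : ℝ × E d => ψ z.1 (proj z.2)
  div_free : ∀ s (y : E d),
    ∑ j, (fderiv ℝ (fun z : E d => ψ s (proj z)) y (EuclideanSpace.single j 1)) j = 0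
  terminal : ∀ x, ψ T x = 0

/-- `(∂ₛφ + v·∇ₓφ + (u - v)·∇ᵥφ + (σ²/2) Δᵥφ)(s, x, v)`. -/
def kineticDual (σ : ℝ) (u : ℝ → Torus d → E d) (φ : ℝ → Torus d → E d → ℝ)
    (s : ℝ) (x : Torus d) (v : E d) : ℝ :=
  deriv (fun r => φ r x v) s
    + fderiv ℝ (fun y : E d => φ s (proj y) v) (rep x) v
    + fderiv ℝ (fun w : E d => φ s x w) v (u s x - v)
    + σ ^ 2 / 2 * Laplacian.laplacian (fun w : E d => φ s x w) v

/-- `(u·∂ₛψ + ((u·∇)ψ)·u + u·Δψ)(s, x)`. -/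
def fluidDual (u : ℝ → Torus d → E d) (ψ : ℝ → Torus d → E d) (s : ℝ) (x : Torus d) : ℝ :=
  inner ℝ (u s x) (deriv (fun r => ψ r x) s)
    + inner ℝ (fderiv ℝ (fun y : E d => ψ s (proj y)) (rep x) (u s x)) (u s x)
    + inner ℝ (u s x) (Laplacian.laplacian (fun y : E d => ψ s (proj y)) (rep x))

/-- Weak solutions on `[0,T]` of
`∂ₜu - Δu + (u·∇)u + ∇p + ∫ (u - v) F dv = 0`, `div u = 0`, `u(0) = u₀`,
`∂ₜF + v·∇ₓF + divᵥ((u - v)F) = (σ²/2) Δᵥ F`, `F(0) = F₀`. -/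
structure IsWeakSolution (T σ : ℝ) (u₀ : Torus d → E d) (F₀ : Torus d → E d → ℝ)
    (u : ℝ → Torus d → E d) (F : ℝ → Torus d → E d → ℝ) : Prop where
  meas_u : AEStronglyMeasurable (fun z : ℝ × Torus d => u z.1 z.2)
    ((volume.restrict (Icc 0 T)).prod (torusVol d))
  meas_F : AEStronglyMeasurable (fun z : ℝ × Torus d × E d => F z.1 z.2.1 z.2.2)
    ((volume.restrict (Icc 0 T)).prod ((torusVol d).prod volume))
  u_energy : ∃ M : ℝ≥0, ∀ᵐ t ∂(volume.restrict (Icc 0 T)), eLpNorm (u t) 2 (torusVol d) ≤ M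
  u_dissipation : ∫⁻ t in Icc 0 T, besselENorm 1 2 (u t) ^ 2 < ∞
  u_div_free : ∀ᵐ t ∂(volume.restrict (Icc 0 T)), IsDivFree (u t)
  F_nonneg : ∀ᵐ z ∂((volume.restrict (Icc 0 T)).prod ((torusVol d).prod volume)),
    0 ≤ F z.1 z.2.1 z.2.2
  F_bounded : ∃ M : ℝ≥0, ∀ᵐ t ∂(volume.restrict (Icc 0 T)),
    eLpNorm (fun z : Torus d × E d => F t z.1 z.2) ∞ ((torusVol d).prod volume) ≤ M
  F_integrable : ∃ M : ℝ≥0, ∀ᵐ t ∂(volume.restrict (Icc 0 T)),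
    eLpNorm (fun z : Torus d × E d => F t z.1 z.2) 1 ((torusVol d).prod volume) ≤ M
  F_energy : ∃ M : ℝ≥0, ∀ᵐ t ∂(volume.restrict (Icc 0 T)),
    eLpNorm (fun z : Torus d × E d => ‖z.2‖ ^ 2 * F t z.1 z.2) 1
      ((torusVol d).prod volume) ≤ M
  kinetic : ∀ φ, IsKineticTest T φ →
    -(∫ s in (0 : ℝ)..T, ∫ v, ∫ x, kineticDual σ u φ s x v * F s x v ∂(torusVol d))
      = ∫ v, ∫ x, φ 0 x v * F₀ x v ∂(torusVol d)
  fluid : ∀ ψ, IsFluidTest T ψ →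
    -(∫ s in (0 : ℝ)..T, ∫ x, fluidDual u ψ s x ∂(torusVol d))
      = -(∫ s in (0 : ℝ)..T, ∫ v, ∫ x,
            F s x v * inner ℝ (u s x - v) (ψ s x) ∂(torusVol d))
        + ∫ x, inner ℝ (u₀ x) (ψ 0 x) ∂(torusVol d)

/-- The assumptions on the data `(u₀, F₀)` and on the fluid velocity `u` of the limit system. -/
structure PDEAssumptions (T p γ : ℝ) (k : ℕ) (u₀ : Torus d → E d) (F₀ : Torus d → E d → ℝ)
    (u : ℝ → Torus d → E d) : Prop where
  F_bounded : MemLp (fun z : Torus d × E d => F₀ z.1 z.2) ∞ ((torusVol d).prod volume)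
  F_integrable : MemLp (fun z : Torus d × E d => F₀ z.1 z.2) 1 ((torusVol d).prod volume)
  F_moment : ∫⁻ x, ∫⁻ v, ‖v‖ₑ ^ (p + d * (p - 1)) * ‖F₀ x v‖ₑ ∂volume ∂(torusVol d) < ∞
  F_weight : ∫⁻ x, (∫⁻ v, ENNReal.ofReal ((1 + ‖v‖ ^ 2) ^ k) * ‖F₀ x v‖ₑ ^ 2) ^ 2
    ∂(torusVol d) < ∞
  u_init : AEStronglyMeasurable u₀ (torusVol d) ∧ besselENorm γ (ENNReal.ofReal p) u₀ < ∞
  u_bounded : eLpNorm (fun z : ℝ × Torus d => u z.1 z.2) ∞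
    ((volume.restrict (Icc 0 T)).prod (torusVol d)) < ∞

/-- `w` is the representative of `u` that is jointly continuous on `[0,T] × 𝕋ᵈ`. -/
def IsContinuousRep (T : ℝ) (u w : ℝ → Torus d → E d) : Prop :=
  ContinuousOn (fun z : ℝ × Torus d => w z.1 z.2) (Icc 0 T ×ˢ univ) ∧
    ∀ᵐ z ∂((volume.restrict (Icc 0 T)).prod (torusVol d)), u z.1 z.2 = w z.1 z.2

/-! ### Mollifiers and cut-off -/

/-- The profile `ϑ¹`: a smooth probability density supported in `(-1/2, 1/2)ᵈ`. -/
structure IsSpaceProfile (θ : E d → ℝ) : Prop where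
  smooth : ContDiff ℝ ((⊤ : ℕ∞) : WithTop ℕ∞) θ
  nonneg : ∀ x, 0 ≤ θ x
  mass : ∫ x, θ x = 1
  support : Function.support θ ⊆ {x | ∀ j, x j ∈ Ioo (-1 / 2 : ℝ) (1 / 2)}

/-- The profile `ϑ²`: a smooth centred probability density supported in the unit ball. -/
structure IsVelocityProfile (θ : E d → ℝ) : Prop where
  smooth : ContDiff ℝ ((⊤ : ℕ∞) : WithTop ℕ∞) θ
  nonneg : ∀ v, 0 ≤ θ v
  mass : ∫ v, θ v = 1
  support : Function.support θ ⊆ Metric.ball 0 1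
  centred : ∫ v, θ v • v = 0

/-- `ϑ^{1,N}`: the periodisation of `N^{dβ} ϑ¹(N^β ·)` on `[-1/2, 1/2)ᵈ`. -/
def spaceMollifier (β : ℝ) (θ₁ : E d → ℝ) (N : ℕ) (x : Torus d) : ℝ :=
  (N : ℝ) ^ (d * β) * θ₁ ((N : ℝ) ^ β • rep x)

/-- `ϑ^{2,N}(v) = N^{dα} ϑ²(N^α v)`. -/
def velocityMollifier (α : ℝ) (θ₂ : E d → ℝ) (N : ℕ) (v : E d) : ℝ :=
  (N : ℝ) ^ (d * α) * θ₂ ((N : ℝ) ^ α • v)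

/-- The mollified empirical measure `ϑ^N ∗ ((1/N) ∑ δ_{(X i, V i)})`. -/
def mollifiedEmpirical (α β : ℝ) (θ₁ θ₂ : E d → ℝ) (N : ℕ) (X : ℕ → Torus d) (V : ℕ → E d)
    (x : Torus d) (v : E d) : ℝ :=
  (1 / N : ℝ) * ∑ i ∈ Finset.range N,
    spaceMollifier β θ₁ N (x - X i) * velocityMollifier α θ₂ N (v - V i)

/-- The scalar cut-off `χ_A`. -/
structure IsCutoff (A : ℝ) (χ : ℝ → ℝ) : Prop where
  contDiff : ContDiff ℝ 2 χ
  id_on : ∀ r ∈ Icc (-A) A, χ r = r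
  right : ∀ r, 1 + A < r → χ r = A
  left : ∀ r, r < -(1 + A) → χ r = -A
  deriv_le : ∀ r, |deriv χ r| ≤ 1
  deriv_two_bdd : ∃ M : ℝ, ∀ r, |deriv (deriv χ) r| ≤ M

/-- The vector cut-off, `χ_A` in each coordinate. -/
def cutoffVec (χ : ℝ → ℝ) (v : E d) : E d := WithLp.toLp 2 fun j => χ (v j)

/-! ### Brownian motion -/

/-- `B` is a standard `d`-dimensional Brownian motion with respect to the filtration `ℱ`. -/
structure IsFilteredBrownian {Ω : Type*} {m : MeasurableSpace Ω} (ℱ : Filtration ℝ≥0 m)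
    (P : Measure Ω) (B : ℝ≥0 → Ω → E d) : Prop where
  adapted : ∀ t, Measurable[ℱ t] (B t)
  zero : ∀ᵐ ω ∂P, B 0 ω = 0
  continuous : ∀ᵐ ω ∂P, Continuous fun t => B t ω
  indep : ∀ s t, s ≤ t →
    Indep (MeasurableSpace.comap (fun ω => B t ω - B s ω) inferInstance) (ℱ s) P
  law : ∀ s t, s ≤ t → P.map (fun ω => B t ω - B s ω)
    = (stdGaussian (E d)).map fun z => Real.sqrt ((t : ℝ) - s) • z

/-! ### The fluid-particle system -/

/-- The heat semigroup `e^{tΔ}` on Fourier coefficients. -/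
def heatCoeff (t : ℝ) (a : (Fin d → ℤ) → Fin d → ℂ) (k : Fin d → ℤ) : Fin d → ℂ :=
  Real.exp (-(4 * Real.pi ^ 2 * freqSq k * t)) • a k

/-- The Leray projector on Fourier coefficients: `a(k) - (⟨k, a(k)⟩ / |k|²) k`, and `a(0)` at
`k = 0`. -/
def lerayCoeff (a : (Fin d → ℤ) → Fin d → ℂ) (k : Fin d → ℤ) : Fin d → ℂ :=
  if k = 0 then a 0
  else fun j => a k j - (∑ l, (k l : ℂ) * a k l) / (freqSq k : ℂ) * (k j : ℂ)

/-- Fourier coefficients of the distribution `(u·∇)w = div(u ⊗ w)` for a divergence-free `u`. -/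
def advectionCoeff (u w : Torus d → E d) (k : Fin d → ℤ) : Fin d → ℂ :=
  fun j => ∑ l, (2 * Real.pi * Complex.I * (k l : ℂ)) *
    UnitAddTorus.mFourierCoeff (fun x => ((u x l * w x j : ℝ) : ℂ)) k

/-- The drag exerted by `N` particles on the fluid,
`(1/N) ∑ᵢ (χ(u(Xᵢ)) - Vᵢ) θ(x - Xᵢ)`. -/
def dragForce (χ : ℝ → ℝ) (θ : Torus d → ℝ) {N : ℕ} (u : Torus d → E d) (X : Fin N → Torus d)
    (V : Fin N → E d) (x : Torus d) : E d :=
  (1 / N : ℝ) • ∑ i, θ (x - X i) • (cutoffVec χ (u (X i)) - V i)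

/-- The mild formulation on `[0,T]` of the fluid equation, along given particle paths:
`u_t = e^{tΔ}u₀ - ∫₀ᵗ e^{(t-s)Δ} P[(u_s·∇)χ(u_s)] ds - ∫₀ᵗ e^{(t-s)Δ} P[drag_s] ds`,
an identity of distributions on the torus, i.e. of all Fourier coefficients. -/
def IsMildFluid (T : ℝ) (χ : ℝ → ℝ) (θ : Torus d → ℝ) {N : ℕ} (u₀ : Torus d → E d)
    (u : ℝ → Torus d → E d) (X : Fin N → ℝ → Torus d) (V : Fin N → ℝ → E d) : Prop :=
  ∀ t ∈ Icc 0 T, ∀ k : Fin d → ℤ,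
    fourierVec (u t) k = heatCoeff t (fourierVec u₀) k
      - (∫ s in (0 : ℝ)..t, heatCoeff (t - s)
          (lerayCoeff (advectionCoeff (u s) fun x => cutoffVec χ (u s x))) k)
      - ∫ s in (0 : ℝ)..t, heatCoeff (t - s)
          (lerayCoeff (fourierVec (dragForce χ θ (u s) (fun i => X i s) fun i => V i s))) k

/-- `(x, v)` is a continuous path on `[0,T]` solving `dx = v dt`, `dv = (b_t(x) - v) dt + σ dB`
with initial point `(x₀, v₀)`, for the driving path `B`. -/
structure IsKineticPath (T σ : ℝ) (b : ℝ → Torus d → E d) (B : ℝ≥0 → E d) (x₀ : Torus d)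
    (v₀ : E d) (x : ℝ → Torus d) (v : ℝ → E d) : Prop where
  cont_x : ContinuousOn x (Icc 0 T)
  cont_v : ContinuousOn v (Icc 0 T)
  position : ∀ t ∈ Icc 0 T, x t = x₀ + proj (∫ s in (0 : ℝ)..t, v s)
  velocity : ∀ t : ℝ≥0, (t : ℝ) ≤ T →
    v t = v₀ + (∫ s in (0 : ℝ)..t, (b s (x s) - v s)) + σ • B t

/-- `(u, X¹, V¹, …, X^N, V^N)` solves the fluid-particle system on `[0,T]` with noise `σ`, cut-off
`χ`, mollified Dirac mass `θ`, initial data `u₀`, `X₀`, `V₀` and driving Brownian motions `B`: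
the processes are adapted and almost surely `u ∈ L^∞([0,T]; H^γ_p)` is divergence-free, continuous
and a mild solution of the fluid equation and the particles solve their equations. -/
structure IsFluidParticleSolution {Ω : Type*} {m : MeasurableSpace Ω} (ℱ : Filtration ℝ≥0 m)
    (P : Measure Ω) (T p γ σ : ℝ) (χ : ℝ → ℝ) (θ : Torus d → ℝ) {N : ℕ}
    (u₀ : Ω → Torus d → E d) (X₀ : ℕ → Ω → Torus d) (V₀ : ℕ → Ω → E d)
    (B : ℕ → ℝ≥0 → Ω → E d)
    (u : ℝ → Ω → Torus d → E d) (X : Fin N → ℝ → Ω → Torus d) (V : Fin N → ℝ → Ω → E d) :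
    Prop where
  adapted_u : ∀ t : ℝ≥0, (t : ℝ) ≤ T → ∀ x, Measurable[ℱ t] fun ω => u t ω x
  adapted_X : ∀ t : ℝ≥0, (t : ℝ) ≤ T → ∀ i, Measurable[ℱ t] (X i t)
  adapted_V : ∀ t : ℝ≥0, (t : ℝ) ≤ T → ∀ i, Measurable[ℱ t] (V i t)
  continuous_u : ∀ᵐ ω ∂P,
    ContinuousOn (fun z : ℝ × Torus d => u z.1 ω z.2) (Icc 0 T ×ˢ univ)
  bessel_u : ∀ᵐ ω ∂P, (⨆ t ∈ Icc 0 T, besselENorm γ (ENNReal.ofReal p) (u t ω)) < ∞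
  div_free_u : ∀ᵐ ω ∂P, ∀ t ∈ Icc 0 T, IsDivFree (u t ω)
  mild_u : ∀ᵐ ω ∂P, IsMildFluid T χ θ (u₀ ω) (fun t => u t ω) (fun i t => X i t ω)
    (fun i t => V i t ω)
  particles : ∀ᵐ ω ∂P, ∀ i : Fin N,
    IsKineticPath T σ (fun t x => cutoffVec χ (u t ω x)) (fun t => B i t ω) (X₀ i ω) (V₀ i ω)
      (fun t => X i t ω) (fun t => V i t ω)

/-- `(X, V)` is an adapted solution on `[0,T]` of `dX = V dt`, `dV = (w_t(X) - V) dt + σ dB`. -/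
structure IsLimitParticle {Ω : Type*} {m : MeasurableSpace Ω} (ℱ : Filtration ℝ≥0 m)
    (P : Measure Ω) (T σ : ℝ) (w : ℝ → Torus d → E d) (X₀ : Ω → Torus d) (V₀ : Ω → E d)
    (B : ℝ≥0 → Ω → E d) (X : ℝ → Ω → Torus d) (V : ℝ → Ω → E d) : Prop where
  adapted_X : ∀ t : ℝ≥0, (t : ℝ) ≤ T → Measurable[ℱ t] (X t)
  adapted_V : ∀ t : ℝ≥0, (t : ℝ) ≤ T → Measurable[ℱ t] (V t)
  path : ∀ᵐ ω ∂P, IsKineticPath T σ w (fun t => B t ω) (X₀ ω) (V₀ ω) (fun t => X t ω)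
    (fun t => V t ω)

/-- The assumptions on the parameters and the initial data of the particle systems. -/
structure ParticleAssumptions {Ω : Type*} {m : MeasurableSpace Ω} (P : Measure Ω)
    (p γ : ℝ) (k : ℕ) (α β : ℝ) (θ₁ θ₂ : E d → ℝ) (σ : ℝ) (σN : ℕ → ℝ)
    (u₀ : ℕ → Ω → Torus d → E d) (X₀ : ℕ → Ω → Torus d) (V₀ : ℕ → Ω → E d) : Prop where
  alpha_mem : α ∈ Ioc (0 : ℝ) 1
  beta_mem : β ∈ Ioc (0 : ℝ) 1
  exponents : d * β + (d + 1) * α < 1 / 2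
  beta_lt_alpha : β < α
  sigma_pos : ∀ N, 1 ≤ N → 0 < σN N
  sigma_lim : Filter.Tendsto σN Filter.atTop (nhds σ)
  sigma_log : Filter.Tendsto (fun N : ℕ => Real.sqrt (Real.log N) * σN N) Filter.atTop
    Filter.atTop
  init_L2 : ∀ q : ℝ, 1 ≤ q →
    (⨆ (N : ℕ) (_ : 1 ≤ N), ∫⁻ ω, eLpNorm (u₀ N ω) 2 (torusVol d) ^ q ∂P) < ∞
  init_bessel : ∀ q : ℝ, 1 ≤ q →
    (⨆ (N : ℕ) (_ : 1 ≤ N), ∫⁻ ω, besselENorm γ (ENNReal.ofReal p) (u₀ N ω) ^ q ∂P) < ∞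
  init_empirical : ∀ q : ℝ, 1 ≤ q →
    (⨆ (N : ℕ) (_ : 1 ≤ N), ∫⁻ ω, eLpNorm (fun z : Torus d × E d =>
      Real.sqrt (1 + ‖z.2‖ ^ 2) ^ k *
        mollifiedEmpirical α β θ₁ θ₂ N (fun i => X₀ i ω) (fun i => V₀ i ω) z.1 z.2) 2
      ((torusVol d).prod volume) ^ q ∂P) < ∞

end FluidParticle

end

open MeasureTheory ProbabilityTheory Set
open scoped ENNReal NNReal

noncomputable section

namespace FluidParticle

variable {d : ℕ}

open UnitAddTorus Filter Topology

/-! ### Gaussian sums over `ℤᵈ` -/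

/-! Both particles of a pair are driven by the same Brownian motion, so the comparison is made path
by path. The velocity difference solves an integral equation whose sources are `u^N - u` along the
first path, the increment of `u` between the two positions, the friction, and `(σ_N - σ) B`. Since
`|u| ≤ A`, the 1-Lipschitz cut-off fixes `u` and does not enlarge `u^N - u`. If `u_t` is Lipschitz
in space with a constant integrable in time, a Gronwall argument bounds the distance by `sup |u^N -
u| + |σ - σ_N| sup |B|` (`phaseDist_kineticPath_le`). The embedding `H^γ_p ⊂ L^∞`, valid because `γ
> d/p` (`bessel_embedding`), turns the first term into the Bessel norm; dyadic chaining bounds the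
moments of `sup |B|` by a constant that does not see the probability space
(`exists_brownian_sup_bound`).

The main work is the Lipschitz bound `L t^{-μ}` with `μ < 1` for `u_t`
(`exists_isContinuousRep_lipschitz`). Velocity moments of `F` propagate in time (`moment_bound`),
and interpolation between `F ∈ L^∞` and the moment of order `p + d(p-1)` puts the drag in `L^p`
(`exists_drag_bound`). Testing the fluid equation with divergence-free plane waves gives Duhamel's
formula for every Fourier coefficient (`mild_formula`).

Regularity is then measured by sup bounds on `e^{sΔ} a` for a distribution `a` given by its
coefficients (`HeatBound`). Gaussian averaging and Gaussian integration by parts show that a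
derivative costs `s^{-1/2}`; starting from `L^p` costs `s^{-d/(2p)}`, and `(I - Δ)^{-γ/2}` gives
powers of `s` back. The Leray projector `P` has a singular symbol, but `(-Δ)P` is a differential
operator of order two (`lam_mul_sum_lerayMat`). Hence `u` is rebuilt as `e^Δ u + ∫₀¹ e^{rΔ}(-Δ)u dr`
(`synth`), and it suffices to bound `e^{rΔ}(-Δ)u` by an integrable power of `r`.

In Duhamel's integral the heat time is `r + (t - s)`, and the singularity `(r + t - s)^{-2μ}` splits
into `r^{-μ}(t-s)^{-μ}`, integrable in both variables. This gives continuity. Applied to `u(x+y) -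
u(x)`, the same bounds control the difference by `|y|` plus a singular time integral of itself,
because the flux `u ⊗ u` is Lipschitz in the bounded field `u`. With the weight `t^μ e^{-Λt}` and
`Λ` large the self-referential term is absorbed (`FluidRegularityData.exists_lipschitz`). -/

lemma hasSum_prod_pi {f : ℤ → ℝ} (hf : Summable f) (h0 : ∀ n, 0 ≤ f n) (d : ℕ) :
    HasSum (fun k : Fin d → ℤ => ∏ j, f (k j)) ((∑' n, f n) ^ d) := by
  induction d with
  | zero => simp
  | succ d ih =>
    have hs : Summable fun q : ℤ × (Fin d → ℤ) => f q.1 * ∏ j, f (q.2 j) :=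
      Summable.mul_of_nonneg (f := f) (g := fun k : Fin d → ℤ => ∏ j, f (k j)) hf ih.summable
        (Pi.le_def.2 h0) (Pi.le_def.2 fun k => Finset.prod_nonneg fun j _ => h0 _)
    have h : HasSum (fun q : ℤ × (Fin d → ℤ) => f q.1 * ∏ j, f (q.2 j)) ((∑' n, f n) ^ (d + 1)) := by
      rw [pow_succ']
      exact HasSum.mul (f := f) (g := fun k : Fin d → ℤ => ∏ j, f (k j)) hf.hasSum ih hs
    rw [← (Fin.consEquiv (fun _ : Fin (d + 1) => ℤ)).hasSum_iff]
    convert h using 1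
    ext q
    simp [Fin.prod_univ_succ, Fin.consEquiv]

/-- The term `n = 0` gives the `1`; each half-line is dominated by half the Gaussian integral, since
the summand decreases in `|n|`. -/
lemma summable_exp_neg_int_sq {c : ℝ} (hc : 0 < c) :
    Summable (fun n : ℤ => Real.exp (-(c * (n : ℝ) ^ 2))) ∧
      ∑' n : ℤ, Real.exp (-(c * (n : ℝ) ^ 2)) ≤ 1 + Real.sqrt (Real.pi / c) := by
  set f : ℝ → ℝ := fun x => Real.exp (-c * x ^ 2) with hf
  have hanti : AntitoneOn f (Ici 0) := by
    intro x hx y hy hxy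
    refine Real.exp_le_exp.2 ?_
    have : x ^ 2 ≤ y ^ 2 := pow_le_pow_left₀ hx hxy 2
    nlinarith
  have hint : IntegrableOn f (Ioi 0) := (integrable_exp_neg_mul_sq hc).integrableOn
  have hle : ∑' n : ℕ, f ((n : ℝ) + 1) ≤ Real.sqrt (Real.pi / c) / 2 := by
    have h1 := hanti.tsum_add_one_le_integral hint (fun x _ => (Real.exp_pos _).le)
    rw [hf, integral_gaussian_Ioi] at h1
    simpa [hf] using h1
  have hsum : Summable fun n : ℕ => f ((n : ℝ) + 1) := by
    have h2 : Summable fun n : ℕ => Real.exp (-c) ^ n :=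
      summable_geometric_of_lt_one (Real.exp_pos _).le (Real.exp_lt_one_iff.2 (by linarith))
    refine Summable.of_nonneg_of_le (fun n => (Real.exp_pos _).le) (fun n => ?_) h2
    rw [hf, ← Real.exp_nat_mul]
    refine Real.exp_le_exp.2 ?_
    have : (0 : ℝ) ≤ c * n := mul_nonneg hc.le n.cast_nonneg
    nlinarith [mul_nonneg hc.le (sq_nonneg (n : ℝ))]
  have h0 : Summable fun n : ℕ => Real.exp (-(c * ((n : ℤ) : ℝ) ^ 2)) := by
    rw [← summable_nat_add_iff 1]
    refine hsum.congr fun n => ?_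
    simp [hf]
  have h1 : Summable fun n : ℕ => Real.exp (-(c * ((-((n : ℤ) + 1) : ℤ) : ℝ) ^ 2)) := by
    refine hsum.congr fun n => ?_
    simp only [hf]; push_cast; congr 1; ring
  have hS : HasSum (fun n : ℤ => Real.exp (-(c * (n : ℝ) ^ 2)))
      (∑' n : ℕ, Real.exp (-(c * ((n : ℤ) : ℝ) ^ 2))
        + ∑' n : ℕ, Real.exp (-(c * ((-((n : ℤ) + 1) : ℤ) : ℝ) ^ 2))) :=
    HasSum.of_nat_of_neg_add_one (f := fun n : ℤ => Real.exp (-(c * (n : ℝ) ^ 2)))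
      h0.hasSum h1.hasSum
  refine ⟨hS.summable, ?_⟩
  rw [hS.tsum_eq, h0.tsum_eq_zero_add]
  have e1 : ∑' n : ℕ, Real.exp (-(c * (((n + 1 : ℕ) : ℤ) : ℝ) ^ 2)) = ∑' n : ℕ, f ((n : ℝ) + 1) := by
    refine tsum_congr fun n => ?_
    simp [hf]
  have e2 : ∑' n : ℕ, Real.exp (-(c * ((-((n : ℤ) + 1) : ℤ) : ℝ) ^ 2))
      = ∑' n : ℕ, f ((n : ℝ) + 1) := by
    refine tsum_congr fun n => ?_
    simp only [hf]; push_cast; congr 1; ring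
  rw [e1, e2]
  simp only [Int.cast_zero, CharP.cast_eq_zero]
  norm_num
  linarith

/-! ### Heat multipliers and Fourier series -/

/-- The eigenvalue `4π²|k|²` of `-Δ`. -/
def lam (k : Fin d → ℤ) : ℝ := 4 * Real.pi ^ 2 * freqSq k

/-- The heat multiplier `e^{-4π²|k|²s}`. -/
def hw (s : ℝ) (k : Fin d → ℤ) : ℝ := Real.exp (-(lam k * s))

/-- The symbol `2πi k_l` of `∂_l`. -/
def dsym (l : Fin d) (k : Fin d → ℤ) : ℂ := 2 * Real.pi * Complex.I * (k l : ℂ)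

/-- The Fourier series with coefficients `a`. -/
def fseries (a : (Fin d → ℤ) → ℂ) (x : Torus d) : ℂ := ∑' k, a k * mFourier k x

/-- Sequences of polynomial growth. -/
def PolyGrowth (a : (Fin d → ℤ) → ℂ) : Prop :=
  ∃ (M : ℝ) (n : ℕ), ∀ k, ‖a k‖ ≤ M * (1 + freqSq k) ^ n

lemma freqSq_nonneg (k : Fin d → ℤ) : 0 ≤ freqSq k := Finset.sum_nonneg fun _ _ => sq_nonneg _

lemma lam_nonneg (k : Fin d → ℤ) : 0 ≤ lam k := by
  have := freqSq_nonneg k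
  unfold lam; positivity

lemma hw_pos (s : ℝ) (k : Fin d → ℤ) : 0 < hw s k := Real.exp_pos _

lemma hw_add (s t : ℝ) (k : Fin d → ℤ) : hw (s + t) k = hw s k * hw t k := by
  unfold hw; rw [← Real.exp_add]; congr 1; ring

lemma hw_le_one {s : ℝ} (hs : 0 ≤ s) (k : Fin d → ℤ) : hw s k ≤ 1 :=
  Real.exp_le_one_iff.2 (neg_nonpos.2 (mul_nonneg (lam_nonneg k) hs))

lemma hw_anti {s t : ℝ} (hst : s ≤ t) (k : Fin d → ℤ) : hw t k ≤ hw s k :=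
  Real.exp_le_exp.2 (neg_le_neg (mul_le_mul_of_nonneg_left hst (lam_nonneg k)))

lemma abs_le_freqSq (k : Fin d → ℤ) (l : Fin d) : |(k l : ℝ)| ≤ 1 + freqSq k := by
  have h : (k l : ℝ) ^ 2 ≤ freqSq k :=
    Finset.single_le_sum (f := fun j => (k j : ℝ) ^ 2) (fun _ _ => sq_nonneg _) (Finset.mem_univ l)
  rw [← sq_abs] at h
  nlinarith [sq_nonneg (|(k l : ℝ)| - 1)]

lemma norm_dsym_le (l : Fin d) (k : Fin d → ℤ) : ‖dsym l k‖ ≤ 2 * Real.pi * (1 + freqSq k) := by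
  unfold dsym
  simp only [norm_mul, Complex.norm_ofNat, Complex.norm_real, Complex.norm_I, mul_one,
    Real.norm_eq_abs, abs_of_pos Real.pi_pos, Complex.norm_intCast]
  exact mul_le_mul_of_nonneg_left (abs_le_freqSq k l) (by positivity)

lemma norm_mFourier_apply (k : Fin d → ℤ) (x : Torus d) : ‖mFourier k x‖ = 1 := by
  simp only [mFourier, fourier_apply, ContinuousMap.coe_mk, norm_prod, Circle.norm_coe,
    Finset.prod_const_one]

lemma mFourier_apply_add (k : Fin d → ℤ) (x y : Torus d) :
    mFourier k (x + y) = mFourier k x * mFourier k y := by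
  simp only [mFourier, ContinuousMap.coe_mk, Pi.add_apply, fourier_apply, smul_add,
    AddCircle.toCircle_add, Circle.coe_mul, Finset.prod_mul_distrib]

lemma mFourier_proj (k : Fin d → ℤ) (y : E d) :
    mFourier k (proj y) = Complex.exp (2 * Real.pi * Complex.I * ∑ j, (k j : ℂ) * (y j : ℂ)) := by
  simp only [mFourier, ContinuousMap.coe_mk, proj, fourier_coe_apply, Finset.mul_sum,
    Complex.exp_sum]
  refine Finset.prod_congr rfl fun j _ => ?_
  congr 1
  push_cast
  ring

/-- The sum is the heat kernel on the diagonal, of order `s^{-d/2}` for small `s`. It bounds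
`e^{sΔ}` from `L¹` to `L^∞`, and interpolation with the trivial `L^∞` bound will yield the `L^p`
estimate. -/
lemma summable_hw {s : ℝ} (hs : 0 < s) : Summable (hw s : (Fin d → ℤ) → ℝ) ∧
    ∑' k : Fin d → ℤ, hw s k ≤ (1 + Real.sqrt (1 / s)) ^ d := by
  have hc : 0 < 4 * Real.pi ^ 2 * s := by positivity
  obtain ⟨h1, h2⟩ := summable_exp_neg_int_sq hc
  have h3 := hasSum_prod_pi h1 (fun n => (Real.exp_pos _).le) d
  have e : (fun k : Fin d → ℤ => ∏ j, Real.exp (-(4 * Real.pi ^ 2 * s * (k j : ℝ) ^ 2))) = hw s := by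
    ext k
    rw [← Real.exp_sum, hw, lam, freqSq]
    congr 1
    rw [Finset.sum_neg_distrib, Finset.mul_sum, Finset.sum_mul]
    congr 1
    exact Finset.sum_congr rfl fun _ _ => by ring
  rw [e] at h3
  refine ⟨h3.summable, ?_⟩
  rw [h3.tsum_eq]
  refine pow_le_pow_left₀ (tsum_nonneg fun _ => (Real.exp_pos _).le) (h2.trans ?_) d
  refine add_le_add_right (Real.sqrt_le_sqrt ?_) 1
  have := Real.pi_gt_three
  calc Real.pi / (4 * Real.pi ^ 2 * s) = 1 / (4 * Real.pi * s) := by field_simp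
    _ ≤ 1 / s := one_div_le_one_div_of_le hs (by nlinarith)

lemma poly_mul_hw_le {s : ℝ} (hs : 0 < s) (n : ℕ) :
    ∃ C, 0 ≤ C ∧ ∀ k : Fin d → ℤ, (1 + freqSq k) ^ n * hw s k ≤ C := by
  refine ⟨n.factorial * Real.exp (4 * Real.pi ^ 2 * s) / (4 * Real.pi ^ 2 * s) ^ n,
    by positivity, fun k => ?_⟩
  have hc : 0 < 4 * Real.pi ^ 2 * s := by positivity
  have hk : 0 ≤ 4 * Real.pi ^ 2 * s * (1 + freqSq k) :=
    mul_nonneg hc.le (by linarith [freqSq_nonneg k])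
  have h := Real.pow_div_factorial_le_exp _ hk n
  rw [div_le_iff₀ (by positivity), mul_pow] at h
  have e : hw s k = Real.exp (4 * Real.pi ^ 2 * s)
      * (Real.exp (4 * Real.pi ^ 2 * s * (1 + freqSq k)))⁻¹ := by
    rw [← Real.exp_neg, ← Real.exp_add, hw, lam]; congr 1; ring
  rw [e, le_div_iff₀ (by positivity)]
  have hE := Real.exp_pos (4 * Real.pi ^ 2 * s * (1 + freqSq k))
  calc (1 + freqSq k) ^ n * (Real.exp (4 * Real.pi ^ 2 * s)
        * (Real.exp (4 * Real.pi ^ 2 * s * (1 + freqSq k)))⁻¹) * (4 * Real.pi ^ 2 * s) ^ n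
      = ((4 * Real.pi ^ 2 * s) ^ n * (1 + freqSq k) ^ n) * Real.exp (4 * Real.pi ^ 2 * s)
        * (Real.exp (4 * Real.pi ^ 2 * s * (1 + freqSq k)))⁻¹ := by ring
    _ ≤ (Real.exp (4 * Real.pi ^ 2 * s * (1 + freqSq k)) * n.factorial)
        * Real.exp (4 * Real.pi ^ 2 * s)
        * (Real.exp (4 * Real.pi ^ 2 * s * (1 + freqSq k)))⁻¹ := by gcongr
    _ = n.factorial * Real.exp (4 * Real.pi ^ 2 * s) := by field_simp

/-- Half of the heat time absorbs the polynomial, the other half makes the series converge. -/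
lemma summable_poly_mul_hw {s : ℝ} (hs : 0 < s) (n : ℕ) :
    Summable fun k : Fin d → ℤ => (1 + freqSq k) ^ n * hw s k := by
  obtain ⟨C, hC, h⟩ := poly_mul_hw_le (d := d) (half_pos hs) n
  refine Summable.of_nonneg_of_le (fun k => ?_) (fun k => ?_)
    ((summable_hw (d := d) (half_pos hs)).1.mul_left C)
  · have := freqSq_nonneg k
    have := hw_pos s k
    positivity
  · have e : hw s k = hw (s / 2) k * hw (s / 2) k := by rw [← hw_add]; congr 1; ring
    rw [e, ← mul_assoc]
    exact mul_le_mul_of_nonneg_right (h k) (hw_pos _ _).le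

lemma PolyGrowth.summable {a : (Fin d → ℤ) → ℂ} (ha : PolyGrowth a) {s : ℝ} (hs : 0 < s) :
    Summable fun k => ‖(hw s k : ℂ) * a k‖ := by
  obtain ⟨M, n, h⟩ := ha
  refine Summable.of_nonneg_of_le (fun k => norm_nonneg _) (fun k => ?_)
    ((summable_poly_mul_hw (d := d) hs n).mul_left M)
  rw [norm_mul, Complex.norm_real, Real.norm_eq_abs, abs_of_pos (hw_pos s k)]
  calc hw s k * ‖a k‖ ≤ hw s k * (M * (1 + freqSq k) ^ n) :=
        mul_le_mul_of_nonneg_left (h k) (hw_pos s k).le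
    _ = _ := by ring

lemma polyGrowth_of_bounded {a : (Fin d → ℤ) → ℂ} {M : ℝ} (h : ∀ k, ‖a k‖ ≤ M) : PolyGrowth a :=
  ⟨M, 0, by simpa using h⟩

lemma PolyGrowth.dsym_mul {a : (Fin d → ℤ) → ℂ} (ha : PolyGrowth a) (l : Fin d) :
    PolyGrowth fun k => dsym l k * a k := by
  obtain ⟨M, n, h⟩ := ha
  refine ⟨2 * Real.pi * M, n + 1, fun k => ?_⟩
  rw [norm_mul]
  have h0 := freqSq_nonneg k
  calc ‖dsym l k‖ * ‖a k‖ ≤ (2 * Real.pi * (1 + freqSq k)) * (M * (1 + freqSq k) ^ n) :=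
        mul_le_mul (norm_dsym_le l k) (h k) (norm_nonneg _) (by positivity)
    _ = _ := by ring

lemma PolyGrowth.add {a b : (Fin d → ℤ) → ℂ} (ha : PolyGrowth a) (hb : PolyGrowth b) :
    PolyGrowth fun k => a k + b k := by
  obtain ⟨M, n, h⟩ := ha
  obtain ⟨M', n', h'⟩ := hb
  refine ⟨|M| + |M'|, n + n', fun k => ?_⟩
  have h1 : 1 ≤ 1 + freqSq k := by linarith [freqSq_nonneg k]
  have hk : 0 ≤ 1 + freqSq k := by linarith
  calc ‖a k + b k‖ ≤ ‖a k‖ + ‖b k‖ := norm_add_le _ _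
    _ ≤ |M| * (1 + freqSq k) ^ n + |M'| * (1 + freqSq k) ^ n' :=
        add_le_add ((h k).trans (mul_le_mul_of_nonneg_right (le_abs_self M) (by positivity)))
          ((h' k).trans (mul_le_mul_of_nonneg_right (le_abs_self M') (by positivity)))
    _ ≤ |M| * (1 + freqSq k) ^ (n + n') + |M'| * (1 + freqSq k) ^ (n + n') := by
        gcongr <;> first | exact h1 | omega
    _ = _ := by ring

lemma PolyGrowth.sum {ι : Type*} (t : Finset ι) {a : ι → (Fin d → ℤ) → ℂ}
    (ha : ∀ i ∈ t, PolyGrowth (a i)) : PolyGrowth fun k => ∑ i ∈ t, a i k := by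
  classical
  induction t using Finset.induction_on with
  | empty => exact ⟨0, 0, by simp⟩
  | insert i t hi ih =>
    simp only [Finset.sum_insert hi]
    exact (ha i (Finset.mem_insert_self _ _)).add
      (ih fun j hj => ha j (Finset.mem_insert_of_mem hj))

lemma PolyGrowth.bdd_mul {a c : (Fin d → ℤ) → ℂ} (ha : PolyGrowth a) {K : ℝ}
    (hc : ∀ k, ‖c k‖ ≤ K) : PolyGrowth fun k => c k * a k := by
  obtain ⟨M, n, h⟩ := ha
  refine ⟨K * M, n, fun k => ?_⟩
  rw [norm_mul, mul_assoc]
  exact mul_le_mul (hc k) (h k) (norm_nonneg _) ((norm_nonneg _).trans (hc k))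

lemma norm_mul_mFourier (a : (Fin d → ℤ) → ℂ) (k : Fin d → ℤ) (x : Torus d) :
    ‖a k * mFourier k x‖ = ‖a k‖ := by
  rw [norm_mul, norm_mFourier_apply, mul_one]

lemma continuous_fseries {a : (Fin d → ℤ) → ℂ} (ha : Summable fun k => ‖a k‖) :
    Continuous (fseries a) :=
  continuous_tsum (fun k => continuous_const.mul (mFourier k).continuous) ha
    fun k x => (norm_mul_mFourier a k x).le

lemma norm_fseries_le {a : (Fin d → ℤ) → ℂ} (ha : Summable fun k => ‖a k‖) (x : Torus d) :
    ‖fseries a x‖ ≤ ∑' k, ‖a k‖ := by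
  refine (norm_tsum_le_tsum_norm ?_).trans (le_of_eq ?_)
  · simpa only [norm_mul_mFourier] using ha
  · simp only [norm_mul_mFourier]

lemma summable_mul_mFourier {a : (Fin d → ℤ) → ℂ} (ha : Summable fun k => ‖a k‖) (x : Torus d) :
    Summable fun k => a k * mFourier k x :=
  Summable.of_norm (by simpa only [norm_mul_mFourier] using ha)

/-- Interchange of a Fourier series with an integral. -/
lemma fseries_integral {α : Type*} [MeasurableSpace α] {μ : Measure α} {f : α → (Fin d → ℤ) → ℂ}
    {b : (Fin d → ℤ) → ℝ} {G : α → ℝ} (hG : Integrable G μ) (hb : Summable b)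
    (hm : ∀ k, AEStronglyMeasurable (fun s => f s k) μ)
    (hf : ∀ k, ∀ᵐ s ∂μ, ‖f s k‖ ≤ G s * b k) (x : Torus d) :
    fseries (fun k => ∫ s, f s k ∂μ) x = ∫ s, fseries (f s) x ∂μ := by
  unfold fseries
  have hi : ∀ k, Integrable (fun s => f s k * mFourier k x) μ := fun k =>
    (Integrable.mono' (hG.mul_const (b k)) (hm k) (hf k)).mul_const _
  rw [← integral_tsum_of_summable_integral_norm hi]
  · exact tsum_congr fun k => (integral_mul_const _ _).symm
  · refine Summable.of_nonneg_of_le (fun k => integral_nonneg fun s => norm_nonneg _) (fun k => ?_)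
      (hb.mul_left (∫ s, G s ∂μ))
    rw [← integral_mul_const]
    refine integral_mono_ae (hi k).norm (hG.mul_const _) ?_
    filter_upwards [hf k] with s hs
    rwa [norm_mul_mFourier (f s)]

/-! ### Gaussian averages -/

instance : IsProbabilityMeasure (torusVol d) :=
  inferInstanceAs (IsProbabilityMeasure (Measure.pi fun _ : Fin d => AddCircle.haarAddCircle))

instance : Measure.IsAddHaarMeasure (torusVol d) :=
  inferInstanceAs (Measure.IsAddHaarMeasure (Measure.pi fun _ : Fin d => AddCircle.haarAddCircle))

lemma mFourierCoeff_eq (f : Torus d → ℂ) (k : Fin d → ℤ) :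
    mFourierCoeff f k = ∫ x, mFourier (-k) x * f x ∂(torusVol d) := rfl

lemma continuous_proj : Continuous (proj : E d → Torus d) := by
  unfold proj
  refine continuous_pi fun j => ?_
  exact (AddCircle.continuous_mk' 1).comp (by fun_prop)

lemma proj_zero : proj (0 : E d) = 0 := by
  ext j; simp [proj]

/-- The frequency `k` as a vector of `ℝᵈ`. -/
def freqVec (k : Fin d → ℤ) : E d := WithLp.toLp 2 fun j => (k j : ℝ)

lemma norm_freqVec_sq (k : Fin d → ℤ) : ‖freqVec k‖ ^ 2 = freqSq k := by
  simp [EuclideanSpace.norm_sq_eq, freqVec, freqSq]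

lemma inner_freqVec (k : Fin d → ℤ) (z : E d) :
    inner ℝ z (freqVec k) = ∑ j, (k j : ℝ) * z j := by
  simp [PiLp.inner_apply, freqVec]

lemma mFourier_proj_smul (k : Fin d → ℤ) (c : ℝ) (z : E d) :
    mFourier k (proj (c • z))
      = Complex.exp (inner ℝ z ((2 * Real.pi * c) • freqVec k) * Complex.I) := by
  rw [mFourier_proj, inner_smul_right, inner_freqVec]
  congr 1
  push_cast
  simp only [Finset.mul_sum, Finset.sum_mul, PiLp.smul_apply, smul_eq_mul]
  refine Finset.sum_congr rfl fun j _ => ?_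
  push_cast
  ring

lemma gaussian_exp_eq {s : ℝ} (hs : 0 ≤ s) (k : Fin d → ℤ) :
    Complex.exp (-‖(2 * Real.pi * Real.sqrt (2 * s)) • freqVec k‖ ^ 2 / 2) = (hw s k : ℂ) := by
  rw [hw, Complex.ofReal_exp, lam, ← norm_freqVec_sq]
  congr 1
  rw [norm_smul]
  have h : Real.sqrt (2 * s) ^ 2 = 2 * s := Real.sq_sqrt (by linarith)
  have h2 : (‖(2 * Real.pi * Real.sqrt (2 * s) : ℝ)‖ * ‖freqVec k‖) ^ 2 / 2
      = 4 * Real.pi ^ 2 * ‖freqVec k‖ ^ 2 * s := by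
    rw [mul_pow, Real.norm_eq_abs, sq_abs, mul_pow, h]; ring
  rw [neg_div]
  exact_mod_cast congrArg (fun x : ℝ => ((-x : ℝ) : ℂ)) h2

/-- The characteristic function of a Gaussian: `e^{sΔ}` is the average over random translations by
`√(2s) Z`. The variance is `2s` because the generator is `Δ` and not `Δ/2`. -/
lemma integral_mFourier_gaussian {s : ℝ} (hs : 0 ≤ s) (k : Fin d → ℤ) :
    ∫ z, mFourier k (proj (Real.sqrt (2 * s) • z)) ∂(stdGaussian (E d)) = hw s k := by
  simp_rw [mFourier_proj_smul]
  rw [← charFun_apply, charFun_stdGaussian, gaussian_exp_eq hs]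

/-- Gaussian integration by parts for plane waves, obtained by differentiating the characteristic
function once. It moves a derivative onto the weight `z_l` and is the source of every `s^{-1/2}`
below. -/
lemma integral_coord_mul_mFourier_gaussian {s : ℝ} (hs : 0 ≤ s) (k : Fin d → ℤ) (l : Fin d) :
    ∫ z, ((z l : ℝ) : ℂ) * mFourier k (proj (Real.sqrt (2 * s) • z)) ∂(stdGaussian (E d))
      = Real.sqrt (2 * s) * (dsym l k * hw s k) := by
  set t : E d := (2 * Real.pi * Real.sqrt (2 * s)) • freqVec k with ht
  have h1 := iteratedFDeriv_charFun (μ := stdGaussian (E d)) (n := 1) (t := t)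
    (IsGaussian.memLp_id _ _ (by simp)) (fun _ => EuclideanSpace.single l 1)
  have h2 : charFun (stdGaussian (E d)) = fun t => Complex.exp (-‖t‖ ^ 2 / 2) :=
    funext charFun_stdGaussian
  have h3 : HasFDerivAt (fun t : E d => Complex.exp (-‖t‖ ^ 2 / 2))
      (Complex.exp (-‖t‖ ^ 2 / 2) • (-(Complex.ofRealCLM.comp (innerSL ℝ t)))) t := by
    have key : HasFDerivAt (fun t : E d => -(‖t‖ : ℂ) ^ 2 / 2)
        (-(Complex.ofRealCLM.comp (innerSL ℝ t))) t := by
      have h4 := (hasStrictFDerivAt_norm_sq t).hasFDerivAt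
      have h5 := (Complex.ofRealCLM.hasFDerivAt.comp t (h4.const_mul (-1 / 2 : ℝ)))
      have e1 : (fun t : E d => -(‖t‖ : ℂ) ^ 2 / 2)
          = Complex.ofRealCLM ∘ fun y : E d => -1 / 2 * ‖y‖ ^ 2 := by
        ext y; simp only [Function.comp, Complex.ofRealCLM_apply]; push_cast; ring
      have e2 : -(Complex.ofRealCLM.comp (innerSL ℝ t))
          = Complex.ofRealCLM.comp ((-1 / 2 : ℝ) • (2 : ℕ) • innerSL ℝ t) := by
        ext y
        simp only [ContinuousLinearMap.comp_apply, Complex.ofRealCLM_apply, neg_apply, smul_apply,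
          smul_eq_mul, nsmul_eq_mul, innerSL_apply_apply]
        push_cast; ring
      rw [e1, e2]; exact h5
    exact key.cexp
  rw [iteratedFDeriv_one_apply, h2, h3.fderiv] at h1
  simp only [Finset.univ_unique, Fin.default_eq_zero, Finset.prod_singleton,
    pow_one] at h1
  have h6 : inner ℝ t (EuclideanSpace.single l (1 : ℝ)) = 2 * Real.pi * Real.sqrt (2 * s) * k l := by
    simp [ht, freqVec, EuclideanSpace.inner_single_right]
  have h7 : ∀ z : E d, inner ℝ z (EuclideanSpace.single l (1 : ℝ)) = z l := fun z => by
    simp [EuclideanSpace.inner_single_right]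
  simp only [h7] at h1
  simp only [smul_apply, neg_apply,
    ContinuousLinearMap.comp_apply, innerSL_apply_apply, h6, smul_eq_mul] at h1
  rw [ht, gaussian_exp_eq hs] at h1
  simp_rw [mFourier_proj_smul]
  have h8 := congrArg (fun w => -Complex.I * w) h1
  simp only [Complex.ofRealCLM_apply] at h8
  rw [← mul_assoc (-Complex.I) Complex.I, neg_mul, neg_mul, Complex.I_mul_I, neg_neg, one_mul] at h8
  rw [← h8, dsym]
  push_cast
  ring

/-- `E|Z|` for a standard Gaussian vector `Z`. -/
def gaussAbs (d : ℕ) : ℝ := ∫ z, ‖z‖ ∂(stdGaussian (E d))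

lemma gaussAbs_nonneg : 0 ≤ gaussAbs d := integral_nonneg fun _ => norm_nonneg _

lemma integrable_norm_gaussian : Integrable (fun z : E d => ‖z‖) (stdGaussian (E d)) :=
  (IsGaussian.integrable_id).norm

lemma abs_coord_le (z : E d) (l : Fin d) : |z l| ≤ ‖z‖ := by
  simpa using PiLp.norm_apply_le z l

lemma fseries_hw_eq {a : (Fin d → ℤ) → ℂ} (ha : Summable fun k => ‖a k‖) {s : ℝ} (hs : 0 ≤ s)
    (x : Torus d) : fseries (fun k => (hw s k : ℂ) * a k) x
      = ∫ z, fseries a (x + proj (Real.sqrt (2 * s) • z)) ∂(stdGaussian (E d)) := by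
  have hc : Continuous fun z : E d => proj (Real.sqrt (2 * s) • z) :=
    continuous_proj.comp (by fun_prop)
  have h := fseries_integral (μ := stdGaussian (E d))
    (f := fun z k => mFourier k (proj (Real.sqrt (2 * s) • z)) * a k) (G := fun _ => 1)
    (integrable_const _) ha
    (fun k => (((mFourier k).continuous.comp hc).mul continuous_const).aestronglyMeasurable)
    (fun k => ae_of_all _ fun z => by rw [norm_mul, norm_mFourier_apply]) x
  simp_rw [integral_mul_const, integral_mFourier_gaussian hs] at h
  rw [h]
  refine integral_congr_ae (ae_of_all _ fun z => ?_)
  simp only [fseries, mFourier_apply_add]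
  exact tsum_congr fun k => by ring

lemma fseries_dsym_hw_eq {a : (Fin d → ℤ) → ℂ} (ha : Summable fun k => ‖a k‖) {s : ℝ} (hs : 0 ≤ s)
    (l : Fin d) (x : Torus d) :
    Real.sqrt (2 * s) * fseries (fun k => (hw s k : ℂ) * (dsym l k * a k)) x
      = ∫ z, ((z l : ℝ) : ℂ) * fseries a (x + proj (Real.sqrt (2 * s) • z))
        ∂(stdGaussian (E d)) := by
  have hc : Continuous fun z : E d => proj (Real.sqrt (2 * s) • z) :=
    continuous_proj.comp (by fun_prop)
  have h := fseries_integral (μ := stdGaussian (E d))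
    (f := fun z k => (((z l : ℝ) : ℂ) * mFourier k (proj (Real.sqrt (2 * s) • z))) * a k)
    (G := fun z => ‖z‖) integrable_norm_gaussian ha
    (fun k => Continuous.aestronglyMeasurable (by
      have := (mFourier k).continuous.comp hc
      simp only [Function.comp_def] at this
      fun_prop))
    (fun k => ae_of_all _ fun z => by
      rw [norm_mul, norm_mul, norm_mFourier_apply, mul_one, Complex.norm_real]
      exact mul_le_mul_of_nonneg_right (abs_coord_le z l) (norm_nonneg _)) x
  simp_rw [integral_mul_const, integral_coord_mul_mFourier_gaussian hs] at h
  have e : fseries (fun k => Real.sqrt (2 * s) * (dsym l k * hw s k) * a k) x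
      = Real.sqrt (2 * s) * fseries (fun k => (hw s k : ℂ) * (dsym l k * a k)) x := by
    simp only [fseries]
    rw [← tsum_mul_left]
    exact tsum_congr fun k => by ring
  rw [← e, h]
  refine integral_congr_ae (ae_of_all _ fun z => ?_)
  simp only [fseries, mFourier_apply_add]
  rw [← tsum_mul_left]
  exact tsum_congr fun k => by ring

/-! ### Sup bounds along the heat flow of a distribution. -/

/-- `|e^{sΔ} a| ≤ M` pointwise, for the distribution with Fourier coefficients `a`. -/
def HeatBound (a : (Fin d → ℤ) → ℂ) (s M : ℝ) : Prop :=
  ∀ x, ‖fseries (fun k => (hw s k : ℂ) * a k) x‖ ≤ M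

/-- Further heat flow is an average over translations, hence a contraction for the sup norm. -/
lemma HeatBound.add_time {a : (Fin d → ℤ) → ℂ} (ha : PolyGrowth a) {s M : ℝ} (hs : 0 < s)
    (h : HeatBound a s M) {r : ℝ} (hr : 0 ≤ r) : HeatBound a (s + r) M := by
  intro x
  have e : (fun k => (hw (s + r) k : ℂ) * a k) = fun k => (hw r k : ℂ) * ((hw s k : ℂ) * a k) := by
    ext k; rw [hw_add]; push_cast; ring
  rw [e, fseries_hw_eq (ha.summable hs) hr]
  refine (norm_integral_le_of_norm_le_const (ae_of_all _ fun z => h _)).trans ?_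
  simp

/-- The extra time `r` pays for the derivative: by Gaussian integration by parts `√(2r) ∂_l e^{rΔ}
f` is an average of translates of `f` weighted by `z_l`. -/
lemma HeatBound.dsym {a : (Fin d → ℤ) → ℂ} (ha : PolyGrowth a) {s M : ℝ} (hs : 0 < s)
    (h : HeatBound a s M) {r : ℝ} (hr : 0 < r) (l : Fin d) :
    HeatBound (fun k => dsym l k * a k) (s + r) (gaussAbs d * r ^ (-(1 / 2) : ℝ) * M) := by
  intro x
  have e : (fun k => (hw (s + r) k : ℂ) * (FluidParticle.dsym l k * a k))
      = fun k => (hw r k : ℂ) * (FluidParticle.dsym l k * ((hw s k : ℂ) * a k)) := by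
    ext k; rw [hw_add]; push_cast; ring
  have h1 := fseries_dsym_hw_eq (ha.summable hs) hr.le l x
  rw [e]
  set F := fseries (fun k => (hw r k : ℂ) * (FluidParticle.dsym l k * ((hw s k : ℂ) * a k))) x
  have h2 : ‖∫ z, ((z l : ℝ) : ℂ) * fseries (fun k => (hw s k : ℂ) * a k)
      (x + proj (Real.sqrt (2 * r) • z)) ∂(stdGaussian (E d))‖ ≤ gaussAbs d * M := by
    unfold gaussAbs
    rw [← integral_mul_const]
    refine norm_integral_le_of_norm_le (integrable_norm_gaussian.mul_const M)
      (ae_of_all _ fun z => ?_)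
    rw [norm_mul, Complex.norm_real]
    exact mul_le_mul (abs_coord_le z l) (h _) (norm_nonneg _) (norm_nonneg _)
  rw [← h1, norm_mul, Complex.norm_real, Real.norm_eq_abs, abs_of_nonneg (Real.sqrt_nonneg _)] at h2
  have h3 : Real.sqrt r ≤ Real.sqrt (2 * r) := Real.sqrt_le_sqrt (by linarith)
  have h4 : 0 < Real.sqrt r := Real.sqrt_pos.2 hr
  have h5 : r ^ (-(1 / 2) : ℝ) = (Real.sqrt r)⁻¹ := by
    rw [Real.rpow_neg hr.le, Real.sqrt_eq_rpow]
  rw [h5]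
  have h6 : Real.sqrt r * ‖F‖ ≤ gaussAbs d * M :=
    (mul_le_mul_of_nonneg_right h3 (norm_nonneg _)).trans h2
  calc ‖F‖ = (Real.sqrt r)⁻¹ * (Real.sqrt r * ‖F‖) := by field_simp
    _ ≤ (Real.sqrt r)⁻¹ * (gaussAbs d * M) := by gcongr
    _ = _ := by ring

lemma HeatBound.mono {a : (Fin d → ℤ) → ℂ} {s M M' : ℝ} (h : HeatBound a s M) (hM : M ≤ M') :
    HeatBound a s M' := fun x => (h x).trans hM

lemma HeatBound.add {a b : (Fin d → ℤ) → ℂ} (ha : PolyGrowth a) (hb : PolyGrowth b)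
    {s M M' : ℝ} (hs : 0 < s) (h : HeatBound a s M) (h' : HeatBound b s M') :
    HeatBound (fun k => a k + b k) s (M + M') := by
  intro x
  have e : fseries (fun k => (hw s k : ℂ) * (a k + b k)) x
      = fseries (fun k => (hw s k : ℂ) * a k) x + fseries (fun k => (hw s k : ℂ) * b k) x := by
    unfold fseries
    rw [← Summable.tsum_add (summable_mul_mFourier (ha.summable hs) x)
      (summable_mul_mFourier (hb.summable hs) x)]
    exact tsum_congr fun k => by ring
  rw [e]
  exact (norm_add_le _ _).trans (add_le_add (h x) (h' x))

lemma HeatBound.const_mul {a : (Fin d → ℤ) → ℂ} {s M : ℝ} (h : HeatBound a s M) (c : ℂ) :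
    HeatBound (fun k => c * a k) s (‖c‖ * M) := by
  intro x
  have e : fseries (fun k => (hw s k : ℂ) * (c * a k)) x
      = c * fseries (fun k => (hw s k : ℂ) * a k) x := by
    unfold fseries
    rw [← tsum_mul_left]
    exact tsum_congr fun k => by ring
  rw [e, norm_mul]
  exact mul_le_mul_of_nonneg_left (h x) (norm_nonneg _)

lemma HeatBound.sum {ι : Type*} (t : Finset ι) {a : ι → (Fin d → ℤ) → ℂ}
    (ha : ∀ i ∈ t, PolyGrowth (a i)) {s : ℝ} (hs : 0 < s) {M : ι → ℝ}
    (h : ∀ i ∈ t, HeatBound (a i) s (M i)) :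
    HeatBound (fun k => ∑ i ∈ t, a i k) s (∑ i ∈ t, M i) := by
  classical
  induction t using Finset.induction_on with
  | empty => intro x; simp [fseries]
  | insert i t hi ih =>
    simp only [Finset.sum_insert hi]
    exact HeatBound.add (ha i (Finset.mem_insert_self _ _))
      (PolyGrowth.sum t fun j hj => ha j (Finset.mem_insert_of_mem hj)) hs
      (h i (Finset.mem_insert_self _ _))
      (ih (fun j hj => ha j (Finset.mem_insert_of_mem hj))
        (fun j hj => h j (Finset.mem_insert_of_mem hj)))

/-- The symbol of `∂_{l₁} ⋯ ∂_{lₙ}`. -/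
def dsyms (L : List (Fin d)) (k : Fin d → ℤ) : ℂ := (L.map fun l => dsym l k).prod

lemma PolyGrowth.dsyms_mul {a : (Fin d → ℤ) → ℂ} (ha : PolyGrowth a) (L : List (Fin d)) :
    PolyGrowth fun k => dsyms L k * a k := by
  induction L with
  | nil => simpa [dsyms] using ha
  | cons l L ih =>
    have := ih.dsym_mul l
    simpa only [dsyms, List.map_cons, List.prod_cons, mul_assoc] using this

lemma HeatBound.dsyms_aux {a : (Fin d → ℤ) → ℂ} (ha : PolyGrowth a) {s M : ℝ} (hs : 0 < s)
    (h : HeatBound a s M) {r : ℝ} (hr : 0 < r) (L : List (Fin d)) :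
    HeatBound (fun k => dsyms L k * a k) (s + L.length * r)
      ((gaussAbs d * r ^ (-(1 / 2) : ℝ)) ^ L.length * M) := by
  induction L with
  | nil => simpa [dsyms] using h
  | cons l L ih =>
    have h1 := HeatBound.dsym (ha.dsyms_mul L) (by positivity) ih hr l
    have e1 : s + (l :: L).length * r = s + L.length * r + r := by
      simp only [List.length_cons]; push_cast; ring
    have e2 : (fun k => dsyms (l :: L) k * a k) = fun k => FluidParticle.dsym l k * (dsyms L k * a k) := by
      ext k; simp only [dsyms, List.map_cons, List.prod_cons, mul_assoc]
    rw [e1, e2]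
    refine h1.mono (le_of_eq ?_)
    simp only [List.length_cons, pow_succ]
    ring

/-- One quarter of the time carries the given bound and each derivative uses another quarter, which
is why at most three are allowed; unused time is spent by `HeatBound.add_time`. Three suffice: two
from `-Δ`, and one from a divergence or a translation. The factor `2` is `(1/4)^{-1/2}`. -/
lemma HeatBound.dsyms {a : (Fin d → ℤ) → ℂ} (ha : PolyGrowth a) {s M : ℝ} (hs : 0 < s)
    (h : HeatBound a (s / 4) M) (L : List (Fin d)) (hL : L.length ≤ 3) :
    HeatBound (fun k => dsyms L k * a k) s
      ((2 * gaussAbs d) ^ L.length * s ^ (-(L.length / 2) : ℝ) * M) := by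
  have h1 := HeatBound.dsyms_aux ha (by positivity) h (show 0 < s / 4 by positivity) L
  have hl : (L.length : ℝ) ≤ 3 := by exact_mod_cast hL
  have h2 := h1.add_time (ha.dsyms_mul L) (by positivity)
    (r := s - (s / 4 + L.length * (s / 4))) (by nlinarith)
  rw [add_sub_cancel] at h2
  refine h2.mono (le_of_eq ?_)
  congr 1
  rw [Real.div_rpow hs.le (by norm_num), mul_pow, mul_pow, div_pow]
  have e1 : ((4 : ℝ) ^ (-(1 / 2) : ℝ)) = 1 / 2 := by
    rw [show (4 : ℝ) = 2 ^ (2 : ℝ) by norm_num, ← Real.rpow_mul (by norm_num)]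
    norm_num [Real.rpow_neg_one]
  have e2 : (s ^ (-(1 / 2) : ℝ)) ^ L.length = s ^ (-(L.length / 2) : ℝ) := by
    rw [← Real.rpow_mul_natCast hs.le]; congr 1; ring
  rw [e1, e2]
  have e3 : (1 / 2 : ℝ) ^ L.length * 2 ^ L.length = 1 := by rw [← mul_pow]; norm_num
  field_simp
  rw [mul_assoc, e3, mul_one]

/-! ### Fourier coefficients -/

lemma ae_eq_of_mFourierCoeff_eq {f g : Torus d → ℂ} (hf : MemLp f 2 (torusVol d))
    (hg : MemLp g 2 (torusVol d)) (h : ∀ k, mFourierCoeff f k = mFourierCoeff g k) :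
    f =ᵐ[torusVol d] g := by
  let F : Lp ℂ 2 (torusVol d) := hf.toLp f
  let G : Lp ℂ 2 (torusVol d) := hg.toLp g
  have hF : ∀ k, mFourierCoeff F k = mFourierCoeff f k := fun k => by
    rw [mFourierCoeff_eq, mFourierCoeff_eq]
    refine integral_congr_ae ?_
    filter_upwards [hf.coeFn_toLp] with x hx
    rw [hx]
  have hG : ∀ k, mFourierCoeff G k = mFourierCoeff g k := fun k => by
    rw [mFourierCoeff_eq, mFourierCoeff_eq]
    refine integral_congr_ae ?_
    filter_upwards [hg.coeFn_toLp] with x hx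
    rw [hx]
  have hFG : F = G := by
    refine (mFourierBasis (d := Fin d)).repr.injective (lp.ext (funext fun k => ?_))
    exact (mFourierBasis_repr F k).trans (((hF k).trans ((h k).trans (hG k).symm)).trans
      (mFourierBasis_repr G k).symm)
  filter_upwards [hf.coeFn_toLp, hg.coeFn_toLp] with x h1 h2
  have h3 : F x = G x := by rw [hFG]
  exact h1.symm.trans (h3.trans h2)

lemma norm_mFourierCoeff_le (f : Torus d → ℂ) (k : Fin d → ℤ) :
    ‖mFourierCoeff f k‖ ≤ ∫ x, ‖f x‖ ∂(torusVol d) := by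
  rw [mFourierCoeff_eq]
  refine (norm_integral_le_integral_norm _).trans (le_of_eq ?_)
  refine integral_congr_ae (ae_of_all _ fun x => ?_)
  simp only [norm_mul, norm_mFourier_apply, one_mul]

lemma polyGrowth_mFourierCoeff (f : Torus d → ℂ) : PolyGrowth (mFourierCoeff f) :=
  polyGrowth_of_bounded (norm_mFourierCoeff_le f)

lemma integral_mFourier (n : Fin d → ℤ) :
    ∫ x, mFourier n x ∂(torusVol d) = if n = 0 then 1 else 0 := by
  split_ifs with h
  · simp [h, mFourier_zero]
  · obtain ⟨j, hj⟩ := Function.ne_iff.1 h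
    have hj' : (n j : ℂ) ≠ 0 := by exact_mod_cast hj
    -- Translation by half a wavelength in a direction with `n j ≠ 0` changes the sign of the
    -- character but not the integral.
    let y : E d := EuclideanSpace.single j (1 / (2 * (n j : ℝ)))
    have h1 : mFourier n (proj y) = -1 := by
      rw [mFourier_proj, Finset.sum_eq_single j (fun b _ hb => by simp [y, hb]) (by simp)]
      rw [← Complex.exp_pi_mul_I]
      congr 1
      simp only [y, PiLp.single_apply, if_true]
      push_cast
      field_simp
    have h2 := integral_add_right_eq_self (μ := torusVol d) (fun x => mFourier n x) (proj y)
    simp only [mFourier_apply_add, h1, mul_neg, mul_one, integral_neg] at h2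
    have h3 : (2 : ℂ) * ∫ x, mFourier n x ∂(torusVol d) = 0 := by linear_combination -h2
    simpa using h3

lemma mFourierCoeff_fseries {a : (Fin d → ℤ) → ℂ} (ha : Summable fun k => ‖a k‖)
    (k : Fin d → ℤ) : mFourierCoeff (fseries a) k = a k := by
  have h1 : ∀ x, mFourier (-k) x * fseries a x = ∑' m, a m * mFourier (m - k) x := fun x => by
    unfold fseries
    rw [← tsum_mul_left]
    refine tsum_congr fun m => ?_
    rw [sub_eq_add_neg, mFourier_add]
    ring
  rw [mFourierCoeff_eq]
  simp_rw [h1]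
  have hi : ∀ m, Integrable (fun x => a m * mFourier (m - k) x) (torusVol d) := fun m =>
    ((continuous_const.mul (mFourier (m - k)).continuous)).integrable_of_hasCompactSupport
      (HasCompactSupport.of_compactSpace _)
  rw [← integral_tsum_of_summable_integral_norm hi]
  · simp_rw [integral_const_mul, integral_mFourier, sub_eq_zero]
    rw [tsum_eq_single k (fun m hm => by simp [hm])]
    simp
  · refine ha.congr fun m => ?_
    simp [norm_mFourier_apply]

lemma memLp_of_continuous {f : Torus d → ℂ} (hf : Continuous f) (p : ℝ≥0∞) :
    MemLp f p (torusVol d) := by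
  obtain ⟨C, hC⟩ := (isCompact_univ (X := Torus d)).exists_bound_of_continuousOn hf.continuousOn
  exact MemLp.of_bound hf.aestronglyMeasurable C (ae_of_all _ fun x => hC x (mem_univ x))

/-- The heat semigroup as a Gaussian average. -/
lemma fseries_hw_coeff_ae {g : Torus d → ℂ} (hg : Measurable g) {M : ℝ} (hM : ∀ x, ‖g x‖ ≤ M)
    {s : ℝ} (hs : 0 < s) :
    (fseries fun k => (hw s k : ℂ) * mFourierCoeff g k) =ᵐ[torusVol d]
      fun x => ∫ z, g (x + proj (Real.sqrt (2 * s) • z)) ∂(stdGaussian (E d)) := by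
  have hpm : Measurable fun z : E d => proj (Real.sqrt (2 * s) • z) :=
    (continuous_proj.comp (by fun_prop)).measurable
  have hjm : Measurable fun q : Torus d × E d => g (q.1 + proj (Real.sqrt (2 * s) • q.2)) :=
    hg.comp (measurable_fst.add (hpm.comp measurable_snd))
  have hm : StronglyMeasurable
      fun x => ∫ z, g (x + proj (Real.sqrt (2 * s) • z)) ∂(stdGaussian (E d)) :=
    hjm.stronglyMeasurable.integral_prod_right'
  have hb : ∀ x, ‖∫ z, g (x + proj (Real.sqrt (2 * s) • z)) ∂(stdGaussian (E d))‖ ≤ M := fun x => by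
    simpa using norm_integral_le_of_norm_le_const (μ := stdGaussian (E d))
      (ae_of_all _ fun z => hM (x + proj (Real.sqrt (2 * s) • z)))
  have hs1 := (polyGrowth_mFourierCoeff g).summable hs
  refine ae_eq_of_mFourierCoeff_eq (memLp_of_continuous (continuous_fseries hs1) 2)
    (MemLp.of_bound hm.aestronglyMeasurable M (ae_of_all _ hb)) fun k => ?_
  rw [mFourierCoeff_fseries hs1, mFourierCoeff_eq (fun x => ∫ z, _ ∂_)]
  simp_rw [← integral_const_mul]
  rw [integral_integral_swap]
  · have h1 : ∀ z : E d, ∫ x, mFourier (-k) x * g (x + proj (Real.sqrt (2 * s) • z)) ∂(torusVol d)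
        = mFourier k (proj (Real.sqrt (2 * s) • z)) * mFourierCoeff g k := fun z => by
      rw [mFourierCoeff_eq, ← integral_const_mul,
        ← integral_add_right_eq_self (μ := torusVol d) (fun x => mFourier k _ * (mFourier (-k) x * g x))
          (proj (Real.sqrt (2 * s) • z))]
      refine integral_congr_ae (ae_of_all _ fun x => ?_)
      have h2 : mFourier k (proj (Real.sqrt (2 * s) • z))
          * mFourier (-k) (proj (Real.sqrt (2 * s) • z)) = 1 := by
        rw [← mFourier_add, add_neg_cancel, mFourier_zero]; rfl
      simp only [mFourier_apply_add]
      linear_combination (-(mFourier (-k) x * g (x + proj (Real.sqrt (2 * s) • z)))) * h2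
    simp_rw [h1]
    rw [integral_mul_const, integral_mFourier_gaussian hs.le]
  · refine Integrable.of_bound (C := M) (Measurable.aestronglyMeasurable ?_) (ae_of_all _ fun q => ?_)
    · exact ((mFourier (-k)).continuous.measurable.comp measurable_fst).mul hjm
    · simp only [Function.uncurry, norm_mul, norm_mFourier_apply, one_mul]
      exact hM _

lemma eq_of_ae_eq_torus {α : Type*} [TopologicalSpace α] [T2Space α] {f g : Torus d → α}
    (hf : Continuous f) (hg : Continuous g) (h : f =ᵐ[torusVol d] g) : f = g :=
  (hf.ae_eq_iff_eq (torusVol d) hg).1 h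

lemma le_of_ae_le_torus {f : Torus d → ℝ} (hf : Continuous f) {M : ℝ}
    (h : ∀ᵐ x ∂(torusVol d), f x ≤ M) (x : Torus d) : f x ≤ M := by
  have h1 : (fun x => max (f x) M) =ᵐ[torusVol d] fun _ => M := by
    filter_upwards [h] with x hx using max_eq_right hx
  have h2 := congrFun (eq_of_ae_eq_torus (hf.max continuous_const) continuous_const h1) x
  exact max_eq_right_iff.1 h2

lemma heatBound_of_bounded {g : Torus d → ℂ} (hg : AEStronglyMeasurable g (torusVol d)) {M : ℝ}
    (hM : ∀ᵐ x ∂(torusVol d), ‖g x‖ ≤ M) {s : ℝ} (hs : 0 < s) :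
    HeatBound (mFourierCoeff g) s M := by
  have hM0 : 0 ≤ M := by
    obtain ⟨x, hx⟩ := hM.exists
    exact (norm_nonneg _).trans hx
  -- `g` is replaced by a measurable function bounded at every point, so that its Gaussian averages
  -- over translations are defined and bounded everywhere. The coefficients do not change. The
  -- resulting a.e. bound becomes a pointwise one because the series is continuous.
  let g₁ : Torus d → ℂ := hg.mk g
  have hg₁ : Measurable g₁ := hg.stronglyMeasurable_mk.measurable
  let g₂ : Torus d → ℂ := {x | ‖g₁ x‖ ≤ M}.indicator g₁
  have hg₂ : Measurable g₂ := hg₁.indicator (measurableSet_le hg₁.norm measurable_const)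
  have hgg : g =ᵐ[torusVol d] g₂ := by
    filter_upwards [hg.ae_eq_mk, hM] with x h1 h2
    have h3 : x ∈ {x | ‖g₁ x‖ ≤ M} := by
      change ‖hg.mk g x‖ ≤ M
      rwa [← h1]
    have h4 : g₂ x = g₁ x := indicator_of_mem h3 _
    rw [h4]
    exact h1
  have hb : ∀ x, ‖g₂ x‖ ≤ M := fun x => by
    by_cases h : x ∈ {x | ‖g₁ x‖ ≤ M}
    · simp only [g₂, indicator_of_mem h]; exact h
    · simp only [g₂, indicator_of_notMem h, norm_zero]; exact hM0
  have hc : mFourierCoeff g = mFourierCoeff g₂ := by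
    ext k
    rw [mFourierCoeff_eq, mFourierCoeff_eq]
    refine integral_congr_ae ?_
    filter_upwards [hgg] with x hx
    rw [hx]
  rw [hc]
  have hcont := continuous_fseries ((polyGrowth_mFourierCoeff g₂).summable hs)
  refine le_of_ae_le_torus hcont.norm ?_
  filter_upwards [fseries_hw_coeff_ae hg₂ hb hs] with x hx
  rw [hx]
  simpa using norm_integral_le_of_norm_le_const (μ := stdGaussian (E d))
      (ae_of_all _ fun z => hb (x + proj (Real.sqrt (2 * s) • z)))

lemma heatBound_of_integrable {g : Torus d → ℂ} {s : ℝ} (hs : 0 < s) :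
    HeatBound (mFourierCoeff g) s ((1 + Real.sqrt (1 / s)) ^ d * ∫ x, ‖g x‖ ∂(torusVol d)) := by
  intro x
  refine (norm_fseries_le ((polyGrowth_mFourierCoeff g).summable hs) x).trans ?_
  obtain ⟨h1, h2⟩ := summable_hw (d := d) hs
  calc ∑' k, ‖(hw s k : ℂ) * mFourierCoeff g k‖
      ≤ ∑' k : Fin d → ℤ, hw s k * ∫ x, ‖g x‖ ∂(torusVol d) := by
        refine Summable.tsum_le_tsum (fun k => ?_) ((polyGrowth_mFourierCoeff g).summable hs)
          (h1.mul_right _)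
        rw [norm_mul, Complex.norm_real, Real.norm_eq_abs, abs_of_pos (hw_pos s k)]
        exact mul_le_mul_of_nonneg_left (norm_mFourierCoeff_le g k) (hw_pos s k).le
    _ = (∑' k : Fin d → ℤ, hw s k) * ∫ x, ‖g x‖ ∂(torusVol d) := tsum_mul_right
    _ ≤ _ := mul_le_mul_of_nonneg_right h2 (integral_nonneg fun _ => norm_nonneg _)

lemma mFourierCoeff_add {f g : Torus d → ℂ} (hf : Integrable f (torusVol d))
    (hg : Integrable g (torusVol d)) (k : Fin d → ℤ) :
    mFourierCoeff (fun x => f x + g x) k = mFourierCoeff f k + mFourierCoeff g k := by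
  have hb : ∀ {f : Torus d → ℂ}, Integrable f (torusVol d) →
      Integrable (fun x => mFourier (-k) x * f x) (torusVol d) := fun hf =>
    hf.bdd_mul (c := 1) (mFourier (-k)).continuous.aestronglyMeasurable
      (ae_of_all _ fun x => (norm_mFourier_apply _ x).le)
  rw [mFourierCoeff_eq, mFourierCoeff_eq, mFourierCoeff_eq, ← integral_add (hb hf) (hb hg)]
  exact integral_congr_ae (ae_of_all _ fun x => mul_add _ _ _)

/-- `Lᵖ`-`L^∞` smoothing of the heat semigroup. -/
lemma heatBound_of_Lp {p : ℝ} (hp : 1 < p) {g : Torus d → ℂ}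
    (hg : AEStronglyMeasurable g (torusVol d)) {M : ℝ} (hM : 0 < M)
    (hi : Integrable (fun x => ‖g x‖ ^ p) (torusVol d))
    (hgM : ∫ x, ‖g x‖ ^ p ∂(torusVol d) ≤ M ^ p) {s : ℝ} (hs : 0 < s) :
    HeatBound (mFourierCoeff g) s (2 * ((1 + Real.sqrt (1 / s)) ^ d) ^ (1 / p) * M) := by
  set Z : ℝ := (1 + Real.sqrt (1 / s)) ^ d with hZ
  have hZ0 : 0 < Z := by positivity
  -- Truncation height of the interpolation. The part below `L` is estimated in `L^∞`; the part
  -- above has `L¹` norm at most `L^{1-p} M^p`, and this `L` makes `Z * (L^{1-p} M^p) = L`, so both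
  -- parts contribute equally.
  set L : ℝ := Z ^ (1 / p) * M with hL
  have hL0 : 0 < L := by positivity
  let g₁ : Torus d → ℂ := hg.mk g
  have hg₁ : Measurable g₁ := hg.stronglyMeasurable_mk.measurable
  have hS : MeasurableSet {x | ‖g₁ x‖ ≤ L} := measurableSet_le hg₁.norm measurable_const
  let a : Torus d → ℂ := {x | ‖g₁ x‖ ≤ L}.indicator g₁
  let b : Torus d → ℂ := {x | ‖g₁ x‖ ≤ L}ᶜ.indicator g₁
  have hi₁ : Integrable (fun x => ‖g₁ x‖ ^ p) (torusVol d) := hi.congr (by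
    filter_upwards [hg.ae_eq_mk] with x hx; rw [hx])
  have hgM₁ : ∫ x, ‖g₁ x‖ ^ p ∂(torusVol d) ≤ M ^ p := by
    refine le_trans (le_of_eq (integral_congr_ae ?_)) hgM
    filter_upwards [hg.ae_eq_mk] with x hx; rw [hx]
  have hab : ∀ k, mFourierCoeff g k = mFourierCoeff (fun x => a x + b x) k := fun k => by
    rw [mFourierCoeff_eq, mFourierCoeff_eq]
    refine integral_congr_ae ?_
    filter_upwards [hg.ae_eq_mk] with x hx
    have : a x + b x = g₁ x := congrFun (indicator_self_add_compl {x | ‖g₁ x‖ ≤ L} g₁) x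
    rw [this, hx]
  have ha : ∀ x, ‖a x‖ ≤ L := fun x => by
    by_cases h : x ∈ {x | ‖g₁ x‖ ≤ L}
    · simp only [a, indicator_of_mem h]; exact h
    · simp only [a, indicator_of_notMem h, norm_zero]; exact hL0.le
  have ham : Measurable a := hg₁.indicator hS
  have hb : ∀ x, ‖b x‖ ≤ L ^ (1 - p) * ‖g₁ x‖ ^ p := fun x => by
    by_cases h : x ∈ {x | ‖g₁ x‖ ≤ L}
    · have : b x = 0 := indicator_of_notMem (notMem_compl_iff.2 h) _
      rw [this, norm_zero]
      positivity
    · have e : b x = g₁ x := indicator_of_mem h _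
      have h' : L < ‖g₁ x‖ := not_le.1 h
      rw [e]
      have h0 : 0 < ‖g₁ x‖ := hL0.trans h'
      calc ‖g₁ x‖ = ‖g₁ x‖ ^ (1 - p) * ‖g₁ x‖ ^ p := by
            rw [← Real.rpow_add h0]; simp
        _ ≤ _ := mul_le_mul_of_nonneg_right
            (Real.rpow_le_rpow_of_nonpos hL0 h'.le (by linarith)) (by positivity)
  have hbi : Integrable b (torusVol d) :=
    Integrable.mono' (hi₁.const_mul _) (hg₁.indicator hS.compl).aestronglyMeasurable
      (ae_of_all _ hb)
  have hai : Integrable a (torusVol d) :=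
    Integrable.of_bound ham.aestronglyMeasurable L (ae_of_all _ ha)
  have hbn : ∫ x, ‖b x‖ ∂(torusVol d) ≤ L ^ (1 - p) * M ^ p := by
    calc ∫ x, ‖b x‖ ∂(torusVol d) ≤ ∫ x, L ^ (1 - p) * ‖g₁ x‖ ^ p ∂(torusVol d) :=
          integral_mono hbi.norm (hi₁.const_mul _) hb
      _ ≤ _ := by rw [integral_const_mul]; gcongr
  have h1 := heatBound_of_bounded ham.aestronglyMeasurable (ae_of_all _ ha) hs
  have h2 := (heatBound_of_integrable (g := b) hs).mono
    (mul_le_mul_of_nonneg_left hbn hZ0.le)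
  have h3 := HeatBound.add (polyGrowth_mFourierCoeff a) (polyGrowth_mFourierCoeff b) hs h1 h2
  have e : mFourierCoeff g = fun k => mFourierCoeff a k + mFourierCoeff b k := by
    ext k; rw [hab, mFourierCoeff_add hai hbi]
  rw [e]
  refine h3.mono (le_of_eq ?_)
  have e2 : Z * (L ^ (1 - p) * M ^ p) = Z ^ (1 / p) * M := by
    rw [hL, Real.mul_rpow (by positivity) hM.le, ← Real.rpow_mul hZ0.le]
    have : Z * (Z ^ (1 / p * (1 - p)) * M ^ (1 - p) * M ^ p)
        = (Z ^ (1 : ℝ) * Z ^ (1 / p * (1 - p))) * (M ^ (1 - p) * M ^ p) := by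
      rw [Real.rpow_one]; ring
    rw [this, ← Real.rpow_add hZ0, ← Real.rpow_add hM]
    have hp0 : p ≠ 0 := by positivity
    congr 2
    · field_simp; ring
    · simp
  rw [← hZ, e2, hL]
  ring

/-- Subadditivity of the power `d/p ≤ 1` separates the bounded part from the singularity
`s^{-d/(2p)}`. -/
lemma heat_weight_le {p : ℝ} (hp : (d : ℝ) < p) {s : ℝ} (hs : 0 < s) :
    2 * ((1 + Real.sqrt (1 / s)) ^ d) ^ (1 / p) ≤ 4 * (1 + s ^ (-(d / (2 * p)) : ℝ)) := by
  have hp0 : 0 < p := lt_of_le_of_lt (Nat.cast_nonneg d) hp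
  set y := Real.sqrt (1 / s) with hy
  have hy0 : 0 ≤ y := Real.sqrt_nonneg _
  have e1 : ((1 + y) ^ d) ^ (1 / p) = (1 + y) ^ ((d : ℝ) / p) := by
    rw [← Real.rpow_natCast, ← Real.rpow_mul (by positivity)]; congr 1; ring
  have e2 : s ^ (-(d / (2 * p)) : ℝ) = y ^ ((d : ℝ) / p) := by
    rw [hy, Real.sqrt_eq_rpow, ← Real.rpow_mul (by positivity), one_div, Real.inv_rpow hs.le,
      ← Real.rpow_neg hs.le]
    congr 1; field_simp
  rw [e1, e2]
  have ha : 0 ≤ (d : ℝ) / p := by positivity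
  have ha1 : (d : ℝ) / p ≤ 1 := (div_le_one hp0).2 hp.le
  have h1 : (1 + y) ^ ((d : ℝ) / p) ≤ 1 ^ ((d : ℝ) / p) + y ^ ((d : ℝ) / p) :=
    Real.rpow_add_le_add_rpow zero_le_one hy0 ha ha1
  rw [Real.one_rpow] at h1
  have : 0 ≤ y ^ ((d : ℝ) / p) := by positivity
  linarith

/-! ### Translations -/

lemma mFourier_proj_sub_one (k : Fin d → ℤ) (h : E d) :
    mFourier k (proj h) - 1
      = ∫ θ in (0 : ℝ)..1, (∑ l, (h l : ℂ) * dsym l k) * mFourier k (proj (θ • h)) := by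
  set c : ℂ := ∑ l, (h l : ℂ) * dsym l k with hc
  have e : ∀ θ : ℝ, mFourier k (proj (θ • h)) = Complex.exp (c * θ) := fun θ => by
    rw [mFourier_proj]
    congr 1
    rw [hc, Finset.mul_sum, Finset.sum_mul]
    refine Finset.sum_congr rfl fun l _ => ?_
    simp only [dsym, PiLp.smul_apply, smul_eq_mul]
    push_cast
    ring
  have hd : ∀ θ ∈ uIcc (0 : ℝ) 1, HasDerivAt (fun θ : ℝ => Complex.exp (c * θ))
      (c * Complex.exp (c * θ)) θ := fun θ _ => by
    have h1 : HasDerivAt (fun θ : ℝ => c * (θ : ℂ)) c θ := by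
      simpa using (Complex.ofRealCLM.hasDerivAt (x := θ)).const_mul c
    simpa [mul_comm] using h1.cexp
  simp_rw [e]
  rw [intervalIntegral.integral_eq_sub_of_hasDerivAt hd
    (Continuous.intervalIntegrable (by fun_prop) _ _)]
  have := e 1
  rw [one_smul] at this
  rw [this]
  simp

/-- Mean value inequality on the Fourier side: a translation difference is the average over `θ ∈ (0,
1]` of translates by `θ y` of the directional derivative. It converts bounds on first derivatives
into Lipschitz bounds. -/
lemma HeatBound.shift {a : (Fin d → ℤ) → ℂ} (ha : PolyGrowth a) {s M : ℝ} (hs : 0 < s)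
    (h : ∀ l, HeatBound (fun k => FluidParticle.dsym l k * a k) s M) (y : E d) :
    HeatBound (fun k => (mFourier k (proj y) - 1) * a k) s ((∑ l, |y l|) * M) := by
  intro x
  set A : (Fin d → ℤ) → ℂ := fun k => (hw s k : ℂ) * ∑ l, (y l : ℂ) * (FluidParticle.dsym l k * a k)
    with hA
  have hAg : PolyGrowth fun k => ∑ l, (y l : ℂ) * (FluidParticle.dsym l k * a k) :=
    PolyGrowth.sum _ fun l _ => (ha.dsym_mul l).bdd_mul (c := fun _ => (y l : ℂ)) (fun _ => le_rfl)
  have hAb : HeatBound (fun k => ∑ l, (y l : ℂ) * (FluidParticle.dsym l k * a k)) s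
      ((∑ l, |y l|) * M) := by
    have := HeatBound.sum Finset.univ (fun l _ => (ha.dsym_mul l).bdd_mul
      (c := fun _ => (y l : ℂ)) (fun _ => le_rfl)) hs (fun l _ => (h l).const_mul (y l : ℂ))
    refine this.mono (le_of_eq ?_)
    rw [Finset.sum_mul]
    simp
  have e : (fun k => (hw s k : ℂ) * ((mFourier k (proj y) - 1) * a k))
      = fun k => ∫ θ in Ioc (0 : ℝ) 1, A k * mFourier k (proj (θ • y)) := by
    ext k
    rw [mFourier_proj_sub_one, intervalIntegral.integral_of_le zero_le_one, integral_const_mul,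
      integral_const_mul, hA]
    simp only
    rw [Finset.mul_sum, Finset.sum_mul, Finset.sum_mul, Finset.mul_sum, Finset.sum_mul]
    exact Finset.sum_congr rfl fun l _ => by ring
  have hm : ∀ k, Continuous fun θ : ℝ => A k * mFourier k (proj (θ • y)) := fun k =>
    continuous_const.mul ((mFourier k).continuous.comp (continuous_proj.comp (by fun_prop)))
  rw [e, fseries_integral (G := fun _ => 1) (integrable_const _) (hAg.summable hs)
    (fun k => (hm k).aestronglyMeasurable)
    (fun k => ae_of_all _ fun θ => by rw [norm_mul, norm_mFourier_apply, mul_one, one_mul])]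
  have hb : ∀ θ : ℝ, ‖fseries (fun k => A k * mFourier k (proj (θ • y))) x‖
      ≤ (∑ l, |y l|) * M := fun θ => by
    have := hAb (x + proj (θ • y))
    refine le_trans (le_of_eq ?_) this
    congr 1
    simp only [fseries, mFourier_apply_add]
    exact tsum_congr fun k => by ring
  have := norm_integral_le_of_norm_le_const (μ := volume.restrict (Ioc (0 : ℝ) 1))
    (ae_of_all _ hb)
  simpa using this

/-! ### Bessel potentials -/

/-- Subordination: the Gamma integral writes `(I - Δ)^{-γ/2}` as a superposition of heat operators.
The Bessel weight uses `|k|²` whereas the heat multiplier uses `4π²|k|²`, hence the time `r /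
(4π²)`. -/
lemma bessel_weight_eq {γ : ℝ} (hγ : 0 < γ) (k : Fin d → ℤ) :
    ∫ r in Ioi (0 : ℝ), r ^ (γ / 2 - 1) * Real.exp (-r) * hw (r / (4 * Real.pi ^ 2)) k
      = (1 + freqSq k) ^ (-(γ / 2)) * Real.Gamma (γ / 2) := by
  have h1 : 0 < 1 + freqSq k := by linarith [freqSq_nonneg k]
  have h := Real.integral_rpow_mul_exp_neg_mul_Ioi (half_pos hγ) h1
  rw [one_div, Real.inv_rpow h1.le, ← Real.rpow_neg h1.le] at h
  rw [← h]
  refine setIntegral_congr_fun measurableSet_Ioi fun r _ => ?_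
  rw [mul_assoc, hw, ← Real.exp_add, lam]
  congr 2
  have := Real.pi_ne_zero
  field_simp
  ring

lemma integrableOn_rpow_mul_exp {a : ℝ} (ha : 0 < a) :
    IntegrableOn (fun r : ℝ => r ^ (a - 1) * Real.exp (-r)) (Ioi 0) := by
  have := Real.GammaIntegral_convergent ha
  simpa only [mul_comm] using this

/-- The effect of `(I - Δ)^{-γ/2}` on heat bounds. -/
lemma HeatBound.bessel {γ b m δ : ℝ} (hγ : 0 < γ) (hδ : 0 ≤ δ) (hδm : δ ≤ m)
    (hb : 0 ≤ b) (hδb : δ + b < γ / 2) : ∃ C : ℝ, 0 < C ∧ ∀ (a : (Fin d → ℤ) → ℂ) (_ : PolyGrowth a) (K : ℝ)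
    (_ : 0 ≤ K) (_ : ∀ s, 0 < s → HeatBound a s (K * s ^ (-m) * (1 + s ^ (-b)))),
    ∀ τ, 0 < τ → HeatBound (fun k => (((1 + freqSq k) ^ (-(γ / 2)) : ℝ) : ℂ) * a k) τ
      (C * K * τ ^ (-(m - δ))) := by
  set c : ℝ := 4 * Real.pi ^ 2 with hc
  have hc0 : 0 < c := by positivity
  have hG : 0 < Real.Gamma (γ / 2) := Real.Gamma_pos_of_pos (half_pos hγ)
  -- The majorant of the subordination integrand. Its exponents `γ/2 - δ - 1` and `γ/2 - δ - b - 1`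
  -- exceed `-1` exactly when `δ < γ/2` and `δ + b < γ/2`: the gain `δ` in the power of `τ` is
  -- limited by convergence at `r = 0`.
  set w : ℝ → ℝ := fun r => c ^ δ * (r ^ (γ / 2 - δ - 1) * Real.exp (-r))
    + c ^ (δ + b) * (r ^ (γ / 2 - δ - b - 1) * Real.exp (-r)) with hw_def
  have hwi : IntegrableOn w (Ioi 0) :=
    ((integrableOn_rpow_mul_exp (by linarith)).const_mul _).add
      ((integrableOn_rpow_mul_exp (by linarith)).const_mul _)
  set W := ∫ r in Ioi (0 : ℝ), w r with hW
  have hW0 : 0 ≤ W := setIntegral_nonneg measurableSet_Ioi fun r hr => by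
    have : (0 : ℝ) < r := hr
    simp only [hw_def]; positivity
  refine ⟨(W + 1) / Real.Gamma (γ / 2), by positivity, fun a ha K hK h τ hτ x => ?_⟩
  set g : ℝ → ℝ := fun r => r ^ (γ / 2 - 1) * Real.exp (-r) with hg
  have hgi : IntegrableOn g (Ioi 0) := integrableOn_rpow_mul_exp (half_pos hγ)
  have hgm : Measurable g := by
    simp only [hg]; fun_prop
  have hwm : ∀ k : Fin d → ℤ, Measurable fun r : ℝ => hw (τ + r / c) k := fun k => by
    unfold hw; fun_prop
  have e : (fun k => (hw τ k : ℂ) * ((((1 + freqSq k) ^ (-(γ / 2)) : ℝ) : ℂ) * a k))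
      = fun k => (Real.Gamma (γ / 2) : ℂ)⁻¹ * ∫ r in Ioi (0 : ℝ), ((g r * hw (τ + r / c) k : ℝ) : ℂ) * a k := by
    ext k
    have h1 := bessel_weight_eq hγ k
    rw [integral_mul_const, integral_complex_ofReal]
    have h2 : ∫ r in Ioi (0 : ℝ), g r * hw (τ + r / c) k
        = hw τ k * ((1 + freqSq k) ^ (-(γ / 2)) * Real.Gamma (γ / 2)) := by
      rw [← h1, ← integral_const_mul]
      refine integral_congr_ae (ae_of_all _ fun r => ?_)
      simp only [hg, hw_add]
      ring
    rw [h2]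
    have : (Real.Gamma (γ / 2) : ℂ) ≠ 0 := by exact_mod_cast hG.ne'
    push_cast
    field_simp
  have e2 : fseries (fun k => (Real.Gamma (γ / 2) : ℂ)⁻¹
        * ∫ r in Ioi (0 : ℝ), ((g r * hw (τ + r / c) k : ℝ) : ℂ) * a k) x
      = (Real.Gamma (γ / 2) : ℂ)⁻¹ * fseries (fun k =>
        ∫ r in Ioi (0 : ℝ), ((g r * hw (τ + r / c) k : ℝ) : ℂ) * a k) x := by
    unfold fseries
    rw [← tsum_mul_left]
    exact tsum_congr fun k => by ring
  rw [e, e2, fseries_integral (f := fun r k => ((g r * hw (τ + r / c) k : ℝ) : ℂ) * a k) hgi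
    (ha.summable hτ) (fun k => (((hgm.mul (hwm k)).complex_ofReal).mul_const _).aestronglyMeasurable)
    (fun k => by
      filter_upwards [self_mem_ae_restrict measurableSet_Ioi] with r hr
      have hr : (0 : ℝ) < r := hr
      have hg0 : 0 ≤ g r := by simp only [hg]; positivity
      rw [norm_mul, norm_mul, Complex.norm_real, Complex.norm_real, Real.norm_eq_abs,
        Real.norm_eq_abs, abs_of_nonneg (mul_nonneg hg0 (hw_pos _ _).le), abs_of_pos (hw_pos _ _),
        mul_assoc]
      refine mul_le_mul_of_nonneg_left (mul_le_mul_of_nonneg_right (hw_anti ?_ k) (norm_nonneg _)) hg0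
      have : 0 ≤ r / c := by positivity
      linarith), norm_mul, norm_inv, Complex.norm_real, Real.norm_eq_abs, abs_of_pos hG]
  have hbound : ‖∫ r in Ioi (0 : ℝ), fseries (fun k => ((g r * hw (τ + r / c) k : ℝ) : ℂ) * a k) x‖
      ≤ ∫ r in Ioi (0 : ℝ), (K * τ ^ (-(m - δ))) * w r := by
    refine norm_integral_le_of_norm_le (hwi.const_mul _) ?_
    filter_upwards [self_mem_ae_restrict measurableSet_Ioi] with r hr
    have hr : (0 : ℝ) < r := hr
    have hg0 : 0 ≤ g r := by simp only [hg]; positivity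
    have e3 : fseries (fun k => ((g r * hw (τ + r / c) k : ℝ) : ℂ) * a k) x
        = (g r : ℂ) * fseries (fun k => (hw (τ + r / c) k : ℂ) * a k) x := by
      unfold fseries
      rw [← tsum_mul_left]
      exact tsum_congr fun k => by push_cast; ring
    rw [e3, norm_mul, Complex.norm_real, Real.norm_eq_abs, abs_of_nonneg hg0]
    have hrc : 0 < r / c := by positivity
    have hσ : 0 < τ + r / c := by positivity
    have h1 := h _ hσ x
    -- Of the singularity `-m`, the share `m - δ` is charged to `τ` and the share `δ` to `r`.
    have h2 : (τ + r / c) ^ (-m) ≤ τ ^ (-(m - δ)) * (r / c) ^ (-δ) := by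
      have : (τ + r / c) ^ (-m) = (τ + r / c) ^ (-(m - δ)) * (τ + r / c) ^ (-δ) := by
        rw [← Real.rpow_add hσ]; congr 1; ring
      rw [this]
      exact mul_le_mul (Real.rpow_le_rpow_of_nonpos hτ (by linarith) (by linarith))
        (Real.rpow_le_rpow_of_nonpos hrc (by linarith) (by linarith)) (by positivity) (by positivity)
    have h3 : (τ + r / c) ^ (-b) ≤ (r / c) ^ (-b) :=
      Real.rpow_le_rpow_of_nonpos hrc (by linarith) (by linarith)
    have e4 : ∀ e : ℝ, g r * (r / c) ^ (-e) = c ^ e * (r ^ (γ / 2 - e - 1) * Real.exp (-r)) := by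
      intro e
      have : r ^ (γ / 2 - e - 1) = r ^ (γ / 2 - 1) * r ^ (-e) := by
        rw [← Real.rpow_add hr]; congr 1; ring
      rw [this, Real.div_rpow hr.le hc0.le, Real.rpow_neg hc0.le, div_inv_eq_mul]
      simp only [hg]; ring
    have e5 : (r / c) ^ (-δ) * (r / c) ^ (-b) = (r / c) ^ (-(δ + b)) := by
      rw [← Real.rpow_add hrc]; congr 1; ring
    calc g r * ‖fseries (fun k => (hw (τ + r / c) k : ℂ) * a k) x‖
        ≤ g r * (K * (τ ^ (-(m - δ)) * (r / c) ^ (-δ)) * (1 + (r / c) ^ (-b))) := by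
          refine mul_le_mul_of_nonneg_left (h1.trans ?_) hg0
          gcongr
      _ = K * τ ^ (-(m - δ)) * (g r * (r / c) ^ (-δ) + g r * ((r / c) ^ (-δ) * (r / c) ^ (-b))) := by
          ring
      _ = K * τ ^ (-(m - δ)) * w r := by
          rw [e5, e4, e4, hw_def]
          simp only
          rw [show γ / 2 - (δ + b) - 1 = γ / 2 - δ - b - 1 by ring]
  rw [integral_const_mul] at hbound
  calc (Real.Gamma (γ / 2))⁻¹ * _ ≤ (Real.Gamma (γ / 2))⁻¹ * (K * τ ^ (-(m - δ)) * W) := by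
        gcongr
    _ ≤ (Real.Gamma (γ / 2))⁻¹ * (K * τ ^ (-(m - δ)) * (W + 1)) := by
        gcongr; linarith
    _ = _ := by rw [div_eq_inv_mul]; ring

/-! ### From `L^p` bounds to the Sobolev embedding. -/

lemma heatBound_fourierVec {p : ℝ} (hp1 : 1 < p) (hp : (d : ℝ) < p) {g : Torus d → E d}
    (hg : MemLp g (ENNReal.ofReal p) (torusVol d)) {M : ℝ} (hM : 0 < M)
    (hgM : eLpNorm g (ENNReal.ofReal p) (torusVol d) ≤ ENNReal.ofReal M) (j : Fin d) {s : ℝ}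
    (hs : 0 < s) :
    HeatBound (fun k => fourierVec g k j) s (4 * (1 + s ^ (-(d / (2 * p)) : ℝ)) * M) := by
  have hp0 : 0 < p := by linarith
  have hpe : ENNReal.ofReal p ≠ 0 := by simpa using hp0
  have hi : Integrable (fun x => ‖g x‖ ^ p) (torusVol d) := by
    have := hg.integrable_norm_rpow hpe ENNReal.ofReal_ne_top
    simpa [ENNReal.toReal_ofReal hp0.le] using this
  have hiM : ∫ x, ‖g x‖ ^ p ∂(torusVol d) ≤ M ^ p := by
    rw [hg.eLpNorm_eq_integral_rpow_norm hpe ENNReal.ofReal_ne_top,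
      ENNReal.ofReal_le_ofReal_iff hM.le, ENNReal.toReal_ofReal hp0.le] at hgM
    have h0 : 0 ≤ ∫ x, ‖g x‖ ^ p ∂(torusVol d) := integral_nonneg fun _ => by positivity
    calc ∫ x, ‖g x‖ ^ p ∂(torusVol d) = ((∫ x, ‖g x‖ ^ p ∂(torusVol d)) ^ p⁻¹) ^ p := by
          rw [← Real.rpow_mul h0, inv_mul_cancel₀ hp0.ne', Real.rpow_one]
      _ ≤ M ^ p := Real.rpow_le_rpow (by positivity) hgM hp0.le
  have hgm : AEStronglyMeasurable (fun x => ((g x j : ℝ) : ℂ)) (torusVol d) := by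
    have : Continuous fun v : E d => ((v j : ℝ) : ℂ) := by fun_prop
    exact this.comp_aestronglyMeasurable hg.1
  have hle : ∀ x, ‖((g x j : ℝ) : ℂ)‖ ^ p ≤ ‖g x‖ ^ p := fun x => by
    rw [Complex.norm_real]
    exact Real.rpow_le_rpow (norm_nonneg _) (abs_coord_le _ _) hp0.le
  have hij : Integrable (fun x => ‖((g x j : ℝ) : ℂ)‖ ^ p) (torusVol d) := by
    refine Integrable.mono' hi ?_ (ae_of_all _ fun x => ?_)
    · exact (hgm.norm.aemeasurable.pow_const p).aestronglyMeasurable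
    · rw [Real.norm_eq_abs, abs_of_nonneg (by positivity)]
      exact hle x
  have h := heatBound_of_Lp hp1 hgm hM hij ((integral_mono hij hi hle).trans hiM) hs
  exact h.mono (mul_le_mul_of_nonneg_right (heat_weight_le hp hs) hM.le)

/-- For a continuous function the heat flow converges pointwise as the time tends to zero, so a
`HeatBound` uniform in positive times becomes a bound on the function itself. -/
lemma tendsto_fseries_hw {f : Torus d → ℂ} (hf : Continuous f) (x : Torus d) :
    Tendsto (fun n : ℕ => fseries (fun k => (hw (1 / ((n : ℝ) + 1)) k : ℂ) * mFourierCoeff f k) x)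
      atTop (𝓝 (f x)) := by
  obtain ⟨M, hM⟩ := (isCompact_univ (X := Torus d)).exists_bound_of_continuousOn hf.continuousOn
  have hM' : ∀ x, ‖f x‖ ≤ M := fun x => hM x (mem_univ x)
  have e : ∀ s : ℝ, 0 < s → fseries (fun k => (hw s k : ℂ) * mFourierCoeff f k) x
      = ∫ z, f (x + proj (Real.sqrt (2 * s) • z)) ∂(stdGaussian (E d)) := fun s hs => by
    refine congrFun (eq_of_ae_eq_torus
      (continuous_fseries ((polyGrowth_mFourierCoeff f).summable hs)) ?_
      (fseries_hw_coeff_ae hf.measurable hM' hs)) x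
    refine continuous_of_dominated (bound := fun _ => M) (fun x => ?_)
      (fun x => ae_of_all _ fun z => hM' _) (integrable_const _) (ae_of_all _ fun z => by fun_prop)
    have : Continuous fun z : E d => proj (Real.sqrt (2 * s) • z) :=
      continuous_proj.comp (by fun_prop)
    exact (hf.comp (continuous_const.add this)).aestronglyMeasurable
  have e2 : ∀ n : ℕ, fseries (fun k => (hw (1 / ((n : ℝ) + 1)) k : ℂ) * mFourierCoeff f k) x
      = ∫ z, f (x + proj (Real.sqrt (2 * (1 / ((n : ℝ) + 1))) • z)) ∂(stdGaussian (E d)) :=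
    fun n => e _ (by positivity)
  simp_rw [e2]
  have e3 : f x = ∫ _z : E d, f x ∂(stdGaussian (E d)) := by simp
  rw [e3]
  refine tendsto_integral_of_dominated_convergence (fun _ => M) (fun n => ?_) (integrable_const _)
    (fun n => ae_of_all _ fun z => hM' _) (ae_of_all _ fun z => ?_)
  · have : Continuous fun z : E d => proj (Real.sqrt (2 * (1 / ((n : ℝ) + 1))) • z) :=
      continuous_proj.comp (by fun_prop)
    exact (hf.comp (continuous_const.add this)).aestronglyMeasurable
  · have h1 : Tendsto (fun n : ℕ => 1 / ((n : ℝ) + 1)) atTop (𝓝 0) :=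
      tendsto_one_div_add_atTop_nhds_zero_nat
    have h2 : Continuous fun s : ℝ => f (x + proj (Real.sqrt (2 * s) • z)) :=
      hf.comp (continuous_const.add (continuous_proj.comp (by fun_prop)))
    have h3 := (h2.tendsto 0).comp h1
    simpa only [Function.comp_def, mul_zero, Real.sqrt_zero, zero_smul, proj_zero, add_zero]
      using h3

lemma bessel_coeff_eq {γ : ℝ} {f g : Torus d → E d}
    (h : ∀ k, fourierVec g k = ((1 + freqSq k) ^ (γ / 2) : ℝ) • fourierVec f k) (j : Fin d) :
    (fun k => fourierVec f k j)
      = fun k => (((1 + freqSq k) ^ (-(γ / 2)) : ℝ) : ℂ) * fourierVec g k j := by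
  ext k
  have h1 : 0 < 1 + freqSq k := by linarith [freqSq_nonneg k]
  rw [h k, Pi.smul_apply, Complex.real_smul, ← mul_assoc, ← Complex.ofReal_mul,
    ← Real.rpow_add h1]
  simp

lemma norm_le_sum_abs (v : E d) : ‖v‖ ≤ ∑ j, |v j| := by
  have h : v = ∑ j, EuclideanSpace.single j (v j) := by
    ext i
    simp [Finset.sum_apply, Pi.single_apply]
  calc ‖v‖ = ‖∑ j, EuclideanSpace.single j (v j)‖ := by rw [← h]
    _ ≤ ∑ j, ‖EuclideanSpace.single j (v j)‖ := norm_sum_le _ _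
    _ = _ := by simp

/-- Sobolev embedding `H^γ_p ⊂ L^∞` for `γ > d/p`. -/
lemma bessel_embedding {p γ : ℝ} (hp1 : 1 < p) (hp : (d : ℝ) < p) (hγ : (d : ℝ) / p < γ) :
    ∃ C : ℝ, 0 < C ∧ ∀ f : Torus d → E d, Continuous f → ∀ x,
      ENNReal.ofReal ‖f x‖ ≤ ENNReal.ofReal C * besselENorm γ (ENNReal.ofReal p) f := by
  have hp0 : 0 < p := by linarith
  have hγ0 : 0 < γ := lt_of_le_of_lt (by positivity) hγ
  have hb : (d : ℝ) / (2 * p) < γ / 2 := by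
    calc (d : ℝ) / (2 * p) = (d / p) / 2 := by field_simp
      _ < γ / 2 := by linarith
  -- No derivative is taken and no power of time is gained: the potential only has to remove the
  -- `L^p` singularity of exponent `d/(2p)`, which is possible because `d/(2p) < γ/2`.
  obtain ⟨C, hC, h⟩ := HeatBound.bessel (d := d) (m := 0) (δ := 0) hγ0 le_rfl le_rfl
    (show (0 : ℝ) ≤ d / (2 * p) by positivity) (by simpa using hb)
  refine ⟨(d + 1) * (C * 4), by positivity, fun f hf x => ?_⟩
  have hC' : ENNReal.ofReal ((d + 1) * (C * 4)) ≠ 0 := by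
    simp only [ne_eq, ENNReal.ofReal_eq_zero, not_le]; positivity
  rw [mul_comm, ← ENNReal.div_le_iff_le_mul (Or.inl hC') (Or.inl ENNReal.ofReal_ne_top)]
  refine le_iInf fun g => le_iInf fun ⟨_, hg, hk⟩ => ?_
  rw [ENNReal.div_le_iff_le_mul (Or.inl hC') (Or.inl ENNReal.ofReal_ne_top), mul_comm]
  have hfin : eLpNorm g (ENNReal.ofReal p) (torusVol d) ≠ ∞ := hg.2.ne
  rw [← ENNReal.ofReal_toReal hfin, ← ENNReal.ofReal_mul (by positivity)]
  refine ENNReal.ofReal_le_ofReal ?_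
  set M₀ := (eLpNorm g (ENNReal.ofReal p) (torusVol d)).toReal with hM₀
  -- A strictly larger `M` keeps the constant positive even when the norm vanishes; letting `M`
  -- decrease to `M₀` finishes.
  have key : ∀ M, M₀ < M → ‖f x‖ ≤ (d + 1) * (C * 4) * M := by
    intro M hM
    have hM0 : 0 < M := lt_of_le_of_lt ENNReal.toReal_nonneg hM
    have hgM : eLpNorm g (ENNReal.ofReal p) (torusVol d) ≤ ENNReal.ofReal M := by
      rw [← ENNReal.ofReal_toReal hfin]
      exact ENNReal.ofReal_le_ofReal hM.le
    have hj : ∀ j, |f x j| ≤ C * 4 * M := by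
      intro j
      have h1 := h (fun k => fourierVec g k j) (polyGrowth_mFourierCoeff _) (4 * M) (by positivity)
        (fun s hs => (heatBound_fourierVec hp1 hp hg hM0 hgM j hs).mono (by simp; linarith))
      have hcf : Continuous fun x => ((f x j : ℝ) : ℂ) := by fun_prop
      have h2 := tendsto_fseries_hw hcf x
      have h3 : ‖((f x j : ℝ) : ℂ)‖ ≤ C * 4 * M := by
        refine le_of_tendsto h2.norm (Eventually.of_forall fun n => ?_)
        have h4 := h1 (1 / ((n : ℝ) + 1)) (by positivity) x
        rw [← bessel_coeff_eq hk j] at h4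
        refine h4.trans (le_of_eq ?_)
        simp; ring
      simpa using h3
    calc ‖f x‖ ≤ ∑ j, |f x j| := norm_le_sum_abs _
      _ ≤ ∑ _j : Fin d, C * 4 * M := Finset.sum_le_sum fun j _ => hj j
      _ = d * (C * 4 * M) := by simp
      _ ≤ (d + 1) * (C * 4) * M := by nlinarith [mul_pos hC hM0]
  have h5 : 0 < ((d : ℝ) + 1) * (C * 4) := by positivity
  have h6 : ‖f x‖ / ((d + 1) * (C * 4)) ≤ M₀ :=
    le_of_forall_gt_imp_ge_of_dense fun M hM => (div_le_iff₀' h5).2 (key M hM)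
  exact (div_le_iff₀' h5).1 h6

/-! ### Weak formulations in time -/

/-- Fubini on the triangle `s < t`; it is the integration by parts needed for a merely integrable
`n`. -/
lemma integral_smul_primitive {G : Type*} [NormedAddCommGroup G] [NormedSpace ℝ G]
    [CompleteSpace G] {T : ℝ} (hT : 0 < T) {n : ℝ → G} (hn : IntegrableOn n (Ioc 0 T)) {φ : ℝ → ℝ}
    (hφ : Continuous φ) :
    ∫ s in (0 : ℝ)..T, (∫ t in s..T, φ t) • n s = ∫ t in (0 : ℝ)..T, φ t • ∫ s in (0 : ℝ)..t, n s := by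
  obtain ⟨M, hM⟩ := (isCompact_Icc (a := (0 : ℝ)) (b := T)).exists_bound_of_continuousOn
    hφ.continuousOn
  let Φ : ℝ → ℝ → G := fun s t => ({q : ℝ × ℝ | q.1 < q.2}.indicator
    (fun q => φ q.2 • n q.1)) (s, t)
  have hswap : ∫ s in Ioc 0 T, ∫ t in Ioc 0 T, Φ s t = ∫ t in Ioc 0 T, ∫ s in Ioc 0 T, Φ s t := by
    refine integral_integral_swap ?_
    have h1 : Integrable (fun q : ℝ × ℝ => φ q.2 • n q.1)
        ((volume.restrict (Ioc 0 T)).prod (volume.restrict (Ioc 0 T))) := by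
      have hφi : Integrable φ (volume.restrict (Ioc 0 T)) :=
        (hφ.integrableOn_Icc).mono_set Ioc_subset_Icc_self
      have h2 := (hφi.smul_prod hn).swap
      exact h2
    exact h1.indicator (measurableSet_lt measurable_fst measurable_snd)
  rw [intervalIntegral.integral_of_le hT.le, intervalIntegral.integral_of_le hT.le]
  refine Eq.trans ?_ (hswap.trans ?_)
  · refine setIntegral_congr_fun measurableSet_Ioc fun s hs => ?_
    rw [intervalIntegral.integral_of_le hs.2, ← integral_smul_const]
    have e : ∀ t, Φ s t = (Ioi s).indicator (fun t => φ t • n s) t := fun t => by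
      simp only [Φ, indicator, mem_ofPred_eq, mem_Ioi]
    simp_rw [e]
    rw [setIntegral_indicator measurableSet_Ioi]
    congr 2
    ext t
    simp only [mem_inter_iff, mem_Ioc, mem_Ioi]
    exact ⟨fun h => ⟨⟨hs.1.trans h.1, h.2⟩, h.1⟩, fun h => ⟨h.2, h.1.2⟩⟩
  · refine setIntegral_congr_fun measurableSet_Ioc fun t ht => ?_
    rw [intervalIntegral.integral_of_le ht.1.le, ← integral_smul]
    have e : ∀ s, Φ s t = (Iio t).indicator (fun s => φ t • n s) s := fun s => by
      simp only [Φ, indicator, mem_ofPred_eq, mem_Iio]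
    simp_rw [e]
    rw [setIntegral_indicator measurableSet_Iio, integral_Ioc_eq_integral_Ioo (x := 0) (y := t)]
    · congr 2
      ext s
      simp only [mem_inter_iff, mem_Ioc, mem_Iio, mem_Ioo]
      exact ⟨fun h => ⟨h.1.1, h.2⟩, fun h => ⟨⟨h.1, h.2.le.trans ht.2⟩, h.2⟩⟩

/-- Every `φ` supported inside `(0, T)` is the derivative of an admissible test function, namely its
primitive vanishing at `T`. The weak identity then says that `y` minus the integrated equation is
orthogonal to all such `φ`. -/
lemma eq_of_weak_ode {G : Type*} [NormedAddCommGroup G] [NormedSpace ℝ G] [CompleteSpace G]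
    {T : ℝ} (hT : 0 < T) {y n : ℝ → G} {y₀ : G} (hy : IntegrableOn y (Icc 0 T))
    (hn : IntegrableOn n (Icc 0 T))
    (H : ∀ κ : ℝ → ℝ, ContDiff ℝ ((⊤ : ℕ∞) : WithTop ℕ∞) κ → κ T = 0 →
      -(∫ s in (0 : ℝ)..T, (deriv κ s • y s + κ s • n s)) = κ 0 • y₀) :
    ∀ᵐ t ∂(volume.restrict (Icc 0 T)), y t = y₀ + ∫ s in (0 : ℝ)..t, n s := by
  have hn' : IntervalIntegrable n volume 0 T :=
    (intervalIntegrable_iff_integrableOn_Icc_of_le hT.le).2 hn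
  have hy' : IntervalIntegrable y volume 0 T :=
    (intervalIntegrable_iff_integrableOn_Icc_of_le hT.le).2 hy
  set w : ℝ → G := fun t => y₀ + ∫ s in (0 : ℝ)..t, n s with hw
  have hwc : ContinuousOn w (Icc 0 T) := by
    refine continuousOn_const.add ?_
    have := intervalIntegral.continuousOn_primitive_interval (a := 0) (b := T)
      (f := n) (μ := volume) (by rwa [uIcc_of_le hT.le])
    rwa [uIcc_of_le hT.le] at this
  have hwi : IntegrableOn w (Icc 0 T) := hwc.integrableOn_Icc
  have hwi' : IntervalIntegrable w volume 0 T :=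
    (intervalIntegrable_iff_integrableOn_Icc_of_le hT.le).2 hwi
  have key : ∀ᵐ t ∂(volume : Measure ℝ), t ∈ Ioo 0 T → (y t - w t) = 0 := by
    refine isOpen_Ioo.ae_eq_zero_of_integral_contDiff_smul_eq_zero
      ((hy.sub hwi).mono_set Ioo_subset_Icc_self).locallyIntegrableOn fun φ hφ _ hsupp => ?_
    have hφc : Continuous φ := hφ.continuous
    have hzero : ∀ x, x ∉ Ioc 0 T → φ x • (y x - w x) = 0 := fun x hx => by
      have : φ x = 0 := by
        by_contra h
        exact hx (Ioo_subset_Ioc_self (hsupp (subset_tsupport _ h)))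
      rw [this, zero_smul]
    rw [← setIntegral_eq_integral_of_forall_compl_eq_zero hzero,
      ← intervalIntegral.integral_of_le hT.le]
    -- The primitive is based at `T`, so the terminal condition holds, and `κ 0 = -∫ φ` produces the
    -- initial value.
    let κ : ℝ → ℝ := fun t => ∫ s in T..t, φ s
    have hκd : ∀ t, HasDerivAt κ (φ t) t := fun t =>
      intervalIntegral.integral_hasDerivAt_right (hφc.intervalIntegrable _ _)
        (hφc.stronglyMeasurableAtFilter _ _) hφc.continuousAt
    have hκ' : deriv κ = φ := funext fun t => (hκd t).deriv
    have hκs : ContDiff ℝ ((⊤ : ℕ∞) : WithTop ℕ∞) κ :=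
      contDiff_infty_iff_deriv.2 ⟨fun t => (hκd t).differentiableAt, by rw [hκ']; exact hφ⟩
    have hκc : Continuous κ := hκs.continuous
    have h1 := H κ hκs (intervalIntegral.integral_same)
    rw [hκ'] at h1
    have hφy : IntervalIntegrable (fun s => φ s • y s) volume 0 T := hy'.continuousOn_smul hφc.continuousOn
    have hφw : IntervalIntegrable (fun s => φ s • w s) volume 0 T := hwi'.continuousOn_smul hφc.continuousOn
    have hκn : IntervalIntegrable (fun s => κ s • n s) volume 0 T := hn'.continuousOn_smul hκc.continuousOn
    rw [intervalIntegral.integral_add hφy hκn] at h1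
    have h2 := integral_smul_primitive hT (hn.mono_set Ioc_subset_Icc_self) hφc
    have h3 : ∫ s in (0 : ℝ)..T, (∫ t in s..T, φ t) • n s = -∫ s in (0 : ℝ)..T, κ s • n s := by
      rw [← intervalIntegral.integral_neg]
      refine intervalIntegral.integral_congr fun s _ => ?_
      simp only [κ]
      rw [intervalIntegral.integral_symm, neg_smul]
    have h4 : ∫ s in (0 : ℝ)..T, φ s • w s
        = (∫ s in (0 : ℝ)..T, φ s) • y₀ + ∫ t in (0 : ℝ)..T, φ t • ∫ s in (0 : ℝ)..t, n s := by
      have hN : IntervalIntegrable (fun t => φ t • ∫ s in (0 : ℝ)..t, n s) volume 0 T := by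
        have : (fun t => φ t • ∫ s in (0 : ℝ)..t, n s) = fun t => φ t • w t - φ t • y₀ := by
          ext t; simp only [hw, smul_add]; abel
        rw [this]
        exact hφw.sub ((hφc.smul continuous_const).intervalIntegrable _ _)
      have hφ₀ : IntervalIntegrable (fun s => φ s • y₀) volume 0 T :=
        (hφc.smul continuous_const).intervalIntegrable _ _
      rw [← intervalIntegral.integral_smul_const, ← intervalIntegral.integral_add hφ₀ hN]
      refine intervalIntegral.integral_congr fun s _ => ?_
      simp only [hw, smul_add]
    have h5 : κ 0 = -∫ s in (0 : ℝ)..T, φ s := intervalIntegral.integral_symm _ _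
    simp only [smul_sub]
    rw [intervalIntegral.integral_sub hφy hφw, h4, ← h2, h3]
    rw [h5, neg_smul] at h1
    have h6 : (∫ s in (0 : ℝ)..T, φ s • y s)
        = (∫ s in (0 : ℝ)..T, φ s) • y₀ - ∫ s in (0 : ℝ)..T, κ s • n s := by
      have := neg_inj.1 h1
      rw [← this]; abel
    rw [h6]; abel
  rw [← restrict_Ioo_eq_restrict_Icc, ae_restrict_iff' measurableSet_Ioo]
  filter_upwards [key] with t ht h
  exact sub_eq_zero.1 (ht h)

/-- Integrating factor, obtained by testing with `e^{ct} κ`. A negative `c` gives Gronwall's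
inequality for the moments; `c = lam k` gives Duhamel's formula for a Fourier mode. -/
lemma eq_of_weak_ode_exp {G : Type*} [NormedAddCommGroup G] [NormedSpace ℝ G] [CompleteSpace G]
    {T : ℝ} (hT : 0 < T) {y n : ℝ → G} {y₀ : G} (hy : IntegrableOn y (Icc 0 T))
    (hn : IntegrableOn n (Icc 0 T))
    (H : ∀ κ : ℝ → ℝ, ContDiff ℝ ((⊤ : ℕ∞) : WithTop ℕ∞) κ → κ T = 0 →
      -(∫ s in (0 : ℝ)..T, (deriv κ s • y s + κ s • n s)) = κ 0 • y₀) (c : ℝ) :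
    ∀ᵐ t ∂(volume.restrict (Icc 0 T)), Real.exp (c * t) • y t
      = y₀ + ∫ s in (0 : ℝ)..t, Real.exp (c * s) • (n s + c • y s) := by
  have he : ContinuousOn (fun s => Real.exp (c * s)) (Icc 0 T) := by fun_prop
  refine eq_of_weak_ode hT (hy.continuousOn_smul he isCompact_Icc)
    ((hn.add (hy.smul c)).continuousOn_smul he isCompact_Icc) fun κ hκ hκT => ?_
  have h := H (fun s => Real.exp (c * s) * κ s) (by fun_prop) (by simp [hκT])
  simp only [mul_zero, Real.exp_zero, one_mul] at h
  rw [← h]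
  congr 1
  refine intervalIntegral.integral_congr fun s _ => ?_
  have hd : deriv (fun s => Real.exp (c * s) * κ s) s
      = Real.exp (c * s) * c * κ s + Real.exp (c * s) * deriv κ s := by
    have h1 : HasDerivAt (fun s : ℝ => Real.exp (c * s)) (Real.exp (c * s) * c) s := by
      simpa using ((hasDerivAt_id s).const_mul c).exp
    exact (h1.mul (hκ.differentiable (by simp) s).hasDerivAt).deriv
  simp only [hd]
  module

/-! ### Radial test functions in the velocity -/

/-- The kinetic operator applied to a radial function with derivatives `g₁`, `g₂` in `|v|²`. -/
def kinOp (σ : ℝ) (u v : E d) (g₁ g₂ : ℝ) : ℝ :=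
  2 * (inner ℝ u v - ‖v‖ ^ 2) * g₁ + σ ^ 2 / 2 * (4 * ‖v‖ ^ 2 * g₂ + 2 * d * g₁)

lemma hasFDerivAt_radial {g : ℝ → ℝ} {g' : ℝ} {v : E d} (hg : HasDerivAt g g' (‖v‖ ^ 2)) :
    HasFDerivAt (fun w : E d => g (‖w‖ ^ 2)) ((2 * g') • innerSL ℝ v) v := by
  have h := hg.comp_hasFDerivAt v (hasStrictFDerivAt_norm_sq v).hasFDerivAt
  refine h.congr_fderiv ?_
  ext w
  simp
  ring

/-- The range `-1 < r` is an open neighbourhood of the values `|v|² ≥ 0`, so `v = 0` needs no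
special treatment and profiles built on `1 + r` are admissible. -/
lemma laplacian_radial {g g₁ g₂ : ℝ → ℝ} (hg : ∀ r, -1 < r → HasDerivAt g (g₁ r) r)
    (hg₁ : ∀ r, -1 < r → HasDerivAt g₁ (g₂ r) r) (v : E d) :
    Laplacian.laplacian (fun w : E d => g (‖w‖ ^ 2)) v
      = 4 * ‖v‖ ^ 2 * g₂ (‖v‖ ^ 2) + 2 * d * g₁ (‖v‖ ^ 2) := by
  have hpos : ∀ w : E d, -1 < ‖w‖ ^ 2 := fun w => by nlinarith [sq_nonneg ‖w‖]
  have h1 : fderiv ℝ (fun w : E d => g (‖w‖ ^ 2)) = fun w => (2 * g₁ (‖w‖ ^ 2)) • innerSL ℝ w :=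
    funext fun w => (hasFDerivAt_radial (hg _ (hpos w))).fderiv
  let B : E d →L[ℝ] E d →L[ℝ] ℝ :=
    (isBoundedBilinearMap_inner (𝕜 := ℝ) (E := E d)).toContinuousLinearMap
  have hB : ∀ w, B w = innerSL ℝ w := fun w => by ext z; rfl
  have h2 : HasFDerivAt (fun w : E d => (2 * g₁ (‖w‖ ^ 2)) • innerSL ℝ w)
      ((2 * g₁ (‖v‖ ^ 2)) • B
        + ((2 : ℝ) • ((2 * g₂ (‖v‖ ^ 2)) • innerSL ℝ v)).smulRight (B v)) v := by
    simp_rw [← hB]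
    exact ((hasFDerivAt_radial (hg₁ _ (hpos v))).const_mul 2).smul B.hasFDerivAt
  have h3 := InnerProductSpace.laplacian_eq_iteratedFDeriv_orthonormalBasis
    (fun w : E d => g (‖w‖ ^ 2)) (EuclideanSpace.basisFun (Fin d) ℝ)
  have h4 := congrFun h3 v
  refine h4.trans ?_
  simp only [iteratedFDeriv_two_apply, h1, h2.fderiv]
  simp only [Matrix.cons_val_zero, Matrix.cons_val_one, add_apply, smul_apply,
    ContinuousLinearMap.smulRight_apply, hB, innerSL_apply_apply, smul_eq_mul,
    EuclideanSpace.basisFun_apply, EuclideanSpace.inner_single_right, EuclideanSpace.norm_sq_eq,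
    Finset.sum_add_distrib]
  simp only [PiLp.single_apply, if_true, conj_trivial, one_mul, Real.norm_eq_abs, sq_abs]
  rw [Finset.mul_sum, Finset.sum_mul]
  simp only [Finset.sum_const, Finset.card_univ, Fintype.card_fin, nsmul_eq_mul]
  rw [add_comm]
  congr 1
  · exact Finset.sum_congr rfl fun i _ => by ring
  · ring

lemma kineticDual_radial {σ : ℝ} {u : ℝ → Torus d → E d} {θ : ℝ → ℝ} (hθ : Differentiable ℝ θ)
    {g g₁ g₂ : ℝ → ℝ} (hg : ∀ r, -1 < r → HasDerivAt g (g₁ r) r)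
    (hg₁ : ∀ r, -1 < r → HasDerivAt g₁ (g₂ r) r) (s : ℝ) (x : Torus d) (v : E d) :
    kineticDual σ u (fun s _ v => θ s * g (‖v‖ ^ 2)) s x v
      = deriv θ s * g (‖v‖ ^ 2) + θ s * kinOp σ (u s x) v (g₁ (‖v‖ ^ 2)) (g₂ (‖v‖ ^ 2)) := by
  have hpos : -1 < ‖v‖ ^ 2 := by nlinarith [sq_nonneg ‖v‖]
  have h1 : deriv (fun r => θ r * g (‖v‖ ^ 2)) s = deriv θ s * g (‖v‖ ^ 2) :=
    ((hθ s).hasDerivAt.mul_const _).deriv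
  have hg' : ∀ r, -1 < r → HasDerivAt (fun r => θ s * g r) (θ s * g₁ r) r := fun r hr =>
    (hg r hr).const_mul _
  have hg₁' : ∀ r, -1 < r → HasDerivAt (fun r => θ s * g₁ r) (θ s * g₂ r) r := fun r hr =>
    (hg₁ r hr).const_mul _
  have h2 := laplacian_radial hg' hg₁' v
  have h3 := (hasFDerivAt_radial (hg' _ hpos)).fderiv
  unfold kineticDual
  rw [h1, h2, h3, fderiv_fun_const]
  simp only [smul_apply, innerSL_apply_apply, smul_eq_mul, kinOp, Pi.zero_apply, zero_apply]
  rw [inner_sub_right, real_inner_self_eq_norm_sq, real_inner_comm]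
  ring

lemma isKineticTest_radial {T : ℝ} {θ : ℝ → ℝ} (hθ : ContDiff ℝ ((⊤ : ℕ∞) : WithTop ℕ∞) θ)
    (hT : θ T = 0) {g : ℝ → ℝ} (hg : ∀ r, 0 ≤ r → ContDiffAt ℝ ((⊤ : ℕ∞) : WithTop ℕ∞) g r) {R : ℝ}
    (hR : ∀ r, R < r → g r = 0) :
    IsKineticTest (d := d) T (fun s _ v => θ s * g (‖v‖ ^ 2)) := by
  refine ⟨?_, ⟨max R 1, fun s x v hv => ?_⟩, fun x v => by simp [hT]⟩
  · rw [contDiff_iff_contDiffAt]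
    intro z
    have h1 : ContDiffAt ℝ ((⊤ : ℕ∞) : WithTop ℕ∞) (fun z : ℝ × E d × E d => ‖z.2.2‖ ^ 2) z :=
      (contDiff_norm_sq ℝ).contDiffAt.comp z (by fun_prop)
    have h2 := (hg (‖z.2.2‖ ^ 2) (sq_nonneg _)).comp z h1
    exact (hθ.contDiffAt.comp z contDiffAt_fst).mul h2
  · have h1 : R < ‖v‖ := (le_max_left _ _).trans_lt hv
    have h2 : 1 < ‖v‖ := (le_max_right _ _).trans_lt hv
    rw [hR _ (by nlinarith), mul_zero]

/-! ### The kinetic equation tested with radial functions -/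

section WeakKinetic

variable {T σ : ℝ} {u₀ : Torus d → E d} {F₀ : Torus d → E d → ℝ} {u : ℝ → Torus d → E d}
  {F : ℝ → Torus d → E d → ℝ}

/-- Used to pull a.e. properties of the fluid velocity in `(t, x)` back to `(t, x, v)`. -/
lemma quasiMeasurePreserving_time_space :
    Measure.QuasiMeasurePreserving (fun z : ℝ × Torus d × E d => (z.1, z.2.1))
      ((volume.restrict (Icc 0 T)).prod ((torusVol d).prod volume))
      ((volume.restrict (Icc 0 T)).prod (torusVol d)) :=
  Measure.quasiMeasurePreserving_fst.comp
    (measurePreserving_prodAssoc (volume.restrict (Icc 0 T)) (torusVol d)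
      (volume : Measure (E d))).symm.quasiMeasurePreserving

lemma ae_norm_le_of_eLpNorm_top {A : ℝ} (hA : 0 ≤ A)
    (h : eLpNorm (fun z : ℝ × Torus d => u z.1 z.2) ∞
      ((volume.restrict (Icc 0 T)).prod (torusVol d)) ≤ ENNReal.ofReal A) :
    ∀ᵐ z ∂((volume.restrict (Icc 0 T)).prod (torusVol d)), ‖u z.1 z.2‖ ≤ A := by
  rw [eLpNorm_exponent_top] at h
  filter_upwards [ae_le_eLpNormEssSup (f := fun z : ℝ × Torus d => u z.1 z.2)
    (μ := (volume.restrict (Icc 0 T)).prod (torusVol d))] with z hz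
  have := hz.trans h
  rwa [← ofReal_norm, ENNReal.ofReal_le_ofReal_iff hA] at this

lemma integrable_prod_of_slices {f : ℝ → Torus d × E d → ℝ}
    (hm : AEStronglyMeasurable (fun z : ℝ × Torus d × E d => f z.1 z.2)
      ((volume.restrict (Icc 0 T)).prod ((torusVol d).prod volume))) {M : ℝ≥0}
    (h : ∀ᵐ t ∂(volume.restrict (Icc 0 T)), eLpNorm (f t) 1 ((torusVol d).prod volume) ≤ M) :
    Integrable (fun z : ℝ × Torus d × E d => f z.1 z.2)
      ((volume.restrict (Icc 0 T)).prod ((torusVol d).prod volume)) := by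
  refine ⟨hm, ?_⟩
  rw [hasFiniteIntegral_iff_enorm, lintegral_prod _ hm.enorm]
  calc ∫⁻ t in Icc 0 T, ∫⁻ z, ‖f t z‖ₑ ∂((torusVol d).prod volume)
      ≤ ∫⁻ _t in Icc 0 T, (M : ℝ≥0∞) := lintegral_mono_ae (by
        filter_upwards [h] with t ht
        rwa [eLpNorm_one_eq_lintegral_enorm] at ht)
    _ < ∞ := by
        rw [lintegral_const]
        exact ENNReal.mul_lt_top ENNReal.coe_lt_top (by simp)

lemma IsWeakSolution.integrable_F (hw : IsWeakSolution T σ u₀ F₀ u F) :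
    Integrable (fun z : ℝ × Torus d × E d => F z.1 z.2.1 z.2.2)
      ((volume.restrict (Icc 0 T)).prod ((torusVol d).prod volume)) := by
  obtain ⟨M, hM⟩ := hw.F_integrable
  exact integrable_prod_of_slices (f := fun t z => F t z.1 z.2) hw.meas_F hM

lemma IsWeakSolution.integrable_energy (hw : IsWeakSolution T σ u₀ F₀ u F) :
    Integrable (fun z : ℝ × Torus d × E d => ‖z.2.2‖ ^ 2 * F z.1 z.2.1 z.2.2)
      ((volume.restrict (Icc 0 T)).prod ((torusVol d).prod volume)) := by
  obtain ⟨M, hM⟩ := hw.F_energy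
  refine integrable_prod_of_slices (f := fun t z => ‖z.2‖ ^ 2 * F t z.1 z.2)
    (AEStronglyMeasurable.mul ?_ hw.meas_F) hM
  exact (by fun_prop : Continuous fun z : ℝ × Torus d × E d => ‖z.2.2‖ ^ 2).aestronglyMeasurable

/-- A test function independent of `x` kills the transport term, so radial velocity averages of `F`
satisfy a closed integral identity in time. The constant `K` dominates the test function and the
operator applied to it; every integral is then controlled by the mass of `F`. -/
lemma kinetic_ode (hT : 0 < T) (hw : IsWeakSolution T σ u₀ F₀ u F) {A : ℝ}
    (hA : ∀ᵐ z ∂((volume.restrict (Icc 0 T)).prod (torusVol d)), ‖u z.1 z.2‖ ≤ A)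
    (hF₀ : Integrable (fun z : Torus d × E d => F₀ z.1 z.2) ((torusVol d).prod volume))
    {g g₁ g₂ : ℝ → ℝ} (hgs : ∀ r, 0 ≤ r → ContDiffAt ℝ ((⊤ : ℕ∞) : WithTop ℕ∞) g r)
    (hg : ∀ r, -1 < r → HasDerivAt g (g₁ r) r)
    (hg₁ : ∀ r, -1 < r → HasDerivAt g₁ (g₂ r) r)
    (hgm : Measurable g) (hg₁m : Measurable g₁) (hg₂m : Measurable g₂) {R K : ℝ}
    (hR : ∀ r, R < r → g r = 0) (hK : ∀ v : E d, |g (‖v‖ ^ 2)| ≤ K)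
    (hK₁ : ∀ u v : E d, ‖u‖ ≤ A → |kinOp σ u v (g₁ (‖v‖ ^ 2)) (g₂ (‖v‖ ^ 2))| ≤ K) (c : ℝ) :
    (∀ᵐ t ∂(volume.restrict (Icc 0 T)),
      Integrable (fun z : Torus d × E d => g (‖z.2‖ ^ 2) * F t z.1 z.2) ((torusVol d).prod volume) ∧
      Integrable (fun z : Torus d × E d =>
        kinOp σ (u t z.1) z.2 (g₁ (‖z.2‖ ^ 2)) (g₂ (‖z.2‖ ^ 2)) * F t z.1 z.2)
        ((torusVol d).prod volume)) ∧
    IntegrableOn (fun s => (∫ z, kinOp σ (u s z.1) z.2 (g₁ (‖z.2‖ ^ 2)) (g₂ (‖z.2‖ ^ 2))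
          * F s z.1 z.2 ∂((torusVol d).prod volume))
          + c * ∫ z, g (‖z.2‖ ^ 2) * F s z.1 z.2 ∂((torusVol d).prod volume)) (Icc 0 T) ∧
    ∀ᵐ t ∂(volume.restrict (Icc 0 T)),
      Real.exp (c * t) * ∫ z, g (‖z.2‖ ^ 2) * F t z.1 z.2 ∂((torusVol d).prod volume)
      = ∫ z, g (‖z.2‖ ^ 2) * F₀ z.1 z.2 ∂((torusVol d).prod volume)
        + ∫ s in (0 : ℝ)..t, Real.exp (c * s) *
          ((∫ z, kinOp σ (u s z.1) z.2 (g₁ (‖z.2‖ ^ 2)) (g₂ (‖z.2‖ ^ 2)) * F s z.1 z.2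
            ∂((torusVol d).prod volume))
          + c * ∫ z, g (‖z.2‖ ^ 2) * F s z.1 z.2 ∂((torusVol d).prod volume)) := by
  set μ := (torusVol d).prod (volume : Measure (E d)) with hμ
  set Q := (volume.restrict (Icc 0 T)).prod μ with hQ
  have hFi := hw.integrable_F
  have hum : AEStronglyMeasurable (fun z : ℝ × Torus d × E d => u z.1 z.2.1) Q :=
    hw.meas_u.comp_quasiMeasurePreserving quasiMeasurePreserving_time_space
  have huA : ∀ᵐ z ∂Q, ‖u z.1 z.2.1‖ ≤ A := quasiMeasurePreserving_time_space.ae hA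
  have hnm : Measurable fun z : ℝ × Torus d × E d => ‖z.2.2‖ ^ 2 := by fun_prop
  have hY : Integrable (fun z : ℝ × Torus d × E d => g (‖z.2.2‖ ^ 2) * F z.1 z.2.1 z.2.2) Q :=
    hFi.bdd_mul (c := K) (hgm.comp hnm).aestronglyMeasurable (ae_of_all _ fun z => hK z.2.2)
  have hZ : Integrable (fun z : ℝ × Torus d × E d =>
      kinOp σ (u z.1 z.2.1) z.2.2 (g₁ (‖z.2.2‖ ^ 2)) (g₂ (‖z.2.2‖ ^ 2)) * F z.1 z.2.1 z.2.2) Q := by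
    refine hFi.bdd_mul (c := K) ?_ ?_
    · have h1 : AEStronglyMeasurable (fun z : ℝ × Torus d × E d => g₁ (‖z.2.2‖ ^ 2)) Q :=
        (hg₁m.comp hnm).aestronglyMeasurable
      have h2 : AEStronglyMeasurable (fun z : ℝ × Torus d × E d => g₂ (‖z.2.2‖ ^ 2)) Q :=
        (hg₂m.comp hnm).aestronglyMeasurable
      have h3 : AEStronglyMeasurable (fun z : ℝ × Torus d × E d => ‖z.2.2‖ ^ 2) Q :=
        hnm.aestronglyMeasurable
      have h4 : AEStronglyMeasurable (fun z : ℝ × Torus d × E d => inner ℝ (u z.1 z.2.1) z.2.2) Q :=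
        hum.inner (by fun_prop : Measurable fun z : ℝ × Torus d × E d => z.2.2).aestronglyMeasurable
      unfold kinOp
      exact (((h4.sub h3).const_mul 2).mul h1).add
        ((((h3.const_mul 4).mul h2).add (h1.const_mul (2 * d))).const_mul (σ ^ 2 / 2))
    · filter_upwards [huA] with z hz
      exact hK₁ _ _ hz
  have hYs := hY.prod_right_ae
  have hZs := hZ.prod_right_ae
  have hYi : IntegrableOn (fun s => ∫ z, g (‖z.2‖ ^ 2) * F s z.1 z.2 ∂μ) (Icc 0 T) :=
    hY.integral_prod_left
  have hZi : IntegrableOn (fun s => ∫ z, kinOp σ (u s z.1) z.2 (g₁ (‖z.2‖ ^ 2)) (g₂ (‖z.2‖ ^ 2))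
      * F s z.1 z.2 ∂μ) (Icc 0 T) := hZ.integral_prod_left
  refine ⟨?_, hZi.add (hYi.const_mul c), ?_⟩
  · filter_upwards [hYs, hZs] with t h1 h2 using ⟨h1, h2⟩
  refine eq_of_weak_ode_exp (G := ℝ) hT hYi hZi (fun κ hκ hκT => ?_) c
  have h := hw.kinetic _ (isKineticTest_radial hκ hκT hgs hR)
  have hκd : Differentiable ℝ κ := hκ.differentiable (by simp)
  have e0 : ∫ v, ∫ x, κ 0 * g (‖v‖ ^ 2) * F₀ x v ∂(torusVol d)
      = κ 0 • ∫ z, g (‖z.2‖ ^ 2) * F₀ z.1 z.2 ∂μ := by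
    have h1 : Integrable (fun z : Torus d × E d => g (‖z.2‖ ^ 2) * F₀ z.1 z.2) μ :=
      hF₀.bdd_mul (c := K) (hgm.comp (by fun_prop)).aestronglyMeasurable
        (ae_of_all _ fun z => hK z.2)
    rw [hμ, integral_prod_symm _ h1, smul_eq_mul, ← integral_const_mul]
    refine integral_congr_ae (ae_of_all _ fun v => ?_)
    simp only
    rw [← integral_const_mul]
    exact integral_congr_ae (ae_of_all _ fun x => by simp only; ring)
  rw [e0] at h
  rw [← h]
  congr 1
  rw [intervalIntegral.integral_of_le hT.le, intervalIntegral.integral_of_le hT.le]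
  refine integral_congr_ae (ae_restrict_of_ae_restrict_of_subset Ioc_subset_Icc_self ?_)
  filter_upwards [hYs, hZs] with s h1 h2
  simp only [kineticDual_radial hκd hg hg₁, smul_eq_mul]
  rw [← integral_const_mul, ← integral_const_mul, ← integral_add (h1.const_mul _) (h2.const_mul _),
    hμ, integral_prod_symm]
  · refine integral_congr_ae (ae_of_all _ fun v => ?_)
    refine integral_congr_ae (ae_of_all _ fun x => ?_)
    simp only
    ring
  · exact (h1.const_mul (deriv κ s)).add (h2.const_mul (κ s))

end WeakKinetic

/-! ### Propagation of velocity moments -/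

/-- A smooth cut-off: `1` on `(-∞, 1]`, `0` on `[2, ∞)`. -/
def cutFn (x : ℝ) : ℝ := Real.smoothTransition (2 - x)

lemma contDiff_cutFn : ContDiff ℝ ((⊤ : ℕ∞) : WithTop ℕ∞) cutFn :=
  Real.smoothTransition.contDiff.comp (by fun_prop)

lemma cutFn_eq_zero {x : ℝ} (hx : 2 ≤ x) : cutFn x = 0 :=
  Real.smoothTransition.zero_of_nonpos (by linarith)

lemma cutFn_eq_one {x : ℝ} (hx : x ≤ 1) : cutFn x = 1 :=
  Real.smoothTransition.one_of_one_le (by linarith)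

lemma cutFn_nonneg (x : ℝ) : 0 ≤ cutFn x := Real.smoothTransition.nonneg _

lemma cutFn_le_one (x : ℝ) : cutFn x ≤ 1 := Real.smoothTransition.le_one _

lemma contDiff_deriv_cutFn : ContDiff ℝ ((⊤ : ℕ∞) : WithTop ℕ∞) (deriv cutFn) :=
  (contDiff_infty_iff_deriv.1 contDiff_cutFn).2

lemma deriv_cutFn_eq_zero {x : ℝ} (hx : 2 < x) : deriv cutFn x = 0 := by
  have : cutFn =ᶠ[𝓝 x] fun _ => 0 := by
    filter_upwards [lt_mem_nhds hx] with y hy using cutFn_eq_zero (le_of_lt hy)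
  rw [this.deriv_eq, deriv_const]

lemma deriv_deriv_cutFn_eq_zero {x : ℝ} (hx : 2 < x) : deriv (deriv cutFn) x = 0 := by
  have : deriv cutFn =ᶠ[𝓝 x] fun _ => 0 := by
    filter_upwards [lt_mem_nhds hx] with y hy using deriv_cutFn_eq_zero hy
  rw [this.deriv_eq, deriv_const]

lemma exists_cutFn_bound : ∃ K : ℝ, 0 ≤ K ∧ ∀ x, 0 ≤ x → |deriv cutFn x| ≤ K ∧
    |deriv (deriv cutFn) x| ≤ K := by
  have h1 : Continuous (deriv cutFn) := contDiff_deriv_cutFn.continuous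
  have h2 : Continuous (deriv (deriv cutFn)) :=
    (contDiff_infty_iff_deriv.1 contDiff_deriv_cutFn).2.continuous
  obtain ⟨K₁, hK₁⟩ := (isCompact_Icc (a := (0 : ℝ)) (b := 2)).exists_bound_of_continuousOn
    h1.continuousOn
  obtain ⟨K₂, hK₂⟩ := (isCompact_Icc (a := (0 : ℝ)) (b := 2)).exists_bound_of_continuousOn
    h2.continuousOn
  refine ⟨max 0 (max K₁ K₂), le_max_left _ _, fun x hx => ?_⟩
  by_cases h : x ≤ 2
  · exact ⟨(hK₁ x ⟨hx, h⟩).trans ((le_max_left _ _).trans (le_max_right _ _)),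
      (hK₂ x ⟨hx, h⟩).trans ((le_max_right _ _).trans (le_max_right _ _))⟩
  · rw [deriv_cutFn_eq_zero (not_le.1 h), deriv_deriv_cutFn_eq_zero (not_le.1 h), abs_zero]
    exact ⟨le_max_left _ _, le_max_left _ _⟩

/-! ### A bounded smooth profile for the velocity weight, and its cut-off. -/

/-- The bounded approximation `(ε + (1 + r)⁻¹)^{-a}` of `(1 + r)^a`. -/
def prof (ε a r : ℝ) : ℝ := (ε + (1 + r)⁻¹) ^ (-a)

/-- The first derivative of `prof`. -/
def prof₁ (ε a r : ℝ) : ℝ := a * (ε + (1 + r)⁻¹) ^ (-a - 1) * ((1 + r) ^ 2)⁻¹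

/-- The second derivative of `prof`. -/
def prof₂ (ε a r : ℝ) : ℝ :=
  a * (a + 1) * (ε + (1 + r)⁻¹) ^ (-a - 2) * ((1 + r) ^ 4)⁻¹
    - 2 * a * (ε + (1 + r)⁻¹) ^ (-a - 1) * ((1 + r) ^ 3)⁻¹

section Prof

variable {ε a r : ℝ}

lemma prof_base_pos (hε : 0 < ε) (hr : -1 < r) : 0 < ε + (1 + r)⁻¹ := by
  have : 0 < 1 + r := by linarith
  positivity

lemma hasDerivAt_prof_base (hr : -1 < r) :
    HasDerivAt (fun r : ℝ => ε + (1 + r)⁻¹) (-((1 + r) ^ 2)⁻¹) r := by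
  have h1 : HasDerivAt (fun r : ℝ => 1 + r) 1 r := (hasDerivAt_id r).const_add 1
  refine ((h1.fun_inv (by linarith)).const_add ε).congr_deriv ?_
  rw [neg_div, one_div]

lemma hasDerivAt_prof (hε : 0 < ε) (hr : -1 < r) : HasDerivAt (prof ε a) (prof₁ ε a r) r := by
  have h := (hasDerivAt_prof_base (ε := ε) hr).rpow_const (p := -a) (Or.inl (prof_base_pos hε hr).ne')
  refine h.congr_deriv ?_
  unfold prof₁
  ring

lemma hasDerivAt_prof₁ (hε : 0 < ε) (hr : -1 < r) : HasDerivAt (prof₁ ε a) (prof₂ ε a r) r := by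
  have h0 : 1 + r ≠ 0 := by linarith
  have h := (hasDerivAt_prof_base (ε := ε) hr).rpow_const (p := -a - 1)
    (Or.inl (prof_base_pos hε hr).ne')
  have h1 : HasDerivAt (fun r : ℝ => ((1 + r) ^ 2)⁻¹) (-2 * ((1 + r) ^ 3)⁻¹) r := by
    have h2 : HasDerivAt (fun r : ℝ => (1 + r) ^ 2) (2 * (1 + r)) r := by
      simpa using ((hasDerivAt_id r).const_add 1).fun_pow 2
    refine (h2.fun_inv (pow_ne_zero 2 h0)).congr_deriv ?_
    field_simp
  refine ((h.const_mul a).mul h1).congr_deriv ?_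
  unfold prof₂
  rw [show -a - 1 - 1 = -a - 2 by ring]
  have : ((1 + r) ^ 4)⁻¹ = ((1 + r) ^ 2)⁻¹ * ((1 + r) ^ 2)⁻¹ := by rw [← mul_inv]; ring_nf
  rw [this]
  ring

lemma prof_nonneg (hε : 0 < ε) (hr : 0 ≤ r) : 0 ≤ prof ε a r :=
  (Real.rpow_pos_of_pos (prof_base_pos hε (by linarith)) _).le

lemma prof_le (hε : 0 < ε) (ha : 0 ≤ a) (hr : 0 ≤ r) : prof ε a r ≤ ε ^ (-a) := by
  refine Real.rpow_le_rpow_of_nonpos hε ?_ (by linarith)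
  have : 0 ≤ (1 + r)⁻¹ := by positivity
  linarith

lemma prof_le_rpow (hε : 0 < ε) (ha : 0 ≤ a) (hr : 0 ≤ r) : prof ε a r ≤ (1 + r) ^ a := by
  have h1 : 0 < 1 + r := by linarith
  have : (1 + r) ^ a = ((1 + r)⁻¹) ^ (-a) := by rw [Real.inv_rpow h1.le, Real.rpow_neg h1.le, inv_inv]
  rw [this]
  exact Real.rpow_le_rpow_of_nonpos (by positivity) (by linarith) (by linarith)

/-- The constants here and in `abs_prof₂_le` do not depend on `ε`: each derivative of the profile
costs a factor `(1 + r)⁻¹`, as for `(1 + r)^a` itself. The Gronwall rate therefore survives `ε → 0`.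
-/
lemma prof₁_bounds (hε : 0 < ε) (ha : 0 ≤ a) (hr : 0 ≤ r) :
    0 ≤ prof₁ ε a r ∧ prof₁ ε a r * (1 + r) ≤ a * prof ε a r := by
  have hb := prof_base_pos hε (show -1 < r by linarith)
  have h1 : 0 < 1 + r := by linarith
  refine ⟨by unfold prof₁; positivity, ?_⟩
  have hP : 0 < (ε + (1 + r)⁻¹) ^ (-a) := Real.rpow_pos_of_pos hb _
  have e : prof₁ ε a r * (1 + r) = a * prof ε a r * ((ε + (1 + r)⁻¹)⁻¹ * (1 + r)⁻¹) := by
    unfold prof₁ prof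
    rw [Real.rpow_sub_one hb.ne']
    field_simp
  rw [e]
  refine mul_le_of_le_one_right (by unfold prof; positivity) ?_
  rw [← mul_inv]
  refine inv_le_one_of_one_le₀ ?_
  have : (ε + (1 + r)⁻¹) * (1 + r) = ε * (1 + r) + 1 := by field_simp
  rw [this]
  nlinarith

lemma abs_prof₂_le (hε : 0 < ε) (ha : 0 ≤ a) (hr : 0 ≤ r) :
    |prof₂ ε a r| * (1 + r) ^ 2 ≤ a * (a + 3) * prof ε a r := by
  have hb := prof_base_pos hε (show -1 < r by linarith)
  have h1 : 0 < 1 + r := by linarith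
  have hP : 0 < (ε + (1 + r)⁻¹) ^ (-a) := Real.rpow_pos_of_pos hb _
  -- With this `q ∈ [0, 1]` the scaled second derivative is the profile times a quadratic polynomial
  -- in `q`.
  set q := (ε + (1 + r)⁻¹)⁻¹ * (1 + r)⁻¹ with hq
  have hq0 : 0 ≤ q := by positivity
  have hq1 : q ≤ 1 := by
    rw [hq, ← mul_inv]
    refine inv_le_one_of_one_le₀ ?_
    have : (ε + (1 + r)⁻¹) * (1 + r) = ε * (1 + r) + 1 := by field_simp
    rw [this]
    nlinarith
  have e : prof₂ ε a r * (1 + r) ^ 2 = prof ε a r * (a * (a + 1) * q ^ 2 - 2 * a * q) := by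
    unfold prof₂ prof
    have e2 : (ε + (1 + r)⁻¹) ^ (-a - 2) = (ε + (1 + r)⁻¹) ^ (-a) * ((ε + (1 + r)⁻¹)⁻¹) ^ 2 := by
      rw [show -a - 2 = -a - 1 - 1 by ring, Real.rpow_sub_one hb.ne', Real.rpow_sub_one hb.ne']
      field_simp
    rw [e2, Real.rpow_sub_one hb.ne', hq]
    field_simp
  have h2 : |prof₂ ε a r| * (1 + r) ^ 2 = |prof₂ ε a r * (1 + r) ^ 2| := by
    rw [abs_mul, abs_of_pos (show 0 < (1 + r) ^ 2 by positivity)]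
  rw [h2, e, abs_mul, abs_of_nonneg (show 0 ≤ prof ε a r from hP.le), mul_comm]
  refine mul_le_mul_of_nonneg_right ?_ hP.le
  have hq2 : q ^ 2 ≤ 1 := pow_le_one₀ hq0 hq1
  rw [abs_le]
  have ha2 : 0 ≤ a * (a + 1) := by positivity
  constructor
  · nlinarith [mul_nonneg ha2 (sq_nonneg q), mul_le_mul_of_nonneg_left hq1 ha]
  · nlinarith [mul_le_mul_of_nonneg_left hq2 ha2, mul_nonneg ha hq0]

lemma measurable_prof : Measurable (prof ε a) := by unfold prof; fun_prop

lemma measurable_prof₁ : Measurable (prof₁ ε a) := by unfold prof₁; fun_prop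

lemma measurable_prof₂ : Measurable (prof₂ ε a) := by unfold prof₂; fun_prop

lemma contDiffAt_prof (hε : 0 < ε) (hr : 0 ≤ r) :
    ContDiffAt ℝ ((⊤ : ℕ∞) : WithTop ℕ∞) (prof ε a) r := by
  have h1 : 1 + r ≠ 0 := by linarith
  unfold prof
  refine ContDiffAt.rpow_const_of_ne ?_ (prof_base_pos hε (by linarith)).ne'
  exact contDiffAt_const.add ((contDiffAt_const.add contDiffAt_id).inv h1)

end Prof

/-- Pointwise inequality behind the propagation of moments. -/
lemma kinOp_cut_le {σ A a P P₁ P₂ G K c e₁ e₂ R : ℝ} (hA : 0 ≤ A) (ha : 0 ≤ a) {u v : E d}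
    (hu : ‖u‖ ≤ A) (hP : 0 ≤ P) (hPG : P ≤ G) (hP₁ : 0 ≤ P₁) (hP₁' : P₁ * (1 + ‖v‖ ^ 2) ≤ a * P)
    (hP₂ : |P₂| * (1 + ‖v‖ ^ 2) ^ 2 ≤ a * (a + 3) * P) (hc : 0 ≤ c) (he₁ : |e₁| ≤ K)
    (he₂ : |e₂| ≤ K) (hR : 1 ≤ R) :
    kinOp σ u v (P₁ * c + P * (e₁ / R)) (P₂ * c + 2 * (P₁ * (e₁ / R)) + P * (e₂ / R ^ 2))
      ≤ (2 * A * a + σ ^ 2 / 2 * (4 * (a * (a + 3)) + 2 * d * a)) * (P * c)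
        + G * K * (2 * A + 2 + σ ^ 2 / 2 * (4 * (2 * a + 1) + 2 * d)) * ((1 + ‖v‖ ^ 2) / R) := by
  set r := ‖v‖ ^ 2 with hr
  have hr0 : 0 ≤ r := sq_nonneg _
  have hv : ‖v‖ ≤ 1 + r := by nlinarith [sq_nonneg (‖v‖ - 1), norm_nonneg v]
  have hin : |inner ℝ u v| ≤ A * (1 + r) := (abs_real_inner_le_norm u v).trans
    (mul_le_mul hu hv (norm_nonneg _) hA)
  set i := inner ℝ u v
  have hR0 : 0 < R := by linarith
  have hK : 0 ≤ K := (abs_nonneg _).trans he₁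
  have hG : 0 ≤ G := hP.trans hPG
  have hs : 0 ≤ σ ^ 2 / 2 := by positivity
  have hd : (0 : ℝ) ≤ d := Nat.cast_nonneg d
  set f₁ := e₁ / R with hf₁
  set f₂ := e₂ / R ^ 2 with hf₂
  set k := K / R with hk
  have hk0 : 0 ≤ k := by positivity
  have hf₁' : |f₁| ≤ k := by
    rw [hf₁, abs_div, abs_of_pos hR0, hk]; gcongr
  have hf₂' : |f₂| ≤ k := by
    rw [hf₂, abs_div, abs_of_pos (by positivity : 0 < R ^ 2), hk]
    calc |e₂| / R ^ 2 ≤ K / R ^ 2 := by gcongr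
      _ ≤ K / R := by
        refine div_le_div_of_nonneg_left hK hR0 ?_
        nlinarith
  have hP₁a : P₁ ≤ a * P := le_trans (by nlinarith) hP₁'
  have hPf : ∀ f : ℝ, |f| ≤ k → |P * f| ≤ G * k := fun f hf => by
    rw [abs_mul, abs_of_nonneg hP]; exact mul_le_mul hPG hf (abs_nonneg _) hG
  -- In `t1`, `t2`, `t3` the cut-off is not differentiated; they are multiples of `P * c` and feed
  -- Gronwall, the friction `-r * P₁` being dropped for its good sign. In `t4` to `t7` a derivative
  -- falls on the cut-off; these errors are of order `(1 + r) / R`, integrable against `F` by the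
  -- energy bound.
  have t1 : 2 * (i - r) * (P₁ * c) ≤ 2 * A * a * (P * c) := by
    have h1 : (i - r) * P₁ ≤ A * (a * P) := by
      calc (i - r) * P₁ ≤ (A * (1 + r)) * P₁ :=
            mul_le_mul_of_nonneg_right (by linarith [le_abs_self i]) hP₁
        _ = A * (P₁ * (1 + r)) := by ring
        _ ≤ A * (a * P) := mul_le_mul_of_nonneg_left hP₁' hA
    linarith [mul_le_mul_of_nonneg_right h1 hc]
  have t2 : 4 * r * (P₂ * c) ≤ 4 * (a * (a + 3)) * (P * c) := by
    have h1 : r * P₂ ≤ a * (a + 3) * P := by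
      calc r * P₂ ≤ (1 + r) ^ 2 * |P₂| := by
            refine (mul_le_mul_of_nonneg_left (le_abs_self P₂) hr0).trans ?_
            exact mul_le_mul_of_nonneg_right (by nlinarith) (abs_nonneg _)
        _ = |P₂| * (1 + r) ^ 2 := by ring
        _ ≤ _ := hP₂
    linarith [mul_le_mul_of_nonneg_right h1 hc]
  have t3 : 2 * d * (P₁ * c) ≤ 2 * d * a * (P * c) := by
    have h1 : d * (P₁ * c) ≤ d * ((a * P) * c) := by gcongr
    linarith
  have t4 : 2 * (i - r) * (P * f₁) ≤ G * k * (2 * A + 2) * (1 + r) := by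
    have h1 : |i - r| ≤ (A + 1) * (1 + r) := by
      refine (abs_sub _ _).trans ?_
      rw [abs_of_nonneg hr0]; linarith
    have h2 : (i - r) * (P * f₁) ≤ ((A + 1) * (1 + r)) * (G * k) :=
      (le_abs_self _).trans (by
        rw [abs_mul]; exact mul_le_mul h1 (hPf _ hf₁') (abs_nonneg _) (by positivity))
    linarith
  have t5 : 4 * r * (2 * (P₁ * f₁)) ≤ 4 * (2 * a) * (G * k) * (1 + r) := by
    have h2 : P₁ * f₁ ≤ a * (G * k) := by
      calc P₁ * f₁ ≤ P₁ * k := mul_le_mul_of_nonneg_left ((le_abs_self _).trans hf₁') hP₁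
        _ ≤ (a * P) * k := mul_le_mul_of_nonneg_right hP₁a hk0
        _ ≤ (a * G) * k := by gcongr
        _ = _ := by ring
    have h3 : 0 ≤ a * (G * k) := by positivity
    linarith [mul_le_mul_of_nonneg_left h2 hr0]
  have t6 : 4 * r * (P * f₂) ≤ 4 * (G * k) * (1 + r) := by
    have h2 := (le_abs_self _).trans (hPf _ hf₂')
    have h3 : 0 ≤ G * k := by positivity
    linarith [mul_le_mul_of_nonneg_left h2 hr0]
  have t7 : 2 * d * (P * f₁) ≤ 2 * d * (G * k) * (1 + r) := by
    have h2 := (le_abs_self _).trans (hPf _ hf₁')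
    have h3 : 0 ≤ G * k := by positivity
    have h4 : d * (P * f₁) ≤ d * (G * k) := mul_le_mul_of_nonneg_left h2 hd
    have h5 : 0 ≤ d * (G * k) * r := by positivity
    linarith
  have e : G * K * (2 * A + 2 + σ ^ 2 / 2 * (4 * (2 * a + 1) + 2 * d)) * ((1 + r) / R)
      = G * k * (2 * A + 2 + σ ^ 2 / 2 * (4 * (2 * a + 1) + 2 * d)) * (1 + r) := by
    rw [hk]; field_simp
  rw [e]
  unfold kinOp
  have h8 := mul_le_mul_of_nonneg_left (add_le_add (add_le_add t2 t3) (add_le_add t5 (add_le_add t6 t7))) hs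
  linarith

/-- The compactly supported approximation of `(1 + r)^a`. -/
def cutProf (ε a R r : ℝ) : ℝ := prof ε a r * cutFn (r / R)

/-- The first derivative of `cutProf`. -/
def cutProf₁ (ε a R r : ℝ) : ℝ :=
  prof₁ ε a r * cutFn (r / R) + prof ε a r * (deriv cutFn (r / R) / R)

/-- The second derivative of `cutProf`. -/
def cutProf₂ (ε a R r : ℝ) : ℝ :=
  prof₂ ε a r * cutFn (r / R) + 2 * (prof₁ ε a r * (deriv cutFn (r / R) / R))
    + prof ε a r * (deriv (deriv cutFn) (r / R) / R ^ 2)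

lemma hasDerivAt_cutFn_div (R r : ℝ) :
    HasDerivAt (fun r => cutFn (r / R)) (deriv cutFn (r / R) / R) r := by
  have h1 : HasDerivAt (fun r : ℝ => r / R) (1 / R) r := (hasDerivAt_id r).div_const R
  have h2 := ((contDiff_cutFn.differentiable (by simp)).differentiableAt (x := r / R)).hasDerivAt
  refine (HasDerivAt.comp r h2 h1).congr_deriv ?_
  ring

lemma hasDerivAt_deriv_cutFn_div (R r : ℝ) :
    HasDerivAt (fun r => deriv cutFn (r / R) / R) (deriv (deriv cutFn) (r / R) / R ^ 2) r := by
  have h1 : HasDerivAt (fun r : ℝ => r / R) (1 / R) r := (hasDerivAt_id r).div_const R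
  have h2 := ((contDiff_deriv_cutFn.differentiable (by simp)).differentiableAt
    (x := r / R)).hasDerivAt
  refine ((HasDerivAt.comp r h2 h1).div_const R).congr_deriv ?_
  ring

lemma hasDerivAt_cutProf {ε a R r : ℝ} (hε : 0 < ε) (hr : -1 < r) :
    HasDerivAt (cutProf ε a R) (cutProf₁ ε a R r) r :=
  (hasDerivAt_prof hε hr).mul (hasDerivAt_cutFn_div R r)

lemma hasDerivAt_cutProf₁ {ε a R r : ℝ} (hε : 0 < ε) (hr : -1 < r) :
    HasDerivAt (cutProf₁ ε a R) (cutProf₂ ε a R r) r := by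
  refine (((hasDerivAt_prof₁ hε hr).mul (hasDerivAt_cutFn_div R r)).add
    ((hasDerivAt_prof hε hr).mul (hasDerivAt_deriv_cutFn_div R r))).congr_deriv ?_
  unfold cutProf₂
  ring

lemma measurable_cutProf {ε a R : ℝ} : Measurable (cutProf ε a R) :=
  measurable_prof.mul (contDiff_cutFn.continuous.measurable.comp (by fun_prop))

lemma measurable_cutProf₁ {ε a R : ℝ} : Measurable (cutProf₁ ε a R) :=
  (measurable_prof₁.mul (contDiff_cutFn.continuous.measurable.comp (by fun_prop))).add
    (measurable_prof.mul ((contDiff_deriv_cutFn.continuous.measurable.comp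
      (by fun_prop)).div_const R))

lemma measurable_cutProf₂ {ε a R : ℝ} : Measurable (cutProf₂ ε a R) :=
  ((measurable_prof₂.mul (contDiff_cutFn.continuous.measurable.comp (by fun_prop))).add
    ((measurable_prof₁.mul ((contDiff_deriv_cutFn.continuous.measurable.comp
      (by fun_prop)).div_const R)).const_mul 2)).add
    (measurable_prof.mul (((measurable_deriv _).comp (by fun_prop)).div_const _))

lemma cutProf_bounds {ε a R r : ℝ} (hε : 0 < ε) (ha : 0 ≤ a) (hr : 0 ≤ r) :
    0 ≤ cutProf ε a R r ∧ cutProf ε a R r ≤ ε ^ (-a) ∧ cutProf ε a R r ≤ (1 + r) ^ a := by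
  have h0 := prof_nonneg (a := a) hε hr
  have h1 : cutProf ε a R r ≤ prof ε a r := mul_le_of_le_one_right h0 (cutFn_le_one _)
  exact ⟨mul_nonneg h0 (cutFn_nonneg _), h1.trans (prof_le hε ha hr),
    h1.trans (prof_le_rpow hε ha hr)⟩

lemma cutProf_vanish {ε a R r : ℝ} (hR : 0 < R) (hr : 2 * R < r) :
    cutProf ε a R r = 0 ∧ cutProf₁ ε a R r = 0 ∧ cutProf₂ ε a R r = 0 := by
  have h : 2 < r / R := by rwa [lt_div_iff₀ hR]
  unfold cutProf cutProf₁ cutProf₂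
  rw [cutFn_eq_zero h.le, deriv_cutFn_eq_zero h, deriv_deriv_cutFn_eq_zero h]
  simp

lemma cutProf_deriv_bounds {ε a R K r : ℝ} (hε : 0 < ε) (ha : 0 ≤ a) (hR : 1 ≤ R) (hr : 0 ≤ r)
    (hK : ∀ x, 0 ≤ x → |deriv cutFn x| ≤ K ∧ |deriv (deriv cutFn) x| ≤ K) :
    |cutProf₁ ε a R r| ≤ (a + K) * ε ^ (-a) ∧
    |cutProf₂ ε a R r| ≤ (a * (a + 3) + 2 * a * K + K) * ε ^ (-a) := by
  have h0 := prof_nonneg (a := a) hε hr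
  have hG := prof_le hε ha hr
  set P := prof ε a r
  set G := ε ^ (-a)
  have hG0 : 0 ≤ G := h0.trans hG
  obtain ⟨hP₁, hP₁'⟩ := prof₁_bounds hε ha hr
  have hP₂ := abs_prof₂_le hε ha hr
  have hR0 : 0 < R := by linarith
  obtain ⟨k1, k2⟩ := hK (r / R) (by positivity)
  have hK0 : 0 ≤ K := (abs_nonneg _).trans k1
  have k1' : |deriv cutFn (r / R) / R| ≤ K := by
    rw [abs_div, abs_of_pos hR0]
    exact (div_le_self (abs_nonneg _) hR).trans k1
  have k2' : |deriv (deriv cutFn) (r / R) / R ^ 2| ≤ K := by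
    rw [abs_div, abs_of_pos (by positivity : 0 < R ^ 2)]
    exact (div_le_self (abs_nonneg _) (by nlinarith)).trans k2
  have hc : |cutFn (r / R)| ≤ 1 := by
    rw [abs_of_nonneg (cutFn_nonneg _)]; exact cutFn_le_one _
  have q1 : |prof₁ ε a r| ≤ a * G := by
    rw [abs_of_nonneg hP₁]
    calc prof₁ ε a r ≤ prof₁ ε a r * (1 + r) := le_mul_of_one_le_right hP₁ (by linarith)
      _ ≤ a * P := hP₁'
      _ ≤ a * G := by gcongr
  have q2 : |prof₂ ε a r| ≤ a * (a + 3) * G := by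
    calc |prof₂ ε a r| ≤ |prof₂ ε a r| * (1 + r) ^ 2 :=
          le_mul_of_one_le_right (abs_nonneg _) (by nlinarith)
      _ ≤ a * (a + 3) * P := hP₂
      _ ≤ a * (a + 3) * G := by gcongr
  have q0 : |P| ≤ G := by rwa [abs_of_nonneg h0]
  unfold cutProf₁ cutProf₂
  constructor
  · refine (abs_add_le _ _).trans ?_
    rw [abs_mul, abs_mul]
    have := mul_le_mul q1 hc (abs_nonneg _) (by positivity)
    have := mul_le_mul q0 k1' (abs_nonneg _) (by positivity)
    linarith
  · refine (abs_add_three _ _ _).trans ?_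
    rw [abs_mul, abs_mul, abs_mul, abs_mul, abs_two]
    have := mul_le_mul q2 hc (abs_nonneg _) (by positivity)
    have := mul_le_mul q1 k1' (abs_nonneg _) (by positivity)
    have := mul_le_mul q0 k2' (abs_nonneg _) (by positivity)
    linarith

lemma abs_kinOp_le {σ A S M g₁ g₂ : ℝ} {u v : E d} (hA : 0 ≤ A) (hu : ‖u‖ ≤ A)
    (hv : ‖v‖ ^ 2 ≤ S) (h₁ : |g₁| ≤ M) (h₂ : |g₂| ≤ M) :
    |kinOp σ u v g₁ g₂| ≤ 2 * (A * (1 + S) + S) * M + σ ^ 2 / 2 * (4 * S * M + 2 * d * M) := by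
  set r := ‖v‖ ^ 2 with hr
  have hr0 : 0 ≤ r := sq_nonneg _
  have hv' : ‖v‖ ≤ 1 + S := by nlinarith [sq_nonneg (‖v‖ - 1), norm_nonneg v]
  have hin : |inner ℝ u v| ≤ A * (1 + S) := (abs_real_inner_le_norm u v).trans
    (mul_le_mul hu hv' (norm_nonneg _) hA)
  have hM : 0 ≤ M := (abs_nonneg _).trans h₁
  have hS : 0 ≤ S := hr0.trans hv
  have h3 : |inner ℝ u v - r| ≤ A * (1 + S) + S := by
    refine (abs_sub _ _).trans ?_
    rw [abs_of_nonneg hr0]; linarith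
  have h4 : |(inner ℝ u v - r) * g₁| ≤ (A * (1 + S) + S) * M := by
    rw [abs_mul]; exact mul_le_mul h3 h₁ (abs_nonneg _) (by positivity)
  have h5 : |r * g₂| ≤ S * M := by
    rw [abs_mul, abs_of_nonneg hr0]; exact mul_le_mul hv h₂ (abs_nonneg _) hS
  have h6 : |(d : ℝ) * g₁| ≤ d * M := by
    rw [abs_mul, Nat.abs_cast]; gcongr
  unfold kinOp
  have e : 2 * (inner ℝ u v - r) * g₁ + σ ^ 2 / 2 * (4 * r * g₂ + 2 * d * g₁)
      = 2 * ((inner ℝ u v - r) * g₁) + σ ^ 2 / 2 * (4 * (r * g₂) + 2 * (d * g₁)) := by ring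
  rw [e]
  refine (abs_add_le _ _).trans ?_
  rw [abs_mul 2, abs_mul (σ ^ 2 / 2), abs_two, abs_of_nonneg (by positivity : 0 ≤ σ ^ 2 / 2)]
  have h7 : |4 * (r * g₂) + 2 * (d * g₁)| ≤ 4 * (S * M) + 2 * (d * M) := by
    refine (abs_add_le _ _).trans ?_
    rw [abs_mul 4, abs_mul 2, abs_two, abs_of_nonneg (by norm_num : (0 : ℝ) ≤ 4)]
    gcongr
  calc _ ≤ 2 * ((A * (1 + S) + S) * M) + σ ^ 2 / 2 * (4 * (S * M) + 2 * (d * M)) := by gcongr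
    _ = _ := by ring

section Moments

variable {T σ : ℝ} {u₀ : Torus d → E d} {F₀ : Torus d → E d → ℝ} {u : ℝ → Torus d → E d}
  {F : ℝ → Torus d → E d → ℝ}

/-- Gronwall for the cut-off moment. The cut-off errors are paid for by the second moment `M₂`,
already part of the energy bound, with the factor `ε^{-a} / R`; the exponential rate contains
neither `ε` nor `R`. -/
lemma moment_cut_bound (hT : 0 < T) (hw : IsWeakSolution T σ u₀ F₀ u F) {A : ℝ} (hA0 : 0 ≤ A)
    (hA : ∀ᵐ z ∂((volume.restrict (Icc 0 T)).prod (torusVol d)), ‖u z.1 z.2‖ ≤ A)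
    (hF₀ : Integrable (fun z : Torus d × E d => F₀ z.1 z.2) ((torusVol d).prod volume))
    {ε a R K M₂ : ℝ} (hε : 0 < ε) (ha : 0 ≤ a) (hR : 1 ≤ R)
    (hF₀a : Integrable (fun z : Torus d × E d => (1 + ‖z.2‖ ^ 2) ^ a * ‖F₀ z.1 z.2‖)
      ((torusVol d).prod volume))
    (hK : ∀ x, 0 ≤ x → |deriv cutFn x| ≤ K ∧ |deriv (deriv cutFn) x| ≤ K) (hM₂ : 0 ≤ M₂)
    (hE : ∀ᵐ t ∂(volume.restrict (Icc 0 T)),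
      Integrable (fun z : Torus d × E d => (1 + ‖z.2‖ ^ 2) * F t z.1 z.2)
        ((torusVol d).prod volume) ∧
      ∫ z : Torus d × E d, (1 + ‖z.2‖ ^ 2) * F t z.1 z.2 ∂((torusVol d).prod volume) ≤ M₂) :
    ∀ᵐ t ∂(volume.restrict (Icc 0 T)),
      Integrable (fun z : Torus d × E d => cutProf ε a R (‖z.2‖ ^ 2) * F t z.1 z.2)
        ((torusVol d).prod volume) ∧
      ∫ z : Torus d × E d, cutProf ε a R (‖z.2‖ ^ 2) * F t z.1 z.2 ∂((torusVol d).prod volume)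
        ≤ Real.exp ((2 * A * a + σ ^ 2 / 2 * (4 * (a * (a + 3)) + 2 * d * a)) * T)
          * ((∫ z : Torus d × E d, (1 + ‖z.2‖ ^ 2) ^ a * ‖F₀ z.1 z.2‖ ∂((torusVol d).prod volume))
            + T * (ε ^ (-a) * K * (2 * A + 2 + σ ^ 2 / 2 * (4 * (2 * a + 1) + 2 * d)) * M₂) / R) := by
  set μ := (torusVol d).prod (volume : Measure (E d)) with hμ
  set C₀ := 2 * A * a + σ ^ 2 / 2 * (4 * (a * (a + 3)) + 2 * d * a) with hC₀
  set Ce := ε ^ (-a) * K * (2 * A + 2 + σ ^ 2 / 2 * (4 * (2 * a + 1) + 2 * d)) with hCe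
  have hR0 : 0 < R := by linarith
  have hC₀0 : 0 ≤ C₀ := by positivity
  have hK0 : 0 ≤ K := (abs_nonneg _).trans (hK 0 le_rfl).1
  have hG0 : 0 ≤ ε ^ (-a) := Real.rpow_nonneg hε.le _
  have hCe0 : 0 ≤ Ce := by positivity
  set M := (a + K) * ε ^ (-a) + (a * (a + 3) + 2 * a * K + K) * ε ^ (-a) with hM
  have hM1 : 0 ≤ (a + K) * ε ^ (-a) := by positivity
  have hM2 : 0 ≤ (a * (a + 3) + 2 * a * K + K) * ε ^ (-a) := by positivity
  -- The first entry bounds the test function. The second bounds the operator on `|v|² ≤ 2R`,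
  -- outside of which both derivatives of the profile vanish.
  set KK := max (ε ^ (-a)) (2 * (A * (1 + 2 * R) + 2 * R) * M
    + σ ^ 2 / 2 * (4 * (2 * R) * M + 2 * d * M)) with hKK
  have key := kinetic_ode (g := cutProf ε a R) (g₁ := cutProf₁ ε a R) (g₂ := cutProf₂ ε a R)
    (R := 2 * R) (K := KK) hT hw hA hF₀
    (fun r hr => (contDiffAt_prof hε hr).mul
      (contDiff_cutFn.contDiffAt.comp r (contDiffAt_id.div_const R)))
    (fun r hr => hasDerivAt_cutProf hε hr) (fun r hr => hasDerivAt_cutProf₁ hε hr)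
    measurable_cutProf measurable_cutProf₁ measurable_cutProf₂
    (fun r hr => (cutProf_vanish hR0 hr).1)
    (fun v => by
      have := cutProf_bounds (R := R) hε ha (sq_nonneg ‖v‖)
      rw [abs_of_nonneg this.1]
      exact this.2.1.trans (le_max_left _ _))
    (fun u v hu => by
      by_cases hv : ‖v‖ ^ 2 ≤ 2 * R
      · have := cutProf_deriv_bounds hε ha hR (sq_nonneg ‖v‖) hK
        exact (abs_kinOp_le hA0 hu hv (this.1.trans (by linarith))
          (this.2.trans (by linarith))).trans (le_max_right _ _)
      · obtain ⟨-, h1, h2⟩ := cutProf_vanish (ε := ε) (a := a) hR0 (not_le.1 hv)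
        rw [h1, h2]
        simp only [kinOp, mul_zero, add_zero, abs_zero]
        exact hG0.trans (le_max_left _ _))
    (-C₀)
  obtain ⟨hint, hio, hode⟩ := key
  have hFpos := Measure.ae_ae_of_ae_prod hw.F_nonneg
  have hus : ∀ᵐ t ∂(volume.restrict (Icc 0 T)), ∀ᵐ z ∂μ, ‖u t z.1‖ ≤ A :=
    Measure.ae_ae_of_ae_prod (quasiMeasurePreserving_time_space.ae hA)
  have hineq : ∀ᵐ s ∂(volume.restrict (Icc 0 T)),
      (∫ z, kinOp σ (u s z.1) z.2 (cutProf₁ ε a R (‖z.2‖ ^ 2)) (cutProf₂ ε a R (‖z.2‖ ^ 2))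
          * F s z.1 z.2 ∂μ) + -C₀ * ∫ z, cutProf ε a R (‖z.2‖ ^ 2) * F s z.1 z.2 ∂μ
        ≤ Ce * M₂ / R := by
    filter_upwards [hint, hFpos, hus, hE] with s hs hF hu hEs
    rw [neg_mul, ← sub_eq_add_neg, ← integral_const_mul,
      ← integral_sub hs.2 (hs.1.const_mul C₀)]
    calc _ ≤ ∫ z : Torus d × E d, Ce / R * ((1 + ‖z.2‖ ^ 2) * F s z.1 z.2) ∂μ := by
          refine integral_mono_ae (hs.2.sub (hs.1.const_mul C₀)) (hEs.1.const_mul _) ?_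
          filter_upwards [hF, hu] with z hz1 hz2
          obtain ⟨k1, k2⟩ := hK (‖z.2‖ ^ 2 / R) (by positivity)
          have hb := prof₁_bounds hε ha (sq_nonneg ‖z.2‖)
          have := kinOp_cut_le (σ := σ) (u := u s z.1) (v := z.2) (R := R) hA0 ha hz2
            (prof_nonneg (a := a) hε (sq_nonneg ‖z.2‖)) (prof_le hε ha (sq_nonneg ‖z.2‖))
            hb.1 hb.2 (abs_prof₂_le hε ha (sq_nonneg ‖z.2‖))
            (cutFn_nonneg (‖z.2‖ ^ 2 / R)) k1 k2 hR
          rw [← hCe] at this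
          have h2 := mul_le_mul_of_nonneg_right this hz1
          simp only [cutProf, cutProf₁, cutProf₂]
          have e : Ce / R * ((1 + ‖z.2‖ ^ 2) * F s z.1 z.2)
            = Ce * ((1 + ‖z.2‖ ^ 2) / R) * F s z.1 z.2 := by ring
          rw [e]
          rw [add_mul, mul_assoc C₀] at h2
          linarith
      _ = Ce / R * ∫ z : Torus d × E d, (1 + ‖z.2‖ ^ 2) * F s z.1 z.2 ∂μ := integral_const_mul _ _
      _ ≤ Ce / R * M₂ := mul_le_mul_of_nonneg_left hEs.2 (by positivity)
      _ = Ce * M₂ / R := by ring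
  filter_upwards [hint, hode, ae_restrict_mem measurableSet_Icc] with t ht htode htm
  refine ⟨ht.1, ?_⟩
  have h1 : ∫ z, cutProf ε a R (‖z.2‖ ^ 2) * F₀ z.1 z.2 ∂μ
      ≤ ∫ z : Torus d × E d, (1 + ‖z.2‖ ^ 2) ^ a * ‖F₀ z.1 z.2‖ ∂μ := by
    refine (Real.le_norm_self _).trans ((norm_integral_le_integral_norm _).trans ?_)
    refine integral_mono_of_nonneg (ae_of_all _ fun z => norm_nonneg _) hF₀a
      (ae_of_all _ fun z => ?_)
    simp only [norm_mul]
    refine mul_le_mul_of_nonneg_right ?_ (norm_nonneg _)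
    have := cutProf_bounds (R := R) hε ha (sq_nonneg ‖z.2‖)
    rw [Real.norm_of_nonneg this.1]
    exact this.2.2
  set D := fun s : ℝ => (∫ z, kinOp σ (u s z.1) z.2 (cutProf₁ ε a R (‖z.2‖ ^ 2))
    (cutProf₂ ε a R (‖z.2‖ ^ 2)) * F s z.1 z.2 ∂μ)
      + -C₀ * ∫ z, cutProf ε a R (‖z.2‖ ^ 2) * F s z.1 z.2 ∂μ with hD
  have h2 : ∫ s in (0 : ℝ)..t, Real.exp (-C₀ * s) * D s ≤ T * (Ce * M₂) / R := by
    have hsub : Ioc 0 t ⊆ Icc 0 T := fun s hs => ⟨hs.1.le, hs.2.trans htm.2⟩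
    rw [intervalIntegral.integral_of_le htm.1]
    have hi : IntegrableOn (fun s => Real.exp (-C₀ * s) * D s) (Ioc 0 t) := by
      refine IntegrableOn.mono_set ?_ hsub
      exact hio.continuousOn_mul (by fun_prop) isCompact_Icc
    calc ∫ s in Ioc 0 t, Real.exp (-C₀ * s) * D s ≤ ∫ _s in Ioc 0 t, Ce * M₂ / R := by
          refine integral_mono_ae hi (integrable_const _) ?_
          filter_upwards [ae_restrict_of_ae_restrict_of_subset hsub hineq,
            ae_restrict_mem measurableSet_Ioc] with s hs hsm
          have hB : 0 ≤ Ce * M₂ / R := by positivity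
          have he : Real.exp (-C₀ * s) ≤ 1 := Real.exp_le_one_iff.2 (by nlinarith [hsm.1])
          calc Real.exp (-C₀ * s) * D s ≤ Real.exp (-C₀ * s) * (Ce * M₂ / R) :=
                mul_le_mul_of_nonneg_left hs (Real.exp_pos _).le
            _ ≤ Ce * M₂ / R := mul_le_of_le_one_left hB he
      _ = t * (Ce * M₂ / R) := by simp [htm.1]
      _ ≤ T * (Ce * M₂ / R) := mul_le_mul_of_nonneg_right htm.2 (by positivity)
      _ = _ := by ring
  set Y := ∫ z, cutProf ε a R (‖z.2‖ ^ 2) * F t z.1 z.2 ∂μ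
  have h3 : Real.exp (-C₀ * t) * Y
      ≤ (∫ z : Torus d × E d, (1 + ‖z.2‖ ^ 2) ^ a * ‖F₀ z.1 z.2‖ ∂μ) + T * (Ce * M₂) / R := by
    rw [htode]; exact add_le_add h1 h2
  have h4 : 0 ≤ ∫ z : Torus d × E d, (1 + ‖z.2‖ ^ 2) ^ a * ‖F₀ z.1 z.2‖ ∂μ :=
    integral_nonneg fun z => by positivity
  calc Y = Real.exp (C₀ * t) * (Real.exp (-C₀ * t) * Y) := by
        rw [← mul_assoc, ← Real.exp_add]; simp
    _ ≤ Real.exp (C₀ * t) * _ := mul_le_mul_of_nonneg_left h3 (Real.exp_pos _).le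
    _ ≤ _ := by
        refine mul_le_mul_of_nonneg_right (Real.exp_le_exp.2 ?_) (by positivity)
        exact mul_le_mul_of_nonneg_left htm.2 hC₀0

end Moments

/-! ### Moments and drag of the limit density -/

section Drag

variable {T σ : ℝ} {u₀ : Torus d → E d} {F₀ : Torus d → E d → ℝ} {u : ℝ → Torus d → E d}
  {F : ℝ → Torus d → E d → ℝ}

lemma integral_le_of_eLpNorm_one {X : Type*} [MeasurableSpace X] {ν : Measure X} {f : X → ℝ}
    {M : ℝ≥0} (hf : Integrable f ν) (h : eLpNorm f 1 ν ≤ M) : ∫ x, f x ∂ν ≤ M := by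
  refine (Real.le_norm_self _).trans ((norm_integral_le_integral_norm _).trans ?_)
  rw [integral_norm_eq_lintegral_enorm hf.1, ← eLpNorm_one_eq_lintegral_enorm]
  exact ENNReal.toReal_le_coe_of_le_coe h

lemma IsWeakSolution.exists_energy_bound (hw : IsWeakSolution T σ u₀ F₀ u F) :
    ∃ M₂ : ℝ, 0 ≤ M₂ ∧ ∀ᵐ t ∂(volume.restrict (Icc 0 T)),
      Integrable (fun z : Torus d × E d => (1 + ‖z.2‖ ^ 2) * F t z.1 z.2)
        ((torusVol d).prod volume) ∧
      ∫ z : Torus d × E d, (1 + ‖z.2‖ ^ 2) * F t z.1 z.2 ∂((torusVol d).prod volume) ≤ M₂ := by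
  obtain ⟨M, hM⟩ := hw.F_integrable
  obtain ⟨M', hM'⟩ := hw.F_energy
  refine ⟨M + M', by positivity, ?_⟩
  filter_upwards [hM, hM', hw.integrable_F.prod_right_ae, hw.integrable_energy.prod_right_ae]
    with t h1 h2 h3 h4
  have e : (fun z : Torus d × E d => (1 + ‖z.2‖ ^ 2) * F t z.1 z.2)
      = fun z => F t z.1 z.2 + ‖z.2‖ ^ 2 * F t z.1 z.2 := by
    funext z; ring
  rw [e]
  refine ⟨h3.add h4, ?_⟩
  rw [integral_add h3 h4]
  exact add_le_add (integral_le_of_eLpNorm_one h3 h1) (integral_le_of_eLpNorm_one h4 h2)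

lemma tendsto_cutProf {a r : ℝ} (hr : 0 ≤ r) {R : ℕ → ℝ} (hR : ∀ n : ℕ, (n : ℝ) + 1 ≤ R n) :
    Tendsto (fun n : ℕ => cutProf (1 / ((n : ℝ) + 1)) a (R n) r) atTop (𝓝 ((1 + r) ^ a)) := by
  have h1 : 0 < 1 + r := by linarith
  have e : (1 + r) ^ a = ((0 : ℝ) + (1 + r)⁻¹) ^ (-a) * 1 := by
    rw [zero_add, Real.inv_rpow h1.le, Real.rpow_neg h1.le, inv_inv, mul_one]
  rw [e]
  refine Tendsto.mul ?_ ?_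
  · refine Tendsto.rpow_const (tendsto_one_div_add_atTop_nhds_zero_nat.add_const _) (Or.inl ?_)
    positivity
  · refine tendsto_const_nhds.congr' ?_
    obtain ⟨n, hn⟩ := exists_nat_ge r
    filter_upwards [eventually_ge_atTop n] with k hk
    have : (n : ℝ) ≤ k := by exact_mod_cast hk
    have h2 := hR k
    rw [cutFn_eq_one]
    rw [div_le_one (by linarith [(Nat.cast_nonneg k : (0 : ℝ) ≤ k)])]
    linarith

/-- The approximations are removed by Fatou: with `ε = 1/(n+1)` and `R` chosen afterwards, the
cut-off moments are bounded uniformly in `n` and their integrands converge pointwise. -/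
lemma moment_bound (hT : 0 < T) (hw : IsWeakSolution T σ u₀ F₀ u F) {A : ℝ} (hA0 : 0 ≤ A)
    (hA : ∀ᵐ z ∂((volume.restrict (Icc 0 T)).prod (torusVol d)), ‖u z.1 z.2‖ ≤ A)
    (hF₀ : Integrable (fun z : Torus d × E d => F₀ z.1 z.2) ((torusVol d).prod volume))
    {a : ℝ} (ha : 0 ≤ a)
    (hF₀a : Integrable (fun z : Torus d × E d => (1 + ‖z.2‖ ^ 2) ^ a * ‖F₀ z.1 z.2‖)
      ((torusVol d).prod volume)) :
    ∃ M : ℝ, 0 ≤ M ∧ ∀ᵐ t ∂(volume.restrict (Icc 0 T)),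
      ∫⁻ z : Torus d × E d, ENNReal.ofReal ((1 + ‖z.2‖ ^ 2) ^ a) * ‖F t z.1 z.2‖ₑ
        ∂((torusVol d).prod volume) ≤ ENNReal.ofReal M := by
  obtain ⟨K, -, hK⟩ := exists_cutFn_bound
  obtain ⟨M₂, hM₂, hE⟩ := hw.exists_energy_bound
  set K₀ := ∫ z : Torus d × E d, (1 + ‖z.2‖ ^ 2) ^ a * ‖F₀ z.1 z.2‖ ∂((torusVol d).prod volume)
  have hK₀ : 0 ≤ K₀ := integral_nonneg fun z => by positivity
  set D : ℕ → ℝ := fun n => T * ((1 / ((n : ℝ) + 1)) ^ (-a) * K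
    * (2 * A + 2 + σ ^ 2 / 2 * (4 * (2 * a + 1) + 2 * d)) * M₂)
  -- `R n ≥ D n` keeps the cut-off error at most `1` despite the growth of `ε^{-a}`; `R n ≥ n + 1`
  -- makes the cut-off tend to `1`.
  set R : ℕ → ℝ := fun n => max ((n : ℝ) + 1) (D n)
  have hR1 : ∀ n, 1 ≤ R n := fun n =>
    le_trans (by linarith [(Nat.cast_nonneg n : (0 : ℝ) ≤ n)]) (le_max_left _ _)
  have hDR : ∀ n, D n / R n ≤ 1 := fun n => by
    rw [div_le_one (by linarith [hR1 n])]; exact le_max_right _ _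
  refine ⟨Real.exp ((2 * A * a + σ ^ 2 / 2 * (4 * (a * (a + 3)) + 2 * d * a)) * T) * (K₀ + 1),
    by positivity, ?_⟩
  have h := fun n : ℕ => moment_cut_bound hT hw hA0 hA hF₀ (ε := 1 / ((n : ℝ) + 1)) (R := R n)
    (by positivity) ha (hR1 n) hF₀a hK hM₂ hE
  filter_upwards [ae_all_iff.2 h, Measure.ae_ae_of_ae_prod hw.F_nonneg] with t ht hF
  calc ∫⁻ z : Torus d × E d, ENNReal.ofReal ((1 + ‖z.2‖ ^ 2) ^ a) * ‖F t z.1 z.2‖ₑ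
        ∂((torusVol d).prod volume)
      = ∫⁻ z : Torus d × E d, liminf (fun n : ℕ => ENNReal.ofReal
          (cutProf (1 / ((n : ℝ) + 1)) a (R n) (‖z.2‖ ^ 2) * F t z.1 z.2)) atTop
        ∂((torusVol d).prod volume) := by
        refine lintegral_congr_ae ?_
        filter_upwards [hF] with z hz
        have h1 := ((tendsto_cutProf (a := a) (sq_nonneg ‖z.2‖)
          (fun n => le_max_left ((n : ℝ) + 1) (D n))).mul_const (F t z.1 z.2))
        rw [(ENNReal.tendsto_ofReal h1).liminf_eq, ENNReal.ofReal_mul (by positivity),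
          Real.enorm_eq_ofReal hz]
    _ ≤ liminf (fun n : ℕ => ∫⁻ z : Torus d × E d, ENNReal.ofReal
          (cutProf (1 / ((n : ℝ) + 1)) a (R n) (‖z.2‖ ^ 2) * F t z.1 z.2)
          ∂((torusVol d).prod volume)) atTop :=
        lintegral_liminf_le' fun n => (ht n).1.aemeasurable.ennreal_ofReal
    _ ≤ _ := by
        refine liminf_le_of_frequently_le' (Frequently.of_forall fun n => ?_)
        rw [← ofReal_integral_eq_lintegral_ofReal (ht n).1]
        · refine ENNReal.ofReal_le_ofReal ((ht n).2.trans ?_)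
          have := hDR n
          gcongr
        · filter_upwards [hF] with z hz
          exact mul_nonneg (cutProf_bounds (by positivity) ha (sq_nonneg _)).1 hz

/-! ### The drag of the limit density in `L^p`. -/

/-- The drag `∫ (u - v) F dv` exerted by a density on the fluid. -/
def dragField (u : Torus d → E d) (F : Torus d → E d → ℝ) (x : Torus d) : E d :=
  ∫ v, F x v • (u x - v)

/-- Velocities are split at `⟨v⟩ = R`. Below, `F ≤ M` gives `R^{d+1}`; above, the moment of order
`m` gives `R^{1-m}` times that moment. -/
lemma enorm_integral_drag_le {f : E d → ℝ} {M A m : ℝ} (hM0 : 0 ≤ M) (hM : ∀ᵐ v, ‖f v‖ ≤ M)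
    (hA : 0 ≤ A) (hm : 1 ≤ m) {U : E d} (hU : ‖U‖ ≤ A) :
    ‖∫ v, f v • (U - v)‖ₑ ≤
      ENNReal.ofReal ((A + 1) * (M * (volume (Metric.closedBall (0 : E d) 1)).toReal + 1)) *
        (1 + ∫⁻ v, ENNReal.ofReal ((1 + ‖v‖ ^ 2) ^ (m / 2)) * ‖f v‖ₑ) ^ (((d : ℝ) + 1) / (d + m)) := by
  set K := ∫⁻ v, ENNReal.ofReal ((1 + ‖v‖ ^ 2) ^ (m / 2)) * ‖f v‖ₑ with hKdef
  have hd : (0 : ℝ) ≤ d := Nat.cast_nonneg d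
  have hdm : 0 < (d : ℝ) + m := by linarith
  set ω := volume (Metric.closedBall (0 : E d) 1) with hω
  have hωt : ω ≠ ∞ := (isCompact_closedBall _ _).measure_lt_top.ne
  by_cases hKt : K = ∞
  · rw [hKt]
    have : (0 : ℝ) < ((d : ℝ) + 1) / (d + m) := by positivity
    rw [add_top, ENNReal.top_rpow_of_pos this, ENNReal.mul_top]
    · exact le_top
    · simp only [ne_eq, ENNReal.ofReal_eq_zero, not_le]; positivity
  set κ := K.toReal with hκ
  have hκ0 : 0 ≤ κ := ENNReal.toReal_nonneg
  -- This radius balances the two contributions: `R^{d+m} = 1 + κ`, so both are at most of order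
  -- `R^{d+1}`.
  set R := (1 + κ) ^ (1 / ((d : ℝ) + m)) with hR
  have hR1 : 1 ≤ R := Real.one_le_rpow (by linarith) (by positivity)
  have hR0 : 0 < R := by linarith
  have hRp : R ^ ((d : ℝ) + m) = 1 + κ := by
    rw [hR, ← Real.rpow_mul (by linarith), one_div_mul_cancel hdm.ne', Real.rpow_one]
  have hRd : (1 + K) ^ (((d : ℝ) + 1) / (d + m)) = ENNReal.ofReal (R ^ ((d : ℝ) + 1)) := by
    have : 1 + K = ENNReal.ofReal (1 + κ) := by
      rw [ENNReal.ofReal_add zero_le_one hκ0, ENNReal.ofReal_one, ENNReal.ofReal_toReal hKt]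
    rw [this, ENNReal.ofReal_rpow_of_nonneg (by positivity) (by positivity), hR,
      ← Real.rpow_mul (by linarith)]
    congr 2
    field_simp
  have hpt : ∀ᵐ v, ‖f v • (U - v)‖ₑ ≤
      (Metric.closedBall (0 : E d) R).indicator (fun _ => ENNReal.ofReal ((A + 1) * (M * R))) v
      + ENNReal.ofReal ((A + 1) * R ^ (1 - m)) *
        (ENNReal.ofReal ((1 + ‖v‖ ^ 2) ^ (m / 2)) * ‖f v‖ₑ) := by
    filter_upwards [hM] with v hv
    set b := (1 + ‖v‖ ^ 2) ^ ((1 : ℝ) / 2) with hb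
    have hb1 : 1 ≤ b := Real.one_le_rpow (by nlinarith [sq_nonneg ‖v‖]) (by norm_num)
    have hvb : ‖v‖ ≤ b := by
      rw [hb, ← Real.sqrt_eq_rpow]
      exact Real.le_sqrt_of_sq_le (by linarith)
    have hUv : ‖U - v‖ ≤ (A + 1) * b := by
      refine (norm_sub_le _ _).trans ?_
      nlinarith
    have hbm : (1 + ‖v‖ ^ 2) ^ (m / 2) = b ^ m := by
      rw [hb, ← Real.rpow_mul (by positivity)]
      congr 1
      ring
    rw [hbm, enorm_smul]
    have hle : ‖f v‖ₑ * ‖U - v‖ₑ ≤ ENNReal.ofReal ((A + 1) * (b * ‖f v‖)) := by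
      rw [← ofReal_norm, ← ofReal_norm, ← ENNReal.ofReal_mul (norm_nonneg _)]
      refine ENNReal.ofReal_le_ofReal ?_
      nlinarith [mul_le_mul_of_nonneg_left hUv (norm_nonneg (f v))]
    refine hle.trans ?_
    by_cases hbR : b ≤ R
    · rw [indicator_of_mem (by simpa using hvb.trans hbR)]
      refine le_add_right (ENNReal.ofReal_le_ofReal ?_)
      have : b * ‖f v‖ ≤ R * M := mul_le_mul hbR hv (norm_nonneg _) hR0.le
      nlinarith
    · refine le_add_left ?_
      rw [← ofReal_norm, ← ENNReal.ofReal_mul (by positivity), ← ENNReal.ofReal_mul (by positivity)]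
      refine ENNReal.ofReal_le_ofReal ?_
      have h1 : b ≤ R ^ (1 - m) * b ^ m := by
        have h2 : b = b ^ (1 - m) * b ^ m := by
          rw [← Real.rpow_add (by linarith)]; simp
        have h3 : b ^ (1 - m) ≤ R ^ (1 - m) :=
          Real.rpow_le_rpow_of_nonpos hR0 (not_le.1 hbR).le (by linarith)
        calc b = b ^ (1 - m) * b ^ m := h2
          _ ≤ _ := mul_le_mul_of_nonneg_right h3 (by positivity)
      have h4 := mul_le_mul_of_nonneg_right h1 (norm_nonneg (f v))
      have h5 := mul_le_mul_of_nonneg_left h4 (show 0 ≤ A + 1 by linarith)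
      linarith
  calc ‖∫ v, f v • (U - v)‖ₑ ≤ ∫⁻ v, ‖f v • (U - v)‖ₑ := enorm_integral_le_lintegral_enorm _
    _ ≤ ∫⁻ v, ((Metric.closedBall (0 : E d) R).indicator
          (fun _ => ENNReal.ofReal ((A + 1) * (M * R))) v
        + ENNReal.ofReal ((A + 1) * R ^ (1 - m)) *
          (ENNReal.ofReal ((1 + ‖v‖ ^ 2) ^ (m / 2)) * ‖f v‖ₑ)) := lintegral_mono_ae hpt
    _ = ENNReal.ofReal ((A + 1) * (M * R)) * volume (Metric.closedBall (0 : E d) R)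
        + ENNReal.ofReal ((A + 1) * R ^ (1 - m)) * K := by
        rw [lintegral_add_left ((measurable_const).indicator Metric.isClosed_closedBall.measurableSet),
          lintegral_indicator_const Metric.isClosed_closedBall.measurableSet,
          lintegral_const_mul' _ _ ENNReal.ofReal_ne_top]
    _ = ENNReal.ofReal ((A + 1) * (M * R) * (R ^ d * ω.toReal) + (A + 1) * R ^ (1 - m) * κ) := by
        rw [Measure.addHaar_closedBall' _ _ hR0.le, finrank_euclideanSpace_fin, ← hω,
          ENNReal.ofReal_add (by positivity) (by positivity),
          ENNReal.ofReal_mul (p := (A + 1) * (M * R)) (by positivity),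
          ENNReal.ofReal_mul (p := R ^ d) (by positivity), ENNReal.ofReal_toReal hωt,
          ENNReal.ofReal_mul (p := (A + 1) * R ^ (1 - m)) (by positivity),
          ENNReal.ofReal_toReal hKt]
    _ ≤ ENNReal.ofReal ((A + 1) * (M * ω.toReal + 1) * R ^ ((d : ℝ) + 1)) := by
        refine ENNReal.ofReal_le_ofReal ?_
        have e1 : R ^ ((d : ℝ) + 1) = R * R ^ d := by
          rw [Real.rpow_add_one hR0.ne', Real.rpow_natCast, mul_comm]
        have e2 : R ^ (1 - m) * κ ≤ R ^ ((d : ℝ) + 1) := by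
          calc R ^ (1 - m) * κ ≤ R ^ (1 - m) * (1 + κ) := by gcongr; linarith
            _ = R ^ ((d : ℝ) + 1) := by
              rw [← hRp, ← Real.rpow_add hR0]; congr 1; ring
        have e3 := mul_le_mul_of_nonneg_left e2 (show 0 ≤ A + 1 by linarith)
        have e4 : (A + 1) * (M * R) * (R ^ d * ω.toReal)
            = (A + 1) * (M * ω.toReal) * R ^ ((d : ℝ) + 1) := by rw [e1]; ring
        rw [e4]
        linarith
    _ = _ := by rw [hRd, ENNReal.ofReal_mul (by positivity)]

lemma integrable_drag (hw : IsWeakSolution T σ u₀ F₀ u F) {A : ℝ}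
    (hA : ∀ᵐ z ∂((volume.restrict (Icc 0 T)).prod (torusVol d)), ‖u z.1 z.2‖ ≤ A) :
    Integrable (fun z : ℝ × Torus d × E d => F z.1 z.2.1 z.2.2 • (u z.1 z.2.1 - z.2.2))
      ((volume.restrict (Icc 0 T)).prod ((torusVol d).prod volume)) := by
  have hum : AEStronglyMeasurable (fun z : ℝ × Torus d × E d => u z.1 z.2.1)
      ((volume.restrict (Icc 0 T)).prod ((torusVol d).prod volume)) :=
    hw.meas_u.comp_quasiMeasurePreserving quasiMeasurePreserving_time_space
  have huA := quasiMeasurePreserving_time_space.ae hA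
  refine Integrable.mono' ((hw.integrable_F.norm.const_mul (|A| + 1)).add
    hw.integrable_energy.norm) ?_ ?_
  · exact hw.meas_F.smul (hum.sub
      (by fun_prop : Measurable fun z : ℝ × Torus d × E d => z.2.2).aestronglyMeasurable)
  · filter_upwards [huA] with z hz
    simp only [Pi.add_apply, norm_smul, norm_mul, norm_pow, norm_norm]
    have h1 : ‖u z.1 z.2.1 - z.2.2‖ ≤ |A| + 1 + ‖z.2.2‖ ^ 2 := by
      refine (norm_sub_le _ _).trans ?_
      nlinarith [sq_nonneg (‖z.2.2‖ - 1), le_abs_self A, norm_nonneg z.2.2]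
    have := mul_le_mul_of_nonneg_left h1 (norm_nonneg (F z.1 z.2.1 z.2.2))
    linarith

lemma integrable_moment_init {p γ : ℝ} {k : ℕ} (hpd : (d : ℝ) < p) (hp1 : 1 ≤ p)
    (h : PDEAssumptions T p γ k u₀ F₀ u) :
    Integrable (fun z : Torus d × E d =>
      (1 + ‖z.2‖ ^ 2) ^ ((p + d * (p - 1)) / 2) * ‖F₀ z.1 z.2‖) ((torusVol d).prod volume) := by
  set m := p + d * (p - 1) with hm
  have hd : (0 : ℝ) ≤ d := Nat.cast_nonneg d
  have hm0 : 0 ≤ m := by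
    have : 0 ≤ d * (p - 1) := mul_nonneg hd (by linarith)
    linarith
  have hFi : Integrable (fun z : Torus d × E d => F₀ z.1 z.2) ((torusVol d).prod volume) :=
    memLp_one_iff_integrable.1 h.F_integrable
  have hFm := hFi.1
  have hmom : Integrable (fun z : Torus d × E d => ‖z.2‖ ^ m * ‖F₀ z.1 z.2‖)
      ((torusVol d).prod volume) := by
    have hmeas : AEStronglyMeasurable (fun z : Torus d × E d => ‖z.2‖ ^ m * ‖F₀ z.1 z.2‖)
        ((torusVol d).prod volume) :=
      (by fun_prop : Measurable fun z : Torus d × E d => ‖z.2‖ ^ m).aestronglyMeasurable.mul hFm.norm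
    refine ⟨hmeas, ?_⟩
    rw [hasFiniteIntegral_iff_enorm, lintegral_prod _ hmeas.enorm]
    refine lt_of_le_of_lt (lintegral_mono fun x => lintegral_mono fun v => ?_) h.F_moment
    simp only
    rw [enorm_mul, enorm_norm, Real.enorm_eq_ofReal (by positivity), ← ofReal_norm v,
      ENNReal.ofReal_rpow_of_nonneg (norm_nonneg _) hm0]
  refine Integrable.mono' ((hFi.norm.add hmom).const_mul (2 ^ (m / 2))) ?_ ?_
  · exact (by fun_prop : Measurable fun z : Torus d × E d =>
      (1 + ‖z.2‖ ^ 2) ^ (m / 2)).aestronglyMeasurable.mul hFm.norm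
  · refine ae_of_all _ fun z => ?_
    have h1 : (1 + ‖z.2‖ ^ 2) ^ (m / 2) ≤ 2 ^ (m / 2) * (1 + ‖z.2‖ ^ m) := by
      have hv : ‖z.2‖ ^ m = (‖z.2‖ ^ 2) ^ (m / 2) := by
        rw [← Real.rpow_natCast, ← Real.rpow_mul (norm_nonneg _)]
        congr 1
        push_cast
        ring
      rw [hv]
      set r := ‖z.2‖ ^ 2
      have hr : 0 ≤ r := sq_nonneg _
      have h2 : 1 + r ≤ 2 * max 1 r := by
        have := le_max_left 1 r
        have := le_max_right 1 r
        linarith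
      have hmx : (0 : ℝ) ≤ max 1 r := le_max_of_le_left zero_le_one
      calc (1 + r) ^ (m / 2) ≤ (2 * max 1 r) ^ (m / 2) :=
            Real.rpow_le_rpow (by positivity) h2 (by positivity)
        _ = 2 ^ (m / 2) * (max 1 r) ^ (m / 2) := Real.mul_rpow (by norm_num) hmx
        _ ≤ 2 ^ (m / 2) * (1 + r ^ (m / 2)) := by
          refine mul_le_mul_of_nonneg_left ?_ (by positivity)
          rcases le_total 1 r with hr1 | hr1
          · rw [max_eq_right hr1]; linarith
          · rw [max_eq_left hr1, Real.one_rpow]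
            linarith [Real.rpow_nonneg hr (m / 2)]
    simp only [Pi.add_apply]
    rw [norm_mul, norm_norm, Real.norm_of_nonneg (by positivity)]
    have := mul_le_mul_of_nonneg_right h1 (norm_nonneg (F₀ z.1 z.2))
    linarith

/-- With `m = p + d(p-1)` one has `d + m = (d+1)p`, so the `p`-th power of the pointwise drag bound
is linear in the moment density and can be integrated in `x`. This is where the order of the initial
moment comes from. -/
lemma exists_drag_bound {p γ A : ℝ} {k : ℕ} (hT : 0 < T) (hpd : (d : ℝ) < p) (hp1 : 1 ≤ p)
    (hw : IsWeakSolution T σ u₀ F₀ u F) (h : PDEAssumptions T p γ k u₀ F₀ u) (hA0 : 0 ≤ A)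
    (hA : ∀ᵐ z ∂((volume.restrict (Icc 0 T)).prod (torusVol d)), ‖u z.1 z.2‖ ≤ A) :
    ∃ C : ℝ, 0 < C ∧ ∀ᵐ t ∂(volume.restrict (Icc 0 T)),
      AEStronglyMeasurable (dragField (u t) (F t)) (torusVol d) ∧
      eLpNorm (dragField (u t) (F t)) (ENNReal.ofReal p) (torusVol d) ≤ ENNReal.ofReal C := by
  set m := p + d * (p - 1) with hm
  have hd : (0 : ℝ) ≤ d := Nat.cast_nonneg d
  have hm1 : 1 ≤ m := by
    have : 0 ≤ d * (p - 1) := mul_nonneg hd (by linarith)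
    linarith
  have hp0 : 0 < p := by linarith
  obtain ⟨B, hB0, hB⟩ := moment_bound hT hw hA0 hA (memLp_one_iff_integrable.1 h.F_integrable)
    (a := m / 2) (by positivity) (integrable_moment_init hpd hp1 h)
  obtain ⟨M, hM⟩ := hw.F_bounded
  set C₁ := (A + 1) * (M * (volume (Metric.closedBall (0 : E d) 1)).toReal + 1) with hC₁
  have hC₁0 : 0 < C₁ := by positivity
  refine ⟨C₁ * (1 + B) ^ (1 / p), by positivity, ?_⟩
  have hFs : ∀ᵐ t ∂(volume.restrict (Icc 0 T)), AEStronglyMeasurable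
      (fun z : Torus d × E d => F t z.1 z.2) ((torusVol d).prod volume) :=
    hw.integrable_F.prod_right_ae.mono fun t ht => ht.1
  filter_upwards [hB, hM, (integrable_drag hw hA).prod_right_ae, hFs,
    Measure.ae_ae_of_ae_prod hA] with t h1 h2 h3 h4 h5
  refine ⟨h3.integral_prod_left.1, ?_⟩
  have hMz : ∀ᵐ z ∂((torusVol d).prod (volume : Measure (E d))), ‖F t z.1 z.2‖ ≤ M := by
    rw [eLpNorm_exponent_top] at h2
    filter_upwards [ae_le_eLpNormEssSup (f := fun z : Torus d × E d => F t z.1 z.2)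
      (μ := (torusVol d).prod volume)] with z hz
    have := hz.trans h2
    rwa [enorm_le_coe] at this
  have hpt : ∀ᵐ x ∂(torusVol d), ‖dragField (u t) (F t) x‖ₑ ^ p ≤
      ENNReal.ofReal C₁ ^ p *
        (1 + ∫⁻ v, ENNReal.ofReal ((1 + ‖v‖ ^ 2) ^ (m / 2)) * ‖F t x v‖ₑ) := by
    filter_upwards [Measure.ae_ae_of_ae_prod hMz, h5] with x hx hux
    have := enorm_integral_drag_le (f := F t x) M.2 hx hA0 hm1 hux
    calc ‖dragField (u t) (F t) x‖ₑ ^ p ≤ _ := ENNReal.rpow_le_rpow this hp0.le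
      _ = _ := by
        rw [ENNReal.mul_rpow_of_nonneg _ _ hp0.le, ← ENNReal.rpow_mul]
        have e : ((d : ℝ) + 1) / (d + m) * p = 1 := by
          rw [hm]
          have : (d : ℝ) + (p + d * (p - 1)) = (d + 1) * p := by ring
          rw [this]
          field_simp
        rw [e, ENNReal.rpow_one]
        rfl
  have hmeas : AEMeasurable (fun z : Torus d × E d =>
      ENNReal.ofReal ((1 + ‖z.2‖ ^ 2) ^ (m / 2)) * ‖F t z.1 z.2‖ₑ) ((torusVol d).prod volume) :=
    (by fun_prop : Measurable fun z : Torus d × E d =>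
      ENNReal.ofReal ((1 + ‖z.2‖ ^ 2) ^ (m / 2))).aemeasurable.mul h4.enorm
  rw [lintegral_prod _ hmeas] at h1
  rw [eLpNorm_eq_lintegral_rpow_enorm_toReal (by simpa using hp0) ENNReal.ofReal_ne_top,
    ENNReal.toReal_ofReal hp0.le]
  calc (∫⁻ x, ‖dragField (u t) (F t) x‖ₑ ^ p ∂(torusVol d)) ^ (1 / p)
      ≤ (ENNReal.ofReal C₁ ^ p * (1 + ENNReal.ofReal B)) ^ (1 / p) := by
        refine ENNReal.rpow_le_rpow ((lintegral_mono_ae hpt).trans ?_) (by positivity)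
        rw [lintegral_const_mul' _ _ (ENNReal.rpow_ne_top_of_nonneg hp0.le ENNReal.ofReal_ne_top),
          lintegral_add_left measurable_const]
        gcongr
        simp
    _ = ENNReal.ofReal (C₁ * (1 + B) ^ (1 / p)) := by
        rw [ENNReal.mul_rpow_of_nonneg _ _ (by positivity), ← ENNReal.rpow_mul,
          mul_one_div_cancel hp0.ne', ENNReal.rpow_one, ENNReal.ofReal_mul hC₁0.le,
          ← ENNReal.ofReal_rpow_of_nonneg (by positivity) (by positivity),
          ENNReal.ofReal_add zero_le_one hB0, ENNReal.ofReal_one]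

end Drag

/-! ### Plane wave test fields -/

/-- The real plane wave `Re (ζ e^{i⟨ω, y⟩})`. -/
def wave (ζ : ℂ) (ω y : E d) : ℝ := (ζ * Complex.exp ((inner ℝ ω y : ℝ) * Complex.I)).re

lemma hasFDerivAt_wave (ζ : ℂ) (ω y : E d) :
    HasFDerivAt (wave ζ ω) (wave (ζ * Complex.I) ω y • innerSL ℝ ω) y := by
  have h1 : HasFDerivAt (fun y : E d => (inner ℝ ω y : ℝ)) (innerSL ℝ ω) y :=
    (innerSL ℝ ω).hasFDerivAt
  have h2 : HasDerivAt (fun t : ℝ => (ζ * Complex.exp ((t : ℂ) * Complex.I)).re)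
      ((ζ * (Complex.exp ((inner ℝ ω y : ℝ) * Complex.I) * (1 * Complex.I))).re) (inner ℝ ω y) := by
    have h3 : HasDerivAt (fun z : ℂ => ζ * Complex.exp (z * Complex.I))
        (ζ * (Complex.exp ((inner ℝ ω y : ℝ) * Complex.I) * (1 * Complex.I)))
        ((inner ℝ ω y : ℝ) : ℂ) :=
      (((hasDerivAt_id _).mul_const Complex.I).cexp).const_mul ζ
    exact h3.real_of_complex
  have h4 := h2.comp_hasFDerivAt y h1
  refine h4.congr_fderiv ?_
  congr 1
  unfold wave
  congr 1
  ring

lemma contDiff_wave (ζ : ℂ) (ω : E d) : ContDiff ℝ ((⊤ : ℕ∞) : WithTop ℕ∞) (wave ζ ω) := by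
  unfold wave
  have h1 : ContDiff ℝ ((⊤ : ℕ∞) : WithTop ℕ∞) fun y : E d => ((inner ℝ ω y : ℝ) : ℂ) :=
    Complex.ofRealCLM.contDiff.comp (innerSL ℝ ω).contDiff
  exact Complex.reCLM.contDiff.comp (contDiff_const.mul (h1.mul contDiff_const).cexp)

lemma laplacian_wave_smul (ζ : ℂ) (ω a y : E d) (c : ℝ) :
    Laplacian.laplacian (fun y : E d => (c * wave ζ ω y) • a) y
      = -(‖ω‖ ^ 2 * (c * wave ζ ω y)) • a := by
  have h1 : ∀ ζ : ℂ, ∀ y, HasFDerivAt (fun y : E d => (c * wave ζ ω y) • a)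
      ((c * wave (ζ * Complex.I) ω y) • (innerSL ℝ ω).smulRight a) y := fun ζ y => by
    refine (((hasFDerivAt_wave ζ ω y).const_mul c).smul_const a).congr_fderiv ?_
    ext z
    simp [smul_smul, mul_assoc]
  have h2 : fderiv ℝ (fun y : E d => (c * wave ζ ω y) • a)
      = fun y => (c * wave (ζ * Complex.I) ω y) • (innerSL ℝ ω).smulRight a :=
    funext fun y => (h1 ζ y).fderiv
  have h3 := ((hasFDerivAt_wave (ζ * Complex.I) ω y).const_mul c).smul_const
    ((innerSL ℝ ω).smulRight a)
  have h4 := congrFun (InnerProductSpace.laplacian_eq_iteratedFDeriv_orthonormalBasis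
    (fun y : E d => (c * wave ζ ω y) • a) (EuclideanSpace.basisFun (Fin d) ℝ)) y
  refine h4.trans ?_
  have h5 : wave (ζ * Complex.I * Complex.I) ω y = -wave ζ ω y := by
    unfold wave
    rw [mul_assoc ζ, Complex.I_mul_I]
    simp
  simp only [iteratedFDeriv_two_apply, h2, h3.fderiv, h5]
  simp only [Matrix.cons_val_zero, Matrix.cons_val_one, smul_apply,
    ContinuousLinearMap.smulRight_apply, innerSL_apply_apply, smul_eq_mul,
    EuclideanSpace.basisFun_apply, EuclideanSpace.inner_single_right, EuclideanSpace.norm_sq_eq,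
    conj_trivial, one_mul, Real.norm_eq_abs, sq_abs, smul_smul]
  rw [← Finset.sum_smul]
  congr 1
  rw [Finset.sum_mul, ← Finset.sum_neg_distrib]
  exact Finset.sum_congr rfl fun i _ => by ring

lemma proj_rep (x : Torus d) : proj (rep x) = x := by
  funext j
  exact AddCircle.coe_equivIco

lemma wave_freq (ζ : ℂ) (k : Fin d → ℤ) (y : E d) :
    wave ζ (-(2 * Real.pi) • freqVec k) y = (ζ * mFourier (-k) (proj y)).re := by
  unfold wave
  rw [mFourier_proj]
  congr 3
  have h1 : inner ℝ (freqVec k) y = ∑ j, (k j : ℝ) * y j := by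
    rw [PiLp.inner_apply]
    exact Finset.sum_congr rfl fun j _ => by simp [freqVec, mul_comm]
  rw [inner_smul_left, h1]
  simp only [conj_trivial, Pi.neg_apply]
  push_cast
  simp only [neg_mul, Finset.sum_neg_distrib]
  ring

/-- A plane wave is divergence-free when its amplitude is orthogonal to its frequency. -/
lemma isFluidTest_wave {T : ℝ} {κ : ℝ → ℝ} (hκ : ContDiff ℝ ((⊤ : ℕ∞) : WithTop ℕ∞) κ)
    (hT : κ T = 0) (ζ : ℂ) {k : Fin d → ℤ} {a : E d} (ha : inner ℝ (freqVec k) a = 0) :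
    IsFluidTest T fun s x => (κ s * (ζ * mFourier (-k) x).re) • a := by
  refine ⟨?_, fun s y => ?_, fun x => by simp [hT]⟩
  · simp only [← wave_freq]
    exact ((hκ.comp contDiff_fst).mul ((contDiff_wave _ _).comp contDiff_snd)).smul contDiff_const
  · simp only [← wave_freq]
    have h1 : HasFDerivAt (fun y : E d => (κ s * wave ζ (-(2 * Real.pi) • freqVec k) y) • a) _ y :=
      ((hasFDerivAt_wave ζ (-(2 * Real.pi) • freqVec k) y).const_mul (κ s)).smul_const a
    rw [h1.fderiv]
    simp only [ContinuousLinearMap.smulRight_apply, smul_apply, innerSL_apply_apply, smul_eq_mul,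
      PiLp.smul_apply, inner_smul_left, EuclideanSpace.inner_single_right, conj_trivial, one_mul]
    have h2 : ∑ j, (k j : ℝ) * a j = 0 := by
      rw [← ha, PiLp.inner_apply]
      exact Finset.sum_congr rfl fun j _ => by simp [freqVec, mul_comm]
    calc _ = ∑ j, (κ s * (wave (ζ * Complex.I) (-(2 * Real.pi) • freqVec k) y * -(2 * Real.pi)))
          * ((k j : ℝ) * a j) := Finset.sum_congr rfl fun j _ => by simp [freqVec]; ring
      _ = 0 := by rw [← Finset.mul_sum, h2, mul_zero]

lemma fluidDual_wave {u : ℝ → Torus d → E d} {κ : ℝ → ℝ} (hκ : Differentiable ℝ κ) (ζ : ℂ)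
    (k : Fin d → ℤ) (a : E d) (s : ℝ) (x : Torus d) :
    fluidDual u (fun s x => (κ s * (ζ * mFourier (-k) x).re) • a) s x
      = (ζ * (deriv κ s * (mFourier (-k) x * (inner ℝ a (u s x) : ℝ))
        - κ s * (lam k * (mFourier (-k) x * (inner ℝ a (u s x) : ℝ))
          + mFourier (-k) x * (2 * Real.pi * Complex.I *
            ((inner ℝ (freqVec k) (u s x) * inner ℝ a (u s x) : ℝ) : ℂ))))).re := by
  have h1 : deriv (fun r => (κ r * (ζ * mFourier (-k) x).re) • a) s
      = (deriv κ s * (ζ * mFourier (-k) x).re) • a :=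
    (((hκ s).hasDerivAt.mul_const _).smul_const a).deriv
  have h2 : HasFDerivAt (fun y : E d => (κ s * wave ζ (-(2 * Real.pi) • freqVec k) y) • a) _ (rep x) :=
    ((hasFDerivAt_wave ζ (-(2 * Real.pi) • freqVec k) (rep x)).const_mul (κ s)).smul_const a
  have h3 := laplacian_wave_smul ζ (-(2 * Real.pi) • freqVec k) a (rep x) (κ s)
  have hn : ‖-(2 * Real.pi) • freqVec k‖ ^ 2 = lam k := by
    rw [norm_smul, mul_pow, norm_freqVec_sq, lam, Real.norm_eq_abs, sq_abs]
    ring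
  rw [hn] at h3
  unfold fluidDual
  simp only [h1]
  simp only [← wave_freq]
  rw [h2.fderiv, h3]
  simp only [ContinuousLinearMap.smulRight_apply, smul_apply, innerSL_apply_apply, smul_eq_mul,
    inner_smul_left, inner_smul_right, wave_freq, proj_rep, conj_trivial]
  rw [real_inner_comm (u s x) a]
  set e := mFourier (-k) x
  set p := inner ℝ (u s x) a
  set r := inner ℝ (freqVec k) (u s x)
  have e1 : ζ * (deriv κ s * (e * (p : ℂ)) - κ s * (lam k * (e * (p : ℂ)) + e * (2 * Real.pi *
      Complex.I * ((r * p : ℝ) : ℂ))))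
      = ((deriv κ s * p - κ s * (lam k * p) : ℝ) : ℂ) * (ζ * e)
        - ((κ s * (2 * Real.pi) * (r * p) : ℝ) : ℂ) * (ζ * Complex.I * e) := by
    push_cast
    ring
  rw [e1, Complex.sub_re, Complex.re_ofReal_mul, Complex.re_ofReal_mul]
  ring

/-! ### The fluid equation for the Fourier coefficients -/

section FluidODE

variable {T σ : ℝ} {u₀ : Torus d → E d} {F₀ : Torus d → E d → ℝ} {u : ℝ → Torus d → E d}
  {F : ℝ → Torus d → E d → ℝ}

lemma integral_re_mul {X : Type*} [MeasurableSpace X] {ν : Measure X} {f : X → ℂ}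
    (hf : Integrable f ν) (ζ : ℂ) : ∫ x, (ζ * f x).re ∂ν = (ζ * ∫ x, f x ∂ν).re := by
  rw [← integral_const_mul]
  exact Complex.reCLM.integral_comp_comm (hf.const_mul ζ)

lemma Integrable.mFourier_mul {g : Torus d → ℂ} (hg : Integrable g (torusVol d)) (k : Fin d → ℤ) :
    Integrable (fun x => mFourier k x * g x) (torusVol d) :=
  hg.bdd_mul (c := 1) (mFourier k).continuous.aestronglyMeasurable
    (ae_of_all _ fun x => (norm_mFourier_apply k x).le)

lemma Integrable.mFourier_mul_prod {g : ℝ → Torus d → ℂ}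
    (hg : Integrable (fun z : ℝ × Torus d => g z.1 z.2)
      ((volume.restrict (Icc 0 T)).prod (torusVol d))) (k : Fin d → ℤ) :
    Integrable (fun z : ℝ × Torus d => mFourier k z.2 * g z.1 z.2)
      ((volume.restrict (Icc 0 T)).prod (torusVol d)) :=
  hg.bdd_mul (c := 1) ((mFourier k).continuous.comp continuous_snd).aestronglyMeasurable
    (ae_of_all _ fun z => (norm_mFourier_apply k z.2).le)

lemma integrableOn_mFourierCoeff {g : ℝ → Torus d → ℂ}
    (hg : Integrable (fun z : ℝ × Torus d => g z.1 z.2)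
      ((volume.restrict (Icc 0 T)).prod (torusVol d))) (k : Fin d → ℤ) :
    IntegrableOn (fun s => mFourierCoeff (g s) k) (Icc 0 T) :=
  (Integrable.mFourier_mul_prod hg (-k)).integral_prod_left

lemma integrable_dragField (hw : IsWeakSolution T σ u₀ F₀ u F) {A : ℝ}
    (hA : ∀ᵐ z ∂((volume.restrict (Icc 0 T)).prod (torusVol d)), ‖u z.1 z.2‖ ≤ A) :
    Integrable (fun z : ℝ × Torus d => dragField (u z.1) (F z.1) z.2)
      ((volume.restrict (Icc 0 T)).prod (torusVol d)) := by
  have h := integrable_drag hw hA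
  have h2 := (measurePreserving_prodAssoc (volume.restrict (Icc 0 T)) (torusVol d)
    (volume : Measure (E d))).integrable_comp_of_integrable h
  exact h2.integral_prod_left

lemma integrable_of_bounded_velocity {u : ℝ → Torus d → E d} {A : ℝ}
    (hu : AEStronglyMeasurable (fun z : ℝ × Torus d => u z.1 z.2)
      ((volume.restrict (Icc 0 T)).prod (torusVol d)))
    (hA : ∀ᵐ z ∂((volume.restrict (Icc 0 T)).prod (torusVol d)), ‖u z.1 z.2‖ ≤ A)
    {q : E d → ℝ} (hq : Continuous q) {K : ℝ} (hK : ∀ v, ‖v‖ ≤ A → |q v| ≤ K) :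
    Integrable (fun z : ℝ × Torus d => ((q (u z.1 z.2) : ℝ) : ℂ))
      ((volume.restrict (Icc 0 T)).prod (torusVol d)) := by
  refine Integrable.of_bound (C := K)
    ((Complex.continuous_ofReal.comp hq).comp_aestronglyMeasurable hu) ?_
  filter_upwards [hA] with z hz
  rw [Complex.norm_real]
  exact hK _ hz

/-- One Fourier mode of the fluid equation, seen through an amplitude `a ⟂ k` so that the pressure
is invisible. The Laplacian becomes the integrating factor `e^{lam k t}`, and moving the derivative
of the convection term onto the wave gives the factor `2πi (k·u)(a·u)`. -/
lemma fluid_ode (hT : 0 < T) (hw : IsWeakSolution T σ u₀ F₀ u F) {A : ℝ} (hA0 : 0 ≤ A)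
    (hA : ∀ᵐ z ∂((volume.restrict (Icc 0 T)).prod (torusVol d)), ‖u z.1 z.2‖ ≤ A)
    (hu₀ : Integrable u₀ (torusVol d)) {k : Fin d → ℤ} {a : E d}
    (ha : inner ℝ (freqVec k) a = 0) :
    ∀ᵐ t ∂(volume.restrict (Icc 0 T)),
      Real.exp (lam k * t) • mFourierCoeff (fun x => ((inner ℝ a (u t x) : ℝ) : ℂ)) k
      = mFourierCoeff (fun x => ((inner ℝ a (u₀ x) : ℝ) : ℂ)) k
        + ∫ s in (0 : ℝ)..t, Real.exp (lam k * s) •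
          -(2 * Real.pi * Complex.I * mFourierCoeff (fun x =>
              ((inner ℝ (freqVec k) (u s x) * inner ℝ a (u s x) : ℝ) : ℂ)) k
            + mFourierCoeff (fun x => ((inner ℝ a (dragField (u s) (F s) x) : ℝ) : ℂ)) k) := by
  set ν := (volume.restrict (Icc 0 T)).prod (torusVol d) with hν
  have hY : Integrable (fun z : ℝ × Torus d => ((inner ℝ a (u z.1 z.2) : ℝ) : ℂ)) ν :=
    integrable_of_bounded_velocity (q := fun v => inner ℝ a v) (K := ‖a‖ * A) hw.meas_u hA
      (by fun_prop) fun v hv => (abs_real_inner_le_norm _ _).trans (by gcongr)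
  have hN : Integrable (fun z : ℝ × Torus d =>
      ((inner ℝ (freqVec k) (u z.1 z.2) * inner ℝ a (u z.1 z.2) : ℝ) : ℂ)) ν :=
    integrable_of_bounded_velocity (q := fun v => inner ℝ (freqVec k) v * inner ℝ a v)
      (K := (‖freqVec k‖ * A) * (‖a‖ * A)) hw.meas_u hA (by fun_prop) fun v hv => by
      rw [abs_mul]
      refine mul_le_mul ((abs_real_inner_le_norm _ _).trans (by gcongr))
        ((abs_real_inner_le_norm _ _).trans (by gcongr)) (abs_nonneg _) (by positivity)
  have hdr := integrable_drag hw hA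
  have hD0 := integrable_dragField hw hA
  have hD : Integrable (fun z : ℝ × Torus d =>
      ((inner ℝ a (dragField (u z.1) (F z.1) z.2) : ℝ) : ℂ)) ν := (hD0.const_inner a).ofReal
  have iY := integrableOn_mFourierCoeff (g := fun s x => ((inner ℝ a (u s x) : ℝ) : ℂ)) hY k
  have iN := integrableOn_mFourierCoeff (g := fun s x =>
    ((inner ℝ (freqVec k) (u s x) * inner ℝ a (u s x) : ℝ) : ℂ)) hN k
  have iD := integrableOn_mFourierCoeff (g := fun s x =>
    ((inner ℝ a (dragField (u s) (F s) x) : ℝ) : ℂ)) hD k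
  set Y : ℝ → ℂ := fun s => mFourierCoeff (fun x => ((inner ℝ a (u s x) : ℝ) : ℂ)) k with hYdef
  set N : ℝ → ℂ := fun s => mFourierCoeff (fun x =>
    ((inner ℝ (freqVec k) (u s x) * inner ℝ a (u s x) : ℝ) : ℂ)) k with hNdef
  set D : ℝ → ℂ := fun s => mFourierCoeff (fun x =>
    ((inner ℝ a (dragField (u s) (F s) x) : ℝ) : ℂ)) k with hDdef
  set Y₀ := mFourierCoeff (fun x => ((inner ℝ a (u₀ x) : ℝ) : ℂ)) k with hY₀
  have iY' : IntegrableOn Y (Icc 0 T) := iY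
  have iN' : IntegrableOn N (Icc 0 T) := iN
  have iD' : IntegrableOn D (Icc 0 T) := iD
  have iDrift : IntegrableOn (fun s => -(lam k * Y s + (2 * Real.pi * Complex.I * N s + D s)))
      (Icc 0 T) := ((iY'.const_mul _).add ((iN'.const_mul _).add iD')).neg
  have key := eq_of_weak_ode_exp (y₀ := Y₀) hT iY' iDrift (fun κ hκ hκT => ?_) (lam k)
  · filter_upwards [key] with t ht
    rw [ht]
    congr 1
    refine intervalIntegral.integral_congr fun s _ => ?_
    simp only [hYdef, Complex.real_smul]
    ring
  have hκd : Differentiable ℝ κ := hκ.differentiable (by simp)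
  have hκ' : Continuous (deriv κ) := (contDiff_infty_iff_deriv.1 hκ).2.continuous
  have iK : IntegrableOn (fun s => deriv κ s • Y s
      + κ s • -(lam k * Y s + (2 * Real.pi * Complex.I * N s + D s))) (Icc 0 T) :=
    (iY'.continuousOn_smul hκ'.continuousOn isCompact_Icc).add
      (iDrift.continuousOn_smul hκ.continuous.continuousOn isCompact_Icc)
  -- Only real test fields are admissible. The complex identity is obtained as real parts after
  -- multiplication by `ζ`; `ζ = 1` and `ζ = -i` then recover its real and imaginary parts.
  have hre : ∀ ζ : ℂ, (ζ * -(∫ s in (0 : ℝ)..T, (deriv κ s • Y s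
      + κ s • -(lam k * Y s + (2 * Real.pi * Complex.I * N s + D s))))).re
      = (ζ * (κ 0 • Y₀)).re := by
    intro ζ
    have h := hw.fluid _ (isFluidTest_wave hκ hκT ζ ha)
    have e0 : ∫ x, inner ℝ (u₀ x) ((κ 0 * (ζ * mFourier (-k) x).re) • a) ∂(torusVol d)
        = (ζ * (κ 0 • Y₀)).re := by
      have h1 : Integrable (fun x => mFourier (-k) x * ((inner ℝ a (u₀ x) : ℝ) : ℂ)) (torusVol d) :=
        Integrable.mFourier_mul (hu₀.const_inner a).ofReal _
      have h2 := integral_re_mul h1 (ζ * (κ 0 : ℂ))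
      rw [hY₀, mFourierCoeff_eq, Complex.real_smul, ← mul_assoc, ← h2]
      refine integral_congr_ae (ae_of_all _ fun x => ?_)
      simp only
      rw [inner_smul_right, real_inner_comm, ← Complex.re_ofReal_mul, mul_comm,
        ← Complex.re_ofReal_mul]
      congr 1
      ring
    have e1 : ∀ᵐ s ∂(volume.restrict (Icc 0 T)),
        ∫ x, fluidDual u (fun s x => (κ s * (ζ * mFourier (-k) x).re) • a) s x ∂(torusVol d)
        = (ζ * (deriv κ s • Y s - κ s • (lam k * Y s + 2 * Real.pi * Complex.I * N s))).re := by
      filter_upwards [hY.prod_right_ae, hN.prod_right_ae] with s h1 h2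
      have h1' := Integrable.mFourier_mul h1 (-k)
      have h2' := Integrable.mFourier_mul h2 (-k)
      have h3 : Integrable (fun x => (deriv κ s * (mFourier (-k) x * (inner ℝ a (u s x) : ℝ))
        - κ s * (lam k * (mFourier (-k) x * (inner ℝ a (u s x) : ℝ))
          + mFourier (-k) x * (2 * Real.pi * Complex.I *
            ((inner ℝ (freqVec k) (u s x) * inner ℝ a (u s x) : ℝ) : ℂ))) : ℂ)) (torusVol d) := by
        refine (h1'.const_mul _).sub (((h1'.const_mul _).add ?_).const_mul _)
        refine (h2'.const_mul (2 * Real.pi * Complex.I)).congr (ae_of_all _ fun x => ?_)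
        simp only
        ring
      simp only [fluidDual_wave hκd]
      rw [integral_re_mul h3]
      congr 2
      rw [integral_sub (h1'.const_mul _) (by
          refine (((h1'.const_mul _).add ?_).const_mul _)
          refine (h2'.const_mul (2 * Real.pi * Complex.I)).congr (ae_of_all _ fun x => ?_)
          simp only
          ring),
        integral_const_mul, integral_const_mul, integral_add (h1'.const_mul _) (by
          refine (h2'.const_mul (2 * Real.pi * Complex.I)).congr (ae_of_all _ fun x => ?_)
          simp only
          ring),
        integral_const_mul]
      have e : ∫ x, mFourier (-k) x * (2 * Real.pi * Complex.I *
            ((inner ℝ (freqVec k) (u s x) * inner ℝ a (u s x) : ℝ) : ℂ)) ∂(torusVol d)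
          = 2 * Real.pi * Complex.I * N s := by
        rw [hNdef]
        simp only [mFourierCoeff_eq]
        rw [← integral_const_mul]
        exact integral_congr_ae (ae_of_all _ fun x => by simp only; ring)
      rw [e]
      simp only [Complex.real_smul]
      rfl
    have e2 : ∀ᵐ s ∂(volume.restrict (Icc 0 T)),
        ∫ v, ∫ x, F s x v * inner ℝ (u s x - v) ((κ s * (ζ * mFourier (-k) x).re) • a) ∂(torusVol d)
        = (ζ * (κ s • D s)).re := by
      filter_upwards [hdr.prod_right_ae, hD.prod_right_ae] with s h1 h2
      have hb : Integrable (fun z : Torus d × E d => (κ s * (ζ * mFourier (-k) z.1).re) *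
          inner ℝ a (F s z.1 z.2 • (u s z.1 - z.2))) ((torusVol d).prod volume) := by
        refine (h1.const_inner a).bdd_mul (c := |κ s| * ‖ζ‖) ?_ (ae_of_all _ fun z => ?_)
        · exact (by fun_prop : Continuous fun z : Torus d × E d =>
            κ s * (ζ * mFourier (-k) z.1).re).aestronglyMeasurable
        · rw [norm_mul, Real.norm_eq_abs, Real.norm_eq_abs]
          refine mul_le_mul_of_nonneg_left ((Complex.abs_re_le_norm _).trans ?_) (abs_nonneg _)
          rw [norm_mul, norm_mFourier_apply, mul_one]
      have e3 : ∀ x v, F s x v * inner ℝ (u s x - v) ((κ s * (ζ * mFourier (-k) x).re) • a)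
          = (κ s * (ζ * mFourier (-k) x).re) * inner ℝ a (F s x v • (u s x - v)) := fun x v => by
        rw [inner_smul_right, inner_smul_right, real_inner_comm]; ring
      simp only [e3]
      rw [← integral_integral_swap (f := fun x v => (κ s * (ζ * mFourier (-k) x).re) *
          inner ℝ a (F s x v • (u s x - v))) hb]
      have h3 := Integrable.mFourier_mul h2 (-k)
      have h4 := integral_re_mul h3 (ζ * (κ s : ℂ))
      rw [hDdef]
      simp only [mFourierCoeff_eq, Complex.real_smul]
      rw [← mul_assoc, ← h4]
      refine integral_congr_ae ?_
      filter_upwards [h1.prod_right_ae] with x hx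
      rw [integral_const_mul, integral_inner hx, ← Complex.re_ofReal_mul, mul_comm,
        ← Complex.re_ofReal_mul]
      congr 1
      unfold dragField
      ring
    have hrestr : ∀ {p : ℝ → Prop}, (∀ᵐ s ∂(volume.restrict (Icc 0 T)), p s) →
        ∀ᵐ s ∂(volume.restrict (Ioc 0 T)), p s := fun hp =>
      ae_restrict_of_ae_restrict_of_subset Ioc_subset_Icc_self hp
    have i0 : IntegrableOn (fun s => lam k * Y s + 2 * Real.pi * Complex.I * N s) (Icc 0 T) :=
      (iY'.const_mul _).add (iN'.const_mul _)
    have i1 : IntegrableOn (fun s => deriv κ s • Y s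
        - κ s • (lam k * Y s + 2 * Real.pi * Complex.I * N s)) (Ioc 0 T) :=
      ((iY'.continuousOn_smul hκ'.continuousOn isCompact_Icc).sub
        (i0.continuousOn_smul hκ.continuous.continuousOn isCompact_Icc)).mono_set Ioc_subset_Icc_self
    have i2 : IntegrableOn (fun s => κ s • D s) (Ioc 0 T) :=
      (iD'.continuousOn_smul hκ.continuous.continuousOn isCompact_Icc).mono_set Ioc_subset_Icc_self
    rw [e0, intervalIntegral.integral_of_le hT.le, intervalIntegral.integral_of_le hT.le,
      integral_congr_ae (hrestr e1), integral_congr_ae (hrestr e2), integral_re_mul i1,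
      integral_re_mul i2] at h
    have h5 : (ζ * (κ 0 • Y₀)).re = (ζ * ∫ s in Ioc 0 T, κ s • D s).re
        - (ζ * ∫ s in Ioc 0 T, (deriv κ s • Y s
        - κ s • (lam k * Y s + 2 * Real.pi * Complex.I * N s))).re := by linarith
    rw [h5, ← Complex.sub_re, ← mul_sub, ← integral_sub i2 i1,
      intervalIntegral.integral_of_le hT.le, ← integral_neg]
    congr 2
    refine integral_congr_ae (ae_of_all _ fun s => ?_)
    simp only [Complex.real_smul]
    ring
  apply Complex.ext
  · have := hre 1
    simpa using this
  · have := hre (-Complex.I)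
    simpa using this

end FluidODE

/-! ### The mild formula for the limit fluid velocity -/

/-- The symbol of the Leray projector. -/
def lerayMat (k : Fin d → ℤ) (i j : Fin d) : ℝ :=
  (if i = j then 1 else 0) - (k i : ℝ) * k j / freqSq k

/-- Leray projection of the coefficients of the initial velocity. -/
def mildInit (u₀ : Torus d → E d) (i : Fin d) (k : Fin d → ℤ) : ℂ :=
  ∑ j, (lerayMat k i j : ℂ) * fourierVec u₀ k j

/-- The momentum flux `u ⊗ u`. -/
def fluxCoeff (u : Torus d → E d) (l j : Fin d) (k : Fin d → ℤ) : ℂ :=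
  mFourierCoeff (fun x => ((u x l * u x j : ℝ) : ℂ)) k

/-- Leray projection of the coefficients of a force `div N + f`. -/
def leraySrc (N : Fin d → Fin d → (Fin d → ℤ) → ℂ) (f : Fin d → (Fin d → ℤ) → ℂ) (i : Fin d)
    (k : Fin d → ℤ) : ℂ :=
  ∑ j, (lerayMat k i j : ℂ) * (∑ l, dsym l k * N l j k + f j k)

lemma freqSq_eq_zero {k : Fin d → ℤ} (h : freqSq k = 0) (j : Fin d) : (k j : ℝ) = 0 := by
  have := (Finset.sum_eq_zero_iff_of_nonneg (fun i _ => sq_nonneg ((k i : ℝ)))).1 h j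
    (Finset.mem_univ j)
  exact pow_eq_zero_iff (two_ne_zero) |>.1 this

/-- At `k = 0` the division by `freqSq k = 0` returns `0`; the symbol is then the identity, and the
sum vanishes because `k` does. -/
lemma sum_lerayMat_mul (k : Fin d → ℤ) (i : Fin d) : ∑ j, lerayMat k i j * (k j : ℝ) = 0 := by
  unfold lerayMat
  simp only [sub_mul, Finset.sum_sub_distrib, ite_mul, one_mul, zero_mul, Finset.sum_ite_eq,
    Finset.mem_univ, if_true]
  by_cases h : freqSq k = 0
  · simp [freqSq_eq_zero h]
  · have : ∑ j, (k i : ℝ) * k j / freqSq k * k j = k i / freqSq k * freqSq k := by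
      unfold freqSq
      rw [Finset.mul_sum]
      exact Finset.sum_congr rfl fun j _ => by ring
    rw [this, div_mul_cancel₀ _ h, sub_self]

lemma abs_lerayMat_le (k : Fin d → ℤ) (i j : Fin d) : |lerayMat k i j| ≤ 2 := by
  unfold lerayMat
  have h1 : |(k i : ℝ) * k j / freqSq k| ≤ 1 := by
    rw [abs_div, abs_of_nonneg (freqSq_nonneg k)]
    refine div_le_one_of_le₀ ?_ (freqSq_nonneg k)
    have hi : (k i : ℝ) ^ 2 ≤ freqSq k :=
      Finset.single_le_sum (f := fun j => (k j : ℝ) ^ 2) (fun _ _ => sq_nonneg _) (Finset.mem_univ i)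
    have hj : (k j : ℝ) ^ 2 ≤ freqSq k :=
      Finset.single_le_sum (f := fun j => (k j : ℝ) ^ 2) (fun _ _ => sq_nonneg _) (Finset.mem_univ j)
    rw [abs_mul]
    nlinarith [sq_abs (k i : ℝ), sq_abs (k j : ℝ), sq_nonneg (|(k i : ℝ)| - |(k j : ℝ)|)]
  have h2 : |(if i = j then (1 : ℝ) else 0)| ≤ 1 := by split_ifs <;> simp
  exact (abs_sub _ _).trans (by linarith)

/-- Multiplication by `lam k` cancels the denominator of the Leray symbol: `(-Δ)P = ∇div - Δ` is a
differential operator. This is why all estimates concern `(-Δ)u`; the projector alone would be a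
singular integral, which sup bounds do not control. -/
lemma lam_mul_sum_lerayMat (k : Fin d → ℤ) (i : Fin d) (g : Fin d → ℂ) :
    (lam k : ℂ) * ∑ j, (lerayMat k i j : ℂ) * g j
      = ∑ j, dsyms [i, j] k * g j + -1 * ∑ l, dsyms [l, l] k * g i := by
  have h1 : ∀ a b : Fin d, dsyms [a, b] k = -(4 * Real.pi ^ 2 * ((k a : ℝ) * k b) : ℝ) := fun a b => by
    simp only [dsyms, List.map_cons, List.map_nil, List.prod_cons, List.prod_nil, dsym, mul_one]
    push_cast
    linear_combination (4 * (Real.pi : ℂ) ^ 2 * k a * k b) * Complex.I_sq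
  have h2 : ∀ j, (lam k : ℂ) * (lerayMat k i j : ℂ)
      = dsyms [i, j] k + if i = j then (lam k : ℂ) else 0 := fun j => by
    rw [h1]
    have : lam k * ((k i : ℝ) * k j / freqSq k) = 4 * Real.pi ^ 2 * ((k i : ℝ) * k j) := by
      unfold lam
      by_cases h : freqSq k = 0
      · simp [freqSq_eq_zero h]
      · field_simp
    have h3 : (lam k : ℂ) * (lerayMat k i j : ℂ) = ((lam k * (if i = j then 1 else 0)
        - lam k * ((k i : ℝ) * k j / freqSq k) : ℝ) : ℂ) := by
      unfold lerayMat
      push_cast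
      ring
    rw [h3, this]
    split_ifs <;> push_cast <;> ring
  rw [Finset.mul_sum]
  simp only [← mul_assoc, h2, add_mul, Finset.sum_add_distrib, ite_mul, zero_mul, Finset.sum_ite_eq,
    Finset.mem_univ, if_true]
  congr 1
  rw [← Finset.sum_mul]
  simp only [h1]
  rw [neg_one_mul, ← neg_mul]
  congr 1
  unfold lam freqSq
  push_cast
  rw [Finset.mul_sum, ← Finset.sum_neg_distrib]
  exact Finset.sum_congr rfl fun l _ => by ring

lemma mFourierCoeff_sum_mul {g : Fin d → Torus d → ℝ} (hg : ∀ j, Integrable (g j) (torusVol d))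
    (c : Fin d → ℝ) (k : Fin d → ℤ) :
    mFourierCoeff (fun x => ((∑ j, c j * g j x : ℝ) : ℂ)) k
      = ∑ j, (c j : ℂ) * mFourierCoeff (fun x => ((g j x : ℝ) : ℂ)) k := by
  simp only [mFourierCoeff_eq]
  have h1 : ∀ j, Integrable (fun x => mFourier (-k) x * ((g j x : ℝ) : ℂ)) (torusVol d) := fun j =>
    Integrable.mFourier_mul (hg j).ofReal _
  rw [show (∑ j, (c j : ℂ) * ∫ x, mFourier (-k) x * ((g j x : ℝ) : ℂ) ∂(torusVol d))
    = ∑ j, ∫ x, (c j : ℂ) * (mFourier (-k) x * ((g j x : ℝ) : ℂ)) ∂(torusVol d) from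
      Finset.sum_congr rfl fun j _ => (integral_const_mul _ _).symm]
  rw [← integral_finsetSum _ fun j _ => (h1 j).const_mul _]
  refine integral_congr_ae (ae_of_all _ fun x => ?_)
  simp only
  push_cast
  rw [Finset.mul_sum]
  exact Finset.sum_congr rfl fun j _ => by ring

/-- The `i`-th row of the Leray symbol. -/
def lerayRow (k : Fin d → ℤ) (i : Fin d) : E d := WithLp.toLp 2 fun j => lerayMat k i j

lemma inner_eq_sum (a v : E d) : inner ℝ a v = ∑ j, a j * v j := by
  rw [PiLp.inner_apply]
  exact Finset.sum_congr rfl fun j _ => by simp [mul_comm]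

lemma integrable_coord {f : Torus d → E d} (hf : Integrable f (torusVol d)) (j : Fin d) :
    Integrable (fun x => f x j) (torusVol d) :=
  (EuclideanSpace.proj j : E d →L[ℝ] ℝ).integrable_comp hf

lemma mFourierCoeff_inner {f : Torus d → E d} (hf : Integrable f (torusVol d)) (a : E d)
    (k : Fin d → ℤ) : mFourierCoeff (fun x => ((inner ℝ a (f x) : ℝ) : ℂ)) k
      = ∑ j, (a j : ℂ) * fourierVec f k j := by
  simp only [inner_eq_sum]
  exact mFourierCoeff_sum_mul (integrable_coord hf) _ k

lemma integrable_mul_coord {f : Torus d → E d} (hf : AEStronglyMeasurable f (torusVol d)) {A : ℝ}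
    (hA : ∀ᵐ x ∂(torusVol d), ‖f x‖ ≤ A) (l j : Fin d) :
    Integrable (fun x => f x l * f x j) (torusVol d) := by
  refine Integrable.of_bound (C := A * A) ((by fun_prop : Continuous fun v : E d =>
    v l * v j).comp_aestronglyMeasurable hf) ?_
  filter_upwards [hA] with x hx
  rw [norm_mul]
  exact mul_le_mul ((abs_coord_le _ _).trans hx) ((abs_coord_le _ _).trans hx) (norm_nonneg _)
    ((norm_nonneg _).trans hx)

lemma mFourierCoeff_flux {f : Torus d → E d} (hf : AEStronglyMeasurable f (torusVol d)) {A : ℝ}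
    (hA : ∀ᵐ x ∂(torusVol d), ‖f x‖ ≤ A) (a : E d) (k : Fin d → ℤ) :
    2 * Real.pi * Complex.I *
        mFourierCoeff (fun x => ((inner ℝ (freqVec k) (f x) * inner ℝ a (f x) : ℝ) : ℂ)) k
      = ∑ j, (a j : ℂ) * ∑ l, dsym l k * fluxCoeff f l j k := by
  have h1 : ∀ x, inner ℝ (freqVec k) (f x) * inner ℝ a (f x)
      = ∑ j, a j * ∑ l, (k l : ℝ) * (f x l * f x j) := fun x => by
    rw [inner_eq_sum, inner_eq_sum, Finset.sum_mul_sum, Finset.sum_comm]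
    refine Finset.sum_congr rfl fun j _ => ?_
    rw [Finset.mul_sum]
    exact Finset.sum_congr rfl fun l _ => by simp only [freqVec]; ring
  simp only [h1]
  have hi := integrable_mul_coord hf hA
  rw [mFourierCoeff_sum_mul (g := fun j x => ∑ l, (k l : ℝ) * (f x l * f x j)) fun j =>
    integrable_finsetSum _ fun l _ => (hi l j).const_mul _]
  rw [Finset.mul_sum]
  refine Finset.sum_congr rfl fun j _ => ?_
  rw [mFourierCoeff_sum_mul (g := fun l x => f x l * f x j) fun l => hi l j]
  rw [Finset.mul_sum, Finset.mul_sum, Finset.mul_sum]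
  refine Finset.sum_congr rfl fun l _ => ?_
  unfold dsym fluxCoeff
  push_cast
  ring

section Mild

variable {T σ : ℝ} {u₀ : Torus d → E d} {F₀ : Torus d → E d → ℝ} {u : ℝ → Torus d → E d}
  {F : ℝ → Torus d → E d → ℝ}

lemma slices_of_bounded {A : ℝ} (hu : AEStronglyMeasurable (fun z : ℝ × Torus d => u z.1 z.2)
      ((volume.restrict (Icc 0 T)).prod (torusVol d)))
    (hA : ∀ᵐ z ∂((volume.restrict (Icc 0 T)).prod (torusVol d)), ‖u z.1 z.2‖ ≤ A) :
    ∀ᵐ t ∂(volume.restrict (Icc 0 T)), AEStronglyMeasurable (u t) (torusVol d) ∧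
      (∀ᵐ x ∂(torusVol d), ‖u t x‖ ≤ A) ∧ Integrable (u t) (torusVol d) := by
  have h1 : Integrable (fun z : ℝ × Torus d => u z.1 z.2)
      ((volume.restrict (Icc 0 T)).prod (torusVol d)) := Integrable.of_bound hu A hA
  filter_upwards [h1.prod_right_ae, Measure.ae_ae_of_ae_prod hA] with t h2 h3
  exact ⟨h2.1, h3, h2⟩

/-- The rows of the Leray symbol are orthogonal to `k`, hence admissible amplitudes in `fluid_ode`;
on the divergence-free `u_t` the projection acts as the identity. -/
lemma mild_formula (hT : 0 < T) (hW : IsWeakSolution T σ u₀ F₀ u F) {A : ℝ} (hA0 : 0 ≤ A)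
    (hA : ∀ᵐ z ∂((volume.restrict (Icc 0 T)).prod (torusVol d)), ‖u z.1 z.2‖ ≤ A)
    (hu₀ : Integrable u₀ (torusVol d)) :
    ∀ᵐ t ∂(volume.restrict (Icc 0 T)), ∀ i k,
      fourierVec (u t) k i = hw t k * (mildInit u₀ i k + ∫ s in (0 : ℝ)..t,
        Real.exp (lam k * s) •
          -leraySrc (fluxCoeff (u s)) (fun j k => fourierVec (dragField (u s) (F s)) k j) i k) := by
  have hrow : ∀ k i, inner ℝ (freqVec k) (lerayRow (d := d) k i) = 0 := fun k i => by
    rw [inner_eq_sum, ← sum_lerayMat_mul k i]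
    exact Finset.sum_congr rfl fun j _ => by simp only [freqVec, lerayRow]; ring
  have h := fun (i : Fin d) (k : Fin d → ℤ) => fluid_ode hT hW hA0 hA hu₀ (hrow k i)
  have hs := slices_of_bounded hW.meas_u hA
  have hd := (integrable_dragField hW hA).prod_right_ae
  filter_upwards [ae_all_iff.2 fun i => ae_all_iff.2 (h i), hs, hW.u_div_free,
    ae_restrict_mem measurableSet_Icc] with t ht hts hdiv htm i k
  have h1 := ht i k
  have e1 : mFourierCoeff (fun x => ((inner ℝ (lerayRow k i) (u t x) : ℝ) : ℂ)) k
      = fourierVec (u t) k i := by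
    rw [mFourierCoeff_inner hts.2.2]
    simp only [lerayRow, lerayMat]
    push_cast
    simp only [sub_mul, Finset.sum_sub_distrib]
    have : ∑ j, (k i : ℂ) * (k j : ℂ) / (freqSq k : ℂ) * fourierVec (u t) k j
        = (k i : ℂ) / (freqSq k : ℂ) * ∑ j, (k j : ℂ) * fourierVec (u t) k j := by
      rw [Finset.mul_sum]
      exact Finset.sum_congr rfl fun j _ => by ring
    rw [this, hdiv k, mul_zero, sub_zero, Finset.sum_eq_single i]
    · simp
    · intro j _ hj
      simp [hj.symm]
    · simp
  have e2 : mFourierCoeff (fun x => ((inner ℝ (lerayRow k i) (u₀ x) : ℝ) : ℂ)) k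
      = mildInit u₀ i k := mFourierCoeff_inner hu₀ _ _
  have e3 : ∫ s in (0 : ℝ)..t, Real.exp (lam k * s) •
          -(2 * Real.pi * Complex.I * mFourierCoeff (fun x =>
              ((inner ℝ (freqVec k) (u s x) * inner ℝ (lerayRow k i) (u s x) : ℝ) : ℂ)) k
            + mFourierCoeff (fun x =>
              ((inner ℝ (lerayRow k i) (dragField (u s) (F s) x) : ℝ) : ℂ)) k)
      = ∫ s in (0 : ℝ)..t, Real.exp (lam k * s) •
          -leraySrc (fluxCoeff (u s)) (fun j k => fourierVec (dragField (u s) (F s)) k j) i k := by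
    rw [intervalIntegral.integral_of_le htm.1, intervalIntegral.integral_of_le htm.1]
    refine integral_congr_ae ?_
    have hsub : Ioc 0 t ⊆ Icc 0 T := fun s hs => ⟨hs.1.le, hs.2.trans htm.2⟩
    filter_upwards [ae_restrict_of_ae_restrict_of_subset hsub hs,
      ae_restrict_of_ae_restrict_of_subset hsub hd] with s h1 h2
    rw [mFourierCoeff_flux h1.1 h1.2.1, mFourierCoeff_inner h2]
    congr 2
    unfold leraySrc
    rw [← Finset.sum_add_distrib]
    exact Finset.sum_congr rfl fun j _ => by simp only [lerayRow]; ring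
  rw [e1, e2, e3] at h1
  rw [← h1, Complex.real_smul, ← mul_assoc]
  have : (hw t k : ℂ) * (Real.exp (lam k * t) : ℂ) = 1 := by
    rw [← Complex.ofReal_mul, FluidParticle.hw, ← Real.exp_add]
    simp
  rw [this, one_mul]

end Mild

/-! ### Heat bounds for Leray projected forces -/

lemma heatBound_lam_leray {g : Fin d → (Fin d → ℤ) → ℂ} (hg : ∀ j, PolyGrowth (g j)) {τ M : ℝ}
    (hτ : 0 < τ) (h : ∀ a b j, HeatBound (fun k => dsyms [a, b] k * g j k) τ M) (i : Fin d) :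
    HeatBound (fun k => (lam k : ℂ) * ∑ j, (lerayMat k i j : ℂ) * g j k) τ (2 * d * M) := by
  have e : (fun k => (lam k : ℂ) * ∑ j, (lerayMat k i j : ℂ) * g j k)
      = fun k => ∑ j, dsyms [i, j] k * g j k + -1 * ∑ l, dsyms [l, l] k * g i k :=
    funext fun k => lam_mul_sum_lerayMat k i fun j => g j k
  rw [e]
  have h1 : HeatBound (fun k => ∑ j, dsyms [i, j] k * g j k) τ (∑ _j : Fin d, M) :=
    HeatBound.sum _ (fun j _ => (hg j).dsyms_mul _) hτ fun j _ => h i j j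
  have h2 : HeatBound (fun k => ∑ l, dsyms [l, l] k * g i k) τ (∑ _j : Fin d, M) :=
    HeatBound.sum _ (fun l _ => (hg i).dsyms_mul _) hτ fun l _ => h l l i
  have p1 : PolyGrowth fun k => ∑ j, dsyms [i, j] k * g j k :=
    PolyGrowth.sum _ fun j _ => (hg j).dsyms_mul _
  have p2 : PolyGrowth fun k => ∑ l, dsyms [l, l] k * g i k :=
    PolyGrowth.sum _ fun l _ => (hg i).dsyms_mul _
  have p3 : PolyGrowth fun k => -1 * ∑ l, dsyms [l, l] k * g i k :=
    p2.bdd_mul (c := fun _ => -1) (K := 1) fun k => by simp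
  refine (HeatBound.add p1 p3 hτ h1 (h2.const_mul (-1))).mono ?_
  simp
  linarith

/-! ### Duhamel's formula and its high-frequency part -/

/-- `e^{tΔ}α + ∫₀ᵗ e^{(t-s)Δ} η_s ds` on the Fourier side. -/
def duhamel (α : (Fin d → ℤ) → ℂ) (η : ℝ → (Fin d → ℤ) → ℂ) (t : ℝ) (k : Fin d → ℤ) : ℂ :=
  hw t k * (α k + ∫ s in (0 : ℝ)..t, Real.exp (lam k * s) • η s k)

/-- Initial data and forces of uniformly polynomial growth. -/
structure DuhamelData (T M : ℝ) (n : ℕ) (α : (Fin d → ℤ) → ℂ) (η : ℝ → (Fin d → ℤ) → ℂ) :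
    Prop where
  init_le : ∀ k, ‖α k‖ ≤ M * (1 + freqSq k) ^ n
  src_le : ∀ᵐ s ∂(volume.restrict (Icc 0 T)), ∀ k, ‖η s k‖ ≤ M * (1 + freqSq k) ^ n
  src_meas : ∀ k, AEStronglyMeasurable (fun s => η s k) (volume.restrict (Icc 0 T))

/-- The function with Fourier coefficients `c`, written as a low-frequency part plus
`∫₀¹ e^{rΔ}(-Δ)c dr`. -/
def synth (c : (Fin d → ℤ) → ℂ) (x : Torus d) : ℂ :=
  fseries (fun k => (hw 1 k : ℂ) * c k) x
    + ∫ r in (0 : ℝ)..1, fseries (fun k => (hw r k : ℂ) * ((lam k : ℂ) * c k)) x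

lemma lam_le (k : Fin d → ℤ) : lam k ≤ 4 * Real.pi ^ 2 * (1 + freqSq k) := by
  unfold lam
  have : 0 ≤ 4 * Real.pi ^ 2 := by positivity
  nlinarith

lemma PolyGrowth.lam_mul {a : (Fin d → ℤ) → ℂ} (ha : PolyGrowth a) :
    PolyGrowth fun k => (lam k : ℂ) * a k := by
  obtain ⟨M, n, h⟩ := ha
  refine ⟨4 * Real.pi ^ 2 * M, n + 1, fun k => ?_⟩
  rw [norm_mul, Complex.norm_real, Real.norm_of_nonneg (lam_nonneg k)]
  have h0 := freqSq_nonneg k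
  calc lam k * ‖a k‖ ≤ (4 * Real.pi ^ 2 * (1 + freqSq k)) * (M * (1 + freqSq k) ^ n) :=
        mul_le_mul (lam_le k) (h k) (norm_nonneg _) (by positivity)
    _ = _ := by ring

section Duhamel

variable {T M : ℝ} {n : ℕ} {α : (Fin d → ℤ) → ℂ} {η : ℝ → (Fin d → ℤ) → ℂ}

lemma DuhamelData.nonneg (h : DuhamelData T M n α η) : 0 ≤ M := by
  have := (norm_nonneg _).trans (h.init_le 0)
  simpa [freqSq] using this

lemma DuhamelData.integrableOn (h : DuhamelData T M n α η) (k : Fin d → ℤ) :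
    IntegrableOn (fun s => η s k) (Icc 0 T) :=
  Integrable.of_bound (h.src_meas k) (M * (1 + freqSq k) ^ n) (by
    filter_upwards [h.src_le] with s hs using hs k)

lemma DuhamelData.mul (h : DuhamelData T M n α η) {e : (Fin d → ℤ) → ℂ} {K : ℝ}
    (he : ∀ k, ‖e k‖ ≤ K) : DuhamelData T (K * M) n (fun k => e k * α k) fun s k => e k * η s k := by
  have hK : 0 ≤ K := (norm_nonneg _).trans (he 0)
  refine ⟨fun k => ?_, ?_, fun k => (h.src_meas k).const_mul _⟩
  · rw [norm_mul, mul_assoc]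
    exact mul_le_mul (he k) (h.init_le k) (norm_nonneg _) hK
  · filter_upwards [h.src_le] with s hs k
    rw [norm_mul, mul_assoc]
    exact mul_le_mul (he k) (hs k) (norm_nonneg _) hK

lemma duhamel_mul (e : (Fin d → ℤ) → ℂ) (t : ℝ) (k : Fin d → ℤ) :
    duhamel (fun k => e k * α k) (fun s k => e k * η s k) t k = e k * duhamel α η t k := by
  unfold duhamel
  have : ∫ s in (0 : ℝ)..t, Real.exp (lam k * s) • (e k * η s k)
      = e k * ∫ s in (0 : ℝ)..t, Real.exp (lam k * s) • η s k := by
    rw [← intervalIntegral.integral_const_mul]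
    exact intervalIntegral.integral_congr fun s _ => by simp only [Complex.real_smul]; ring
  rw [this]
  ring

lemma duhamel_eq (t : ℝ) (k : Fin d → ℤ) :
    duhamel α η t k = hw t k * α k + ∫ s in (0 : ℝ)..t, (hw (t - s) k : ℂ) * η s k := by
  unfold duhamel
  rw [mul_add, ← intervalIntegral.integral_const_mul]
  congr 1
  refine intervalIntegral.integral_congr fun s _ => ?_
  simp only [Complex.real_smul]
  rw [← mul_assoc, ← Complex.ofReal_mul, hw, hw, ← Real.exp_add]
  congr 3
  ring

lemma DuhamelData.continuousOn (h : DuhamelData T M n α η) (k : Fin d → ℤ) :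
    ContinuousOn (fun t => duhamel α η t k) (Icc 0 T) := by
  have h1 : IntegrableOn (fun s => Real.exp (lam k * s) • η s k) (Icc 0 T) :=
    (h.integrableOn k).continuousOn_smul (by fun_prop) isCompact_Icc
  have h2 : ContinuousOn (fun t => ∫ s in (0 : ℝ)..t, Real.exp (lam k * s) • η s k) (Icc 0 T) := by
    by_cases hT : 0 ≤ T
    · have := intervalIntegral.continuousOn_primitive_interval (a := 0) (b := T)
        (f := fun s => Real.exp (lam k * s) • η s k) (μ := volume) (by rwa [uIcc_of_le hT])
      rwa [uIcc_of_le hT] at this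
    · rw [Icc_eq_empty hT]; exact continuousOn_empty _
  unfold duhamel hw
  exact ContinuousOn.mul (by fun_prop) (continuousOn_const.add h2)

lemma ae_Ioc_of_ae_Icc {p : ℝ → Prop} (h : ∀ᵐ s ∂(volume.restrict (Icc 0 T)), p s) {t : ℝ}
    (ht : t ≤ T) : ∀ᵐ s ∂(volume.restrict (Ioc 0 t)), p s :=
  ae_restrict_of_ae_restrict_of_subset
    (fun _ hs => ⟨(mem_Ioc.1 hs).1.le, (mem_Ioc.1 hs).2.trans ht⟩ : Ioc 0 t ⊆ Icc 0 T) h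

lemma DuhamelData.norm_le (h : DuhamelData T M n α η) {t : ℝ} (ht : t ∈ Icc 0 T)
    (k : Fin d → ℤ) : ‖duhamel α η t k‖ ≤ M * (1 + T) * (1 + freqSq k) ^ n := by
  have h0 := freqSq_nonneg k
  have hM := h.nonneg
  rw [duhamel_eq]
  have h1 : ‖(hw t k : ℂ) * α k‖ ≤ M * (1 + freqSq k) ^ n := by
    rw [norm_mul, Complex.norm_real, Real.norm_of_nonneg (hw_pos t k).le]
    exact (mul_le_of_le_one_left (norm_nonneg _) (hw_le_one ht.1 k)).trans (h.init_le k)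
  have h2 : ‖∫ s in (0 : ℝ)..t, (hw (t - s) k : ℂ) * η s k‖ ≤ M * (1 + freqSq k) ^ n * |t - 0| := by
    refine intervalIntegral.norm_integral_le_of_norm_le_const_ae ?_
    have := (ae_restrict_iff' measurableSet_Ioc).1 (ae_Ioc_of_ae_Icc h.src_le ht.2)
    rw [uIoc_of_le ht.1]
    filter_upwards [this] with s hs hsm
    rw [norm_mul, Complex.norm_real, Real.norm_of_nonneg (hw_pos _ k).le]
    exact (mul_le_of_le_one_left (norm_nonneg _) (hw_le_one (by linarith [hsm.2]) k)).trans
      (hs hsm k)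
  have h3 : M * (1 + freqSq k) ^ n * |t - 0| ≤ M * (1 + freqSq k) ^ n * T := by
    rw [sub_zero, abs_of_nonneg ht.1]
    exact mul_le_mul_of_nonneg_left ht.2 (by positivity)
  refine (norm_add_le _ _).trans ?_
  linarith

lemma DuhamelData.polyGrowth (h : DuhamelData T M n α η) {t : ℝ} (ht : t ∈ Icc 0 T) :
    PolyGrowth (duhamel α η t) := ⟨M * (1 + T), n, h.norm_le ht⟩

/-- Under `e^{rΔ}` the initial value is seen after heat time `r + t` and the force of time `s` after
`r + (t - s)`. The polynomial growth only serves to interchange sum and integral, since `r > 0`; the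
size of the result comes from the given heat bounds. -/
lemma DuhamelData.heatBound (h : DuhamelData T M n α η) {t r : ℝ} (ht : t ∈ Icc 0 T) (hr : 0 < r)
    {Φ₀ : ℝ} {Φ : ℝ → ℝ} (h₀ : HeatBound (fun k => (lam k : ℂ) * α k) (r + t) Φ₀)
    (hΦ : ∀ᵐ s ∂(volume.restrict (Ioc 0 t)),
      HeatBound (fun k => (lam k : ℂ) * η s k) (r + (t - s)) (Φ s))
    (hi : IntegrableOn Φ (Ioc 0 t)) :
    HeatBound (fun k => (lam k : ℂ) * duhamel α η t k) r (Φ₀ + ∫ s in Ioc 0 t, Φ s) := by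
  intro x
  have hM := h.nonneg
  have hlam : ∀ k : Fin d → ℤ, ‖(lam k : ℂ)‖ ≤ 4 * Real.pi ^ 2 * (1 + freqSq k) := fun k => by
    rw [Complex.norm_real, Real.norm_of_nonneg (lam_nonneg k)]; exact lam_le k
  have hsum : Summable fun k : Fin d → ℤ => (1 + freqSq k) ^ (n + 1) * hw r k :=
    summable_poly_mul_hw hr (n + 1)
  have hα : PolyGrowth α := ⟨M, n, h.init_le⟩
  have hsrc := ae_Ioc_of_ae_Icc h.src_le ht.2
  have hbd : ∀ k, ∀ᵐ s ∂(volume.restrict (Ioc 0 t)),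
      ‖(hw (r + (t - s)) k : ℂ) * ((lam k : ℂ) * η s k)‖
        ≤ 4 * Real.pi ^ 2 * M * ((1 + freqSq k) ^ (n + 1) * hw r k) := fun k => by
    filter_upwards [hsrc, ae_restrict_mem measurableSet_Ioc] with s hs hsm
    have h0 := freqSq_nonneg k
    rw [norm_mul, norm_mul, Complex.norm_real, Real.norm_of_nonneg (hw_pos _ k).le]
    calc hw (r + (t - s)) k * (‖(lam k : ℂ)‖ * ‖η s k‖)
        ≤ hw r k * ((4 * Real.pi ^ 2 * (1 + freqSq k)) * (M * (1 + freqSq k) ^ n)) := by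
          refine mul_le_mul (hw_anti (by linarith [hsm.2]) k) ?_ (by positivity) (hw_pos r k).le
          exact mul_le_mul (hlam k) (hs k) (norm_nonneg _) (by positivity)
      _ = _ := by ring
  have hmeas : ∀ k, AEStronglyMeasurable
      (fun s => (hw (r + (t - s)) k : ℂ) * ((lam k : ℂ) * η s k)) (volume.restrict (Ioc 0 t)) := by
    intro k
    have h1 : AEStronglyMeasurable (fun s => η s k) (volume.restrict (Ioc 0 t)) :=
      (h.src_meas k).mono_measure (Measure.restrict_mono
        (fun _ hs => ⟨(mem_Ioc.1 hs).1.le, (mem_Ioc.1 hs).2.trans ht.2⟩ : Ioc 0 t ⊆ Icc 0 T) le_rfl)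
    have h2 : Continuous fun s : ℝ => (hw (r + (t - s)) k : ℂ) := by unfold hw; fun_prop
    exact h2.aestronglyMeasurable.mul (h1.const_mul _)
  have hdom : Integrable (fun _ : ℝ => 4 * Real.pi ^ 2 * M) (volume.restrict (Ioc 0 t)) :=
    integrable_const _
  have hint := fseries_integral (f := fun s k => (hw (r + (t - s)) k : ℂ) * ((lam k : ℂ) * η s k))
    hdom hsum hmeas hbd x
  have hsplit : (fun k => (hw r k : ℂ) * ((lam k : ℂ) * duhamel α η t k))
      = fun k => (hw (r + t) k : ℂ) * ((lam k : ℂ) * α k)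
        + ∫ s in Ioc 0 t, (hw (r + (t - s)) k : ℂ) * ((lam k : ℂ) * η s k) := by
    funext k
    rw [duhamel_eq, intervalIntegral.integral_of_le ht.1, hw_add, mul_add, mul_add,
      ← integral_const_mul, ← integral_const_mul]
    congr 1
    · push_cast; ring
    · refine integral_congr_ae (ae_of_all _ fun s => ?_)
      simp only [hw_add]
      push_cast
      ring
  have hnb : ∀ k, ‖∫ s in Ioc 0 t, (hw (r + (t - s)) k : ℂ) * ((lam k : ℂ) * η s k)‖
      ≤ 4 * Real.pi ^ 2 * M * t * ((1 + freqSq k) ^ (n + 1) * hw r k) := fun k => by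
    refine (norm_integral_le_of_norm_le (integrable_const _) (hbd k)).trans (le_of_eq ?_)
    simp [ht.1]
    ring
  have hs2 : Summable fun k => ‖∫ s in Ioc 0 t, (hw (r + (t - s)) k : ℂ) * ((lam k : ℂ) * η s k)‖ :=
    Summable.of_nonneg_of_le (fun k => norm_nonneg _) hnb (hsum.mul_left _)
  have hs1 := hα.lam_mul.summable (s := r + t) (by linarith [ht.1])
  have e : fseries (fun k => (hw r k : ℂ) * ((lam k : ℂ) * duhamel α η t k)) x
      = fseries (fun k => (hw (r + t) k : ℂ) * ((lam k : ℂ) * α k)) x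
        + ∫ s in Ioc 0 t, fseries (fun k => (hw (r + (t - s)) k : ℂ) * ((lam k : ℂ) * η s k)) x := by
    rw [hsplit, ← hint]
    unfold fseries
    rw [← Summable.tsum_add (summable_mul_mFourier hs1 x) (summable_mul_mFourier hs2 x)]
    exact tsum_congr fun k => by ring
  rw [e]
  refine (norm_add_le _ _).trans (add_le_add (h₀ x) (norm_integral_le_of_norm_le hi ?_))
  filter_upwards [hΦ] with s hs using hs x

/-- Near a positive heat time the series converges uniformly, half of that time providing the
majorant. -/
lemma continuousOn_fseries_heat {c : ℝ → (Fin d → ℤ) → ℂ} {K : ℝ} {m : ℕ}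
    (hc : ∀ k, ContinuousOn (fun t => c t k) (Icc 0 T))
    (hK : ∀ t ∈ Icc 0 T, ∀ k, ‖c t k‖ ≤ K * (1 + freqSq k) ^ m) :
    ContinuousOn (fun z : ℝ × ℝ × Torus d => fseries (fun k => (hw z.1 k : ℂ) * c z.2.1 k) z.2.2)
      (Ioi 0 ×ˢ Icc 0 T ×ˢ univ) := by
  intro z hz
  have hz1 : 0 < z.1 := hz.1
  have key : ContinuousOn (fun z : ℝ × ℝ × Torus d =>
      fseries (fun k => (hw z.1 k : ℂ) * c z.2.1 k) z.2.2) (Ioi (z.1 / 2) ×ˢ Icc 0 T ×ˢ univ) := by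
    unfold fseries
    refine continuousOn_tsum (u := fun k => K * ((1 + freqSq k) ^ m * hw (z.1 / 2) k)) (fun k => ?_)
      ((summable_poly_mul_hw (by positivity) m).mul_left K) fun k y hy => ?_
    · have h1 : ContinuousOn (fun y : ℝ × ℝ × Torus d => c y.2.1 k)
          (Ioi (z.1 / 2) ×ˢ Icc 0 T ×ˢ univ) :=
        (hc k).comp (by fun_prop) fun y hy => hy.2.1
      have h2 : Continuous fun y : ℝ × ℝ × Torus d => (hw y.1 k : ℂ) := by unfold hw; fun_prop
      exact (h2.continuousOn.mul h1).mul (by fun_prop)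
    · rw [norm_mul, norm_mul, norm_mFourier_apply, mul_one, Complex.norm_real,
        Real.norm_of_nonneg (hw_pos _ k).le]
      have hy1 : z.1 / 2 < y.1 := hy.1
      calc hw y.1 k * ‖c y.2.1 k‖ ≤ hw (z.1 / 2) k * (K * (1 + freqSq k) ^ m) :=
            mul_le_mul (hw_anti hy1.le k) (hK _ hy.2.1 k) (norm_nonneg _) (hw_pos _ k).le
        _ = _ := by ring
  refine (key z ⟨show z.1 / 2 < z.1 by linarith, hz.2⟩).mono_of_mem_nhdsWithin ?_
  have h3 : (Ioi (z.1 / 2) ×ˢ (univ : Set (ℝ × Torus d))) ∈ 𝓝 z :=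
    prod_mem_nhds (Ioi_mem_nhds (by linarith)) univ_mem
  filter_upwards [mem_nhdsWithin_of_mem_nhds h3, self_mem_nhdsWithin] with y hy1 hy2
  exact ⟨hy1.1, hy2.2⟩

/-- Dominated convergence in `r`: each integrand is continuous for `r > 0`, and the integrable
majorant `g` handles the singularity at `r = 0`. -/
lemma continuousOn_synth {c : ℝ → (Fin d → ℤ) → ℂ} {K : ℝ} {m : ℕ}
    (hc : ∀ k, ContinuousOn (fun t => c t k) (Icc 0 T))
    (hK : ∀ t ∈ Icc 0 T, ∀ k, ‖c t k‖ ≤ K * (1 + freqSq k) ^ m) {g : ℝ → ℝ}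
    (hg : IntegrableOn g (Ioc 0 1))
    (hb : ∀ r ∈ Ioc (0 : ℝ) 1, ∀ t ∈ Icc 0 T, HeatBound (fun k => (lam k : ℂ) * c t k) r (g r)) :
    ContinuousOn (fun z : ℝ × Torus d => synth (c z.1) z.2) (Icc 0 T ×ˢ univ) := by
  have hc' : ∀ k, ContinuousOn (fun t => (lam k : ℂ) * c t k) (Icc 0 T) := fun k =>
    continuousOn_const.mul (hc k)
  have hK' : ∀ t ∈ Icc 0 T, ∀ k, ‖(lam k : ℂ) * c t k‖
      ≤ 4 * Real.pi ^ 2 * K * (1 + freqSq k) ^ (m + 1) := fun t ht k => by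
    rw [norm_mul, Complex.norm_real, Real.norm_of_nonneg (lam_nonneg k)]
    have h0 := freqSq_nonneg k
    calc lam k * ‖c t k‖ ≤ (4 * Real.pi ^ 2 * (1 + freqSq k)) * (K * (1 + freqSq k) ^ m) :=
          mul_le_mul (lam_le k) (hK t ht k) (norm_nonneg _) (by positivity)
      _ = _ := by ring
  have h1 := continuousOn_fseries_heat hc hK
  have h2 := continuousOn_fseries_heat hc' hK'
  refine ContinuousOn.add ?_ ?_
  · exact h1.comp (f := fun z : ℝ × Torus d => ((1 : ℝ), z)) (by fun_prop)
      fun z hz => ⟨show (0 : ℝ) < 1 by norm_num, hz⟩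
  · intro z hz
    refine intervalIntegral.continuousWithinAt_of_dominated_interval (bound := g) ?_ ?_ ?_ ?_
    · filter_upwards [self_mem_nhdsWithin] with y hy
      rw [uIoc_of_le zero_le_one]
      refine ContinuousOn.aestronglyMeasurable ?_ measurableSet_Ioc
      exact h2.comp (f := fun r : ℝ => (r, y)) (by fun_prop) fun r hr => ⟨hr.1, hy⟩
    · filter_upwards [self_mem_nhdsWithin] with y hy
      refine ae_of_all _ fun r hr => ?_
      rw [uIoc_of_le zero_le_one] at hr
      exact hb r hr y.1 hy.1 y.2
    · rwa [intervalIntegrable_iff_integrableOn_Ioc_of_le zero_le_one]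
    · refine ae_of_all _ fun r hr => ?_
      rw [uIoc_of_le zero_le_one] at hr
      exact h2.comp (f := fun y : ℝ × Torus d => (r, y)) (by fun_prop) (fun y hy => ⟨hr.1, hy⟩) z hz

lemma integral_lam_mul_hw (k : Fin d → ℤ) : ∫ r in (0 : ℝ)..1, lam k * hw r k = 1 - hw 1 k := by
  have h : ∀ r ∈ uIcc (0 : ℝ) 1, HasDerivAt (fun r => -hw r k) (lam k * hw r k) r := fun r _ => by
    have h1 : HasDerivAt (fun r : ℝ => -(lam k * r)) (-(lam k)) r := by
      simpa using ((hasDerivAt_id r).const_mul (lam k)).fun_neg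
    exact h1.exp.neg.congr_deriv (by unfold hw; ring)
  rw [intervalIntegral.integral_eq_sub_of_hasDerivAt h]
  · simp [hw]
    ring
  · exact Continuous.intervalIntegrable (by unfold hw; fun_prop) _ _

/-- On the mode `k` the two parts of `synth` contribute `e^{-lam k}` and `∫₀¹ lam k e^{-lam k r} dr
= 1 - e^{-lam k}`, which add up to one. -/
lemma mFourierCoeff_synth {c : (Fin d → ℤ) → ℂ} (hc : PolyGrowth c) {g : ℝ → ℝ}
    (hg : IntegrableOn g (Ioc 0 1))
    (hb : ∀ r ∈ Ioc (0 : ℝ) 1, HeatBound (fun k => (lam k : ℂ) * c k) r (g r)) (k : Fin d → ℤ) :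
    mFourierCoeff (synth c) k = c k := by
  obtain ⟨K, m, hK⟩ := hc.lam_mul
  have h2 : ContinuousOn (fun z : ℝ × Torus d =>
      fseries (fun k => (hw z.1 k : ℂ) * ((lam k : ℂ) * c k)) z.2) (Ioi 0 ×ˢ univ) := by
    have := continuousOn_fseries_heat (T := 0) (c := fun _ k => (lam k : ℂ) * c k)
      (fun k => continuousOn_const) (fun _ _ => hK)
    exact this.comp (f := fun z : ℝ × Torus d => (z.1, (0 : ℝ), z.2)) (by fun_prop)
      fun z hz => ⟨hz.1, by simp, trivial⟩
  have hmeas : AEStronglyMeasurable (fun z : ℝ × Torus d =>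
      fseries (fun k => (hw z.1 k : ℂ) * ((lam k : ℂ) * c k)) z.2)
      ((volume.restrict (Ioc (0 : ℝ) 1)).prod (torusVol d)) := by
    have h3 : (volume.restrict (Ioc (0 : ℝ) 1)).prod (torusVol d)
        = (volume.prod (torusVol d)).restrict (Ioc (0 : ℝ) 1 ×ˢ univ) := by
      rw [← Measure.prod_restrict, Measure.restrict_univ]
    rw [h3]
    exact (h2.mono (prod_mono (fun r hr => hr.1) subset_rfl)).aestronglyMeasurable
      (measurableSet_Ioc.prod MeasurableSet.univ)
  have hmem : ∀ᵐ z ∂((volume.restrict (Ioc (0 : ℝ) 1)).prod (torusVol d)), z.1 ∈ Ioc (0 : ℝ) 1 :=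
    Measure.quasiMeasurePreserving_fst.ae (ae_restrict_mem measurableSet_Ioc)
  have hint : Integrable (fun z : ℝ × Torus d =>
      fseries (fun k => (hw z.1 k : ℂ) * ((lam k : ℂ) * c k)) z.2)
      ((volume.restrict (Ioc (0 : ℝ) 1)).prod (torusVol d)) := by
    refine Integrable.mono' (g := fun z : ℝ × Torus d => g z.1)
      (Integrable.comp_fst hg (torusVol d)) hmeas ?_
    filter_upwards [hmem] with z hz using hb z.1 hz z.2
  have hint2 : Integrable (fun z : ℝ × Torus d =>
      mFourier (-k) z.2 * fseries (fun k => (hw z.1 k : ℂ) * ((lam k : ℂ) * c k)) z.2)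
      ((volume.restrict (Ioc (0 : ℝ) 1)).prod (torusVol d)) :=
    hint.bdd_mul (c := 1) ((mFourier (-k)).continuous.comp continuous_snd).aestronglyMeasurable
      (ae_of_all _ fun z => (norm_mFourier_apply _ _).le)
  have hs1 := hc.summable (s := 1) one_pos
  have e1 : synth c = fun x => fseries (fun k => (hw 1 k : ℂ) * c k) x
      + ∫ r in Ioc (0 : ℝ) 1, fseries (fun k => (hw r k : ℂ) * ((lam k : ℂ) * c k)) x := by
    funext x
    rw [synth, intervalIntegral.integral_of_le zero_le_one]
  rw [e1, mFourierCoeff_add (memLp_one_iff_integrable.1 (memLp_of_continuous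
    (continuous_fseries hs1) 1)) hint.integral_prod_right, mFourierCoeff_fseries hs1]
  have e2 : mFourierCoeff (fun x => ∫ r in Ioc (0 : ℝ) 1,
      fseries (fun k => (hw r k : ℂ) * ((lam k : ℂ) * c k)) x) k
      = ∫ r in Ioc (0 : ℝ) 1, (hw r k : ℂ) * ((lam k : ℂ) * c k) := by
    rw [mFourierCoeff_eq]
    simp_rw [← integral_const_mul]
    rw [← integral_integral_swap (f := fun r x => mFourier (-k) x *
      fseries (fun k => (hw r k : ℂ) * ((lam k : ℂ) * c k)) x) hint2]
    refine setIntegral_congr_fun measurableSet_Ioc fun r hr => ?_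
    have := mFourierCoeff_fseries (hc.lam_mul.summable hr.1) k
    rwa [mFourierCoeff_eq] at this
  rw [e2]
  have e3 : ∫ r in Ioc (0 : ℝ) 1, (hw r k : ℂ) * ((lam k : ℂ) * c k)
      = ((∫ r in (0 : ℝ)..1, lam k * hw r k : ℝ) : ℂ) * c k := by
    rw [intervalIntegral.integral_of_le zero_le_one, ← integral_complex_ofReal,
      ← integral_mul_const]
    refine integral_congr_ae (ae_of_all _ fun r => ?_)
    simp only
    push_cast
    ring
  rw [e3, integral_lam_mul_hw]
  push_cast
  ring

lemma fseries_shift_sub {a : (Fin d → ℤ) → ℂ} (ha : Summable fun k => ‖a k‖) (x h : Torus d) :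
    fseries a (x + h) - fseries a x = fseries (fun k => (mFourier k h - 1) * a k) x := by
  unfold fseries
  rw [← Summable.tsum_sub (summable_mul_mFourier ha (x + h)) (summable_mul_mFourier ha x)]
  refine tsum_congr fun k => ?_
  rw [mFourier_apply_add]
  ring

lemma norm_synth_shift_sub_le {c : (Fin d → ℤ) → ℂ} (hc : PolyGrowth c) {g g' : ℝ → ℝ}
    (hg : IntegrableOn g (Ioc 0 1))
    (hb : ∀ r ∈ Ioc (0 : ℝ) 1, HeatBound (fun k => (lam k : ℂ) * c k) r (g r)) (x h : Torus d)
    {K : ℝ} (hK : HeatBound (fun k => (mFourier k h - 1) * c k) 1 K)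
    (hg' : IntegrableOn g' (Ioc 0 1))
    (hb' : ∀ r ∈ Ioc (0 : ℝ) 1,
      HeatBound (fun k => (lam k : ℂ) * ((mFourier k h - 1) * c k)) r (g' r)) :
    ‖synth c (x + h) - synth c x‖ ≤ K + ∫ r in Ioc (0 : ℝ) 1, g' r := by
  obtain ⟨Kc, m, hKc⟩ := hc.lam_mul
  have hi : ∀ x, IntegrableOn (fun r => fseries (fun k => (hw r k : ℂ) * ((lam k : ℂ) * c k)) x)
      (Ioc 0 1) := fun x => by
    refine Integrable.mono' hg (ContinuousOn.aestronglyMeasurable ?_ measurableSet_Ioc) ?_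
    · have := continuousOn_fseries_heat (T := 0) (c := fun _ k => (lam k : ℂ) * c k)
        (fun k => continuousOn_const) (fun _ _ => hKc)
      exact this.comp (f := fun r : ℝ => (r, (0 : ℝ), x)) (by fun_prop)
        fun z hz => ⟨hz.1, by simp, trivial⟩
    · filter_upwards [ae_restrict_mem measurableSet_Ioc] with r hr using hb r hr x
  have e : synth c (x + h) - synth c x
      = fseries (fun k => (hw 1 k : ℂ) * ((mFourier k h - 1) * c k)) x
        + ∫ r in Ioc (0 : ℝ) 1,
          fseries (fun k => (hw r k : ℂ) * ((lam k : ℂ) * ((mFourier k h - 1) * c k))) x := by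
    unfold synth
    rw [intervalIntegral.integral_of_le zero_le_one, intervalIntegral.integral_of_le zero_le_one,
      add_sub_add_comm, fseries_shift_sub (hc.summable one_pos), ← integral_sub (hi _) (hi _)]
    congr 1
    · unfold fseries
      exact tsum_congr fun k => by ring
    · refine setIntegral_congr_fun measurableSet_Ioc fun r hr => ?_
      rw [fseries_shift_sub (hc.lam_mul.summable hr.1)]
      unfold fseries
      exact tsum_congr fun k => by ring
  rw [e]
  refine (norm_add_le _ _).trans (add_le_add (hK x) (norm_integral_le_of_norm_le hg' ?_))
  filter_upwards [ae_restrict_mem measurableSet_Ioc] with r hr using hb' r hr x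

end Duhamel

/-! ### Heat bounds for the data of the limit fluid equation -/

/-- On bounded times a weak singularity is dominated by a stronger one, so that all bounds can be
stated with the single exponent `μ`. -/
lemma rpow_neg_le_mul {τ S c c' : ℝ} (hτ : 0 < τ) (hτS : τ ≤ S) (hS : 1 ≤ S) (hc : 0 ≤ c)
    (hcc : c ≤ c') : τ ^ (-c) ≤ S ^ c' * τ ^ (-c') := by
  have h1 : τ ^ (-c) = τ ^ (c' - c) * τ ^ (-c') := by
    rw [← Real.rpow_add hτ]; congr 1; ring
  rw [h1]
  refine mul_le_mul_of_nonneg_right ?_ (by positivity)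
  calc τ ^ (c' - c) ≤ S ^ (c' - c) := Real.rpow_le_rpow hτ.le hτS (by linarith)
    _ ≤ S ^ c' := Real.rpow_le_rpow_of_exponent_le hS (by linarith)

lemma norm_shift_symbol_le (y : Torus d) (k : Fin d → ℤ) : ‖mFourier k y - 1‖ ≤ 2 := by
  refine (norm_sub_le _ _).trans ?_
  rw [norm_mFourier_apply, norm_one]
  norm_num

lemma dsyms_cons (l : Fin d) (L : List (Fin d)) (k : Fin d → ℤ) :
    dsyms (l :: L) k = dsym l k * dsyms L k := by
  simp [dsyms]

lemma heatBound_dsyms_fourierVec {p : ℝ} (hp1 : 1 < p) (hp : (d : ℝ) < p) {g : Torus d → E d}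
    (hg : MemLp g (ENNReal.ofReal p) (torusVol d)) {M : ℝ} (hM : 0 < M)
    (hgM : eLpNorm g (ENNReal.ofReal p) (torusVol d) ≤ ENNReal.ofReal M) (j : Fin d)
    (L : List (Fin d)) (hL : L.length ≤ 3) {s : ℝ} (hs : 0 < s) :
    HeatBound (fun k => dsyms L k * fourierVec g k j) s
      ((2 * gaussAbs d) ^ L.length * 16 * M * s ^ (-(L.length / 2) : ℝ)
        * (1 + s ^ (-(d / (2 * p)) : ℝ))) := by
  have h1 := heatBound_fourierVec hp1 hp hg hM hgM j (show 0 < s / 4 by positivity)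
  have h2 := HeatBound.dsyms (polyGrowth_mFourierCoeff _) hs h1 L hL
  refine h2.mono ?_
  have hp0 : 0 < p := by linarith
  have hb1 : (d : ℝ) / (2 * p) ≤ 1 := by
    rw [div_le_one (by positivity)]; linarith
  have h4 : (s / 4) ^ (-(d / (2 * p)) : ℝ) ≤ 4 * s ^ (-(d / (2 * p)) : ℝ) := by
    rw [div_eq_mul_inv, Real.mul_rpow hs.le (by norm_num), mul_comm]
    refine mul_le_mul_of_nonneg_right ?_ (by positivity)
    rw [Real.inv_rpow (by norm_num), ← Real.rpow_neg (by norm_num), neg_neg]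
    calc (4 : ℝ) ^ ((d : ℝ) / (2 * p)) ≤ 4 ^ (1 : ℝ) :=
          Real.rpow_le_rpow_of_exponent_le (by norm_num) hb1
      _ = 4 := Real.rpow_one _
  have hG := gaussAbs_nonneg (d := d)
  set X := s ^ (-(d / (2 * p)) : ℝ)
  have hX : 0 ≤ X := by positivity
  calc (2 * gaussAbs d) ^ L.length * s ^ (-(L.length / 2) : ℝ)
        * (4 * (1 + (s / 4) ^ (-(d / (2 * p)) : ℝ)) * M)
      ≤ (2 * gaussAbs d) ^ L.length * s ^ (-(L.length / 2) : ℝ) * (4 * (4 * (1 + X)) * M) := by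
        gcongr; linarith
    _ = _ := by ring

lemma polyGrowth_fourierVec (g : Torus d → E d) (j : Fin d) :
    PolyGrowth fun k => fourierVec g k j := polyGrowth_mFourierCoeff _

/-- The initial velocity is `(I - Δ)^{-γ/2} g` with `g ∈ L^p`. The surplus `γ/2 - d/(2p)` makes the
two derivatives of `-Δ` cost strictly less than `τ^{-1}` when `δ > 0`, hence integrable in `τ`. -/
lemma exists_init_heatBound {p γ S μ δ : ℝ} (hp1 : 1 < p) (hp : (d : ℝ) < p)
    (hγ : (d : ℝ) / p < γ) (hS : 1 ≤ S) (hδ0 : 0 ≤ δ) (hδ1 : δ ≤ 1)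
    (hδ : δ + (d : ℝ) / (2 * p) < γ / 2) (hμ1 : 1 - δ ≤ μ) (hμ2 : 3 / 4 ≤ μ)
    {u₀ : Torus d → E d} (hu : besselENorm γ (ENNReal.ofReal p) u₀ < ∞) :
    Integrable u₀ (torusVol d) ∧ ∃ K : ℝ, 0 ≤ K ∧ ∀ (i : Fin d) (τ : ℝ), 0 < τ → τ ≤ S →
      HeatBound (fun k => (lam k : ℂ) * mildInit u₀ i k) τ (K * τ ^ (-μ)) ∧
      ∀ y : E d, HeatBound (fun k => (lam k : ℂ) * ((mFourier k (proj y) - 1) * mildInit u₀ i k)) τ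
        (K * (∑ l, |y l|) * τ ^ (-(2 * μ))) := by
  unfold besselENorm at hu
  obtain ⟨g, hu⟩ := iInf_lt_iff.1 hu
  obtain ⟨⟨hi, hg, hk⟩, hlt⟩ := iInf_lt_iff.1 hu
  refine ⟨hi, ?_⟩
  have hp0 : 0 < p := by linarith
  have hγ0 : 0 < γ := lt_of_le_of_lt (by positivity) hγ
  have hb : (d : ℝ) / (2 * p) < γ / 2 := by linarith
  obtain ⟨M, hM, hgM⟩ : ∃ M : ℝ, 0 < M ∧
      eLpNorm g (ENNReal.ofReal p) (torusVol d) ≤ ENNReal.ofReal M := by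
    refine ⟨(eLpNorm g (ENNReal.ofReal p) (torusVol d)).toReal + 1, by positivity, ?_⟩
    rw [ENNReal.ofReal_add ENNReal.toReal_nonneg zero_le_one, ENNReal.ofReal_toReal hlt.ne]
    exact le_self_add
  have hcoef := fun j => congrFun (bessel_coeff_eq hk j)
  have hpu := polyGrowth_fourierVec u₀
  -- Two derivatives, `τ^{-1}`, improved by the gain `δ` to `τ^{-(1-δ)}`.
  obtain ⟨C₁, hC₁, h₁⟩ := HeatBound.bessel (d := d) (m := 1) (δ := δ) hγ0 hδ0 hδ1
    (show (0 : ℝ) ≤ d / (2 * p) by positivity) hδ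
  -- Three derivatives, the third one for the translation difference. No gain is needed here because
  -- `3/2 ≤ 2μ`.
  obtain ⟨C₂, hC₂, h₂⟩ := HeatBound.bessel (d := d) (m := 3 / 2) (δ := 0) hγ0 le_rfl (by norm_num)
    (show (0 : ℝ) ≤ d / (2 * p) by positivity) (by simpa using hb)
  have hG := gaussAbs_nonneg (d := d)
  have hμ0 : 0 ≤ μ := by linarith
  set K₁ := C₁ * ((2 * gaussAbs d) ^ 2 * 16 * M) with hK₁
  set K₂ := C₂ * ((2 * gaussAbs d) ^ 3 * 16 * M) with hK₂
  have hK₁0 : 0 ≤ K₁ := by positivity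
  have hK₂0 : 0 ≤ K₂ := by positivity
  have b₁ : ∀ (a c j : Fin d) (τ : ℝ), 0 < τ →
      HeatBound (fun k => dsyms [a, c] k * fourierVec u₀ k j) τ (K₁ * τ ^ (-(1 - δ))) := by
    intro a c j τ hτ
    have := h₁ (fun k => dsyms [a, c] k * fourierVec g k j)
      ((polyGrowth_fourierVec g j).dsyms_mul _) ((2 * gaussAbs d) ^ 2 * 16 * M) (by positivity)
      (fun s hs => by
        have := heatBound_dsyms_fourierVec hp1 hp hg hM hgM j [a, c] (by simp) hs
        simpa using this) τ hτ
    have e : (fun k => dsyms [a, c] k * fourierVec u₀ k j)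
        = fun k => (((1 + freqSq k) ^ (-(γ / 2)) : ℝ) : ℂ) * (dsyms [a, c] k * fourierVec g k j) := by
      funext k
      rw [hcoef j k]
      ring
    rw [e]
    exact this
  have b₂ : ∀ (l a c j : Fin d) (τ : ℝ), 0 < τ →
      HeatBound (fun k => dsym l k * (dsyms [a, c] k * fourierVec u₀ k j)) τ
        (K₂ * τ ^ (-(3 / 2) : ℝ)) := by
    intro l a c j τ hτ
    have := h₂ (fun k => dsyms [l, a, c] k * fourierVec g k j)
      ((polyGrowth_fourierVec g j).dsyms_mul _) ((2 * gaussAbs d) ^ 3 * 16 * M) (by positivity)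
      (fun s hs => by
        have := heatBound_dsyms_fourierVec hp1 hp hg hM hgM j [l, a, c] (by simp) hs
        simpa using this) τ hτ
    have e : (fun k => dsym l k * (dsyms [a, c] k * fourierVec u₀ k j))
        = fun k => (((1 + freqSq k) ^ (-(γ / 2)) : ℝ) : ℂ)
          * (dsyms [l, a, c] k * fourierVec g k j) := by
      funext k
      rw [hcoef j k, dsyms_cons l]
      ring
    rw [e]
    simpa using this
  refine ⟨2 * d * (K₁ * S ^ μ) + 2 * d * (K₂ * S ^ (2 * μ)), by positivity,
    fun i τ hτ hτS => ⟨?_, fun y => ?_⟩⟩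
  · refine (heatBound_lam_leray hpu hτ (fun a c j => b₁ a c j τ hτ) i).mono ?_
    have h3 := rpow_neg_le_mul hτ hτS hS (show 0 ≤ 1 - δ by linarith) hμ1
    calc 2 * d * (K₁ * τ ^ (-(1 - δ))) ≤ 2 * d * (K₁ * (S ^ μ * τ ^ (-μ))) := by gcongr
      _ = 2 * d * (K₁ * S ^ μ) * τ ^ (-μ) := by ring
      _ ≤ _ := by
        refine mul_le_mul_of_nonneg_right (le_add_of_nonneg_right ?_) ?_ <;> positivity
  · have hpe : ∀ j, PolyGrowth fun k => (mFourier k (proj y) - 1) * fourierVec u₀ k j := fun j =>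
      (hpu j).bdd_mul (norm_shift_symbol_le (proj y))
    have hY : 0 ≤ ∑ l, |y l| := Finset.sum_nonneg fun _ _ => abs_nonneg _
    have h3 := heatBound_lam_leray hpe hτ (M := (∑ l, |y l|) * (K₂ * τ ^ (-(3 / 2) : ℝ)))
      (fun a c j => by
        have := HeatBound.shift ((hpu j).dsyms_mul [a, c]) hτ (fun l => b₂ l a c j τ hτ) y
        have e : (fun k => dsyms [a, c] k * ((mFourier k (proj y) - 1) * fourierVec u₀ k j))
          = fun k => (mFourier k (proj y) - 1) * (dsyms [a, c] k * fourierVec u₀ k j) := by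
            funext k; ring
        rw [e]
        exact this) i
    have e : (fun k => (lam k : ℂ) * ((mFourier k (proj y) - 1) * mildInit u₀ i k))
        = fun k => (lam k : ℂ) * ∑ j, (lerayMat k i j : ℂ) *
          ((mFourier k (proj y) - 1) * fourierVec u₀ k j) := by
      funext k
      unfold mildInit
      rw [Finset.mul_sum]
      congr 1
      exact Finset.sum_congr rfl fun j _ => by ring
    rw [e]
    refine h3.mono ?_
    have h4 := rpow_neg_le_mul hτ hτS hS (show (0 : ℝ) ≤ 3 / 2 by norm_num)
      (show 3 / 2 ≤ 2 * μ by linarith)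
    calc 2 * d * ((∑ l, |y l|) * (K₂ * τ ^ (-(3 / 2) : ℝ)))
        ≤ 2 * d * ((∑ l, |y l|) * (K₂ * (S ^ (2 * μ) * τ ^ (-(2 * μ))))) := by gcongr
      _ = 2 * d * (K₂ * S ^ (2 * μ)) * (∑ l, |y l|) * τ ^ (-(2 * μ)) := by ring
      _ ≤ _ := by
        refine mul_le_mul_of_nonneg_right (mul_le_mul_of_nonneg_right
          (le_add_of_nonneg_left ?_) hY) ?_ <;> positivity

lemma polyGrowth_flux {N : Fin d → Fin d → (Fin d → ℤ) → ℂ} (hN : ∀ l j, PolyGrowth (N l j))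
    {f : Fin d → (Fin d → ℤ) → ℂ} (hf : ∀ j, PolyGrowth (f j)) (j : Fin d) :
    PolyGrowth fun k => ∑ l, dsym l k * N l j k + f j k :=
  (PolyGrowth.sum _ fun l _ => (hN l j).dsym_mul l).add (hf j)

lemma heatBound_lam_leraySrc {N : Fin d → Fin d → (Fin d → ℤ) → ℂ}
    (hN : ∀ l j, PolyGrowth (N l j)) {f : Fin d → (Fin d → ℤ) → ℂ} (hf : ∀ j, PolyGrowth (f j))
    {τ MN Mf : ℝ} (hτ : 0 < τ) (h₁ : ∀ l j, HeatBound (N l j) (τ / 4) MN)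
    (h₂ : ∀ a c j, HeatBound (fun k => dsyms [a, c] k * f j k) τ Mf) (i : Fin d) :
    HeatBound (fun k => (lam k : ℂ) * leraySrc N f i k) τ
      (2 * d * (d * ((2 * gaussAbs d) ^ 3 * τ ^ (-(3 / 2) : ℝ) * MN) + Mf)) := by
  refine heatBound_lam_leray (polyGrowth_flux hN hf) hτ (fun a c j => ?_) i
  have e : (fun k => dsyms [a, c] k * (∑ l, dsym l k * N l j k + f j k))
      = fun k => ∑ l, dsyms [a, c, l] k * N l j k + dsyms [a, c] k * f j k := by
    funext k
    rw [mul_add, Finset.mul_sum]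
    congr 1
    refine Finset.sum_congr rfl fun l _ => ?_
    simp only [dsyms_cons]
    simp [dsyms]
    ring
  rw [e]
  have h3 : HeatBound (fun k => ∑ l, dsyms [a, c, l] k * N l j k) τ
      (∑ _l : Fin d, (2 * gaussAbs d) ^ 3 * τ ^ (-(3 / 2) : ℝ) * MN) :=
    HeatBound.sum _ (fun l _ => (hN l j).dsyms_mul _) hτ fun l _ => by
      have := HeatBound.dsyms (hN l j) hτ (h₁ l j) [a, c, l] (by simp)
      simpa using this
  refine (HeatBound.add (PolyGrowth.sum _ fun l _ => (hN l j).dsyms_mul _) ((hf j).dsyms_mul _) hτ h3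
    (h₂ a c j)).mono (le_of_eq ?_)
  simp

/-- Count of derivatives after applying `-Δ`: the flux bears three and costs `τ^{-3/2}`. The drag
bears two, and a third when it is translated, costing at most `τ^{-3/2 - d/(2p)}`; this fixes the
lower bound on `μ`. A translation of the flux is measured by the size of its own difference rather
than by a fourth derivative, which would be too singular. -/
lemma exists_src_heatBound {p S μ Cf : ℝ} (hp1 : 1 < p) (hp : (d : ℝ) < p) (hS : 1 ≤ S)
    (hμ : 3 / 4 + (d : ℝ) / (2 * p) / 2 ≤ μ) (hCf : 0 < Cf) :
    ∃ K : ℝ, 0 ≤ K ∧ ∀ (N : Fin d → Fin d → (Fin d → ℤ) → ℂ) (g : Torus d → E d),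
      (∀ l j, PolyGrowth (N l j)) → MemLp g (ENNReal.ofReal p) (torusVol d) →
      eLpNorm g (ENNReal.ofReal p) (torusVol d) ≤ ENNReal.ofReal Cf →
      ∀ (i : Fin d) (τ : ℝ), 0 < τ → τ ≤ S →
      (∀ MN : ℝ, 0 ≤ MN → (∀ l j s, 0 < s → HeatBound (N l j) s MN) →
        HeatBound (fun k => (lam k : ℂ) * leraySrc N (fun j k => fourierVec g k j) i k) τ
          (K * (MN + 1) * τ ^ (-(2 * μ)))) ∧
      (∀ (y : E d) (MN : ℝ), 0 ≤ MN →
        (∀ l j s, 0 < s → HeatBound (fun k => (mFourier k (proj y) - 1) * N l j k) s MN) →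
        HeatBound (fun k => (lam k : ℂ) * ((mFourier k (proj y) - 1) *
          leraySrc N (fun j k => fourierVec g k j) i k)) τ
          (K * (MN + ∑ l, |y l|) * τ ^ (-(2 * μ)))) := by
  have hp0 : 0 < p := by linarith
  have hb0 : 0 ≤ (d : ℝ) / (2 * p) := by positivity
  set b := (d : ℝ) / (2 * p) with hb
  have hG := gaussAbs_nonneg (d := d)
  set G := 2 * gaussAbs d with hGdef
  have hG0 : 0 ≤ G := by positivity
  set K := 2 * d * (d * G ^ 3 + 2 * ((G ^ 2 + G ^ 3) * 16 * Cf)) * S ^ (2 * μ) with hK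
  have hd : (0 : ℝ) ≤ d := Nat.cast_nonneg d
  have hK0 : 0 ≤ K := by positivity
  refine ⟨K, hK0, fun N g hN hg hgC i τ hτ hτS => ?_⟩
  have hpg := polyGrowth_fourierVec g
  have r32 := rpow_neg_le_mul hτ hτS hS (show (0 : ℝ) ≤ 3 / 2 by norm_num)
    (show 3 / 2 ≤ 2 * μ by linarith)
  have r1 := rpow_neg_le_mul hτ hτS hS (show (0 : ℝ) ≤ 1 by norm_num)
    (show 1 ≤ 2 * μ by linarith)
  have r1b := rpow_neg_le_mul hτ hτS hS (show (0 : ℝ) ≤ 1 + b by linarith)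
    (show 1 + b ≤ 2 * μ by linarith)
  have r32b := rpow_neg_le_mul hτ hτS hS (show (0 : ℝ) ≤ 3 / 2 + b by linarith)
    (show 3 / 2 + b ≤ 2 * μ by linarith)
  set X := S ^ (2 * μ) * τ ^ (-(2 * μ)) with hX
  have hX0 : 0 ≤ X := by positivity
  have w2 : τ ^ (-1 : ℝ) * (1 + τ ^ (-b)) ≤ 2 * X := by
    rw [mul_add, mul_one, ← Real.rpow_add hτ, ← neg_add]
    linarith
  have w3 : τ ^ (-(3 / 2) : ℝ) * (1 + τ ^ (-b)) ≤ 2 * X := by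
    rw [mul_add, mul_one, ← Real.rpow_add hτ, ← neg_add]
    linarith
  have f2 : ∀ a c j, HeatBound (fun k => dsyms [a, c] k * fourierVec g k j) τ
      (G ^ 2 * 16 * Cf * (2 * X)) := fun a c j => by
    refine (heatBound_dsyms_fourierVec hp1 hp hg hCf hgC j [a, c] (by simp) hτ).mono ?_
    have e : (-(([a, c] : List (Fin d)).length / 2) : ℝ) = -1 := by norm_num
    rw [e, mul_assoc]
    exact mul_le_mul_of_nonneg_left w2 (by positivity)
  have f3 : ∀ l a c j, HeatBound (fun k => dsym l k * (dsyms [a, c] k * fourierVec g k j)) τ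
      (G ^ 3 * 16 * Cf * (2 * X)) := fun l a c j => by
    have e0 : (fun k => dsym l k * (dsyms [a, c] k * fourierVec g k j))
        = fun k => dsyms [l, a, c] k * fourierVec g k j := by
      funext k; rw [dsyms_cons l, mul_assoc]
    rw [e0]
    refine (heatBound_dsyms_fourierVec hp1 hp hg hCf hgC j [l, a, c] (by simp) hτ).mono ?_
    have e : (-(([l, a, c] : List (Fin d)).length / 2) : ℝ) = -(3 / 2) := by norm_num
    rw [e, mul_assoc]
    exact mul_le_mul_of_nonneg_left w3 (by positivity)
  refine ⟨fun MN hMN hNb => ?_, fun y MN hMN hNb => ?_⟩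
  · refine (heatBound_lam_leraySrc hN hpg hτ (fun l j => hNb l j _ (by positivity)) f2 i).mono ?_
    calc 2 * d * (d * (G ^ 3 * τ ^ (-(3 / 2) : ℝ) * MN) + G ^ 2 * 16 * Cf * (2 * X))
        ≤ 2 * d * (d * (G ^ 3 * X * (MN + 1)) + (G ^ 2 + G ^ 3) * 16 * Cf * (2 * X) * (MN + 1)) := by
          gcongr 2 * d * (d * (G ^ 3 * ?_ * ?_) + ?_)
          · linarith
          · calc G ^ 2 * 16 * Cf * (2 * X) ≤ (G ^ 2 + G ^ 3) * 16 * Cf * (2 * X) := by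
                  gcongr
                  exact le_add_of_nonneg_right (by positivity)
              _ ≤ _ := le_mul_of_one_le_right (by positivity) (by linarith)
      _ = _ := by rw [hK, hX]; ring
  · have hY : 0 ≤ ∑ l, |y l| := Finset.sum_nonneg fun _ _ => abs_nonneg _
    set Y := ∑ l, |y l| with hYdef
    have hNe : ∀ l j, PolyGrowth fun k => (mFourier k (proj y) - 1) * N l j k := fun l j =>
      (hN l j).bdd_mul (norm_shift_symbol_le (proj y))
    have hge : ∀ j, PolyGrowth fun k => (mFourier k (proj y) - 1) * fourierVec g k j := fun j =>
      (hpg j).bdd_mul (norm_shift_symbol_le (proj y))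
    have fe : ∀ a c j, HeatBound (fun k => dsyms [a, c] k *
        ((mFourier k (proj y) - 1) * fourierVec g k j)) τ (Y * (G ^ 3 * 16 * Cf * (2 * X))) := by
      intro a c j
      have := HeatBound.shift ((hpg j).dsyms_mul [a, c]) hτ (fun l => f3 l a c j) y
      have e : (fun k => dsyms [a, c] k * ((mFourier k (proj y) - 1) * fourierVec g k j))
          = fun k => (mFourier k (proj y) - 1) * (dsyms [a, c] k * fourierVec g k j) := by
        funext k; ring
      rw [e]
      exact this
    have h3 := heatBound_lam_leraySrc hNe hge hτ (fun l j => hNb l j _ (by positivity)) fe i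
    have e : (fun k => (lam k : ℂ) * ((mFourier k (proj y) - 1) *
          leraySrc N (fun j k => fourierVec g k j) i k))
        = fun k => (lam k : ℂ) * leraySrc (fun l j k => (mFourier k (proj y) - 1) * N l j k)
          (fun j k => (mFourier k (proj y) - 1) * fourierVec g k j) i k := by
      funext k
      unfold leraySrc
      rw [Finset.mul_sum]
      congr 1
      refine Finset.sum_congr rfl fun j _ => ?_
      have : ∑ l, dsym l k * ((mFourier k (proj y) - 1) * N l j k)
          = (mFourier k (proj y) - 1) * ∑ l, dsym l k * N l j k := by
        rw [Finset.mul_sum]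
        exact Finset.sum_congr rfl fun l _ => by ring
      rw [this]
      ring
    rw [e]
    refine h3.mono ?_
    calc 2 * d * (d * (G ^ 3 * τ ^ (-(3 / 2) : ℝ) * MN) + Y * (G ^ 3 * 16 * Cf * (2 * X)))
        ≤ 2 * d * (d * (G ^ 3 * X * (MN + Y)) + (MN + Y) * ((G ^ 2 + G ^ 3) * 16 * Cf * (2 * X))) := by
          gcongr 2 * d * (d * (G ^ 3 * ?_ * ?_) + ?_ * (?_ * 16 * Cf * (2 * X)))
          · linarith
          · linarith
          · exact le_add_of_nonneg_left (by positivity)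
      _ = _ := by rw [hK, hX]; ring

/-! ### The coefficients of the limit velocity -/

lemma mFourierCoeff_shift (f : Torus d → ℂ) (h : Torus d) (k : Fin d → ℤ) :
    mFourierCoeff (fun x => f (x + h)) k = mFourier k h * mFourierCoeff f k := by
  rw [mFourierCoeff_eq, mFourierCoeff_eq]
  have h1 := integral_add_right_eq_self (μ := torusVol d)
    (fun x => mFourier (-k) (x - h) * f x) h
  simp only [add_sub_cancel_right] at h1
  rw [h1, ← integral_const_mul]
  refine integral_congr_ae (ae_of_all _ fun x => ?_)
  simp only
  rw [sub_eq_add_neg, mFourier_apply_add]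
  have : mFourier (-k) (-h) = mFourier k h := by
    simp [mFourier, Pi.neg_apply, fourier_apply]
  rw [this]
  ring

/-- The multiplier is that of a translation difference, so any a.e. bound on the difference of
values is a bound at all heat times. -/
lemma heatBound_shift_sub {f : Torus d → ℂ} (hf : Integrable f (torusVol d)) {h : Torus d} {M : ℝ}
    (hM : ∀ᵐ x ∂(torusVol d), ‖f (x + h) - f x‖ ≤ M) {s : ℝ} (hs : 0 < s) :
    HeatBound (fun k => (mFourier k h - 1) * mFourierCoeff f k) s M := by
  have hfh : Integrable (fun x => f (x + h)) (torusVol d) := hf.comp_add_right h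
  have e : (fun k => (mFourier k h - 1) * mFourierCoeff f k)
      = mFourierCoeff (fun x => f (x + h) - f x) := by
    funext k
    have h1 : mFourierCoeff (fun x => f (x + h) - f x) k
        = mFourierCoeff (fun x => f (x + h)) k - mFourierCoeff f k := by
      simp only [mFourierCoeff_eq, mul_sub]
      exact integral_sub (Integrable.mFourier_mul hfh _) (Integrable.mFourier_mul hf _)
    rw [h1, mFourierCoeff_shift]
    ring
  rw [e]
  exact heatBound_of_bounded (hfh.sub hf).1 hM hs

/-- The force in the mild formula of the limit velocity. -/
def limitForce (u : ℝ → Torus d → E d) (F : ℝ → Torus d → E d → ℝ) (i : Fin d) (s : ℝ)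
    (k : Fin d → ℤ) : ℂ :=
  -leraySrc (fluxCoeff (u s)) (fun j k => fourierVec (dragField (u s) (F s)) k j) i k

lemma norm_fourierVec_le {p C : ℝ} (hp1 : 1 < p) {g : Torus d → E d}
    (hg : MemLp g (ENNReal.ofReal p) (torusVol d)) (hC : 0 ≤ C)
    (hgC : eLpNorm g (ENNReal.ofReal p) (torusVol d) ≤ ENNReal.ofReal C) (k : Fin d → ℤ)
    (j : Fin d) : ‖fourierVec g k j‖ ≤ C := by
  have h1 : (1 : ℝ≥0∞) ≤ ENNReal.ofReal p := by
    rw [← ENNReal.ofReal_one]; exact ENNReal.ofReal_le_ofReal hp1.le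
  have hg1 : Integrable g (torusVol d) := memLp_one_iff_integrable.1 (hg.mono_exponent h1)
  refine (norm_mFourierCoeff_le _ _).trans ?_
  calc ∫ x, ‖((g x j : ℝ) : ℂ)‖ ∂(torusVol d) ≤ ∫ x, ‖g x‖ ∂(torusVol d) := by
        refine integral_mono_of_nonneg (ae_of_all _ fun x => norm_nonneg _) hg1.norm
          (ae_of_all _ fun x => ?_)
        simp only [Complex.norm_real]
        exact abs_coord_le _ _
    _ ≤ C := by
        rw [integral_norm_eq_lintegral_enorm hg1.1, ← eLpNorm_one_eq_lintegral_enorm]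
        refine ENNReal.toReal_le_of_le_ofReal hC ?_
        exact (eLpNorm_le_eLpNorm_of_exponent_le h1 hg.1).trans hgC

/-- The properties of the initial velocity `α` and the force `η` in Duhamel's formula for the limit
velocity `u` that are needed for its regularity. -/
structure FluidRegularityData (T μ K M S : ℝ) (u : ℝ → Torus d → E d)
    (α : Fin d → (Fin d → ℤ) → ℂ) (η : Fin d → ℝ → (Fin d → ℤ) → ℂ) : Prop where
  mu_ge : 3 / 4 ≤ μ
  mu_lt : μ < 1
  K_nonneg : 0 ≤ K
  S_ge : 1 + T ≤ S
  data : ∀ i, DuhamelData T M 1 (α i) (η i)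
  mild : ∀ᵐ t ∂(volume.restrict (Icc 0 T)), ∀ i k, fourierVec (u t) k i = duhamel (α i) (η i) t k
  init : ∀ (i : Fin d) (τ : ℝ), 0 < τ → τ ≤ S →
    HeatBound (fun k => (lam k : ℂ) * α i k) τ (K * τ ^ (-μ)) ∧
    ∀ y : E d, HeatBound (fun k => (lam k : ℂ) * ((mFourier k (proj y) - 1) * α i k)) τ
      (K * (∑ l, |y l|) * τ ^ (-(2 * μ)))
  force : ∀ᵐ s ∂(volume.restrict (Icc 0 T)), ∀ (i : Fin d) (τ : ℝ), 0 < τ → τ ≤ S →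
    HeatBound (fun k => (lam k : ℂ) * η i s k) τ (K * τ ^ (-(2 * μ))) ∧
    ∀ (y : E d) (MN : ℝ), 0 ≤ MN → (∀ l j, ∀ᵐ x ∂(torusVol d),
      |u s (x + proj y) l * u s (x + proj y) j - u s x l * u s x j| ≤ MN) →
      HeatBound (fun k => (lam k : ℂ) * ((mFourier k (proj y) - 1) * η i s k)) τ
        (K * (MN + ∑ l, |y l|) * τ ^ (-(2 * μ)))

lemma exists_fluidRegularityData {T p γ σ A : ℝ} {k₀ : ℕ} {u₀ : Torus d → E d}
    {F₀ : Torus d → E d → ℝ} {u : ℝ → Torus d → E d} {F : ℝ → Torus d → E d → ℝ}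
    (hT : 0 < T) (hp1 : 1 < p) (hp : (d : ℝ) < p) (hγ : (d : ℝ) / p < γ) (hγ1 : γ < 1)
    (hW : IsWeakSolution T σ u₀ F₀ u F) (hpde : PDEAssumptions T p γ k₀ u₀ F₀ u) (hA0 : 0 ≤ A)
    (hA : ∀ᵐ z ∂((volume.restrict (Icc 0 T)).prod (torusVol d)), ‖u z.1 z.2‖ ≤ A) :
    ∃ μ K M, FluidRegularityData T μ K M (1 + T) u (mildInit u₀) (limitForce u F) := by
  have hp0 : 0 < p := by linarith
  set b := (d : ℝ) / (2 * p) with hb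
  have hb0 : 0 ≤ b := by positivity
  have hγb : b < γ / 2 := by
    calc b = (d / p) / 2 := by rw [hb]; field_simp
      _ < γ / 2 := by linarith
  have hb2 : b < 1 / 2 := by linarith
  set δ := (γ / 2 - b) / 2 with hδ
  have hδ0 : 0 < δ := by linarith
  have hδ1 : δ ≤ 1 := by linarith
  -- The first entry is dictated by the translated drag, the second by the initial velocity. Both
  -- are below `1` since `b < γ/2 < 1/2` and `δ > 0`.
  set μ := max (3 / 4 + b / 2) (1 - δ) with hμ
  have hμ34 : 3 / 4 + b / 2 ≤ μ := le_max_left _ _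
  have hμδ : 1 - δ ≤ μ := le_max_right _ _
  have hμ1 : μ < 1 := max_lt (by linarith) (by linarith)
  obtain ⟨Cf, hCf, hdrag⟩ := exists_drag_bound hT hp hp1.le hW hpde hA0 hA
  obtain ⟨hu₀i, K₁, hK₁, hinit⟩ := exists_init_heatBound hp1 hp hγ (show 1 ≤ 1 + T by linarith)
    hδ0.le hδ1 (by linarith : δ + (d : ℝ) / (2 * p) < γ / 2) hμδ (by linarith) hpde.u_init.2
  obtain ⟨K₂, hK₂, hsrc⟩ := exists_src_heatBound (d := d) hp1 hp (show 1 ≤ 1 + T by linarith) hμ34 hCf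
  have hslice := slices_of_bounded hW.meas_u hA
  set K := K₁ + K₂ * (A * A + 1) with hK
  have hK0 : 0 ≤ K := by positivity
  set B₀ := ∫ x, ‖u₀ x‖ ∂(torusVol d) with hB₀
  have hB₀0 : 0 ≤ B₀ := integral_nonneg fun _ => norm_nonneg _
  set M := d * (2 * B₀) + d * (2 * (d * (2 * Real.pi * (A * A)) + Cf)) with hM
  have hd : (0 : ℝ) ≤ d := Nat.cast_nonneg d
  have hle1 : ∀ k : Fin d → ℤ, 1 ≤ (1 + freqSq k) := fun k => by linarith [freqSq_nonneg k]
  have hbounds : ∀ᵐ s ∂(volume.restrict (Icc 0 T)),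
      (∀ l j, Integrable (fun x => ((u s x l * u s x j : ℝ) : ℂ)) (torusVol d)) ∧
      (∀ l j, ∀ᵐ x ∂(torusVol d), ‖((u s x l * u s x j : ℝ) : ℂ)‖ ≤ A * A) := by
    filter_upwards [hslice] with s hs
    refine ⟨fun l j => (integrable_mul_coord hs.1 hs.2.1 l j).ofReal, fun l j => ?_⟩
    filter_upwards [hs.2.1] with x hx
    rw [Complex.norm_real, norm_mul]
    exact mul_le_mul ((abs_coord_le _ _).trans hx) ((abs_coord_le _ _).trans hx) (norm_nonneg _) hA0
  refine ⟨μ, K, M, by linarith, hμ1, hK0, le_rfl, fun i => ⟨fun k => ?_, ?_, fun k => ?_⟩, ?_, ?_, ?_⟩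
  · unfold mildInit
    have h1 : ‖∑ j, (lerayMat k i j : ℂ) * fourierVec u₀ k j‖ ≤ d * (2 * B₀) := by
      refine (norm_sum_le _ _).trans ?_
      calc ∑ j, ‖(lerayMat k i j : ℂ) * fourierVec u₀ k j‖ ≤ ∑ _j : Fin d, 2 * B₀ := by
            refine Finset.sum_le_sum fun j _ => ?_
            rw [norm_mul, Complex.norm_real]
            refine mul_le_mul (abs_lerayMat_le k i j) ?_ (norm_nonneg _) (by norm_num)
            refine (norm_mFourierCoeff_le _ _).trans ?_
            refine integral_mono_of_nonneg (ae_of_all _ fun x => norm_nonneg _) hu₀i.norm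
              (ae_of_all _ fun x => ?_)
            simp only [Complex.norm_real]
            exact abs_coord_le _ _
        _ = _ := by simp
    calc _ ≤ d * (2 * B₀) := h1
      _ ≤ M := le_add_of_nonneg_right (by positivity)
      _ ≤ M * (1 + freqSq k) ^ 1 := by
        rw [pow_one]; exact le_mul_of_one_le_right (by positivity) (hle1 k)
  · filter_upwards [hbounds, hdrag] with s hs hds k
    have hds' : MemLp (dragField (u s) (F s)) (ENNReal.ofReal p) (torusVol d) :=
      ⟨hds.1, hds.2.trans_lt ENNReal.ofReal_lt_top⟩
    unfold limitForce leraySrc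
    rw [norm_neg]
    have h0 := hle1 k
    refine (norm_sum_le _ _).trans ?_
    calc _ ≤ ∑ _j : Fin d, 2 * ((d * (2 * Real.pi * (A * A)) + Cf) * (1 + freqSq k)) := by
          refine Finset.sum_le_sum fun j _ => ?_
          rw [norm_mul, Complex.norm_real]
          refine mul_le_mul (abs_lerayMat_le k i j) ?_ (norm_nonneg _) (by norm_num)
          refine (norm_add_le _ _).trans ?_
          have h2 : ‖∑ l, dsym l k * fluxCoeff (u s) l j k‖
              ≤ ∑ _l : Fin d, 2 * Real.pi * (1 + freqSq k) * (A * A) := by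
            refine (norm_sum_le _ _).trans (Finset.sum_le_sum fun l _ => ?_)
            rw [norm_mul]
            refine mul_le_mul (norm_dsym_le l k) ?_ (norm_nonneg _) (by positivity)
            refine (norm_mFourierCoeff_le _ _).trans ?_
            refine (integral_mono_ae (hs.1 l j).norm (integrable_const (A * A)) (hs.2 l j)).trans ?_
            simp
          have h3 := norm_fourierVec_le hp1 hds' hCf.le hds.2 k j
          simp only [Finset.sum_const, Finset.card_univ, Fintype.card_fin, nsmul_eq_mul] at h2
          have h4 : Cf ≤ Cf * (1 + freqSq k) := le_mul_of_one_le_right hCf.le h0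
          linarith
      _ = (d * (2 * (d * (2 * Real.pi * (A * A)) + Cf))) * (1 + freqSq k) ^ 1 := by
          simp only [Finset.sum_const, Finset.card_univ, Fintype.card_fin, nsmul_eq_mul, pow_one]
          ring
      _ ≤ _ := by
          refine mul_le_mul_of_nonneg_right (le_add_of_nonneg_left (by positivity)) (by positivity)
  · unfold limitForce leraySrc
    have h1 : ∀ l j, AEStronglyMeasurable (fun s => fluxCoeff (u s) l j k)
        (volume.restrict (Icc 0 T)) := fun l j =>
      (integrableOn_mFourierCoeff (g := fun s x => ((u s x l * u s x j : ℝ) : ℂ))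
        (integrable_of_bounded_velocity (q := fun v : E d => v l * v j) (K := A * A) hW.meas_u hA
          (by fun_prop) fun v hv => by
          rw [abs_mul]
          exact mul_le_mul ((abs_coord_le _ _).trans hv) ((abs_coord_le _ _).trans hv)
            (abs_nonneg _) hA0) k).1
    have h2 : ∀ j, AEStronglyMeasurable (fun s => fourierVec (dragField (u s) (F s)) k j)
        (volume.restrict (Icc 0 T)) := fun j => by
      have h3 : Integrable (fun z : ℝ × Torus d => dragField (u z.1) (F z.1) z.2 j)
          ((volume.restrict (Icc 0 T)).prod (torusVol d)) :=
        (EuclideanSpace.proj j : E d →L[ℝ] ℝ).integrable_comp (integrable_dragField hW hA)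
      exact (integrableOn_mFourierCoeff (g := fun s x => ((dragField (u s) (F s) x j : ℝ) : ℂ))
        h3.ofReal k).1
    refine AEStronglyMeasurable.neg ?_
    exact Finset.aestronglyMeasurable_fun_sum _ fun j _ =>
      AEStronglyMeasurable.const_mul ((Finset.aestronglyMeasurable_fun_sum _ fun l _ =>
        (h1 l j).const_mul _).add (h2 j)) _
  · exact mild_formula hT hW hA0 hA hu₀i
  · intro i τ hτ hτS
    have hKK : K₁ ≤ K := le_add_of_nonneg_right (by positivity)
    have hτp : 0 ≤ τ ^ (-(2 * μ)) := by positivity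
    refine ⟨(hinit i τ hτ hτS).1.mono (by gcongr), fun y => ((hinit i τ hτ hτS).2 y).mono ?_⟩
    gcongr
  · filter_upwards [hbounds, hdrag, hslice] with s hs hds hsl i τ hτ hτS
    have hds' : MemLp (dragField (u s) (F s)) (ENNReal.ofReal p) (torusVol d) :=
      ⟨hds.1, hds.2.trans_lt ENNReal.ofReal_lt_top⟩
    have h := hsrc (fluxCoeff (u s)) (dragField (u s) (F s))
      (fun l j => polyGrowth_mFourierCoeff _) hds' hds.2 i τ hτ hτS
    refine ⟨?_, fun y MN hMN hN => ?_⟩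
    · have h1 := h.1 (A * A) (by positivity) fun l j s' hs' =>
        heatBound_of_bounded (hs.1 l j).1 (hs.2 l j) hs'
      have h2 := h1.const_mul (-1)
      have e : (fun k => (lam k : ℂ) * limitForce u F i s k)
          = fun k => -1 * ((lam k : ℂ) * leraySrc (fluxCoeff (u s))
            (fun j k => fourierVec (dragField (u s) (F s)) k j) i k) := by
        funext k; unfold limitForce; ring
      rw [e]
      refine h2.mono ?_
      rw [norm_neg, norm_one, one_mul]
      exact mul_le_mul_of_nonneg_right (le_add_of_nonneg_left hK₁) (by positivity)
    · have h1 := h.2 y MN hMN fun l j s' hs' => by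
        refine heatBound_shift_sub (hs.1 l j) ?_ hs'
        filter_upwards [hN l j] with x hx
        rw [← Complex.ofReal_sub, Complex.norm_real]
        exact hx
      have h2 := h1.const_mul (-1)
      have e : (fun k => (lam k : ℂ) * ((mFourier k (proj y) - 1) * limitForce u F i s k))
          = fun k => -1 * ((lam k : ℂ) * ((mFourier k (proj y) - 1) * leraySrc (fluxCoeff (u s))
            (fun j k => fourierVec (dragField (u s) (F s)) k j) i k)) := by
        funext k; unfold limitForce; ring
      rw [e]
      refine h2.mono ?_
      rw [norm_neg, norm_one, one_mul]
      have hY : 0 ≤ ∑ l, |y l| := Finset.sum_nonneg fun _ _ => abs_nonneg _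
      have hKK : K₂ ≤ K := by
        have : K₂ ≤ K₂ * (A * A + 1) := le_mul_of_one_le_right hK₂ (by nlinarith)
        linarith
      gcongr

/-! ### The continuous representative of the limit velocity -/

lemma integral_sub_rpow {t ν : ℝ} (ht : 0 ≤ t) (hν : ν < 1) :
    IntegrableOn (fun s => (t - s) ^ (-ν)) (Ioc 0 t) ∧
      ∫ s in Ioc 0 t, (t - s) ^ (-ν) = t ^ (1 - ν) / (1 - ν) := by
  have h1 : IntervalIntegrable (fun s : ℝ => s ^ (-ν)) volume 0 t :=
    intervalIntegral.intervalIntegrable_rpow' (by linarith)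
  have h2 := (h1.comp_sub_left t).symm
  simp only [sub_zero, sub_self] at h2
  refine ⟨(intervalIntegrable_iff_integrableOn_Ioc_of_le ht).1 h2, ?_⟩
  rw [← intervalIntegral.integral_of_le ht,
    intervalIntegral.integral_comp_sub_left (fun s : ℝ => s ^ (-ν)) t]
  simp only [sub_zero, sub_self]
  rw [integral_rpow (Or.inl (by linarith)), Real.zero_rpow (by linarith), sub_zero,
    show -ν + 1 = 1 - ν by ring]

lemma integral_rpow_neg {t ν : ℝ} (ht : 0 ≤ t) (hν : ν < 1) :
    IntegrableOn (fun s => s ^ (-ν)) (Ioc 0 t) ∧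
      ∫ s in Ioc 0 t, s ^ (-ν) = t ^ (1 - ν) / (1 - ν) := by
  have h1 : IntervalIntegrable (fun s : ℝ => s ^ (-ν)) volume 0 t :=
    intervalIntegral.intervalIntegrable_rpow' (by linarith)
  refine ⟨(intervalIntegrable_iff_integrableOn_Ioc_of_le ht).1 h1, ?_⟩
  rw [← intervalIntegral.integral_of_le ht, integral_rpow (Or.inl (by linarith)),
    Real.zero_rpow (by linarith), sub_zero, show -ν + 1 = 1 - ν by ring]

/-- The singularity is shared equally between the heat variable `r` and the time lag `τ`, each power
`-μ` being integrable on its own. This is the reason for normalising the force bounds with exponent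
`2μ`. -/
lemma add_rpow_neg_two_mul_le {r τ μ : ℝ} (hr : 0 < r) (hτ : 0 < τ) (hμ : 0 ≤ μ) :
    (r + τ) ^ (-(2 * μ)) ≤ r ^ (-μ) * τ ^ (-μ) := by
  have e : (r + τ) ^ (-(2 * μ)) = (r + τ) ^ (-μ) * (r + τ) ^ (-μ) := by
    rw [← Real.rpow_add (by positivity)]; congr 1; ring
  rw [e]
  exact mul_le_mul (Real.rpow_le_rpow_of_nonpos hr (by linarith) (by linarith))
    (Real.rpow_le_rpow_of_nonpos hτ (by linarith) (by linarith)) (by positivity) (by positivity)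

lemma exp_neg_le_rpow_neg {x ε : ℝ} (hx : 0 < x) (hε0 : 0 ≤ ε) (hε1 : ε ≤ 1) :
    Real.exp (-x) ≤ x ^ (-ε) := by
  rw [Real.exp_neg, Real.rpow_neg hx.le]
  refine inv_anti₀ (by positivity) ?_
  have h1 : x ^ ε ≤ 1 + x := by
    rcases le_total x 1 with h | h
    · exact (Real.rpow_le_one hx.le h hε0).trans (by linarith)
    · calc x ^ ε ≤ x ^ (1 : ℝ) := Real.rpow_le_rpow_of_exponent_le h hε1
        _ ≤ 1 + x := by rw [Real.rpow_one]; linarith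
  linarith [Real.add_one_le_exp x]

/-- A majorant for the weighted singular kernel in the Lipschitz estimate. -/
lemma exists_kernel_majorant {T t μ ν Λ : ℝ} (ht : 0 < t) (htT : t ≤ T) (hμ : 0 ≤ μ) (hμν : μ ≤ ν)
    (hν : ν < 1) (hΛ : 0 < Λ) : ∃ κ : ℝ → ℝ, IntegrableOn κ (Ioc 0 t) ∧
      (∀ s, 0 < s → s < t → s ^ (-μ) * Real.exp (Λ * s) * (t - s) ^ (-μ) ≤ κ s) ∧
      ∫ s in Ioc 0 t, κ s ≤ (T ^ (1 - ν) * (2 ^ μ / (1 - ν) + 2 ^ ν / (1 - μ))) * Λ ^ (-(ν - μ))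
        * (Real.exp (Λ * t) * t ^ (-μ)) := by
  obtain ⟨i1, e1⟩ := integral_sub_rpow ht.le hν
  obtain ⟨i2, e2⟩ := integral_rpow_neg ht.le (show μ < 1 by linarith)
  refine ⟨fun s => Real.exp (Λ * t) * Λ ^ (-(ν - μ)) * ((t / 2) ^ (-μ) * (t - s) ^ (-ν)
    + (t / 2) ^ (-ν) * s ^ (-μ)), ((i1.const_mul _).add (i2.const_mul _)).const_mul _, ?_, ?_⟩
  · intro s hs hst
    have hτ : 0 < t - s := by linarith
    -- Part of the decay `e^{-Λ(t-s)}` is traded for a slightly worse singularity `(t-s)^{-ν}`; the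
    -- reward is the factor `Λ^{-(ν-μ)}`, small for large `Λ` if `ν > μ`.
    have h1 : Real.exp (Λ * s) ≤ Real.exp (Λ * t) * (Λ ^ (-(ν - μ)) * (t - s) ^ (-(ν - μ))) := by
      have h2 := exp_neg_le_rpow_neg (x := Λ * (t - s)) (by positivity) (show 0 ≤ ν - μ by linarith)
        (by linarith)
      rw [Real.mul_rpow hΛ.le hτ.le] at h2
      calc Real.exp (Λ * s) = Real.exp (Λ * t) * Real.exp (-(Λ * (t - s))) := by
            rw [← Real.exp_add]; congr 1; ring
        _ ≤ _ := mul_le_mul_of_nonneg_left h2 (Real.exp_pos _).le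
    have h3 : (t - s) ^ (-(ν - μ)) * (t - s) ^ (-μ) = (t - s) ^ (-ν) := by
      rw [← Real.rpow_add hτ]; congr 1; ring
    -- On either side of `t/2` only one of the two singularities is active; the other factor is
    -- frozen at `t/2`.
    have h4 : s ^ (-μ) * (t - s) ^ (-ν)
        ≤ (t / 2) ^ (-μ) * (t - s) ^ (-ν) + (t / 2) ^ (-ν) * s ^ (-μ) := by
      rcases le_total (t / 2) s with h | h
      · refine (mul_le_mul_of_nonneg_right (Real.rpow_le_rpow_of_nonpos (by positivity) h
          (by linarith)) (by positivity)).trans (le_add_of_nonneg_right (by positivity))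
      · rw [mul_comm (s ^ (-μ))]
        refine (mul_le_mul_of_nonneg_right (Real.rpow_le_rpow_of_nonpos (by positivity)
          (show t / 2 ≤ t - s by linarith) (by linarith)) (by positivity)).trans
          (le_add_of_nonneg_left (by positivity))
    calc s ^ (-μ) * Real.exp (Λ * s) * (t - s) ^ (-μ)
        ≤ s ^ (-μ) * (Real.exp (Λ * t) * (Λ ^ (-(ν - μ)) * (t - s) ^ (-(ν - μ)))) * (t - s) ^ (-μ) := by
          gcongr
      _ = Real.exp (Λ * t) * Λ ^ (-(ν - μ)) * (s ^ (-μ) * (t - s) ^ (-ν)) := by rw [← h3]; ring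
      _ ≤ _ := mul_le_mul_of_nonneg_left h4 (by positivity)
  · rw [integral_const_mul, integral_add (i1.const_mul _) (i2.const_mul _), integral_const_mul,
      integral_const_mul, e1, e2]
    have hd1 : ∀ c : ℝ, (t / 2) ^ (-c) = t ^ (-c) * 2 ^ c := fun c => by
      rw [Real.div_rpow ht.le (by norm_num), Real.rpow_neg (x := (2 : ℝ)) (by norm_num), div_inv_eq_mul]
    have h6 : t ^ (-ν) * t ^ (1 - μ) = t ^ (-μ) * t ^ (1 - ν) := by
      rw [← Real.rpow_add ht, ← Real.rpow_add ht]; congr 1; ring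
    have h7 : t ^ (1 - ν) ≤ T ^ (1 - ν) := Real.rpow_le_rpow ht.le htT (by linarith)
    have h1ν : 0 < 1 - ν := by linarith
    have h1μ : 0 < 1 - μ := by linarith
    calc Real.exp (Λ * t) * Λ ^ (-(ν - μ)) * ((t / 2) ^ (-μ) * (t ^ (1 - ν) / (1 - ν))
          + (t / 2) ^ (-ν) * (t ^ (1 - μ) / (1 - μ)))
        = Real.exp (Λ * t) * Λ ^ (-(ν - μ)) * ((t ^ (-μ) * t ^ (1 - ν)) * 2 ^ μ / (1 - ν)
          + (t ^ (-ν) * t ^ (1 - μ)) * 2 ^ ν / (1 - μ)) := by rw [hd1, hd1]; ring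
      _ = t ^ (1 - ν) * (2 ^ μ / (1 - ν) + 2 ^ ν / (1 - μ)) * Λ ^ (-(ν - μ))
          * (Real.exp (Λ * t) * t ^ (-μ)) := by rw [h6]; ring
      _ ≤ _ := by gcongr

section Regularity

variable {T μ K M S : ℝ} {u : ℝ → Torus d → E d} {α : Fin d → (Fin d → ℤ) → ℂ}
  {η : Fin d → ℝ → (Fin d → ℤ) → ℂ}

/-- The field synthesised from Duhamel's formula. -/
def duhamelField (α : Fin d → (Fin d → ℤ) → ℂ) (η : Fin d → ℝ → (Fin d → ℤ) → ℂ) (t : ℝ)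
    (x : Torus d) : E d :=
  WithLp.toLp 2 fun j => (synth (duhamel (α j) (η j) t) x).re

/-- Insert the force bound at heat time `r + (t - s)`, split the singularity, and integrate
`(t-s)^{-μ}` over time; the remaining `r^{-μ}` is what `synth` can integrate. -/
lemma FluidRegularityData.heatBound (h : FluidRegularityData T μ K M S u α η) (i : Fin d) :
    ∀ r ∈ Ioc (0 : ℝ) 1, ∀ t ∈ Icc 0 T,
      HeatBound (fun k => (lam k : ℂ) * duhamel (α i) (η i) t k) r
        (K * (1 + T ^ (1 - μ) / (1 - μ)) * r ^ (-μ)) := by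
  intro r hr t ht
  have hμ0 : 0 ≤ μ := by linarith [h.mu_ge]
  have h1μ : 0 < 1 - μ := by linarith [h.mu_lt]
  have hK := h.K_nonneg
  have hS := h.S_ge
  obtain ⟨i1, e1⟩ := integral_sub_rpow ht.1 h.mu_lt
  have hr0 : 0 < r := hr.1
  have key := (h.data i).heatBound (Φ₀ := K * r ^ (-μ))
    (Φ := fun s => K * r ^ (-μ) * (t - s) ^ (-μ)) ht hr0 ?_ ?_ (i1.const_mul _)
  · refine key.mono ?_
    rw [integral_const_mul, e1]
    have : t ^ (1 - μ) ≤ T ^ (1 - μ) := Real.rpow_le_rpow ht.1 ht.2 h1μ.le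
    calc K * r ^ (-μ) + K * r ^ (-μ) * (t ^ (1 - μ) / (1 - μ))
        ≤ K * r ^ (-μ) + K * r ^ (-μ) * (T ^ (1 - μ) / (1 - μ)) := by gcongr
      _ = _ := by ring
  · refine (h.init i (r + t) (by linarith [ht.1]) (by linarith [hr.2, ht.2])).1.mono ?_
    exact mul_le_mul_of_nonneg_left (Real.rpow_le_rpow_of_nonpos hr0 (by linarith [ht.1])
      (by linarith)) hK
  · have hne : ∀ᵐ s ∂(volume.restrict (Ioc 0 t)), s ≠ t :=
      ae_restrict_of_ae (Measure.ae_ne volume t)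
    filter_upwards [ae_Ioc_of_ae_Icc h.force ht.2, ae_restrict_mem measurableSet_Ioc, hne]
      with s hs hsm hst
    have hτ : 0 < t - s := by
      have := lt_of_le_of_ne hsm.2 hst
      linarith
    refine (hs i (r + (t - s)) (by linarith) (by linarith [hr.2, ht.2, hsm.1])).1.mono ?_
    rw [mul_assoc]
    exact mul_le_mul_of_nonneg_left (add_rpow_neg_two_mul_le hr0 hτ hμ0) hK

lemma FluidRegularityData.integrable_bound (h : FluidRegularityData T μ K M S u α η) (c : ℝ) :
    IntegrableOn (fun r : ℝ => c * r ^ (-μ)) (Ioc 0 1) :=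
  (integral_rpow_neg zero_le_one h.mu_lt).1.const_mul c

lemma FluidRegularityData.continuousOn (h : FluidRegularityData T μ K M S u α η) :
    ContinuousOn (fun z : ℝ × Torus d => duhamelField α η z.1 z.2) (Icc 0 T ×ˢ univ) := by
  have h1 : ContinuousOn (fun z : ℝ × Torus d => fun j : Fin d =>
      (synth (duhamel (α j) (η j) z.1) z.2).re) (Icc 0 T ×ˢ univ) :=
    continuousOn_pi.2 fun j => Complex.continuous_re.comp_continuousOn
      (continuousOn_synth (fun k => (h.data j).continuousOn k)
        (fun t ht k => (h.data j).norm_le ht k) (h.integrable_bound _) (h.heatBound j))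
  exact (PiLp.continuous_toLp 2 _).comp_continuousOn h1

lemma continuous_slice {V : Type*} [TopologicalSpace V] {w : ℝ → Torus d → V}
    (hw : ContinuousOn (fun z : ℝ × Torus d => w z.1 z.2) (Icc 0 T ×ˢ univ)) {t : ℝ}
    (ht : t ∈ Icc 0 T) : Continuous (w t) := by
  rw [← continuousOn_univ]
  exact hw.comp (f := fun x : Torus d => (t, x)) (by fun_prop) fun x _ => ⟨ht, trivial⟩

lemma FluidRegularityData.continuous_synth (h : FluidRegularityData T μ K M S u α η) (j : Fin d)
    {t : ℝ} (ht : t ∈ Icc 0 T) : Continuous (synth (duhamel (α j) (η j) t)) :=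
  continuous_slice (w := fun t x => synth (duhamel (α j) (η j) t) x)
    (continuousOn_synth (fun k => (h.data j).continuousOn k)
      (fun _ ht k => (h.data j).norm_le ht k) (h.integrable_bound _) (h.heatBound j)) ht

lemma FluidRegularityData.ae_eq (h : FluidRegularityData T μ K M S u α η) {A : ℝ}
    (hu : AEStronglyMeasurable (fun z : ℝ × Torus d => u z.1 z.2)
      ((volume.restrict (Icc 0 T)).prod (torusVol d)))
    (hA : ∀ᵐ z ∂((volume.restrict (Icc 0 T)).prod (torusVol d)), ‖u z.1 z.2‖ ≤ A) :
    ∀ᵐ t ∂(volume.restrict (Icc 0 T)), u t =ᵐ[torusVol d] duhamelField α η t := by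
  filter_upwards [h.mild, slices_of_bounded hu hA, ae_restrict_mem measurableSet_Icc]
    with t hm hs ht
  have key : ∀ j, ∀ᵐ x ∂(torusVol d), ((u t x j : ℝ) : ℂ) = synth (duhamel (α j) (η j) t) x := by
    intro j
    refine ae_eq_of_mFourierCoeff_eq ?_ (memLp_of_continuous (h.continuous_synth j ht) 2) ?_
    · refine MemLp.of_bound (C := A) ((by fun_prop : Continuous fun v : E d =>
        ((v j : ℝ) : ℂ)).comp_aestronglyMeasurable hs.1) ?_
      filter_upwards [hs.2.1] with x hx
      rw [Complex.norm_real]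
      exact (abs_coord_le _ _).trans hx
    · intro k
      rw [mFourierCoeff_synth ((h.data j).polyGrowth ht) (h.integrable_bound _)
        (fun r hr => h.heatBound j r hr t ht), ← hm j k]
      rfl
  filter_upwards [ae_all_iff.2 key] with x hx
  ext j
  simp only [duhamelField]
  rw [← hx j, Complex.ofReal_re]

lemma ae_prod_eq_of_ae_slices {w : ℝ → Torus d → E d}
    (hu : AEStronglyMeasurable (fun z : ℝ × Torus d => u z.1 z.2)
      ((volume.restrict (Icc 0 T)).prod (torusVol d)))
    (hw : ContinuousOn (fun z : ℝ × Torus d => w z.1 z.2) (Icc 0 T ×ˢ univ))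
    (h : ∀ᵐ t ∂(volume.restrict (Icc 0 T)), u t =ᵐ[torusVol d] w t) :
    ∀ᵐ z ∂((volume.restrict (Icc 0 T)).prod (torusVol d)), u z.1 z.2 = w z.1 z.2 := by
  have hw' : AEStronglyMeasurable (fun z : ℝ × Torus d => w z.1 z.2)
      ((volume.restrict (Icc 0 T)).prod (torusVol d)) := by
    have h3 : (volume.restrict (Icc 0 T)).prod (torusVol d)
        = (volume.prod (torusVol d)).restrict (Icc 0 T ×ˢ univ) := by
      rw [← Measure.prod_restrict, Measure.restrict_univ]
    rw [h3]
    exact hw.aestronglyMeasurable (measurableSet_Icc.prod MeasurableSet.univ)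
  have hm : AEMeasurable (fun z : ℝ × Torus d => ‖u z.1 z.2 - w z.1 z.2‖ₑ)
      ((volume.restrict (Icc 0 T)).prod (torusVol d)) := (hu.sub hw').enorm
  have h0 : ∫⁻ z, ‖u z.1 z.2 - w z.1 z.2‖ₑ ∂((volume.restrict (Icc 0 T)).prod (torusVol d)) = 0 := by
    rw [lintegral_prod _ hm]
    rw [lintegral_congr_ae (g := fun _ => 0), lintegral_zero]
    filter_upwards [h] with t ht
    rw [lintegral_congr_ae (g := fun _ => 0), lintegral_zero]
    filter_upwards [ht] with x hx
    simp [hx]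
  rw [lintegral_eq_zero_iff' hm] at h0
  filter_upwards [h0] with z hz
  simpa [sub_eq_zero] using hz

lemma FluidRegularityData.isContinuousRep (h : FluidRegularityData T μ K M S u α η) {A : ℝ}
    (hu : AEStronglyMeasurable (fun z : ℝ × Torus d => u z.1 z.2)
      ((volume.restrict (Icc 0 T)).prod (torusVol d)))
    (hA : ∀ᵐ z ∂((volume.restrict (Icc 0 T)).prod (torusVol d)), ‖u z.1 z.2‖ ≤ A) :
    IsContinuousRep T u (duhamelField α η) :=
  ⟨h.continuousOn, ae_prod_eq_of_ae_slices hu h.continuousOn (h.ae_eq hu hA)⟩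

lemma IsContinuousRep.ae_slices {w : ℝ → Torus d → E d} (hw : IsContinuousRep T u w) :
    ∀ᵐ t ∂(volume.restrict (Icc 0 T)), u t =ᵐ[torusVol d] w t :=
  Measure.ae_ae_of_ae_prod hw.2

/-- Two continuous functions equal almost everywhere agree everywhere on the closed cylinder. The
Lipschitz bound, proved for the synthesised field, thus holds for every continuous representative.
-/
lemma IsContinuousRep.eqOn {w w' : ℝ → Torus d → E d} (hT : 0 < T) (hw : IsContinuousRep T u w)
    (hw' : IsContinuousRep T u w') {t : ℝ} (ht : t ∈ Icc 0 T) (x : Torus d) : w t x = w' t x := by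
  have h1 : ∀ᵐ t ∂(volume.restrict (Icc 0 T)), w t x = w' t x := by
    filter_upwards [hw.ae_slices, hw'.ae_slices, ae_restrict_mem measurableSet_Icc] with t h1 h2 ht
    have := eq_of_ae_eq_torus (continuous_slice hw.1 ht) (continuous_slice hw'.1 ht)
      (h1.symm.trans h2)
    exact congrFun this x
  have hc : ∀ {w : ℝ → Torus d → E d}, IsContinuousRep T u w →
      ContinuousOn (fun t => w t x) (Icc 0 T) := fun hw =>
    hw.1.comp (f := fun t : ℝ => (t, x)) (by fun_prop) fun t ht => ⟨ht, trivial⟩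
  exact Measure.eqOn_Icc_of_ae_eq volume hT.ne h1 (hc hw) (hc hw') ht

lemma IsContinuousRep.norm_le {w : ℝ → Torus d → E d} (hw : IsContinuousRep T u w) {A : ℝ}
    (hA : ∀ᵐ z ∂((volume.restrict (Icc 0 T)).prod (torusVol d)), ‖u z.1 z.2‖ ≤ A) :
    ∀ᵐ t ∂(volume.restrict (Icc 0 T)), ∀ x, ‖w t x‖ ≤ A := by
  filter_upwards [hw.ae_slices, Measure.ae_ae_of_ae_prod hA, ae_restrict_mem measurableSet_Icc]
    with t h1 h2 ht
  refine le_of_ae_le_torus (continuous_slice hw.1 ht).norm ?_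
  filter_upwards [h1, h2] with x hx1 hx2
  rwa [← hx1]

end Regularity

/-! ### Lipschitz bound in space by a weighted absorption argument. -/

section Lipschitz

variable {T μ K M S : ℝ} {u : ℝ → Torus d → E d} {α : Fin d → (Fin d → ℤ) → ℂ}
  {η : Fin d → ℝ → (Fin d → ℤ) → ℂ}

/-- After heat time `1` polynomial growth of the coefficients already gives a bounded gradient,
uniformly in `t`, so the low-frequency part of `synth` is harmless. -/
lemma DuhamelData.exists_low_frequency_bound (h : ∀ i, DuhamelData T M 1 (α i) (η i)) :
    ∃ C : ℝ, 0 ≤ C ∧ ∀ t ∈ Icc 0 T, ∀ (i : Fin d) (y : E d),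
      HeatBound (fun k => (mFourier k (proj y) - 1) * duhamel (α i) (η i) t k) 1
        ((∑ l, |y l|) * C) := by
  have hs := (summable_poly_mul_hw (d := d) one_pos 2).mul_left (2 * Real.pi * |M * (1 + T)|)
  refine ⟨∑' k : Fin d → ℤ, 2 * Real.pi * |M * (1 + T)| * ((1 + freqSq k) ^ 2 * hw 1 k),
    tsum_nonneg fun k => ?_, fun t ht i y => ?_⟩
  · have := freqSq_nonneg k
    have := hw_pos 1 k
    positivity
  · refine HeatBound.shift ((h i).polyGrowth ht) one_pos (fun l x => ?_) y
    have hle : ∀ k, ‖(hw 1 k : ℂ) * (dsym l k * duhamel (α i) (η i) t k)‖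
        ≤ 2 * Real.pi * |M * (1 + T)| * ((1 + freqSq k) ^ 2 * hw 1 k) := by
      intro k
      have h0 := freqSq_nonneg k
      have h1 := hw_pos 1 k
      rw [norm_mul, norm_mul, Complex.norm_real, Real.norm_of_nonneg h1.le]
      have h2 := (h i).norm_le ht k
      have h3 := norm_dsym_le l k
      have h4 : M * (1 + T) ≤ |M * (1 + T)| := le_abs_self _
      calc hw 1 k * (‖dsym l k‖ * ‖duhamel (α i) (η i) t k‖)
          ≤ hw 1 k * ((2 * Real.pi * (1 + freqSq k)) * (|M * (1 + T)| * (1 + freqSq k) ^ 1)) := by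
            refine mul_le_mul_of_nonneg_left (mul_le_mul h3 (h2.trans ?_) (norm_nonneg _)
              (by positivity)) h1.le
            gcongr
        _ = _ := by ring
    have hs' := Summable.of_nonneg_of_le (fun k => norm_nonneg _) hle hs
    exact (norm_fseries_le hs' x).trans (hs'.tsum_le_tsum hle hs)

lemma abs_mul_sub_mul_le {a b a' b' A D : ℝ} (hb : |b| ≤ A) (ha' : |a'| ≤ A) (h1 : |a - a'| ≤ D)
    (h2 : |b - b'| ≤ D) : |a * b - a' * b'| ≤ 2 * A * D := by
  have hA : 0 ≤ A := (abs_nonneg _).trans hb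
  have hD : 0 ≤ D := (abs_nonneg _).trans h1
  calc |a * b - a' * b'| = |(a - a') * b + a' * (b - b')| := by congr 1; ring
    _ ≤ |a - a'| * |b| + |a'| * |b - b'| := by
        rw [← abs_mul, ← abs_mul]; exact abs_add_le _ _
    _ ≤ D * A + A * D := by gcongr
    _ = _ := by ring

/-- One turn of the bootstrap. An assumed weighted bound `R` on the translation difference re-enters
through the flux, multiplied by `Λ^{-(ν-μ)}`; the initial value and the drag contribute multiples of
`∑ l, |y l|` that do not involve `R`. -/
lemma FluidRegularityData.shift_heatBound (h : FluidRegularityData T μ K M S u α η) {A : ℝ}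
    (hA0 : 0 ≤ A)
    (hu : ∀ᵐ s ∂(volume.restrict (Icc 0 T)), u s =ᵐ[torusVol d] duhamelField α η s)
    (hA : ∀ᵐ s ∂(volume.restrict (Icc 0 T)), ∀ x, ‖duhamelField α η s x‖ ≤ A)
    {y : E d} {R Λ ν : ℝ} (hR : 0 ≤ R) (hΛ : 0 < Λ) (hμν : μ ≤ ν) (hν : ν < 1)
    (hD : ∀ s, 0 < s → s ≤ T → ∀ x, ‖duhamelField α η s (x + proj y) - duhamelField α η s x‖
      ≤ R * (s ^ (-μ) * Real.exp (Λ * s)))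
    {t : ℝ} (ht : t ∈ Ioc 0 T) (i : Fin d) {r : ℝ} (hr : r ∈ Ioc (0 : ℝ) 1) :
    HeatBound (fun k => (lam k : ℂ) * ((mFourier k (proj y) - 1) * duhamel (α i) (η i) t k)) r
      (K * ((∑ l, |y l|) * t ^ (-μ)
        + 2 * A * R * ((T ^ (1 - ν) * (2 ^ μ / (1 - ν) + 2 ^ ν / (1 - μ))) * Λ ^ (-(ν - μ))
          * (Real.exp (Λ * t) * t ^ (-μ)))
        + (∑ l, |y l|) * (T ^ (1 - μ) / (1 - μ))) * r ^ (-μ)) := by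
  have hμ0 : 0 ≤ μ := by linarith [h.mu_ge]
  have h1μ : 0 < 1 - μ := by linarith [h.mu_lt]
  have hK := h.K_nonneg
  have hS := h.S_ge
  have hr0 : 0 < r := hr.1
  have ht0 : 0 < t := ht.1
  have htT : t ∈ Icc 0 T := ⟨ht0.le, ht.2⟩
  obtain ⟨κ, hκi, hκ, hκint⟩ := exists_kernel_majorant ht.1 ht.2 hμ0 hμν hν hΛ
  obtain ⟨i1, e1⟩ := integral_sub_rpow ht0.le h.mu_lt
  set Y := ∑ l, |y l| with hY
  have hY0 : 0 ≤ Y := Finset.sum_nonneg fun _ _ => abs_nonneg _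
  have hE := (h.data i).mul (fun k => norm_shift_symbol_le (proj y) k)
  have key := hE.heatBound (Φ₀ := K * Y * (r ^ (-μ) * t ^ (-μ)))
    (Φ := fun s => K * r ^ (-μ) * (2 * A * R * κ s + Y * (t - s) ^ (-μ))) htT hr0 ?_ ?_
    (((hκi.const_mul _).add (i1.const_mul _)).const_mul _)
  · have e : (fun k => (lam k : ℂ) * ((mFourier k (proj y) - 1) * duhamel (α i) (η i) t k))
        = fun k => (lam k : ℂ) * duhamel (fun k => (mFourier k (proj y) - 1) * α i k)
          (fun s k => (mFourier k (proj y) - 1) * η i s k) t k := by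
      funext k
      rw [duhamel_mul (fun k => mFourier k (proj y) - 1)]
    rw [e]
    refine key.mono ?_
    rw [integral_const_mul, integral_add (hκi.const_mul _) (i1.const_mul _), integral_const_mul,
      integral_const_mul, e1]
    have h2 : t ^ (1 - μ) ≤ T ^ (1 - μ) := Real.rpow_le_rpow ht0.le ht.2 h1μ.le
    calc K * Y * (r ^ (-μ) * t ^ (-μ)) + K * r ^ (-μ) * (2 * A * R * (∫ s in Ioc 0 t, κ s)
          + Y * (t ^ (1 - μ) / (1 - μ)))
        = K * (Y * t ^ (-μ) + 2 * A * R * (∫ s in Ioc 0 t, κ s) + Y * (t ^ (1 - μ) / (1 - μ)))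
          * r ^ (-μ) := by ring
      _ ≤ _ := by gcongr
  · refine ((h.init i (r + t) (by linarith) (by linarith [hr.2, ht.2])).2 y).mono ?_
    exact mul_le_mul_of_nonneg_left (add_rpow_neg_two_mul_le hr0 ht0 hμ0) (by positivity)
  · have hne : ∀ᵐ s ∂(volume.restrict (Ioc 0 t)), s ≠ t :=
      ae_restrict_of_ae (Measure.ae_ne volume t)
    filter_upwards [ae_Ioc_of_ae_Icc h.force ht.2, ae_Ioc_of_ae_Icc hu ht.2,
      ae_Ioc_of_ae_Icc hA ht.2, ae_restrict_mem measurableSet_Ioc, hne]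
      with s hs hus hAs hsm hst
    have hτ : 0 < t - s := by
      have := lt_of_le_of_ne hsm.2 hst
      linarith
    -- Bound for the flux difference: products of two coordinates bounded by `A`, each moving by at
    -- most the assumed amount.
    set MN : ℝ := 2 * A * (R * (s ^ (-μ) * Real.exp (Λ * s))) with hMN
    have hs0 : 0 < s := hsm.1
    have hMN0 : 0 ≤ MN := by positivity
    refine ((hs i (r + (t - s)) (by linarith) (by linarith [hr.2, ht.2, hsm.1])).2 y MN hMN0
      fun l j => ?_).mono ?_
    · filter_upwards [hus, (measurePreserving_add_right (torusVol d)
        (proj y)).quasiMeasurePreserving.ae hus] with x hx1 hx2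
      rw [hx1, hx2]
      have hd := hD s hs0 (hsm.2.trans ht.2) x
      exact abs_mul_sub_mul_le ((abs_coord_le _ _).trans (hAs _)) ((abs_coord_le _ _).trans (hAs _))
        ((abs_coord_le (duhamelField α η s (x + proj y) - duhamelField α η s x) l).trans hd)
        ((abs_coord_le (duhamelField α η s (x + proj y) - duhamelField α η s x) j).trans hd)
    · have h2 := hκ s hs0 (by linarith)
      calc K * (MN + Y) * (r + (t - s)) ^ (-(2 * μ))
          ≤ K * (MN + Y) * (r ^ (-μ) * (t - s) ^ (-μ)) :=
            mul_le_mul_of_nonneg_left (add_rpow_neg_two_mul_le hr0 hτ hμ0) (by positivity)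
        _ = K * r ^ (-μ) * (2 * A * R * (s ^ (-μ) * Real.exp (Λ * s) * (t - s) ^ (-μ))
            + Y * (t - s) ^ (-μ)) := by rw [hMN]; ring
        _ ≤ _ := by gcongr

lemma norm_duhamelField_sub_le {t B : ℝ} {x x' : Torus d}
    (h : ∀ j, ‖synth (duhamel (α j) (η j) t) x - synth (duhamel (α j) (η j) t) x'‖ ≤ B) :
    ‖duhamelField α η t x - duhamelField α η t x'‖ ≤ d * B := by
  refine (norm_le_sum_abs _).trans ((Finset.sum_le_sum fun j _ => ?_).trans
    (le_of_eq (by simp : ∑ _ : Fin d, B = d * B)))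
  refine le_trans ?_ (h j)
  have e : (duhamelField α η t x - duhamelField α η t x') j
      = (synth (duhamel (α j) (η j) t) x - synth (duhamel (α j) (η j) t) x').re := by
    simp [duhamelField]
  rw [e]
  exact Complex.abs_re_le_norm _

/-- For fixed `y` the weighted supremum `R` of the translation difference is finite beforehand, so
`R ≤ C₁ |y| + R/2` can be solved for `R`. The constants do not depend on `y`. -/
lemma FluidRegularityData.exists_lipschitz (h : FluidRegularityData T μ K M S u α η) (hT : 0 < T)
    {A : ℝ} (hA0 : 0 ≤ A)
    (hu : ∀ᵐ s ∂(volume.restrict (Icc 0 T)), u s =ᵐ[torusVol d] duhamelField α η s)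
    (hA : ∀ᵐ s ∂(volume.restrict (Icc 0 T)), ∀ x, ‖duhamelField α η s x‖ ≤ A) :
    ∃ L : ℝ, 0 < L ∧ ∀ t ∈ Ioc 0 T, ∀ x y,
      ‖duhamelField α η t (x + proj y) - duhamelField α η t x‖ ≤ L * t ^ (-μ) * ∑ l, |y l| := by
  have hμ0 : 0 ≤ μ := by linarith [h.mu_ge]
  have h1μ : 0 < 1 - μ := by linarith [h.mu_lt]
  have hK := h.K_nonneg
  obtain ⟨Cl, hCl0, hCl⟩ := DuhamelData.exists_low_frequency_bound h.data
  obtain ⟨B, hB⟩ := (isCompact_Icc.prod isCompact_univ).exists_bound_of_continuousOn h.continuousOn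
  -- Any exponent strictly between `μ` and `1` would do; the gap `ν - μ` produces the small power of
  -- `Λ`.
  set ν := (1 + μ) / 2 with hν
  have hμν : μ < ν := by linarith
  have hν1 : ν < 1 := by linarith
  have h1ν : 0 < 1 - ν := by linarith
  set δ := ν - μ with hδ
  have hδ0 : 0 < δ := by linarith
  set Cκ := T ^ (1 - ν) * (2 ^ μ / (1 - ν) + 2 ^ ν / (1 - μ)) with hCκ
  have hCκ0 : 0 ≤ Cκ := by positivity
  set C2 := d * (K / (1 - μ) * (2 * A * Cκ)) with hC2
  have hC20 : 0 ≤ C2 := by positivity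
  set C1 := d * (Cl * T ^ μ + K / (1 - μ) * (1 + T ^ μ * (T ^ (1 - μ) / (1 - μ)))) with hC1
  have hC10 : 0 ≤ C1 := by positivity
  -- Chosen so that the coefficient of `R` after one turn is at most `1/2`.
  set Λ := (2 * C2 + 1) ^ (1 / δ) with hΛ
  have hΛ0 : 0 < Λ := by positivity
  have hΛδ : C2 * Λ ^ (-δ) ≤ 1 / 2 := by
    rw [hΛ, ← Real.rpow_mul (by positivity), show 1 / δ * -δ = -1 by field_simp, Real.rpow_neg_one,
      ← div_eq_mul_inv, div_le_iff₀ (by positivity)]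
    linarith
  have key : ∀ y : E d, ∀ t ∈ Ioc 0 T, ∀ x,
      t ^ μ * Real.exp (-(Λ * t)) * ‖duhamelField α η t (x + proj y) - duhamelField α η t x‖
        ≤ 2 * C1 * ∑ l, |y l| := by
    intro y
    set Y := ∑ l, |y l| with hY
    have hY0 : 0 ≤ Y := Finset.sum_nonneg fun _ _ => abs_nonneg _
    set s : Set ℝ := {a | ∃ t ∈ Ioc 0 T, ∃ x, a = t ^ μ * Real.exp (-(Λ * t))
      * ‖duhamelField α η t (x + proj y) - duhamelField α η t x‖} with hs
    -- Continuity on the compact cylinder gives a crude bound; finiteness of `R` is what legitimates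
    -- the absorption.
    have hbdd : BddAbove s := by
      refine ⟨T ^ μ * 1 * (B + B), ?_⟩
      rintro _ ⟨t, ht, x, rfl⟩
      have ht0 : 0 < t := ht.1
      have hB' : ∀ x, ‖duhamelField α η t x‖ ≤ B := fun x => hB (t, x) ⟨⟨ht.1.le, ht.2⟩, trivial⟩
      refine mul_le_mul (mul_le_mul (Real.rpow_le_rpow ht.1.le ht.2 hμ0) ?_ (by positivity)
        (by positivity)) ((norm_sub_le _ _).trans (add_le_add (hB' _) (hB' _))) (norm_nonneg _)
        (by positivity)
      rw [Real.exp_le_one_iff, neg_nonpos]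
      positivity
    have hne : s.Nonempty := ⟨_, T, ⟨hT, le_rfl⟩, 0, rfl⟩
    set R := sSup s with hR
    have hRle : ∀ t ∈ Ioc 0 T, ∀ x, t ^ μ * Real.exp (-(Λ * t))
        * ‖duhamelField α η t (x + proj y) - duhamelField α η t x‖ ≤ R :=
      fun t ht x => le_csSup hbdd ⟨t, ht, x, rfl⟩
    have hR0 : 0 ≤ R := le_trans (by positivity) (hRle T ⟨hT, le_rfl⟩ 0)
    have hweight : ∀ t : ℝ, 0 < t →
        (t ^ (-μ) * Real.exp (Λ * t)) * (t ^ μ * Real.exp (-(Λ * t))) = 1 := fun t ht => by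
      rw [mul_mul_mul_comm, ← Real.rpow_add ht, ← Real.exp_add]
      simp
    have hD : ∀ s, 0 < s → s ≤ T → ∀ x,
        ‖duhamelField α η s (x + proj y) - duhamelField α η s x‖
          ≤ R * (s ^ (-μ) * Real.exp (Λ * s)) := fun t ht htT x => by
      have h1 := mul_le_mul_of_nonneg_left (hRle t ⟨ht, htT⟩ x)
        (show 0 ≤ t ^ (-μ) * Real.exp (Λ * t) by positivity)
      rwa [← mul_assoc, hweight t ht, one_mul, mul_comm _ R] at h1
    -- The weight `t^μ e^{-Λt}` cancels exactly the factor `e^{Λt} t^{-μ}` carried by the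
    -- self-referential term.
    have hstep : R ≤ C1 * Y + 1 / 2 * R := by
      refine csSup_le hne ?_
      rintro _ ⟨t, ht, x, rfl⟩
      have ht0 : 0 < t := ht.1
      have htT : t ∈ Icc 0 T := ⟨ht.1.le, ht.2⟩
      set G := K * (Y * t ^ (-μ) + 2 * A * R * (Cκ * Λ ^ (-δ) * (Real.exp (Λ * t) * t ^ (-μ)))
        + Y * (T ^ (1 - μ) / (1 - μ))) with hG
      have h1 : ∀ j, ‖synth (duhamel (α j) (η j) t) (x + proj y)
          - synth (duhamel (α j) (η j) t) x‖ ≤ Y * Cl + G * (1 / (1 - μ)) := by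
        intro j
        have h2 := norm_synth_shift_sub_le ((h.data j).polyGrowth htT) (h.integrable_bound _)
          (fun r hr => h.heatBound j r hr t htT) x (proj y) (hCl t htT j y)
          (h.integrable_bound G)
          (fun r hr => h.shift_heatBound hA0 hu hA hR0 hΛ0 hμν.le hν1 hD ht j hr)
        rwa [integral_const_mul, (integral_rpow_neg zero_le_one h.mu_lt).2, Real.one_rpow] at h2
      have h3 := norm_duhamelField_sub_le h1
      have hw1 : t ^ μ * Real.exp (-(Λ * t)) ≤ T ^ μ := by
        refine (mul_le_of_le_one_right (by positivity) ?_).trans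
          (Real.rpow_le_rpow ht.1.le ht.2 hμ0)
        rw [Real.exp_le_one_iff, neg_nonpos]
        positivity
      have hw2 : t ^ μ * Real.exp (-(Λ * t)) * t ^ (-μ) ≤ 1 := by
        rw [mul_right_comm, ← Real.rpow_add ht0, add_neg_cancel, Real.rpow_zero, one_mul,
          Real.exp_le_one_iff, neg_nonpos]
        positivity
      set W := t ^ μ * Real.exp (-(Λ * t)) with hW
      have hW0 : 0 ≤ W := by positivity
      have hWe : W * (Real.exp (Λ * t) * t ^ (-μ)) = 1 := by
        rw [mul_comm, mul_comm (Real.exp _)]; exact hweight t ht0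
      calc W * ‖duhamelField α η t (x + proj y) - duhamelField α η t x‖
          ≤ W * (d * (Y * Cl + G * (1 / (1 - μ)))) := mul_le_mul_of_nonneg_left h3 hW0
        _ = d * (W * Cl * Y + K / (1 - μ) * ((W * t ^ (-μ)) * Y
              + W * (T ^ (1 - μ) / (1 - μ)) * Y))
            + d * (K / (1 - μ) * (2 * A * Cκ)) * Λ ^ (-δ) * R
              * (W * (Real.exp (Λ * t) * t ^ (-μ))) := by rw [hG]; ring
        _ = d * (W * Cl * Y + K / (1 - μ) * ((W * t ^ (-μ)) * Y
              + W * (T ^ (1 - μ) / (1 - μ)) * Y)) + C2 * Λ ^ (-δ) * R := by rw [hWe, mul_one]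
        _ ≤ d * (T ^ μ * Cl * Y + K / (1 - μ) * (1 * Y
              + T ^ μ * (T ^ (1 - μ) / (1 - μ)) * Y)) + 1 / 2 * R := by gcongr
        _ = _ := by rw [hC1]; ring
    intro t ht x
    exact (hRle t ht x).trans (by linarith)
  refine ⟨2 * C1 * Real.exp (Λ * T) + 1, by positivity, fun t ht x y => ?_⟩
  have ht0 : 0 < t := ht.1
  have hY0 : 0 ≤ ∑ l, |y l| := Finset.sum_nonneg fun _ _ => abs_nonneg _
  have h1 := mul_le_mul_of_nonneg_left (key y t ht x)
    (show 0 ≤ t ^ (-μ) * Real.exp (Λ * t) by positivity)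
  have hw : (t ^ (-μ) * Real.exp (Λ * t)) * (t ^ μ * Real.exp (-(Λ * t))) = 1 := by
    rw [mul_mul_mul_comm, ← Real.rpow_add ht0, ← Real.exp_add]
    simp
  rw [← mul_assoc, hw, one_mul] at h1
  refine h1.trans ?_
  have h2 : Real.exp (Λ * t) ≤ Real.exp (Λ * T) :=
    Real.exp_le_exp.2 (mul_le_mul_of_nonneg_left ht.2 hΛ0.le)
  calc t ^ (-μ) * Real.exp (Λ * t) * (2 * C1 * ∑ l, |y l|)
      ≤ t ^ (-μ) * Real.exp (Λ * T) * (2 * C1 * ∑ l, |y l|) := by gcongr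
    _ = 2 * C1 * Real.exp (Λ * T) * t ^ (-μ) * ∑ l, |y l| := by ring
    _ ≤ _ := by
        gcongr
        linarith

end Lipschitz

/-- The velocity of the limit system has a continuous representative, which is Lipschitz in space
with a constant integrable in time. -/
theorem exists_isContinuousRep_lipschitz {T p γ σ A : ℝ} {k₀ : ℕ} {u₀ : Torus d → E d}
    {F₀ : Torus d → E d → ℝ} {u : ℝ → Torus d → E d} {F : ℝ → Torus d → E d → ℝ}
    (hT : 0 < T) (hp1 : 1 < p) (hp : (d : ℝ) < p) (hγ : (d : ℝ) / p < γ) (hγ1 : γ < 1)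
    (hW : IsWeakSolution T σ u₀ F₀ u F) (hpde : PDEAssumptions T p γ k₀ u₀ F₀ u) (hA0 : 0 ≤ A)
    (hA : ∀ᵐ z ∂((volume.restrict (Icc 0 T)).prod (torusVol d)), ‖u z.1 z.2‖ ≤ A) :
    (∃ w, IsContinuousRep T u w) ∧ ∃ μ L : ℝ, 0 ≤ μ ∧ μ < 1 ∧ 0 < L ∧
      ∀ w, IsContinuousRep T u w → ∀ t ∈ Ioc 0 T, ∀ x y,
        ‖w t (x + proj y) - w t x‖ ≤ L * t ^ (-μ) * ∑ l, |y l| := by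
  obtain ⟨μ, K, M, h⟩ := exists_fluidRegularityData hT hp1 hp hγ hγ1 hW hpde hA0 hA
  have hrep := h.isContinuousRep hW.meas_u hA
  obtain ⟨L, hL, hLip⟩ := h.exists_lipschitz hT hA0 hrep.ae_slices (hrep.norm_le hA)
  refine ⟨⟨_, hrep⟩, μ, L, by linarith [h.mu_ge], h.mu_lt, hL, fun w hw t ht x y => ?_⟩
  have htT : t ∈ Icc 0 T := ⟨ht.1.le, ht.2⟩
  rw [hw.eqOn hT hrep htT, hw.eqOn hT hrep htT]
  exact hLip t ht x y

/-! ### Moments of the supremum of a Brownian motion -/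

/-- Chaining: a grid point of level `n + 1` either lies in the grid of level `n` or is one step to
the right of such a point. -/
lemma norm_dyadic_le {V : Type*} [SeminormedAddCommGroup V] {g : ℕ → ℕ → V} {D : ℕ → ℝ}
    (hg0 : g 0 0 = 0) (hg : ∀ j m, g (j + 1) (2 * m) = g j m)
    (hD : ∀ j m, m < 2 ^ j → ‖g j (m + 1) - g j m‖ ≤ D j) (n : ℕ) :
    ∀ m ≤ 2 ^ n, ‖g n m‖ ≤ ∑ j ∈ Finset.range (n + 1), D j := by
  have hD0 : ∀ j, 0 ≤ D j := fun j => (norm_nonneg _).trans (hD j 0 (by positivity))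
  induction n with
  | zero =>
    intro m hm
    have h1 := hD 0 0 (by norm_num)
    rw [hg0, sub_zero] at h1
    interval_cases m
    · simpa [hg0] using hD0 0
    · simpa using h1
  | succ n ih =>
    intro m hm
    rw [Finset.sum_range_succ]
    rw [pow_succ] at hm
    rcases Nat.even_or_odd' m with ⟨c, rfl | rfl⟩
    · rw [hg]
      exact (ih c (by omega)).trans (le_add_of_nonneg_right (hD0 _))
    · have h1 := hD (n + 1) (2 * c) (by rw [pow_succ]; omega)
      have h2 := ih c (by omega)
      rw [← hg] at h2
      calc ‖g (n + 1) (2 * c + 1)‖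
          = ‖g (n + 1) (2 * c) + (g (n + 1) (2 * c + 1) - g (n + 1) (2 * c))‖ := by
            rw [add_sub_cancel]
        _ ≤ _ := (norm_add_le _ _).trans (add_le_add h2 h1)

/-- The dyadic functional controlling the supremum of a continuous path. -/
def dyadicSum {V : Type*} [NormedAddCommGroup V] (n : ℕ) (g : ℕ → ℕ → V) : ℝ≥0∞ :=
  ∑' j : ℕ, (4 : ℝ≥0∞) ^ (j * n) * ∑ m ∈ Finset.range (2 ^ j), ‖g j (m + 1) - g j m‖ₑ ^ (8 * n)

/-- The constant `(1 - 2^{-1/4})⁻¹` of the chaining argument. -/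
def chainConst : ℝ := (1 - (1 / 2 : ℝ) ^ (1 / 4 : ℝ))⁻¹

lemma half_rpow_lt_one : (1 / 2 : ℝ) ^ (1 / 4 : ℝ) < 1 :=
  Real.rpow_lt_one (by norm_num) (by norm_num) (by norm_num)

lemma chainConst_pos : 0 < chainConst := inv_pos.2 (sub_pos.2 half_rpow_lt_one)

/-- Finiteness of the sum forces each increment of level `j` below `Z a^j`, where `Z` is the `8n`-th
root of the sum and `a = 2^{-1/4}`, since `a^{8n} = 4^{-n}`. Summing over the levels gives
`chainConst * Z`. -/
lemma norm_pow_le_dyadicSum {V : Type*} [NormedAddCommGroup V] {n : ℕ} (hn : n ≠ 0)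
    {g : ℕ → ℕ → V} (hg0 : g 0 0 = 0) (hg : ∀ j m, g (j + 1) (2 * m) = g j m) {j m : ℕ}
    (hm : m ≤ 2 ^ j) :
    ‖g j m‖ₑ ^ (8 * n) ≤ ENNReal.ofReal chainConst ^ (8 * n) * dyadicSum n g := by
  have hc := chainConst_pos
  rcases eq_or_ne (dyadicSum n g) ∞ with h | h
  · rw [h, ENNReal.mul_top]
    · exact le_top
    · exact pow_ne_zero _ (by simpa using hc)
  set W := (dyadicSum n g).toReal with hW
  have hW0 : 0 ≤ W := ENNReal.toReal_nonneg
  have hWe : dyadicSum n g = ENNReal.ofReal W := (ENNReal.ofReal_toReal h).symm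
  set a : ℝ := (1 / 2 : ℝ) ^ (1 / 4 : ℝ) with ha
  have ha0 : 0 < a := by positivity
  have ha1 : a < 1 := half_rpow_lt_one
  have ha8 : a ^ (8 * n) * 4 ^ n = 1 := by
    have h1 : a ^ 8 = 1 / 4 := by
      rw [ha, ← Real.rpow_natCast, ← Real.rpow_mul (by norm_num)]
      norm_num
    rw [pow_mul, h1, ← mul_pow]
    norm_num
  set Z := W ^ (1 / (8 * n : ℕ) : ℝ) with hZ
  have hZ0 : 0 ≤ Z := by positivity
  have h8n : 8 * n ≠ 0 := by omega
  have hZp : Z ^ (8 * n) = W := by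
    rw [hZ, one_div, Real.rpow_inv_natCast_pow hW0 h8n]
  have hD : ∀ j m, m < 2 ^ j → ‖g j (m + 1) - g j m‖ ≤ Z * a ^ j := by
    intro j m hm
    have h1 : (4 : ℝ≥0∞) ^ (j * n) * ‖g j (m + 1) - g j m‖ₑ ^ (8 * n) ≤ ENNReal.ofReal W := by
      rw [← hWe]
      refine le_trans ?_ (ENNReal.le_tsum j)
      gcongr
      exact Finset.single_le_sum (f := fun m => ‖g j (m + 1) - g j m‖ₑ ^ (8 * n))
        (fun _ _ => zero_le) (Finset.mem_range.2 hm)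
    have h2 : (4 : ℝ) ^ (j * n) * ‖g j (m + 1) - g j m‖ ^ (8 * n) ≤ W := by
      rw [← ENNReal.ofReal_le_ofReal_iff hW0, ENNReal.ofReal_mul (by positivity),
        ENNReal.ofReal_pow (by norm_num), ENNReal.ofReal_pow (norm_nonneg _), ofReal_norm]
      simpa using h1
    refine le_of_pow_le_pow_left₀ h8n (by positivity) ?_
    rw [mul_pow, hZp]
    have h3 : (a ^ j) ^ (8 * n) * 4 ^ (j * n) = 1 := by
      rw [← pow_mul, mul_comm j, pow_mul, mul_comm j n, pow_mul 4, ← mul_pow, ha8, one_pow]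
    calc ‖g j (m + 1) - g j m‖ ^ (8 * n)
        = (a ^ j) ^ (8 * n) * 4 ^ (j * n) * ‖g j (m + 1) - g j m‖ ^ (8 * n) := by rw [h3, one_mul]
      _ = (4 ^ (j * n) * ‖g j (m + 1) - g j m‖ ^ (8 * n)) * (a ^ j) ^ (8 * n) := by ring
      _ ≤ _ := by gcongr
  have h4 := norm_dyadic_le hg0 hg hD j m hm
  rw [← Finset.mul_sum] at h4
  have h5 : ‖g j m‖ ≤ chainConst * Z := by
    refine h4.trans ?_
    rw [mul_comm]
    refine mul_le_mul_of_nonneg_right ?_ hZ0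
    rw [chainConst, ← tsum_geometric_of_lt_one ha0.le ha1]
    exact (summable_geometric_of_lt_one ha0.le ha1).sum_le_tsum _ fun _ _ => by positivity
  rw [hWe, ← ofReal_norm, ← ENNReal.ofReal_pow (norm_nonneg _), ← ENNReal.ofReal_pow hc.le,
    ← ENNReal.ofReal_mul (by positivity), ← hZp, ← mul_pow]
  exact ENNReal.ofReal_le_ofReal (pow_le_pow_left₀ (norm_nonneg _) h5 _)

/-- The dyadic grid of `[0, T]`. -/
def dyadicTime (T : ℝ≥0) (j m : ℕ) : ℝ≥0 := T * (m / 2 ^ j)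

lemma dyadicTime_le {T : ℝ≥0} {j m m' : ℕ} (h : m ≤ m') : dyadicTime T j m ≤ dyadicTime T j m' := by
  unfold dyadicTime
  have : (m : ℝ≥0) ≤ m' := by exact_mod_cast h
  gcongr

lemma exists_tendsto_dyadicTime {T t : ℝ≥0} (ht : t ≤ T) (hT : 0 < T) :
    ∃ m : ℕ → ℕ, (∀ j, m j ≤ 2 ^ j) ∧ Tendsto (fun j => dyadicTime T j (m j)) atTop (𝓝 t) := by
  set r : ℝ := t / T with hr
  have hr0 : 0 ≤ r := by positivity
  have hr1 : r ≤ 1 := div_le_one_of_le₀ (by exact_mod_cast ht) T.2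
  refine ⟨fun j => ⌊r * 2 ^ j⌋₊, fun j => ?_, ?_⟩
  · refine Nat.floor_le_of_le ?_
    push_cast
    exact mul_le_of_le_one_left (by positivity) hr1
  · have h1 : Tendsto (fun x : ℝ => (⌊r * x⌋₊ : ℝ) / x) atTop (𝓝 r) :=
      tendsto_nat_floor_mul_div_atTop hr0
    have h2 : Tendsto (fun j : ℕ => (2 : ℝ) ^ j) atTop atTop :=
      tendsto_pow_atTop_atTop_of_one_lt one_lt_two
    have h3 := (h1.comp h2).const_mul (T : ℝ)
    rw [show (T : ℝ) * r = t by rw [hr, mul_div_cancel₀ _ (by exact_mod_cast hT.ne')]] at h3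
    refine NNReal.tendsto_coe.1 (h3.congr fun j => ?_)
    simp [dyadicTime]

section Brownian

variable {Ω : Type*} {m : MeasurableSpace Ω} {P : Measure Ω} {ℱ : Filtration ℝ≥0 m}
  {B : ℝ≥0 → Ω → E d}

lemma IsFilteredBrownian.measurable (hB : IsFilteredBrownian ℱ P B) (t : ℝ≥0) :
    Measurable (B t) := (hB.adapted t).mono (ℱ.le t) le_rfl

lemma IsFilteredBrownian.lintegral_increment_pow (hB : IsFilteredBrownian ℱ P B) {s t : ℝ≥0}
    (hst : s ≤ t) (n : ℕ) :
    ∫⁻ ω, ‖B t ω - B s ω‖ₑ ^ n ∂P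
      = ENNReal.ofReal (Real.sqrt ((t : ℝ) - s)) ^ n * ∫⁻ z, ‖z‖ₑ ^ n ∂(stdGaussian (E d)) := by
  have h1 : ∫⁻ ω, ‖B t ω - B s ω‖ₑ ^ n ∂P
      = ∫⁻ z, ‖z‖ₑ ^ n ∂(P.map fun ω => B t ω - B s ω) :=
    (lintegral_map (f := fun z : E d => ‖z‖ₑ ^ n) (by fun_prop)
      ((hB.measurable t).sub (hB.measurable s))).symm
  rw [h1, hB.law s t hst, lintegral_map (by fun_prop) (by fun_prop),
    ← lintegral_const_mul _ (by fun_prop)]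
  refine lintegral_congr fun z => ?_
  rw [enorm_smul, mul_pow, Real.enorm_of_nonneg (Real.sqrt_nonneg _)]

lemma lintegral_gaussian_pow_lt_top (n : ℕ) : ∫⁻ z, ‖z‖ₑ ^ n ∂(stdGaussian (E d)) < ∞ := by
  rcases eq_or_ne n 0 with rfl | hn
  · simp
  have h := (IsGaussian.memLp_id (stdGaussian (E d)) (n : ℝ≥0∞) (by simp)).2
  rw [eLpNorm_lt_top_iff_lintegral_rpow_enorm_lt_top (by simpa using hn) (by simp)] at h
  simpa using h

/-- Level `j` has `2^j` increments, each with `8n`-th moment of order `(T/2^j)^{4n}`. With the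
weight `4^{jn}` the level contributes `2^{j(1-2n)} ≤ 2^{-j}`, and the geometric series sums to `2`.
-/
lemma IsFilteredBrownian.lintegral_dyadicSum_le (hB : IsFilteredBrownian ℱ P B) (T : ℝ≥0) {n : ℕ}
    (hn : n ≠ 0) :
    ∫⁻ ω, dyadicSum n (fun j m => B (dyadicTime T j m) ω) ∂P
      ≤ 2 * ((T : ℝ≥0∞) ^ (4 * n) * ∫⁻ z, ‖z‖ₑ ^ (8 * n) ∂(stdGaussian (E d))) := by
  have hm := hB.measurable
  set c := ∫⁻ z, ‖z‖ₑ ^ (8 * n) ∂(stdGaussian (E d)) with hc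
  unfold dyadicSum
  rw [lintegral_tsum fun j => by fun_prop]
  have h1 : ∀ j : ℕ, ∫⁻ ω, (4 : ℝ≥0∞) ^ (j * n) * ∑ m ∈ Finset.range (2 ^ j),
      ‖B (dyadicTime T j (m + 1)) ω - B (dyadicTime T j m) ω‖ₑ ^ (8 * n) ∂P
      ≤ 2⁻¹ ^ j * ((T : ℝ≥0∞) ^ (4 * n) * c) := by
    intro j
    rw [lintegral_const_mul _ (by fun_prop), lintegral_finsetSum _ (fun m _ => by fun_prop)]
    have h2 : ∀ m, ∫⁻ ω, ‖B (dyadicTime T j (m + 1)) ω - B (dyadicTime T j m) ω‖ₑ ^ (8 * n) ∂P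
        = ((T / 2 ^ j : ℝ≥0) : ℝ≥0∞) ^ (4 * n) * c := by
      intro m
      rw [hB.lintegral_increment_pow (dyadicTime_le (Nat.le_succ m))]
      congr 1
      have h3 : ((dyadicTime T j (m + 1) : ℝ≥0) : ℝ) - dyadicTime T j m = ((T / 2 ^ j : ℝ≥0) : ℝ) := by
        unfold dyadicTime
        push_cast
        ring
      rw [h3, show 8 * n = 2 * (4 * n) by ring, pow_mul, ← ENNReal.ofReal_pow (Real.sqrt_nonneg _),
        Real.sq_sqrt (NNReal.coe_nonneg _), ENNReal.ofReal_coe_nnreal]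
    simp only [h2, Finset.sum_const, Finset.card_range, nsmul_eq_mul]
    have h4 : (4 : ℝ≥0) ^ (j * n) * (2 ^ j * (T / 2 ^ j) ^ (4 * n)) ≤ 2⁻¹ ^ j * T ^ (4 * n) := by
      rw [div_pow]
      have h5 : (4 : ℝ≥0) ^ (j * n) * 2 ^ j * 2 ^ j ≤ (2 ^ j) ^ (4 * n) := by
        rw [show (4 : ℝ≥0) = 2 ^ 2 by norm_num, ← pow_mul, ← pow_mul, ← pow_add, ← pow_add]
        refine pow_le_pow_right₀ one_le_two ?_
        have : j * 1 ≤ j * n := Nat.mul_le_mul_left _ (Nat.one_le_iff_ne_zero.2 hn)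
        nlinarith
      calc (4 : ℝ≥0) ^ (j * n) * (2 ^ j * (T ^ (4 * n) / (2 ^ j) ^ (4 * n)))
          = (4 ^ (j * n) * 2 ^ j * 2 ^ j) * (2⁻¹ ^ j * T ^ (4 * n)) / (2 ^ j) ^ (4 * n) := by
            rw [inv_pow]
            field_simp
        _ ≤ (2 ^ j) ^ (4 * n) * (2⁻¹ ^ j * T ^ (4 * n)) / (2 ^ j) ^ (4 * n) := by gcongr
        _ = _ := by rw [mul_div_assoc, mul_div_cancel₀ _ (by positivity)]
    have h6 : (4 : ℝ≥0∞) ^ (j * n) * (2 ^ j * ((T / 2 ^ j : ℝ≥0) : ℝ≥0∞) ^ (4 * n))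
        ≤ 2⁻¹ ^ j * (T : ℝ≥0∞) ^ (4 * n) := by
      generalize T / 2 ^ j = x at h4
      have := ENNReal.coe_le_coe.2 h4
      simpa only [ENNReal.coe_mul, ENNReal.coe_pow, ENNReal.coe_inv two_ne_zero,
        ENNReal.coe_ofNat] using this
    calc (4 : ℝ≥0∞) ^ (j * n) * (((2 ^ j : ℕ) : ℝ≥0∞) * (((T / 2 ^ j : ℝ≥0) : ℝ≥0∞) ^ (4 * n) * c))
        = (4 : ℝ≥0∞) ^ (j * n) * (2 ^ j * ((T / 2 ^ j : ℝ≥0) : ℝ≥0∞) ^ (4 * n)) * c := by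
          push_cast
          ring
      _ ≤ 2⁻¹ ^ j * (T : ℝ≥0∞) ^ (4 * n) * c := by gcongr
      _ = _ := by ring
  refine (ENNReal.tsum_le_tsum h1).trans (le_of_eq ?_)
  rw [ENNReal.tsum_mul_right, ENNReal.tsum_geometric, ENNReal.one_sub_inv_two, inv_inv]

lemma rpow_le_one_add_pow (x : ℝ≥0∞) {q : ℝ} (hq : 0 ≤ q) {n : ℕ} (hqn : q ≤ n) :
    x ^ q ≤ 1 + x ^ n := by
  rcases le_total x 1 with h | h
  · exact (ENNReal.rpow_le_one h hq).trans le_self_add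
  · refine le_trans ?_ le_add_self
    rw [← ENNReal.rpow_natCast]
    exact ENNReal.rpow_le_rpow_of_exponent_le h hqn

end Brownian

/-- Moments of the supremum of a Brownian motion, through a measurable majorant. -/
theorem exists_brownian_sup_bound (d : ℕ) (T q : ℝ) (hT : 0 < T) (hq : 0 ≤ q) :
    ∃ C : ℝ≥0, ∀ (Ω : Type*) (m : MeasurableSpace Ω) (P : Measure Ω) (_ : IsProbabilityMeasure P)
      (ℱ : Filtration ℝ≥0 m) (B : ℝ≥0 → Ω → E d), IsFilteredBrownian ℱ P B →
      ∃ G : Ω → ℝ≥0∞, Measurable G ∧ ∫⁻ ω, G ω ∂P ≤ C ∧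
        ∀ᵐ ω ∂P, ∀ t : ℝ≥0, (t : ℝ) ≤ T → ‖B t ω‖ₑ ^ q ≤ G ω := by
  lift T to ℝ≥0 using hT.le
  have hT' : 0 < T := by exact_mod_cast hT
  -- Large enough for `x^q ≤ 1 + x^{8n}`, and nonzero as chaining requires.
  set n := ⌈q⌉₊ + 1 with hn
  have hn0 : n ≠ 0 := by omega
  have hqn : q ≤ (8 * n : ℕ) := by
    refine (Nat.le_ceil q).trans ?_
    exact_mod_cast (by omega : ⌈q⌉₊ ≤ 8 * n)
  set K := ENNReal.ofReal chainConst ^ (8 * n) with hK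
  have hKtop : K ≠ ∞ := ENNReal.pow_ne_top ENNReal.ofReal_ne_top
  have hC : 1 + K * (2 * ((T : ℝ≥0∞) ^ (4 * n) * ∫⁻ z, ‖z‖ₑ ^ (8 * n) ∂(stdGaussian (E d)))) ≠ ∞ := by
    refine ENNReal.add_ne_top.2 ⟨ENNReal.one_ne_top, ENNReal.mul_ne_top hKtop (ENNReal.mul_ne_top
      (by simp) (ENNReal.mul_ne_top (ENNReal.pow_ne_top ENNReal.coe_ne_top)
        (lintegral_gaussian_pow_lt_top _).ne))⟩
  refine ⟨(1 + K * (2 * ((T : ℝ≥0∞) ^ (4 * n)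
    * ∫⁻ z, ‖z‖ₑ ^ (8 * n) ∂(stdGaussian (E d))))).toNNReal, fun Ω m P hP ℱ B hB => ⟨fun ω => 1 + K * dyadicSum n fun j m => B (dyadicTime T j m) ω,
    ?_, ?_, ?_⟩⟩
  · have hm := hB.measurable
    unfold dyadicSum
    fun_prop
  · rw [ENNReal.coe_toNNReal hC]
    have hm := hB.measurable
    rw [lintegral_add_left (by fun_prop), lintegral_const_mul _ (by unfold dyadicSum; fun_prop)]
    refine add_le_add (by simp) ?_
    gcongr
    exact hB.lintegral_dyadicSum_le T hn0
  · filter_upwards [hB.zero, hB.continuous] with ω h0 hc t ht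
    refine (rpow_le_one_add_pow _ hq hqn).trans ?_
    gcongr
    -- Every time is a limit of dyadic ones, so path continuity extends the bound from the countable
    -- grid to all times. The majorant is measurable as a countable sum, whereas a supremum over all
    -- times need not be.
    obtain ⟨k, hk, hlim⟩ := exists_tendsto_dyadicTime (t := t) (by exact_mod_cast ht) hT'
    have h1 : Tendsto (fun j => ‖B (dyadicTime T j (k j)) ω‖ₑ ^ (8 * n)) atTop
        (𝓝 (‖B t ω‖ₑ ^ (8 * n))) :=
      ((ENNReal.continuous_pow _).tendsto _).comp
        ((continuous_enorm.tendsto _).comp ((hc.tendsto t).comp hlim))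
    refine le_of_tendsto h1 (Eventually.of_forall fun j => ?_)
    refine norm_pow_le_dyadicSum hn0 (g := fun j m => B (dyadicTime T j m) ω) ?_ (fun j m => ?_)
      (hk j)
    · simp [dyadicTime, h0]
    · have : dyadicTime T (j + 1) (2 * m) = dyadicTime T j m := by
        unfold dyadicTime
        push_cast
        rw [pow_succ]
        congr 1
        field_simp
      simp only [this]

/-! ### Comparison of the particle paths -/

lemma IsCutoff.abs_sub_le {A : ℝ} {χ : ℝ → ℝ} (hχ : IsCutoff A χ) (a b : ℝ) :
    |χ a - χ b| ≤ |a - b| := by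
  have h := lipschitzWith_of_nnnorm_deriv_le (C := 1) (hχ.contDiff.differentiable two_ne_zero)
    (fun r => by
      rw [← NNReal.coe_le_coe, coe_nnnorm, Real.norm_eq_abs]
      exact hχ.deriv_le r)
  simpa [Real.dist_eq] using h.dist_le_mul a b

lemma IsCutoff.norm_cutoffVec_sub_le {A : ℝ} {χ : ℝ → ℝ} (hχ : IsCutoff A χ) (a b : E d) :
    ‖cutoffVec χ a - cutoffVec χ b‖ ≤ ‖a - b‖ := by
  rw [EuclideanSpace.norm_eq, EuclideanSpace.norm_eq]
  refine Real.sqrt_le_sqrt (Finset.sum_le_sum fun j _ => ?_)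
  exact pow_le_pow_left₀ (norm_nonneg _) (hχ.abs_sub_le (a j) (b j)) 2

lemma IsCutoff.continuous_cutoffVec {A : ℝ} {χ : ℝ → ℝ} (hχ : IsCutoff A χ) :
    Continuous (cutoffVec χ : E d → E d) :=
  (LipschitzWith.of_dist_le_mul (K := 1) fun a b => by
    simpa [dist_eq_norm] using hχ.norm_cutoffVec_sub_le a b).continuous

lemma IsCutoff.cutoffVec_eq {A : ℝ} {χ : ℝ → ℝ} (hχ : IsCutoff A χ) {a : E d} (ha : ‖a‖ ≤ A) :
    cutoffVec χ a = a := by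
  ext j
  exact hχ.id_on _ (abs_le.1 ((abs_coord_le a j).trans ha))

lemma proj_add_sub (a b : E d) : proj a = proj b + proj (a - b) := by
  funext j
  simp [proj]

/-- Any lift `z` of the position difference may be used, since the quotient norm on the circle does
not exceed the norm of a representative. -/
lemma phaseDist_le {x y : Torus d} {v w z : E d} (h : x = y + proj z) :
    phaseDist x v y w ≤ ‖z‖ + ‖v - w‖ := by
  have h1 : ∑ j, ‖x j - y j‖ ^ 2 ≤ ‖z‖ ^ 2 := by
    rw [EuclideanSpace.norm_sq_eq]
    refine Finset.sum_le_sum fun j _ => pow_le_pow_left₀ (norm_nonneg _) ?_ 2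
    rw [h, Pi.add_apply, add_sub_cancel_left]
    exact QuotientAddGroup.norm_mk_le_norm
  refine Real.sqrt_le_iff.2 ⟨by positivity, ?_⟩
  nlinarith [mul_nonneg (norm_nonneg z) (norm_nonneg (v - w))]

lemma continuousOn_along {T : ℝ} {b : ℝ → Torus d → E d}
    (hb : ContinuousOn (fun z : ℝ × Torus d => b z.1 z.2) (Icc 0 T ×ˢ univ)) {x : ℝ → Torus d}
    (hx : ContinuousOn x (Icc 0 T)) : ContinuousOn (fun s => b s (x s)) (Icc 0 T) :=
  hb.comp (f := fun s => (s, x s)) (continuousOn_id.prodMk hx) fun _ hs => ⟨hs, trivial⟩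

lemma intervalIntegrable_of_continuousOn_Icc {V : Type*} [NormedAddCommGroup V] {T t : ℝ}
    {f : ℝ → V} (hf : ContinuousOn f (Icc 0 T)) (ht : t ∈ Icc 0 T) :
    IntervalIntegrable f volume 0 t :=
  (hf.mono (by rw [uIcc_of_le ht.1]; exact Icc_subset_Icc_right ht.2)).intervalIntegrable

lemma norm_integral_exp_le {V : Type*} [NormedAddCommGroup V] [NormedSpace ℝ V] {f : ℝ → V}
    {t a S l : ℝ} (ht : 0 ≤ t) (hl : 0 < l) (hS : 0 ≤ S)
    (hf : ∀ᵐ s ∂(volume.restrict (Ioc 0 t)), ‖f s‖ ≤ a + S * Real.exp (l * s)) :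
    ‖∫ s in (0 : ℝ)..t, f s‖ ≤ a * t + S / l * Real.exp (l * t) := by
  have hi : IntervalIntegrable (fun s => a + S * Real.exp (l * s)) volume 0 t :=
    Continuous.intervalIntegrable (by fun_prop) _ _
  have h1 := intervalIntegral.norm_integral_le_of_norm_le ht
    ((ae_restrict_iff' measurableSet_Ioc).1 hf) hi
  refine h1.trans ?_
  rw [intervalIntegral.integral_add (by simp) (Continuous.intervalIntegrable (by fun_prop) _ _),
    intervalIntegral.integral_const, intervalIntegral.integral_const_mul,
    intervalIntegral.integral_comp_mul_left (fun s => Real.exp s) hl.ne', integral_exp]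
  simp only [mul_zero, Real.exp_zero, smul_eq_mul, sub_zero]
  have h2 : 0 ≤ S * l⁻¹ := by positivity
  rw [div_eq_mul_inv]
  nlinarith

/-- A growth estimate for velocity differences, with a kernel singular at the initial time. -/
lemma norm_le_of_integral_inequality {V : Type*} [NormedAddCommGroup V] [NormedSpace ℝ V]
    [CompleteSpace V] {T L μ ε ρ : ℝ} (hT : 0 < T) (hL : 0 ≤ L) (hμ1 : μ < 1)
    (hε : 0 ≤ ε) (hρ : 0 ≤ ρ) {D f : ℝ → V} (hD : ContinuousOn D (Icc 0 T))
    (hDf : ∀ t ∈ Icc 0 T, ‖D t - ∫ s in (0 : ℝ)..t, f s‖ ≤ ρ)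
    (hf : ∀ᵐ s ∂(volume.restrict (Ioc 0 T)), ‖f s‖ ≤ ε + L * s ^ (-μ) * ‖∫ r in (0 : ℝ)..s, D r‖
      + ‖D s‖) :
    ∀ t ∈ Icc 0 T, ‖D t‖ ≤ 2 * Real.exp (2 * (L * T ^ (1 - μ) + 1) * T) * (ε * T + ρ) := by
  set M := L * T ^ (1 - μ) + 1 with hM
  have hM0 : 0 < M := by positivity
  set l := 2 * M with hl
  have hl0 : 0 < l := by positivity
  have hcont : ContinuousOn (fun t => Real.exp (-(l * t)) * ‖D t‖) (Icc 0 T) :=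
    (by fun_prop : Continuous fun t : ℝ => Real.exp (-(l * t))).continuousOn.mul hD.norm
  -- The inequality is evaluated at the maximum of `e^{-lt}‖D t‖`; with `l = 2M` the integral terms
  -- contribute only half of that maximum and are absorbed.
  obtain ⟨t₀, ht₀, hmax⟩ := isCompact_Icc.exists_isMaxOn (nonempty_Icc.2 hT.le) hcont
  set S := Real.exp (-(l * t₀)) * ‖D t₀‖ with hS
  have hS0 : 0 ≤ S := by positivity
  have hle : ∀ t ∈ Icc 0 T, ‖D t‖ ≤ S * Real.exp (l * t) := by
    intro t ht
    have h1 : Real.exp (-(l * t)) * ‖D t‖ ≤ S := hmax ht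
    have h2 := mul_le_mul_of_nonneg_right h1 (Real.exp_pos (l * t)).le
    rwa [mul_right_comm, ← Real.exp_add, neg_add_cancel, Real.exp_zero, one_mul] at h2
  have hprim : ∀ s ∈ Icc 0 T, ‖∫ r in (0 : ℝ)..s, D r‖ ≤ s * (S * Real.exp (l * s)) := by
    intro s hs
    have := intervalIntegral.norm_integral_le_of_norm_le_const (a := 0) (b := s) (f := D)
      (C := S * Real.exp (l * s)) fun r hr => by
        rw [uIoc_of_le hs.1] at hr
        refine (hle r ⟨hr.1.le, hr.2.trans hs.2⟩).trans ?_
        have := hr.2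
        gcongr
    rwa [sub_zero, abs_of_nonneg hs.1, mul_comm] at this
  have hf' : ∀ᵐ s ∂(volume.restrict (Ioc 0 T)), ‖f s‖ ≤ ε + (M * S) * Real.exp (l * s) := by
    filter_upwards [hf, ae_restrict_mem measurableSet_Ioc] with s hs hsm
    have hs0 : 0 < s := hsm.1
    have hsT : s ∈ Icc 0 T := ⟨hs0.le, hsm.2⟩
    -- The position difference is itself an integral over `[0, s]`; the extra factor `s` compensates
    -- the singular kernel.
    have h1 : s ^ (-μ) * s ≤ T ^ (1 - μ) := by
      have : s ^ (-μ) * s = s ^ (1 - μ) := by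
        nth_rw 2 [← Real.rpow_one s]
        rw [← Real.rpow_add hs0]
        congr 1
        ring
      rw [this]
      exact Real.rpow_le_rpow hs0.le hsm.2 (by linarith)
    calc ‖f s‖ ≤ ε + L * s ^ (-μ) * (s * (S * Real.exp (l * s))) + S * Real.exp (l * s) := by
          refine hs.trans (add_le_add (add_le_add le_rfl ?_) (hle s hsT))
          exact mul_le_mul_of_nonneg_left (hprim s hsT) (by positivity)
      _ = ε + (L * (s ^ (-μ) * s) + 1) * S * Real.exp (l * s) := by ring
      _ ≤ _ := by rw [hM]; gcongr
  have hS' : S ≤ 2 * (ε * T + ρ) := by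
    have h1 := norm_integral_exp_le ht₀.1 hl0 (by positivity : 0 ≤ M * S)
      (ae_restrict_of_ae_restrict_of_subset (Ioc_subset_Ioc_right ht₀.2) hf')
    have h2 : ‖D t₀‖ ≤ ρ + (ε * t₀ + M * S / l * Real.exp (l * t₀)) := by
      have := norm_add_le (D t₀ - ∫ s in (0 : ℝ)..t₀, f s) (∫ s in (0 : ℝ)..t₀, f s)
      rw [sub_add_cancel] at this
      exact this.trans (add_le_add (hDf t₀ ht₀) h1)
    have h3 : M * S / l = S / 2 := by rw [hl]; field_simp
    have h4 : Real.exp (-(l * t₀)) ≤ 1 := by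
      rw [Real.exp_le_one_iff, neg_nonpos]
      exact mul_nonneg hl0.le ht₀.1
    have h5 : Real.exp (-(l * t₀)) * Real.exp (l * t₀) = 1 := by
      rw [← Real.exp_add, neg_add_cancel, Real.exp_zero]
    have h6 : S ≤ (ρ + ε * T) + S / 2 := by
      calc S ≤ Real.exp (-(l * t₀)) * (ρ + (ε * t₀ + M * S / l * Real.exp (l * t₀))) :=
            mul_le_mul_of_nonneg_left h2 (Real.exp_pos _).le
        _ = Real.exp (-(l * t₀)) * (ρ + ε * t₀)
            + S / 2 * (Real.exp (-(l * t₀)) * Real.exp (l * t₀)) := by rw [h3]; ring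
        _ ≤ 1 * (ρ + ε * T) + S / 2 := by
            rw [h5, mul_one]
            have := ht₀.1
            have := ht₀.2
            gcongr
        _ = _ := by ring
    linarith
  intro t ht
  have := ht.2
  calc ‖D t‖ ≤ S * Real.exp (l * t) := hle t ht
    _ ≤ (2 * (ε * T + ρ)) * Real.exp (l * T) := by gcongr
    _ = _ := by ring

/-- Stability of kinetic paths with respect to the force field and the noise intensity. -/
lemma phaseDist_kineticPath_le {T L μ A ε β σ σ' : ℝ} (hT : 0 < T) (hL : 0 ≤ L)
    (hμ1 : μ < 1) (hε : 0 ≤ ε) (hβ : 0 ≤ β) {χ : ℝ → ℝ} (hχ : IsCutoff A χ)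
    {w b : ℝ → Torus d → E d}
    (hw : ContinuousOn (fun z : ℝ × Torus d => w z.1 z.2) (Icc 0 T ×ˢ univ))
    (hb : ContinuousOn (fun z : ℝ × Torus d => b z.1 z.2) (Icc 0 T ×ˢ univ))
    (hwA : ∀ᵐ t ∂(volume.restrict (Icc 0 T)), ∀ x, ‖w t x‖ ≤ A)
    (hLip : ∀ t ∈ Ioc 0 T, ∀ x y, ‖w t (x + proj y) - w t x‖ ≤ L * t ^ (-μ) * ∑ l, |y l|)
    (hbw : ∀ t ∈ Icc 0 T, ∀ x, ‖b t x - w t x‖ ≤ ε) {B : ℝ≥0 → E d}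
    (hB : ∀ t : ℝ≥0, (t : ℝ) ≤ T → ‖B t‖ ≤ β) {x₀ : Torus d} {v₀ : E d} {x y : ℝ → Torus d}
    {v z : ℝ → E d} (h : IsKineticPath T σ' (fun t x => cutoffVec χ (b t x)) B x₀ v₀ x v)
    (h' : IsKineticPath T σ w B x₀ v₀ y z) :
    ∀ t ∈ Icc 0 T, phaseDist (x t) (v t) (y t) (z t)
      ≤ (T + 1) * (2 * Real.exp (2 * (L * d * T ^ (1 - μ) + 1) * T) * (T + 1)) * (ε + |σ - σ'| * β) := by
  set D : ℝ → E d := fun t => v t - z t with hDdef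
  have hDc : ContinuousOn D (Icc 0 T) := h.cont_v.sub h'.cont_v
  have hcb : ContinuousOn (fun s => cutoffVec χ (b s (x s))) (Icc 0 T) :=
    hχ.continuous_cutoffVec.comp_continuousOn (continuousOn_along hb h.cont_x)
  have hcw : ContinuousOn (fun s => w s (y s)) (Icc 0 T) := continuousOn_along hw h'.cont_x
  set f : ℝ → E d := fun s => (cutoffVec χ (b s (x s)) - v s) - (w s (y s) - z s) with hf
  -- Both positions start at the same point, so their difference on the torus lifts to the
  -- integrated velocity difference in `ℝᵈ`.
  have hpos : ∀ t ∈ Icc 0 T, x t = y t + proj (∫ s in (0 : ℝ)..t, D s) := by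
    intro t ht
    rw [h.position t ht, h'.position t ht, add_assoc,
      intervalIntegral.integral_sub (intervalIntegrable_of_continuousOn_Icc h.cont_v ht)
        (intervalIntegrable_of_continuousOn_Icc h'.cont_v ht), ← proj_add_sub]
  have hDf : ∀ t ∈ Icc 0 T, ‖D t - ∫ s in (0 : ℝ)..t, f s‖ ≤ |σ - σ'| * β := by
    intro t ht
    lift t to ℝ≥0 using ht.1
    have e : D t - ∫ s in (0 : ℝ)..t, f s = (σ' - σ) • B t := by
      simp only [hDdef, hf]
      have h1 : IntervalIntegrable (fun s => cutoffVec χ (b s (x s)) - v s) volume 0 t :=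
        intervalIntegrable_of_continuousOn_Icc (hcb.sub h.cont_v) ht
      have h2 : IntervalIntegrable (fun s => w s (y s) - z s) volume 0 t :=
        intervalIntegrable_of_continuousOn_Icc (hcw.sub h'.cont_v) ht
      rw [intervalIntegral.integral_sub h1 h2, h.velocity t ht.2, h'.velocity t ht.2, sub_smul]
      abel
    rw [e, norm_smul, Real.norm_eq_abs, abs_sub_comm]
    exact mul_le_mul_of_nonneg_left (hB t ht.2) (abs_nonneg _)
  have hfb : ∀ᵐ s ∂(volume.restrict (Ioc 0 T)), ‖f s‖
      ≤ ε + L * d * s ^ (-μ) * ‖∫ r in (0 : ℝ)..s, D r‖ + ‖D s‖ := by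
    filter_upwards [ae_Ioc_of_ae_Icc hwA le_rfl, ae_restrict_mem measurableSet_Ioc] with s hs hsm
    have hs0 : 0 < s := hsm.1
    have hsT : s ∈ Icc 0 T := ⟨hs0.le, hsm.2⟩
    -- Since `|w| ≤ A` the cut-off fixes `w`, and being 1-Lipschitz it does not enlarge `b - w`.
    have h1 : ‖cutoffVec χ (b s (x s)) - w s (x s)‖ ≤ ε := by
      have := hχ.norm_cutoffVec_sub_le (b s (x s)) (w s (x s))
      rw [hχ.cutoffVec_eq (hs _)] at this
      exact this.trans (hbw s hsT _)
    have h2 : ‖w s (x s) - w s (y s)‖ ≤ L * d * s ^ (-μ) * ‖∫ r in (0 : ℝ)..s, D r‖ := by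
      rw [hpos s hsT]
      refine (hLip s hsm _ _).trans ?_
      have h3 : ∑ l, |(∫ r in (0 : ℝ)..s, D r) l| ≤ d * ‖∫ r in (0 : ℝ)..s, D r‖ :=
        (Finset.sum_le_sum fun l _ => abs_coord_le _ l).trans (le_of_eq (by simp))
      calc L * s ^ (-μ) * ∑ l, |(∫ r in (0 : ℝ)..s, D r) l|
          ≤ L * s ^ (-μ) * (d * ‖∫ r in (0 : ℝ)..s, D r‖) := by gcongr
        _ = _ := by ring
    -- Error of the field at the same point, spatial increment of the limit field, and friction.
    have e : f s = (cutoffVec χ (b s (x s)) - w s (x s)) + (w s (x s) - w s (y s)) - D s := by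
      simp only [hf, hDdef]
      abel
    rw [e]
    exact (norm_sub_le _ _).trans (add_le_add ((norm_add_le _ _).trans (add_le_add h1 h2)) le_rfl)
  have hρ : 0 ≤ |σ - σ'| * β := by positivity
  have key := norm_le_of_integral_inequality hT (by positivity : 0 ≤ L * d) hμ1 hε hρ hDc hDf hfb
  set Λ := 2 * Real.exp (2 * (L * d * T ^ (1 - μ) + 1) * T) with hΛ
  have hΛ0 : 0 < Λ := by positivity
  intro t ht
  have hprim : ‖∫ s in (0 : ℝ)..t, D s‖ ≤ Λ * (ε * T + |σ - σ'| * β) * T := by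
    have := intervalIntegral.norm_integral_le_of_norm_le_const (a := 0) (b := t) (f := D)
      (C := Λ * (ε * T + |σ - σ'| * β)) fun r hr => by
        rw [uIoc_of_le ht.1] at hr
        exact key r ⟨hr.1.le, hr.2.trans ht.2⟩
    rw [sub_zero, abs_of_nonneg ht.1] at this
    exact this.trans (mul_le_mul_of_nonneg_left ht.2 (by positivity))
  calc phaseDist (x t) (v t) (y t) (z t) ≤ _ := phaseDist_le (hpos t ht)
    _ ≤ Λ * (ε * T + |σ - σ'| * β) * T + Λ * (ε * T + |σ - σ'| * β) := add_le_add hprim (key t ht)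
    _ = (T + 1) * Λ * (ε * T + |σ - σ'| * β) := by ring
    _ ≤ (T + 1) * Λ * ((T + 1) * (ε + |σ - σ'| * β)) := by
        gcongr
        nlinarith
    _ = _ := by ring

/-- The pathwise comparison in extended non-negative reals. -/
lemma iSup_phaseDist_rpow_le {T L μ A σ σ' q Cb : ℝ} (hT : 0 < T) (hL : 0 ≤ L)
    (hμ1 : μ < 1) (hq : 1 ≤ q) (hCb : 0 < Cb) {χ : ℝ → ℝ} (hχ : IsCutoff A χ)
    {w b : ℝ → Torus d → E d}
    (hw : ContinuousOn (fun z : ℝ × Torus d => w z.1 z.2) (Icc 0 T ×ˢ univ))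
    (hb : ContinuousOn (fun z : ℝ × Torus d => b z.1 z.2) (Icc 0 T ×ˢ univ))
    (hwA : ∀ᵐ t ∂(volume.restrict (Icc 0 T)), ∀ x, ‖w t x‖ ≤ A)
    (hLip : ∀ t ∈ Ioc 0 T, ∀ x y, ‖w t (x + proj y) - w t x‖ ≤ L * t ^ (-μ) * ∑ l, |y l|)
    {n : ℝ → ℝ≥0∞}
    (hbw : ∀ t ∈ Icc 0 T, ∀ x, ENNReal.ofReal ‖b t x - w t x‖ ≤ ENNReal.ofReal Cb * n t)
    {B : ℝ≥0 → E d} {G : ℝ≥0∞} (hG : G ≠ ∞)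
    (hB : ∀ t : ℝ≥0, (t : ℝ) ≤ T → ‖B t‖ₑ ^ q ≤ G) {x₀ : Torus d} {v₀ : E d} {x y : ℝ → Torus d}
    {v z : ℝ → E d} (h : IsKineticPath T σ' (fun t x => cutoffVec χ (b t x)) B x₀ v₀ x v)
    (h' : IsKineticPath T σ w B x₀ v₀ y z) :
    ⨆ t ∈ Icc 0 T, ENNReal.ofReal (phaseDist (x t) (v t) (y t) (z t)) ^ q
      ≤ ENNReal.ofReal ((T + 1) * (2 * Real.exp (2 * (L * d * T ^ (1 - μ) + 1) * T) * (T + 1))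
          * (Cb + 1)) ^ q * 2 ^ (q - 1)
        * (ENNReal.ofReal |σ - σ'| ^ q * G + ⨆ t ∈ Icc 0 T, n t ^ q) := by
  have hq0 : 0 < q := by linarith
  set H := ⨆ t ∈ Icc 0 T, n t ^ q with hH
  set C₀ := (T + 1) * (2 * Real.exp (2 * (L * d * T ^ (1 - μ) + 1) * T) * (T + 1)) with hC₀
  have hC₀0 : 0 < C₀ := by positivity
  -- If the right-hand side is infinite there is nothing to prove; otherwise all quantities are real
  -- and the pathwise comparison applies.
  rcases eq_or_ne H ∞ with hHt | hHt
  · rw [hHt, add_top, ENNReal.mul_top]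
    · exact le_top
    · refine mul_ne_zero ?_ ?_
      · rw [Ne, ENNReal.rpow_eq_zero_iff_of_pos hq0, ENNReal.ofReal_eq_zero, not_le]
        positivity
      · exact (ENNReal.rpow_pos (by norm_num) (by norm_num)).ne'
  -- The `q`-th roots are the actual bounds on the field error, up to `Cb`, and on the Brownian
  -- path.
  set η := H ^ (1 / q) with hη
  set g := G ^ (1 / q) with hg
  have hηt : η ≠ ∞ := ENNReal.rpow_ne_top_of_nonneg (by positivity) hHt
  have hgt : g ≠ ∞ := ENNReal.rpow_ne_top_of_nonneg (by positivity) hG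
  have hηq : η ^ q = H := by rw [hη, ← ENNReal.rpow_mul, one_div_mul_cancel hq0.ne', ENNReal.rpow_one]
  have hgq : g ^ q = G := by rw [hg, ← ENNReal.rpow_mul, one_div_mul_cancel hq0.ne', ENNReal.rpow_one]
  have hn : ∀ t ∈ Icc 0 T, n t ≤ η := fun t ht => by
    rw [← ENNReal.rpow_le_rpow_iff hq0, hηq]
    exact le_iSup₂ (f := fun t (_ : t ∈ Icc 0 T) => n t ^ q) t ht
  have hbw' : ∀ t ∈ Icc 0 T, ∀ x, ‖b t x - w t x‖ ≤ Cb * η.toReal := fun t ht x => by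
    rw [← ENNReal.ofReal_le_ofReal_iff (by positivity), ENNReal.ofReal_mul hCb.le,
      ENNReal.ofReal_toReal hηt]
    exact (hbw t ht x).trans (by gcongr; exact hn t ht)
  have hB' : ∀ t : ℝ≥0, (t : ℝ) ≤ T → ‖B t‖ ≤ g.toReal := fun t ht => by
    rw [← ENNReal.ofReal_le_ofReal_iff (by positivity), ENNReal.ofReal_toReal hgt, ofReal_norm,
      ← ENNReal.rpow_le_rpow_iff hq0, hgq]
    exact hB t ht
  have key := phaseDist_kineticPath_le hT hL hμ1 (by positivity) (by positivity) hχ hw hb hwA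
    hLip hbw' hB' h h'
  refine iSup₂_le fun t ht => ?_
  have h1 : ENNReal.ofReal (phaseDist (x t) (v t) (y t) (z t))
      ≤ ENNReal.ofReal (C₀ * (Cb + 1)) * (ENNReal.ofReal |σ - σ'| * g + η) := by
    refine (ENNReal.ofReal_le_ofReal (key t ht)).trans ?_
    have e : ENNReal.ofReal |σ - σ'| * g + η
        = ENNReal.ofReal (|σ - σ'| * g.toReal + η.toReal) := by
      rw [ENNReal.ofReal_add (by positivity) (by positivity), ENNReal.ofReal_mul (abs_nonneg _),
        ENNReal.ofReal_toReal hgt, ENNReal.ofReal_toReal hηt]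
    rw [e, ← ENNReal.ofReal_mul (by positivity)]
    refine ENNReal.ofReal_le_ofReal ?_
    rw [mul_assoc C₀]
    refine mul_le_mul_of_nonneg_left ?_ hC₀0.le
    have h2 : 0 ≤ |σ - σ'| * g.toReal := by positivity
    have h3 : 0 ≤ η.toReal := ENNReal.toReal_nonneg
    nlinarith [mul_nonneg hCb.le h2]
  calc ENNReal.ofReal (phaseDist (x t) (v t) (y t) (z t)) ^ q
      ≤ (ENNReal.ofReal (C₀ * (Cb + 1)) * (ENNReal.ofReal |σ - σ'| * g + η)) ^ q :=
        ENNReal.rpow_le_rpow h1 hq0.le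
    _ = ENNReal.ofReal (C₀ * (Cb + 1)) ^ q * (ENNReal.ofReal |σ - σ'| * g + η) ^ q :=
        ENNReal.mul_rpow_of_nonneg _ _ hq0.le
    _ ≤ ENNReal.ofReal (C₀ * (Cb + 1)) ^ q
        * (2 ^ (q - 1) * ((ENNReal.ofReal |σ - σ'| * g) ^ q + η ^ q)) := by
        gcongr
        exact ENNReal.rpow_add_le_mul_rpow_add_rpow _ _ hq
    _ = _ := by
        rw [ENNReal.mul_rpow_of_nonneg _ _ hq0.le, hgq, hηq]
        ring

end FluidParticle

end

/-! ### The main estimate. -/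

theorem theorem3 (d : ℕ) (hd : d = 2 ∨ d = 3) (T p γ σ A : ℝ) (k : ℕ)
    (hT : 0 < T) (hp : (d : ℝ) < p) (hγ : γ ∈ Set.Ioo ((d : ℝ) / p) 1) (hk : 3 ≤ k)
    (hσ : 0 ≤ σ) (hA : 0 < A)
    (h3 : d = 3 → γ / 2 + 3 / 2 * (1 / 2 - 1 / p) < 1)
    (u₀ : FluidParticle.Torus d → FluidParticle.E d)
    (F₀ : FluidParticle.Torus d → FluidParticle.E d → ℝ)
    (u : ℝ → FluidParticle.Torus d → FluidParticle.E d)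
    (F : ℝ → FluidParticle.Torus d → FluidParticle.E d → ℝ)
    (hweak : FluidParticle.IsWeakSolution T σ u₀ F₀ u F)
    (hpde : FluidParticle.PDEAssumptions T p γ k u₀ F₀ u)
    (huA : eLpNorm (fun z : ℝ × FluidParticle.Torus d => u z.1 z.2) ∞
      ((volume.restrict (Set.Icc 0 T)).prod (FluidParticle.torusVol d)) ≤ ENNReal.ofReal A) :
    (∃ w, FluidParticle.IsContinuousRep T u w) ∧
    ∀ w, FluidParticle.IsContinuousRep T u w →
    ∀ q : ℝ, 1 ≤ q → ∃ C : ℝ, 0 < C ∧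
    ∀ (Ω : Type*) (m : MeasurableSpace Ω) (P : Measure Ω) (_ : IsProbabilityMeasure P)
      (ℱ : Filtration ℝ≥0 m)
      (B : ℕ → ℝ≥0 → Ω → FluidParticle.E d)
      (_ : ∀ i, FluidParticle.IsFilteredBrownian ℱ P (B i))
      (_ : iIndepFun (fun i ω (t : ℝ≥0) => B i t ω) P)
      (χ : ℝ → ℝ) (_ : FluidParticle.IsCutoff A χ)
      (α β : ℝ) (θ₁ θ₂ : FluidParticle.E d → ℝ)
      (_ : FluidParticle.IsSpaceProfile θ₁) (_ : FluidParticle.IsVelocityProfile θ₂)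
      (σN : ℕ → ℝ) (u₀N : ℕ → Ω → FluidParticle.Torus d → FluidParticle.E d)
      (X₀ : ℕ → Ω → FluidParticle.Torus d) (V₀ : ℕ → Ω → FluidParticle.E d)
      (_ : FluidParticle.ParticleAssumptions P p γ k α β θ₁ θ₂ σ σN u₀N X₀ V₀)
      (Xbar : ℕ → ℝ → Ω → FluidParticle.Torus d) (Vbar : ℕ → ℝ → Ω → FluidParticle.E d)
      (_ : ∀ i, FluidParticle.IsLimitParticle ℱ P T σ w (X₀ i) (V₀ i) (B i) (Xbar i) (Vbar i))
      (uN : ℕ → ℝ → Ω → FluidParticle.Torus d → FluidParticle.E d)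
      (X : (N : ℕ) → Fin N → ℝ → Ω → FluidParticle.Torus d)
      (V : (N : ℕ) → Fin N → ℝ → Ω → FluidParticle.E d)
      (_ : ∀ N : ℕ, 1 ≤ N → FluidParticle.IsFluidParticleSolution ℱ P T p γ (σN N) χ
        (FluidParticle.spaceMollifier β θ₁ N) (u₀N N) X₀ V₀ B (uN N) (X N) (V N)),
    ∀ N : ℕ, 1 ≤ N →
      (⨆ i : Fin N, ∫⁻ ω, ⨆ t ∈ Set.Icc 0 T,
          ENNReal.ofReal (FluidParticle.phaseDist (X N i t ω) (V N i t ω)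
            (Xbar i t ω) (Vbar i t ω)) ^ q ∂P)
        ≤ ENNReal.ofReal C * (ENNReal.ofReal |σ - σN N| ^ q
          + ∫⁻ ω, ⨆ t ∈ Set.Icc 0 T,
              FluidParticle.besselENorm γ (ENNReal.ofReal p)
                (fun x => uN N t ω x - w t x) ^ q ∂P) := by
  have hd2 : (2 : ℝ) ≤ d := by
    rcases hd with rfl | rfl <;> norm_num
  have hp1 : 1 < p := by linarith
  have hAu := FluidParticle.ae_norm_le_of_eLpNorm_top hA.le huA
  obtain ⟨hex, μ, L, -, hμ1, hL, hLip⟩ := FluidParticle.exists_isContinuousRep_lipschitz hT hp1 hp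
    hγ.1 hγ.2 hweak hpde hA.le hAu
  refine ⟨hex, fun w hw q hq => ?_⟩
  have hq0 : 0 < q := by linarith
  obtain ⟨Cb, hCb, hbes⟩ := FluidParticle.bessel_embedding (d := d) hp1 hp hγ.1
  obtain ⟨CB, hCB⟩ := FluidParticle.exists_brownian_sup_bound d T q hT hq0.le
  -- This constant involves only `T`, `q`, `d`, the Lipschitz data of `u` and the embedding
  -- constant; it is fixed before any particle system is given, as is `CB`.
  set C₁ : ℝ≥0∞ := ENNReal.ofReal ((T + 1) * (2 * Real.exp (2 * (L * d * T ^ (1 - μ) + 1) * T)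
    * (T + 1)) * (Cb + 1)) ^ q * 2 ^ (q - 1) with hC₁
  have hC₁t : C₁ ≠ ∞ := ENNReal.mul_ne_top
    (ENNReal.rpow_ne_top_of_nonneg hq0.le ENNReal.ofReal_ne_top)
    (ENNReal.rpow_ne_top_of_nonneg (by linarith) (by norm_num))
  refine ⟨(C₁ * (1 + CB)).toReal + 1, by positivity, ?_⟩
  intro Ω m P hP ℱ B hB _ χ hχ α β θ₁ θ₂ _ _ σN u₀N X₀ V₀ _ Xbar Vbar hbar uN X V hsol N hN
  refine iSup_le fun i => ?_
  obtain ⟨G, hGm, hGi, hGB⟩ := hCB Ω m P hP ℱ (B i) (hB i)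
  have hGt : ∀ᵐ ω ∂P, G ω < ∞ :=
    ae_lt_top hGm (hGi.trans_lt ENNReal.coe_lt_top).ne
  have hs := hsol N hN
  set H : Ω → ℝ≥0∞ := fun ω => ⨆ t ∈ Set.Icc 0 T,
    FluidParticle.besselENorm γ (ENNReal.ofReal p) (fun x => uN N t ω x - w t x) ^ q with hH
  -- The supremum of `|B|` enters through its measurable majorant `G`. When expectations are taken
  -- only `G` has to be measurable; the supremum `H` of the Bessel norms is integrated as it stands.
  have hpath : ∀ᵐ ω ∂P, (⨆ t ∈ Set.Icc 0 T,
      ENNReal.ofReal (FluidParticle.phaseDist (X N i t ω) (V N i t ω) (Xbar i t ω) (Vbar i t ω)) ^ q)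
        ≤ C₁ * (ENNReal.ofReal |σ - σN N| ^ q * G ω + H ω) := by
    filter_upwards [hGB, hGt, hs.continuous_u, hs.particles, (hbar i).path] with ω h1 h2 h3 h4 h5
    refine FluidParticle.iSup_phaseDist_rpow_le hT hL.le hμ1 hq hCb hχ hw.1 h3 (hw.norm_le hAu)
      (hLip w hw) (fun t ht x => ?_) h2.ne h1 (h4 i) h5
    exact hbes _ ((FluidParticle.continuous_slice (w := fun t x => uN N t ω x) h3 ht).sub
      (FluidParticle.continuous_slice hw.1 ht)) x
  calc ∫⁻ ω, ⨆ t ∈ Set.Icc 0 T, ENNReal.ofReal (FluidParticle.phaseDist (X N i t ω) (V N i t ω)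
        (Xbar i t ω) (Vbar i t ω)) ^ q ∂P
      ≤ ∫⁻ ω, C₁ * (ENNReal.ofReal |σ - σN N| ^ q * G ω + H ω) ∂P := lintegral_mono_ae hpath
    _ = C₁ * (ENNReal.ofReal |σ - σN N| ^ q * ∫⁻ ω, G ω ∂P + ∫⁻ ω, H ω ∂P) := by
        rw [lintegral_const_mul' _ _ hC₁t, lintegral_add_left (hGm.const_mul _),
          lintegral_const_mul _ hGm]
    -- Both coefficients are raised to `1 + CB` so that a common constant factors out.
    _ ≤ C₁ * (ENNReal.ofReal |σ - σN N| ^ q * (1 + CB) + (1 + CB) * ∫⁻ ω, H ω ∂P) := by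
        gcongr
        · exact hGi.trans le_add_self
        · exact le_mul_of_one_le_left zero_le le_self_add
    _ = C₁ * (1 + CB) * (ENNReal.ofReal |σ - σN N| ^ q + ∫⁻ ω, H ω ∂P) := by ring
    _ ≤ _ := by
        gcongr
        rw [ENNReal.ofReal_add ENNReal.toReal_nonneg zero_le_one, ENNReal.ofReal_toReal
          (ENNReal.mul_ne_top hC₁t (ENNReal.add_ne_top.2 ⟨ENNReal.one_ne_top, ENNReal.coe_ne_top⟩))]
        exact le_self_add
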